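/- Let $M$ be a smooth, Hausdorff, $\sigma$-compact manifold without boundary and let $E\to M$ be a Courant algebroid: a smooth vector bundle with a non-degenerate symmetric fibrewise pairing $\langle\cdot,\cdot\rangle$, an anchor $\rho:E\to TM$ and an $\mathbb R$-bilinear bracket on $\Gamma(E)$ such that, for $u,v,w\in\Gamma(E)$ and $f\in C^\infty(M)$, writing $u\cdot f=\rho(u)f$, $$[u,[v,w]]=[[u,v],w]+[v,[u,w]],\quad [u,fv]=f[u,v]+(u\cdot f)v,$$ $$u\cdot\langle v,w\rangle=\langle[u,v],w\rangle+\langle v,[u,w]\rangle,\quad \langle w,[u,v]+[v,u]\rangle=w\cdot\langle u,v\rangle .$$ A generalized pseudometric is a smooth subbundle $V_+\subset E$ on which $\langle\cdot,\cdot\rangle$ is non-degenerate; put $V_-=V_+^\perp$, and let $u_\pm$ denote the orthogonal projections of $u$. It is a generalized metric if $\langle\cdot,\cdot\rangle$ is positive definite on $V_+$ and negative definite on $V_-$. Let $\sigma$ be a smooth nowhere-vanishing half-density on $M$, $\operatorname{div}_{\sigma^2}u=\sigma^{-2}L_{\rho(u)}\sigma^2$, and for $a\in\Gamma(V_+)$,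 $b\in\Gamma(V_-)$ put $$\mathrm{GRic}_{V_+,\sigma}(a,b)=\operatorname{div}_{\sigma^2}[b,a]_+-b\cdot\operatorname{div}_{\sigma^2}a-\operatorname{Tr}_{V_+}\bigl([[\,\cdot\,,b]_-,a]_+\bigr).$$ The Laplacian on half-densities is $$\Delta_{V_+}=4L_{\rho(e^a)}L_{\rho(e_a)}-\tfrac16c_{abc}c^{abc}-\tfrac12c_{ab\bar c}c^{ab\bar c},\qquad c_{\alpha\beta\gamma}=\langle e_\alpha,[e_\beta,e_\gamma]\rangle ,$$ where $e_a$, $e_{\bar a}$ are local frames of $V_+$, $V_-$ with constant inner products and indices are raised with $\langle\cdot,\cdot\rangle$; the action is $S_E(V_+,\sigma)=-\frac12\int_M\sigma\Delta_{V_+}\sigma$. A section $\varphi\in\Gamma(V_+\otimes V_-)$ is identified with the map $V_+\to V_-$ given by $a\otimes b\mapsto\langle a,\cdot\rangle b$. A variation of $V_+$ with velocity $\varphi$ is a smooth family $V_+(t)$ of generalized pseudometrics ($t$ near $0$), constant outside a compact subset of $M$, with $V_+(0)=V_+$ and $\frac{d}{dt}\big|_{0}P_{V_+(t)}v=\varphi(v)$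 for $v\in V_+$, where $P$ is the orthogonal projection. If two pairs $(V_+,\sigma)$ agree outside a compact set, then the difference of their actions means $-\frac12$ times the integral of the difference of the densities $\sigma\Delta_{V_+}\sigma$; derivatives of $S_E$ along compactly supported variations are derivatives of this difference. If $M$ is compact, they are also derivatives of $S_E$ itself. Then: 1. For every generalized pseudometric $V_+$, each compactly supported $\varphi\in\Gamma(V_+\otimes V_-)$ is the velocity of some variation of $V_+$, and for every variation with velocity $\varphi$ (and $\sigma$ fixed) $$\delta_\varphi S_E(V_+,\sigma)=\int_M\mathrm{GRic}_{V_+,\sigma}(\varphi)\,\sigma^2 .$$ 2. For every smooth compactly supported half-density $\varsigma$, the derivative of $S_E(V_+,\sigma+t\varsigma)$ at $t=0$ is $\delta_\varsigma S_E=-\int_M\varsigma\,\Delta_{V_+}\sigma$. 3. $\mathrm{GRic}_{V_+,\sigma}$ is a smooth section of $V_+^*\otimes V_-^*\cong V_+\otimes V_-$. If $M$ is compact, then with respect to $g_\sigma(\varphi_1,\varphi_2)=-\int_M\langle\varphi_1,\varphi_2\rangle\sigma^2$, where $\langle a\otimes b,a'\otimes b'\rangle=\langle a,a'\rangle\langle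 b,b'\rangle$, the gradient of $S_E(\cdot,\sigma)$ at $V_+$ exists, is unique and equals $-\mathrm{GRic}_{V_+,\sigma}$. Moreover $g_\sigma$ is positive definite if $V_+$ is a generalized metric. 4. If $M$ is compact, then a smooth family $V_+(t)$, $t$ in an open subset of $\mathbb R$, solves the generalized Ricci flow $\dot V_+=\mathrm{GRic}_{V_+,\sigma}$ if and only if it solves the gradient flow equation $\dot V_+=-\operatorname{grad}_{g_\sigma}S_E(V_+,\sigma)$. 5. $(V_+,\sigma)$ is stationary for $S_E$, i.e. $\delta_\varphi S_E=0$ for all variations of $V_+$ with $\sigma$ fixed and $\delta_\varsigma S_E=0$ for all smooth compactly supported $\varsigma$ with $V_+$ fixed, if and only if $\mathrm{GRic}_{V_+,\sigma}=0$ and $\Delta_{V_+}\sigma=0$. -/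

import Mathlib

open scoped Manifold ContDiff TensorProduct Topology

noncomputable section

namespace GenRicci

/-! ### Densities on a smooth manifold -/

/-- The line of `w`-densities on an `n`-dimensional vector space `T`: functions `μ` of `n` vectors
such that `μ (A v₁, …, A vₙ) = |det A| ^ w * μ (v₁, …, vₙ)` for all endomorphisms `A`. -/
def densityFiber (n : ℕ) (w : ℝ) (T : Type*) [AddCommGroup T] [Module ℝ T] :
    Submodule ℝ ((Fin n → T) → ℝ) where
  carrier := {μ | ∀ (A : T →ₗ[ℝ] T) (v : Fin n → T),
    μ (fun i => A (v i)) = |LinearMap.det A| ^ w * μ v}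
  add_mem' {μ ν} hμ hν A v := by simp only [Pi.add_apply, hμ A v, hν A v]; ring
  zero_mem' A v := by simp
  smul_mem' c μ hμ A v := by simp only [Pi.smul_apply, smul_eq_mul, hμ A v]; ring

/-- The product of two half-densities on a vector space, a 1-density. -/
def halfMul {n : ℕ} {T : Type*} [AddCommGroup T] [Module ℝ T]
    (σ τ : densityFiber n (1 / 2) T) : densityFiber n 1 T :=
  ⟨fun v => σ.1 v * τ.1 v, fun A v => by
    have h : |LinearMap.det A| ^ (1 / 2 : ℝ) * |LinearMap.det A| ^ (1 / 2 : ℝ)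
        = |LinearMap.det A| ^ (1 : ℝ) := by
      rw [← Real.sqrt_eq_rpow, Real.mul_self_sqrt (abs_nonneg _), Real.rpow_one]
    change σ.1 (fun i => A (v i)) * τ.1 (fun i => A (v i)) = _ * (σ.1 v * τ.1 v)
    rw [σ.2 A v, τ.2 A v, ← h]; ring⟩

/-- The `w`-density that takes the value `c` on the basis `b`. -/
def densityOfBasis {n : ℕ} (w : ℝ) {T : Type*} [AddCommGroup T] [Module ℝ T]
    (b : Module.Basis (Fin n) ℝ T) (c : ℝ) : densityFiber n w T :=
  ⟨fun v => |b.det v| ^ w * c, fun A v => by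
    have h : b.det (fun i => A (v i)) = LinearMap.det A * b.det v := b.det_comp A v
    change |b.det (fun i => A (v i))| ^ w * c = _ * (|b.det v| ^ w * c)
    rw [h, abs_mul, Real.mul_rpow (abs_nonneg _) (abs_nonneg _)]; ring⟩

section Densities

variable {n : ℕ} {M : Type*} [TopologicalSpace M] [ChartedSpace (EuclideanSpace ℝ (Fin n)) M]

variable (n M) in
/-- (Not necessarily smooth) `w`-densities on `M`: sections of the bundle of `w`-densities. -/
abbrev Density (w : ℝ) := ∀ x : M, densityFiber n w (TangentSpace (𝓡 n) x)

variable (n) in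
/-- The coordinate vectors `∂₁, …, ∂ₙ` at `x` of the preferred chart `ψ` at `x₀`
(for `x` in the domain of this chart; the derivative of `ψ⁻¹` at `ψ x` takes values in the
tangent space at `ψ⁻¹ (ψ x) = x`). -/
def coordFrame (x₀ x : M) (i : Fin n) : TangentSpace (𝓡 n) x :=
  mfderiv (𝓡 n) (𝓡 n) (extChartAt (𝓡 n) x₀).symm (extChartAt (𝓡 n) x₀ x)
    (EuclideanSpace.single i (1 : ℝ))

/-- The coefficient of a density with respect to `|dx¹ ⋯ dxⁿ| ^ w` in the preferred chart at `x₀`,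
as a function of the coordinates. -/
def coeff {w : ℝ} (μ : Density n M w) (x₀ : M) (y : EuclideanSpace ℝ (Fin n)) : ℝ :=
  (μ ((extChartAt (𝓡 n) x₀).symm y)).1 (coordFrame n x₀ ((extChartAt (𝓡 n) x₀).symm y))

/-- The components of a vector field in the preferred chart at `x₀`, as functions of the
coordinates. -/
def components (X : ∀ x : M, TangentSpace (𝓡 n) x) (x₀ : M) (y : EuclideanSpace ℝ (Fin n)) :
    EuclideanSpace ℝ (Fin n) :=
  mfderiv (𝓡 n) (𝓡 n) (extChartAt (𝓡 n) x₀) ((extChartAt (𝓡 n) x₀).symm y)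
    (X ((extChartAt (𝓡 n) x₀).symm y))

/-- Smoothness of a density: its coefficients in the charts are smooth. -/
def IsSmoothDensity {w : ℝ} (μ : Density n M w) : Prop :=
  ∀ x₀ : M, ContDiffOn ℝ ∞ (coeff μ x₀) (extChartAt (𝓡 n) x₀).target

/-- A density is nowhere vanishing if its value at every point is a nonzero element of the line of
densities at this point. -/
def NowhereVanishing {w : ℝ} (μ : Density n M w) : Prop := ∀ x : M, μ x ≠ 0

/-- The Lie derivative of a `w`-density along a vector field. At `x`, in the preferred chart at `x`,
`L_X (s |dx| ^ w) = (X s + w (∑ᵢ ∂ᵢ Xⁱ) s) |dx| ^ w`; the coordinate vectors at `x` of this chart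
form the standard basis of the tangent space at `x`. -/
def lieDeriv {w : ℝ} (X : ∀ x : M, TangentSpace (𝓡 n) x) (μ : Density n M w) : Density n M w :=
  fun x => densityOfBasis (T := EuclideanSpace ℝ (Fin n)) w
    (EuclideanSpace.basisFun (Fin n) ℝ).toBasis
    (fderiv ℝ (coeff μ x) (extChartAt (𝓡 n) x x) (components X x (extChartAt (𝓡 n) x x))
      + w * (∑ i, fderiv ℝ (components X x) (extChartAt (𝓡 n) x x)
          (EuclideanSpace.single i (1 : ℝ)) i) * coeff μ x (extChartAt (𝓡 n) x x))

/-- The derivative of a function on `M` along a tangent vector. -/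
def dirDeriv (f : M → ℝ) (x : M) (v : TangentSpace (𝓡 n) x) : ℝ := mfderiv (𝓡 n) 𝓘(ℝ, ℝ) f x v

/-- The product of two half-densities on `M`. -/
def mulHalf (σ τ : Density n M (1 / 2)) : Density n M 1 := fun x => halfMul (σ x) (τ x)

variable [IsManifold (𝓡 n) ∞ M] [T2Space M] [SigmaCompactSpace M]

variable (n M) in
/-- A smooth partition of unity subordinate to the domains of the preferred charts. -/
def chartPartition : SmoothPartitionOfUnity M (𝓡 n) M Set.univ :=
  (SmoothPartitionOfUnity.exists_isSubordinate_chartAt_source (𝓡 n) M).choose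

/-- The integral over `M` of a (continuous, compactly supported) density, computed with a partition
of unity from the Lebesgue integrals of the coefficients in the charts. -/
def integral (μ : Density n M 1) : ℝ :=
  ∑ᶠ i : M, ∫ y in (extChartAt (𝓡 n) i).target,
    chartPartition n M i ((extChartAt (𝓡 n) i).symm y) * coeff μ i y

end Densities

/-! ### Courant algebroids -/

theorem finiteDimensional_fiber {M : Type*} [TopologicalSpace M] (F : Type*) [NormedAddCommGroup F]
    [NormedSpace ℝ F] [FiniteDimensional ℝ F] (E : M → Type*)
    [TopologicalSpace (Bundle.TotalSpace F E)] [∀ x, TopologicalSpace (E x)]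
    [∀ x, AddCommGroup (E x)] [∀ x, Module ℝ (E x)] [FiberBundle F E] [VectorBundle ℝ F E] (x : M) :
    FiniteDimensional ℝ (E x) :=
  LinearEquiv.finiteDimensional
    (((trivializationAt F E x).continuousLinearEquivAt ℝ x
      (FiberBundle.mem_baseSet_trivializationAt F E x)).toLinearEquiv.symm)

theorem contMDiffAt_det {n : ℕ} {M : Type*} [TopologicalSpace M]
    [ChartedSpace (EuclideanSpace ℝ (Fin n)) M] {k : ℕ} (A : M → Matrix (Fin k) (Fin k) ℝ) (x₀ : M)
    (h : ∀ i j, ContMDiffAt (𝓡 n) 𝓘(ℝ, ℝ) ∞ (fun x => A x i j) x₀) :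
    ContMDiffAt (𝓡 n) 𝓘(ℝ, ℝ) ∞ (fun x => (A x).det) x₀ := by
  simp only [Matrix.det_apply']
  refine ContMDiffAt.sum fun σ _ => ContMDiffAt.mul contMDiffAt_const ?_
  exact ContMDiffAt.prod fun i _ => h _ _

theorem contMDiffAt_matrix_inv {n : ℕ} {M : Type*} [TopologicalSpace M]
    [ChartedSpace (EuclideanSpace ℝ (Fin n)) M] {k : ℕ} (A : M → Matrix (Fin k) (Fin k) ℝ) (x₀ : M)
    (h : ∀ i j, ContMDiffAt (𝓡 n) 𝓘(ℝ, ℝ) ∞ (fun x => A x i j) x₀) (h₀ : (A x₀).det ≠ 0)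
    (i j : Fin k) : ContMDiffAt (𝓡 n) 𝓘(ℝ, ℝ) ∞ (fun x => (A x)⁻¹ i j) x₀ := by
  simp only [Matrix.inv_def, Matrix.smul_apply, Ring.inverse_eq_inv', smul_eq_mul,
    Matrix.adjugate_apply]
  refine ContMDiffAt.mul ((contMDiffAt_det A x₀ h).inv₀ h₀) (contMDiffAt_det _ x₀ fun a b => ?_)
  by_cases hj : a = j
  · subst hj
    simpa using contMDiffAt_const
  · simpa [Matrix.updateRow_ne hj] using h a b

section Courant

variable {n : ℕ} {M : Type*} [TopologicalSpace M] [ChartedSpace (EuclideanSpace ℝ (Fin n)) M]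
  [IsManifold (𝓡 n) ∞ M]
  {F : Type*} [NormedAddCommGroup F] [NormedSpace ℝ F] [FiniteDimensional ℝ F]
  {E : M → Type*} [TopologicalSpace (Bundle.TotalSpace F E)]
  [∀ x, TopologicalSpace (E x)] [∀ x, AddCommGroup (E x)] [∀ x, Module ℝ (E x)]
  [FiberBundle F E] [VectorBundle ℝ F E] [ContMDiffVectorBundle ∞ F E (𝓡 n)]

variable (n F E) in
/-- A Courant algebroid structure on the smooth vector bundle `E → M`. -/
structure CourantAlgebroid where
  /-- the inner product on the fibres -/
  metric : ∀ x, LinearMap.BilinForm ℝ (E x)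
  metric_symm : ∀ x u v, metric x u v = metric x v u
  metric_nondegenerate : ∀ x u, (∀ v, metric x u v = 0) → u = 0
  metric_smooth : ∀ u v : Cₛ^∞⟮𝓡 n; F, E⟯, 
    ContMDiff (𝓡 n) 𝓘(ℝ, ℝ) ∞ (fun x => metric x (u x) (v x))
  /-- the anchor map -/
  anchor : ∀ x, E x →ₗ[ℝ] TangentSpace (𝓡 n) x
  anchor_smooth : ∀ u : Cₛ^∞⟮𝓡 n; F, E⟯, ContMDiff (𝓡 n) (𝓡 n).tangent ∞
    (fun x => (⟨x, anchor x (u x)⟩ : TangentBundle (𝓡 n) M))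
  /-- the bracket of sections -/
  bracket : Cₛ^∞⟮𝓡 n; F, E⟯ →ₗ[ℝ] Cₛ^∞⟮𝓡 n; F, E⟯ →ₗ[ℝ] Cₛ^∞⟮𝓡 n; F, E⟯
  jacobi : ∀ u v w, bracket u (bracket v w) = bracket (bracket u v) w + bracket v (bracket u w)
  /-- `[u, f v] = f [u, v] + (u · f) v` -/
  leibniz : ∀ (u v v' : Cₛ^∞⟮𝓡 n; F, E⟯) (f : M → ℝ), 
    ContMDiff (𝓡 n) 𝓘(ℝ, ℝ) ∞ f → (∀ x, v' x = f x • v x) →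
    ∀ x, bracket u v' x = f x • bracket u v x
      + dirDeriv f x (anchor x (u x)) • v x
  /-- `u · ⟨v, w⟩ = ⟨[u, v], w⟩ + ⟨v, [u, w]⟩` -/
  metric_invariant : ∀ (u v w : Cₛ^∞⟮𝓡 n; F, E⟯) (x : M),
    dirDeriv (fun y => metric y (v y) (w y)) x (anchor x (u x))
      = metric x (bracket u v x) (w x) + metric x (v x) (bracket u w x)
  /-- `[u, v] + [v, u] = d_E ⟨u, v⟩`, where `⟨w, d_E f⟩ = w · f` -/
  symm_part : ∀ (u v w : Cₛ^∞⟮𝓡 n; F, E⟯) (x : M),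
    metric x (w x) (bracket u v x + bracket v u x)
      = dirDeriv (fun y => metric y (u y) (v y)) x (anchor x (w x))

namespace CourantAlgebroid

variable (C : CourantAlgebroid n F E)

/-- The vector field `ρ(u)`. -/
def anchorField (u : Cₛ^∞⟮𝓡 n; F, E⟯) (x : M) : TangentSpace (𝓡 n) x := C.anchor x (u x)

/-- The derivative `u · f = ρ(u) f`. -/
def act (u : Cₛ^∞⟮𝓡 n; F, E⟯) (f : M → ℝ) (x : M) : ℝ :=
  dirDeriv f x (C.anchorField u x)

/-- The divergence `div_μ u = μ⁻¹ L_{ρ(u)} μ` given by a nowhere vanishing density `μ`. -/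
def divergence (μ : Density n M 1) (u : Cₛ^∞⟮𝓡 n; F, E⟯) (x : M) : ℝ :=
  (lieDeriv (C.anchorField u) μ x).1 (coordFrame n x x) / (μ x).1 (coordFrame n x x)

end CourantAlgebroid

/-! ### Generalized pseudometrics -/

/-- A generalized pseudometric: a smooth subbundle `V₊ ⊆ E` on which the inner product is
non-degenerate. Smoothness: locally there are smooth sections of `E` which form a basis of the
fibres of `V₊`. -/
structure GenPseudometric (C : CourantAlgebroid n F E) where
  /-- the fibres of `V₊` -/
  plus : ∀ x, Submodule ℝ (E x)
  exists_frame : ∀ x₀ : M, ∃ (k : ℕ) (s : Fin k → Cₛ^∞⟮𝓡 n; F, E⟯), ∀ᶠ x in 𝓝 x₀,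
    LinearIndependent ℝ (fun i => s i x) ∧ Submodule.span ℝ (Set.range fun i => s i x) = plus x
  nondegenerate : ∀ x, ∀ u ∈ plus x, (∀ v ∈ plus x, C.metric x u v = 0) → u = 0

namespace GenPseudometric

variable {C : CourantAlgebroid n F E} (V : GenPseudometric C)

/-- The fibres of `V₋ = V₊^⊥`. -/
def minus (x : M) : Submodule ℝ (E x) := (C.metric x).orthogonal (V.plus x)

/-- `V₊` is a generalized metric if the inner product is positive definite on `V₊` and negative
definite on `V₋`. -/
def IsMetric : Prop :=
  (∀ x, ∀ u ∈ V.plus x, u ≠ 0 → 0 < C.metric x u u) ∧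
    ∀ x, ∀ u ∈ V.minus x, u ≠ 0 → C.metric x u u < 0

theorem isCompl (x : M) : IsCompl (V.plus x) (V.minus x) := by
  have := finiteDimensional_fiber F E x
  refine LinearMap.BilinForm.isCompl_orthogonal_of_restrict_nondegenerate ?_ ?_
  · intro u v h
    rw [C.metric_symm]; exact h
  · have h : ∀ u : V.plus x, (∀ v : V.plus x, C.metric x u v = 0) → u = 0 := fun u hu =>
      Subtype.ext (V.nondegenerate x u u.2 fun v hv => hu ⟨v, hv⟩)
    exact ⟨fun u hu => h u hu, fun u hu => h u fun v => by rw [C.metric_symm]; exact hu v⟩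

/-- The orthogonal projection of the fibre at `x` to `V₊`. -/
def projAt (x : M) : E x →ₗ[ℝ] E x := (V.plus x).projection (V.minus x) (V.isCompl x)

theorem projAt_eq {x : M} {u p : E x} (hp : p ∈ V.plus x) (hu : u - p ∈ V.minus x) :
    V.projAt x u = p := by
  have h : u = p + (u - p) := by abel
  rw [h, map_add]
  have h₁ : V.projAt x p = p := Submodule.projection_apply_of_mem_left (V.isCompl x) hp
  have h₂ : V.projAt x (u - p) = 0 :=
    (Submodule.projection_apply_eq_zero_iff (V.isCompl x)).2 hu
  rw [h₁, h₂, add_zero]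

theorem det_gram_ne_zero {x : M} {k : ℕ} (s : Fin k → E x) (hs : LinearIndependent ℝ s)
    (hsp : Submodule.span ℝ (Set.range s) = V.plus x) :
    (Matrix.of fun i j => C.metric x (s i) (s j)).det ≠ 0 := by
  intro h
  obtain ⟨v, hv, hv'⟩ := Matrix.exists_mulVec_eq_zero_iff.2 h
  have hmem : ∑ j, v j • s j ∈ V.plus x := hsp ▸
    Submodule.sum_mem _ fun j _ => Submodule.smul_mem _ _ (Submodule.subset_span ⟨j, rfl⟩)
  have hz : ∑ j, v j • s j = 0 := by
    refine V.nondegenerate x _ hmem fun w hw => ?_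
    rw [← hsp] at hw
    induction hw using Submodule.span_induction with
    | mem w hw =>
      obtain ⟨i, rfl⟩ := hw
      have := congrFun hv' i
      rw [C.metric_symm]
      simpa [Matrix.mulVec, dotProduct, mul_comm] using this
    | zero => simp
    | add a b _ _ ha hb => rw [map_add, ha, hb, add_zero]
    | smul c a _ ha => rw [map_smul, ha, smul_zero]
  exact hv (funext (Fintype.linearIndependent_iff.1 hs v hz))

theorem contMDiff_projAt (u : Cₛ^∞⟮𝓡 n; F, E⟯) :
    ContMDiff (𝓡 n) ((𝓡 n).prod 𝓘(ℝ, F)) ∞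
      (fun x => Bundle.TotalSpace.mk' F x (V.projAt x (u x))) := by
  intro x₀
  obtain ⟨k, s, hs⟩ := V.exists_frame x₀
  set G : M → Matrix (Fin k) (Fin k) ℝ :=
    fun x => Matrix.of fun i j => C.metric x (s i x) (s j x) with hG
  have hdet : ∀ᶠ x in 𝓝 x₀, (G x).det ≠ 0 := hs.mono fun x hx =>
    V.det_gram_ne_zero (fun i => s i x) hx.1 hx.2
  have hinv := contMDiffAt_matrix_inv G x₀ (fun i j => C.metric_smooth (s i) (s j) x₀)
    hdet.self_of_nhds
  have key : ∀ᶠ x in 𝓝 x₀, V.projAt x (u x)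
      = ∑ i, (∑ j, (G x)⁻¹ i j * C.metric x (s j x) (u x)) • s i x := by
    filter_upwards [hs, hdet] with x hx hd
    refine V.projAt_eq ?_ ?_
    · rw [← hx.2]
      exact Submodule.sum_mem _ fun j _ => Submodule.smul_mem _ _ (Submodule.subset_span ⟨j, rfl⟩)
    · intro w hw
      rw [← hx.2] at hw
      change C.metric x w _ = 0
      induction hw using Submodule.span_induction with
      | mem w hw =>
        obtain ⟨i, rfl⟩ := hw
        have h1 : (G x * (G x)⁻¹) = 1 := Matrix.mul_nonsing_inv _ (isUnit_iff_ne_zero.2 hd)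
        have h2 := congrFun (congrArg (fun A => Matrix.mulVec A
          (fun j => C.metric x (s j x) (u x))) h1) i
        rw [← Matrix.mulVec_mulVec, Matrix.one_mulVec] at h2
        have h3 : C.metric x (s i x) (∑ i, (∑ j, (G x)⁻¹ i j * C.metric x (s j x) (u x)) • s i x)
            = C.metric x (s i x) (u x) := by
          rw [← h2]
          simp only [map_sum, map_smul, Matrix.mulVec, dotProduct, smul_eq_mul]
          refine Finset.sum_congr rfl fun j _ => ?_
          rw [mul_comm]; rfl
        rw [map_sub, h3, sub_self]
      | zero => simp
      | add a b _ _ ha hb => rw [map_add, LinearMap.add_apply, ha, hb, add_zero]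
      | smul c a _ ha => rw [map_smul, LinearMap.smul_apply, ha, smul_zero]
  have hsm : ContMDiffAt (𝓡 n) ((𝓡 n).prod 𝓘(ℝ, F)) ∞
      (fun x => Bundle.TotalSpace.mk' F x
        (∑ i, (∑ j, (G x)⁻¹ i j * C.metric x (s j x) (u x)) • s i x)) x₀ := by
    refine ContMDiffAt.sum_section fun i _ => ContMDiffAt.smul_section ?_ ((s i).contMDiff x₀)
    exact ContMDiffAt.sum fun j _ => (hinv i j).mul (C.metric_smooth (s j) u x₀)
  refine hsm.congr_of_eventuallyEq (key.mono fun x hx => ?_)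
  simp only [hx]

/-- The projection `u ↦ u₊` to `V₊` on sections. -/
def projPlus (u : Cₛ^∞⟮𝓡 n; F, E⟯) : Cₛ^∞⟮𝓡 n; F, E⟯ :=
  ⟨fun x => V.projAt x (u x), V.contMDiff_projAt u⟩

/-- The projection `u ↦ u₋` to `V₋` on sections. -/
def projMinus (u : Cₛ^∞⟮𝓡 n; F, E⟯) : Cₛ^∞⟮𝓡 n; F, E⟯ := u - V.projPlus u

/-- `u ∈ Γ(V₊)`. -/
def IsPlus (u : Cₛ^∞⟮𝓡 n; F, E⟯) : Prop := ∀ x, u x ∈ V.plus x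

/-- `u ∈ Γ(V₋)`. -/
def IsMinus (u : Cₛ^∞⟮𝓡 n; F, E⟯) : Prop := ∀ x, u x ∈ V.minus x

/-! ### The generalized Ricci tensor -/

open Classical in
/-- The trace at `x` of a `C^∞(M)`-linear map `Φ : Γ(V₊) → Γ(V₊)`, i.e. the trace of the
endomorphism of the fibre of `V₊` at `x` induced by `Φ`. -/
def tracePlus (Φ : Cₛ^∞⟮𝓡 n; F, E⟯ → Cₛ^∞⟮𝓡 n; F, E⟯) (x : M) : ℝ :=
  if h : ∃ T : Module.End ℝ (V.plus x), ∀ (u : Cₛ^∞⟮𝓡 n; F, E⟯) (hu : V.IsPlus u),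
    (T ⟨u x, hu x⟩ : E x) = Φ u x
  then LinearMap.trace ℝ (V.plus x) h.choose else 0

/-- The generalized Ricci tensor of `(V₊, div)` on sections `a ∈ Γ(V₊)` and `b ∈ Γ(V₋)`:
`GRic(a, b) = div [b, a]₊ - b · div a - Tr_{V₊} [[·, b]₋, a]₊`. -/
def genRicci (div : Cₛ^∞⟮𝓡 n; F, E⟯ → M → ℝ) (a b : Cₛ^∞⟮𝓡 n; F, E⟯) (x : M) : ℝ :=
  div (V.projPlus (C.bracket b a)) x - C.act b (div a) x
    - V.tracePlus (fun u => V.projPlus (C.bracket (V.projMinus (C.bracket u b)) a)) x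

/-- `GRic_{V₊,σ}`: the generalized Ricci tensor for the divergence of the density `σ²`. -/
def ricci (σ : Density n M (1 / 2)) (a b : Cₛ^∞⟮𝓡 n; F, E⟯) (x : M) : ℝ :=
  V.genRicci (C.divergence (mulHalf σ σ)) a b x

open Classical in
/-- `GRic_{V₊,σ}` as a bilinear form on the fibres `V₊ × V₋` at `x`. -/
def ricciAt (σ : Density n M (1 / 2)) (x : M) : V.plus x →ₗ[ℝ] V.minus x →ₗ[ℝ] ℝ :=
  if h : ∃ B : V.plus x →ₗ[ℝ] V.minus x →ₗ[ℝ] ℝ,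
    ∀ (a b : Cₛ^∞⟮𝓡 n; F, E⟯) (ha : V.IsPlus a) (hb : V.IsMinus b),
      B ⟨a x, ha x⟩ ⟨b x, hb x⟩ = V.ricci σ a b x
  then h.choose else 0

/-! ### Sections of `V₊ ⊗ V₋` and variations of `V₊` -/

/-- The map `V₊ ⊗ V₋ → Hom(E, E)`, `a ⊗ b ↦ ⟨a, ·⟩ b`, on the fibres at `x`. It identifies
`V₊ ⊗ V₋` with `Hom(V₊, V₋)`, extended by zero to `V₋`. -/
def sharp (x : M) : V.plus x ⊗[ℝ] V.minus x →ₗ[ℝ] E x →ₗ[ℝ] E x :=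
  TensorProduct.lift (LinearMap.mk₂ ℝ
    (fun a b => (C.metric x (a : E x)).smulRight (b : E x))
    (fun a a' b => by ext; simp [add_smul]) (fun c a b => by ext; simp [mul_smul])
    (fun a b b' => by ext; simp) (fun c a b => by ext; simp [smul_comm c]))

/-- The inner product `⟨a ⊗ b, a' ⊗ b'⟩ = ⟨a, a'⟩ ⟨b, b'⟩` on the fibre of `V₊ ⊗ V₋` at `x`. -/
def pair (x : M) : LinearMap.BilinForm ℝ (V.plus x ⊗[ℝ] V.minus x) :=
  LinearMap.BilinForm.tmul ((C.metric x).restrict (V.plus x)) ((C.metric x).restrict (V.minus x))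

/-- Smooth sections of `V₊ ⊗ V₋`. -/
structure MixedSection where
  toFun : ∀ x, V.plus x ⊗[ℝ] V.minus x
  smooth : ∀ u : Cₛ^∞⟮𝓡 n; F, E⟯, ContMDiff (𝓡 n) ((𝓡 n).prod 𝓘(ℝ, F)) ∞
    (fun x => Bundle.TotalSpace.mk' F x (V.sharp x (toFun x) (u x)))

instance : Neg V.MixedSection where
  neg φ := ⟨fun x => -φ.toFun x, fun u => by
    have h := (φ.smooth u).neg_section
    refine h.congr fun x => ?_
    simp only [map_neg, LinearMap.neg_apply, Pi.neg_apply]⟩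

/-- `φ` vanishes outside of a compact set. -/
def MixedSection.HasCompactSupport {V : GenPseudometric C} (φ : V.MixedSection) : Prop :=
  ∃ K : Set M, IsCompact K ∧ ∀ x, x ∉ K → φ.toFun x = 0

/-- The density `GRic_{V₊,σ}(φ) σ²`. -/
def ricciDensity (σ : Density n M (1 / 2)) (φ : V.MixedSection) : Density n M 1 :=
  fun x => TensorProduct.lift (V.ricciAt σ x) (φ.toFun x) • mulHalf σ σ x

/-- `R ∈ Γ(V₊ ⊗ V₋)` is the section that corresponds to `GRic_{V₊,σ} ∈ Γ(V₊^* ⊗ V₋^*)`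
under the identification of `V₊`, `V₋` with their duals. -/
def IsRicciSection (σ : Density n M (1 / 2)) (R : V.MixedSection) : Prop :=
  ∀ (a b : Cₛ^∞⟮𝓡 n; F, E⟯) (ha : V.IsPlus a) (hb : V.IsMinus b) (x : M),
    V.pair x (R.toFun x) ((⟨a x, ha x⟩ : V.plus x) ⊗ₜ[ℝ] (⟨b x, hb x⟩ : V.minus x))
      = V.ricci σ a b x

/-- The one-parameter family `W` of generalized pseudometrics is smooth for `t` in the open
set `J ⊆ ℝ`: the projections to `W t` depend smoothly on `t` and on the point of `M`. -/
def IsSmoothFamily (J : Set ℝ) (W : ℝ → GenPseudometric C) : Prop :=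
  IsOpen J ∧ ∀ u : Cₛ^∞⟮𝓡 n; F, E⟯,
    ContMDiffOn (𝓘(ℝ, ℝ).prod (𝓡 n)) ((𝓡 n).prod 𝓘(ℝ, F)) ∞
      (fun z : ℝ × M => Bundle.TotalSpace.mk' F z.2 ((W z.1).projAt z.2 (u z.2)))
      (J ×ˢ Set.univ)

/-- At `t = t₀` the family `W` passes through `V₊` with velocity `φ ∈ Γ(V₊ ⊗ V₋) ≅
Γ(Hom(V₊, V₋))`: if `P_t` is the projection to `W t`, then `d/dt P_t v = φ v` at `t = t₀` for all
`v ∈ V₊`. -/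
def HasVelocity (W : ℝ → GenPseudometric C) (t₀ : ℝ) (φ : V.MixedSection) : Prop :=
  W t₀ = V ∧ ∀ (x : M), ∀ v ∈ V.plus x, ∀ w : E x,
    HasDerivAt (fun t => C.metric x ((W t).projAt x v) w)
      (C.metric x (V.sharp x (φ.toFun x) v) w) t₀

/-- `W` is a smooth family of generalized pseudometrics, defined for `t` near `0` and constant
outside of a compact set, with `W 0 = V₊` and velocity `φ` at `t = 0`. -/
def IsVariation (φ : V.MixedSection) (W : ℝ → GenPseudometric C) : Prop :=
  ∃ J : Set ℝ, 0 ∈ J ∧ IsSmoothFamily J W ∧ V.HasVelocity W 0 φ ∧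
    ∃ K : Set M, IsCompact K ∧ ∀ t ∈ J, ∀ x, x ∉ K → (W t).plus x = V.plus x

/-! ### The Laplacian and the action -/

/-- A local frame of `E` near `x₀`, adapted to the decomposition `E = V₊ ⊕ V₋`, with constant
inner products (the sections are global, but they are required to form such a frame only on a
neighbourhood of `x₀`). -/
structure AdaptedFrame (x₀ : M) where
  p : ℕ
  q : ℕ
  /-- the frame `e_a` of `V₊` -/
  e : Fin p → Cₛ^∞⟮𝓡 n; F, E⟯
  /-- the frame `e_ā` of `V₋` -/
  f : Fin q → Cₛ^∞⟮𝓡 n; F, E⟯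
  /-- the constants `⟨e_a, e_b⟩` -/
  g : Matrix (Fin p) (Fin p) ℝ
  /-- the constants `⟨e_ā, e_b̄⟩` -/
  h : Matrix (Fin q) (Fin q) ℝ
  frame_e : ∀ᶠ x in 𝓝 x₀, LinearIndependent ℝ (fun a => e a x) ∧
    Submodule.span ℝ (Set.range fun a => e a x) = V.plus x
  frame_f : ∀ᶠ x in 𝓝 x₀, LinearIndependent ℝ (fun a => f a x) ∧
    Submodule.span ℝ (Set.range fun a => f a x) = V.minus x
  gram_e : ∀ᶠ x in 𝓝 x₀, ∀ a b, C.metric x (e a x) (e b x) = g a b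
  gram_f : ∀ᶠ x in 𝓝 x₀, ∀ a b, C.metric x (f a x) (f b x) = h a b

namespace AdaptedFrame

variable {V} {x₀ : M} (A : V.AdaptedFrame x₀)

/-- The dual frame `e^a` of `V₊`. -/
def eUp (a : Fin A.p) : Cₛ^∞⟮𝓡 n; F, E⟯ := ∑ b, A.g⁻¹ a b • A.e b

/-- The dual frame `e^ā` of `V₋`. -/
def fUp (a : Fin A.q) : Cₛ^∞⟮𝓡 n; F, E⟯ := ∑ b, A.h⁻¹ a b • A.f b

end AdaptedFrame

end GenPseudometric

namespace CourantAlgebroid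

variable (C : CourantAlgebroid n F E)

/-- `⟨u, [v, w]⟩`. -/
def triple (u v w : Cₛ^∞⟮𝓡 n; F, E⟯) (x : M) : ℝ := C.metric x (u x) (C.bracket v w x)

end CourantAlgebroid

namespace GenPseudometric

variable {C : CourantAlgebroid n F E}

/-- The operator `4 L_{ρ(e^a)} L_{ρ(e_a)} - 1/6 c_{abc} c^{abc} - 1/2 c_{abc̄} c^{abc̄}`, where
`c_{αβγ} = ⟨e_α, [e_β, e_γ]⟩`, on half-densities. -/
def AdaptedFrame.laplacian {V : GenPseudometric C} {x₀ : M} (A : V.AdaptedFrame x₀)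
    (σ : Density n M (1 / 2)) : Density n M (1 / 2) := fun x =>
  (4 : ℝ) • (∑ a, lieDeriv (C.anchorField (A.eUp a)) (lieDeriv (C.anchorField (A.e a)) σ) x)
    - ((1 / 6 : ℝ) * ∑ a, ∑ b, ∑ c, C.triple (A.e a) (A.e b) (A.e c) x
        * C.triple (A.eUp a) (A.eUp b) (A.eUp c) x) • σ x
    - ((1 / 2 : ℝ) * ∑ a, ∑ b, ∑ c, C.triple (A.e a) (A.e b) (A.f c) x
        * C.triple (A.eUp a) (A.eUp b) (A.fUp c) x) • σ x

open Classical in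
/-- The Laplacian `Δ_{V₊}` on half-densities. Its value at `x` is computed with an adapted local
frame near `x` (such a frame exists, and the value does not depend on it). -/
def laplacian (V : GenPseudometric C) (σ : Density n M (1 / 2)) : Density n M (1 / 2) := fun x =>
  if h : Nonempty (V.AdaptedFrame x) then h.some.laplacian σ x else 0

variable [T2Space M] [SigmaCompactSpace M]

/-- The action `S_E(V₊, σ) = -1/2 ∫ σ Δ_{V₊} σ`. -/
def action (V : GenPseudometric C) (σ : Density n M (1 / 2)) : ℝ :=
  -(1 / 2) * integral (mulHalf σ (V.laplacian σ))

/-- The change `S_E(V₊', σ') - S_E(V₊, σ)` of the action, as the integral of the difference of the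
Lagrangian densities. It makes sense on a non-compact manifold, if `(V₊', σ')` and `(V₊, σ)` agree
outside of a compact set. -/
def actionChange (V : GenPseudometric C) (σ : Density n M (1 / 2)) (V' : GenPseudometric C)
    (σ' : Density n M (1 / 2)) : ℝ :=
  -(1 / 2) * integral (mulHalf σ' (V'.laplacian σ') - mulHalf σ (V.laplacian σ))

/-- The inner product `g_σ(φ₁, φ₂) = -∫ ⟨φ₁, φ₂⟩ σ²` on `Γ(V₊ ⊗ V₋)`, the tangent space at `V₊` of
the space of generalized (pseudo)metrics. -/
def gSigma (V : GenPseudometric C) (σ : Density n M (1 / 2)) (φ₁ φ₂ : V.MixedSection) : ℝ :=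
  -integral (fun x => V.pair x (φ₁.toFun x) (φ₂.toFun x) • mulHalf σ σ x)

/-- `Ψ` is the gradient at `V₊` of the action, for `σ` fixed, with respect to `g_σ`. -/
def IsGradient (V : GenPseudometric C) (σ : Density n M (1 / 2)) (Ψ : V.MixedSection) : Prop :=
  ∀ (φ : V.MixedSection) (W : ℝ → GenPseudometric C), V.IsVariation φ W →
    HasDerivAt (fun t => (W t).action σ) (V.gSigma σ Ψ φ) 0

/-- `W` solves the generalized Ricci flow `d/dt W = GRic_{W,σ}` for `t ∈ J`. -/
def IsRicciFlow (σ : Density n M (1 / 2)) (J : Set ℝ) (W : ℝ → GenPseudometric C) : Prop :=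
  IsSmoothFamily J W ∧ ∀ t ∈ J, ∃ R : (W t).MixedSection,
    (W t).IsRicciSection σ R ∧ (W t).HasVelocity W t R

/-- `W` solves the gradient flow equation `d/dt W = -grad S_E(W, σ)` for `t ∈ J`. -/
def IsGradientFlow (σ : Density n M (1 / 2)) (J : Set ℝ) (W : ℝ → GenPseudometric C) : Prop :=
  IsSmoothFamily J W ∧ ∀ t ∈ J, ∃ Ψ : (W t).MixedSection,
    (W t).IsGradient σ Ψ ∧ (W t).HasVelocity W t (-Ψ)

/-- `(V₊, σ)` is stationary for the action: the first variation vanishes for all compactly supported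
variations of `V₊` with `σ` fixed and for all compactly supported variations of `σ` with `V₊`
fixed. -/
def IsStationary (V : GenPseudometric C) (σ : Density n M (1 / 2)) : Prop :=
  (∀ (φ : V.MixedSection) (W : ℝ → GenPseudometric C), V.IsVariation φ W →
    HasDerivAt (fun t => V.actionChange σ (W t) σ) 0 0) ∧
  ∀ ς : Density n M (1 / 2), IsSmoothDensity ς →
    (∃ K : Set M, IsCompact K ∧ ∀ x, x ∉ K → ς x = 0) →
    HasDerivAt (fun t : ℝ => V.actionChange σ V (σ + t • ς)) 0 0

end GenPseudometric

end Courant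

end GenRicci

end

open GenRicci

set_option linter.unusedSectionVars false

noncomputable section

open MeasureTheory

/-! ### Densities and vector fields in charts, and their coordinate changes -/

namespace GenRicci
section Densities
variable {n : ℕ} {M : Type*} [TopologicalSpace M] [ChartedSpace (EuclideanSpace ℝ (Fin n)) M]
  [IsManifold (𝓡 n) ∞ M]

local notation "𝔼" => EuclideanSpace ℝ (Fin n)
local notation "ψ" => extChartAt (𝓡 n)

/-! Division by `σ` turns the statement into one about functions. With `μ = σ²` one has `L_X (f σ) =
(X f + ½ f div X) σ`. In a local frame of `V₊` with `⟨e_a, e_b⟩ = ε_a δ_ab`, `ε_a = ±1`, this gives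
`Δ (f σ) = (4 div (grad f)₊ + f R) σ`, where R = Σ ε_a (2 e_a · div e_a + (div e_a)²) - Σ ε_a ε_b (½
|[e_a, e_b]|² - ⅓ |[e_a, e_b]₊|²) and `|u|² = ⟨u, u⟩` (`potential_eq`, `laplacian_smul_eq`). Hence
the action is `-½ ∫ R σ²`. The Laplacian is defined with an arbitrarily chosen frame, so frame
independence has to be proved. Constant changes of frame are harmless, and for a rotation that is
the identity at the point the derivatives of the rotation cancel, by antisymmetry
(`scal_eq_of_apply_eq`, `principal_eq_of_apply_eq`).

Variation of `V₊`: if `V₊` moves with velocity `φ`, a pseudo-orthonormal frame can be moved along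
with velocity `φ(e_a) ∈ V₋` (`exists_orthoFrame_family`). Differentiation of the formula for `R`
yields `δR = 2 div Z - 2 GRic(φ)` with `Z = Σ ε_a ([φ e_a, e_a]₊ + div(φ e_a) e_a)`
(`scalFnDeriv_add_ricFn`). The section `Z` does not depend on the frame (`ip_divSection`), so it is
global with compact support. Its divergence integrates to zero, and the factor `-½` leaves `∫
GRic(φ) σ²`.

Variation of `σ`: along `(1 + t f) σ` the action is a quadratic polynomial in `t`, and the
derivative terms of first order in `t` form a divergence (`hasDerivAt_actionChange_density`).

The rest follows from three facts. `GRic` is tensorial, because the anchor is a homomorphism of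
brackets (`ricFn_smul_left`, `ricFn_smul_right`). Every compactly supported `φ` is realised by the
graphs `(1 + t φ) V₊` (`exists_isVariation`). Finally, sections and functions are determined by
their integrals against test objects (`eq_of_integral_pair`, `IsVolume.integral_pos`). The gradient,
the flow equation and the Euler-Lagrange equations are then formal.

On the analytic side, `integral` is identified with integration against a measure, which allows
differentiation under the integral sign, and integration by parts in charts gives the divergence
theorem. -/

/-- The derivative of a chart, as a map between model spaces. -/
theorem mfderiv_extChartAt_eq (x₀ : M) {p : M} (hp : p ∈ (ψ x₀).source) :
    (mfderiv (𝓡 n) (𝓡 n) (ψ x₀) p : 𝔼 →L[ℝ] 𝔼) = tangentCoordChange (𝓡 n) p x₀ p := by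
  have : IsManifold (𝓡 n) 1 M := IsManifold.of_le (n := ∞) (by simp)
  rw [extChartAt_source] at hp
  exact mfderiv_chartAt_eq_tangentCoordChange (I := 𝓡 n) hp

theorem mdifferentiableAt_extChartAt_symm' (x₀ : M) {p : M} (hp : p ∈ (ψ x₀).source) :
    MDifferentiableAt (𝓡 n) (𝓡 n) (ψ x₀).symm (ψ x₀ p) := by
  have : IsManifold (𝓡 n) 1 M := IsManifold.of_le (n := ∞) (by simp)
  have := mdifferentiableWithinAt_extChartAt_symm (I := 𝓡 n) ((ψ x₀).map_source hp)
  simpa [mdifferentiableWithinAt_univ] using this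

theorem mfderiv_extChartAt_symm_eq (x₀ : M) {p : M} (hp : p ∈ (ψ x₀).source) :
    (mfderiv (𝓡 n) (𝓡 n) (ψ x₀).symm (ψ x₀ p) : 𝔼 →L[ℝ] 𝔼) = tangentCoordChange (𝓡 n) x₀ p p := by
  have : IsManifold (𝓡 n) 1 M := IsManifold.of_le (n := ∞) (by simp)
  -- The derivative takes values in the tangent space at `(ψ x₀).symm (ψ x₀ p)`, which equals `p`
  -- only propositionally; the base point is generalised so that the equality can be substituted.
  have key : ∀ q : M, q = p → fderivWithin ℝ (ψ q ∘ (ψ x₀).symm) (Set.range (𝓡 n)) (ψ x₀ p)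
      = tangentCoordChange (𝓡 n) x₀ p p := by
    rintro q rfl
    rfl
  refine Eq.trans ?_ (key _ ((ψ x₀).left_inv hp))
  exact (mdifferentiableAt_extChartAt_symm' x₀ hp).mfderiv

theorem coordFrame_eq (x₀ : M) {p : M} (hp : p ∈ (ψ x₀).source) (i : Fin n) :
    (coordFrame n x₀ p i : 𝔼) = tangentCoordChange (𝓡 n) x₀ p p (EuclideanSpace.single i 1) :=
  congrArg (fun L : 𝔼 →L[ℝ] 𝔼 => L (EuclideanSpace.single i 1)) (mfderiv_extChartAt_symm_eq x₀ hp)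

theorem components_eq (X : ∀ x : M, TangentSpace (𝓡 n) x) (x₀ : M) {p : M}
    (hp : p ∈ (ψ x₀).source) :
    components X x₀ (ψ x₀ p) = tangentCoordChange (𝓡 n) p x₀ p (X p : 𝔼) := by
  have h : (ψ x₀).symm (ψ x₀ p) = p := (ψ x₀).left_inv hp
  unfold components
  rw [h]
  exact congrArg (fun L : 𝔼 →L[ℝ] 𝔼 => L (X p)) (mfderiv_extChartAt_eq x₀ hp)

theorem coeff_eq {w : ℝ} (μ : Density n M w) (x₀ : M) {p : M} (hp : p ∈ (ψ x₀).source) :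
    coeff μ x₀ (ψ x₀ p) = (μ p).1 (coordFrame n x₀ p) := by
  have h : (ψ x₀).symm (ψ x₀ p) = p := (ψ x₀).left_inv hp
  unfold coeff
  rw [h]

theorem coordFrame_self (p : M) (i : Fin n) :
    @Eq 𝔼 (coordFrame n p p i) (EuclideanSpace.single i (1 : ℝ) : 𝔼) := by
  refine (coordFrame_eq p (mem_extChartAt_source p) i).trans ?_
  exact tangentCoordChange_self (I := 𝓡 n) (v := (EuclideanSpace.single i 1 : 𝔼))
    (mem_extChartAt_source p)

theorem components_self (X : ∀ x : M, TangentSpace (𝓡 n) x) (p : M) :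
    components X p (ψ p p) = (X p : 𝔼) := by
  refine (components_eq X p (mem_extChartAt_source p)).trans ?_
  exact tangentCoordChange_self (I := 𝓡 n) (v := (X p : 𝔼)) (mem_extChartAt_source p)

/-- The transformation law of the coefficient of a density. -/
theorem coeff_change {w : ℝ} (μ : Density n M w) (x₀ x₁ : M) {p : M} (hp₀ : p ∈ (ψ x₀).source)
    (hp₁ : p ∈ (ψ x₁).source) :
    coeff μ x₀ (ψ x₀ p) =
      |(tangentCoordChange (𝓡 n) x₀ x₁ p).det| ^ w * coeff μ x₁ (ψ x₁ p) := by
  rw [coeff_eq μ x₀ hp₀, coeff_eq μ x₁ hp₁]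
  have hp := mem_extChartAt_source (I := 𝓡 n) p
  set A : 𝔼 →L[ℝ] 𝔼 := tangentCoordChange (𝓡 n) x₁ p p
  set B : 𝔼 →L[ℝ] 𝔼 := tangentCoordChange (𝓡 n) x₀ x₁ p
  set A' : 𝔼 →L[ℝ] 𝔼 := tangentCoordChange (𝓡 n) p x₁ p
  have hAA : A'.toLinearMap ∘ₗ A.toLinearMap = LinearMap.id := by
    ext1 v
    exact (tangentCoordChange_comp ⟨⟨hp₁, hp⟩, hp₁⟩).trans (tangentCoordChange_self hp₁)
  -- One coordinate frame is the image of the other under `A B A'`. Since `A'` inverts `A`, this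
  -- endomorphism is conjugate to the chart change `B` and has the same determinant.
  have h1 : (coordFrame n x₀ p) = fun i => (A.toLinearMap ∘ₗ B.toLinearMap ∘ₗ A'.toLinearMap)
      (coordFrame n x₁ p i : 𝔼) := by
    funext i
    refine (coordFrame_eq x₀ hp₀ i).trans ?_
    have h2 : A'.toLinearMap (coordFrame n x₁ p i : 𝔼) = EuclideanSpace.single i 1 := by
      rw [coordFrame_eq x₁ hp₁ i]
      exact LinearMap.congr_fun hAA _
    refine (tangentCoordChange_comp (x := x₁) ⟨⟨hp₀, hp₁⟩, hp⟩).symm.trans ?_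
    exact congrArg (fun v : 𝔼 => A (B v)) h2.symm
  have hdet : LinearMap.det (A.toLinearMap ∘ₗ B.toLinearMap ∘ₗ A'.toLinearMap) = B.det := by
    have h3 : LinearMap.det A'.toLinearMap * LinearMap.det A.toLinearMap = 1 := by
      rw [← LinearMap.det_comp, hAA, LinearMap.det_id]
    rw [LinearMap.det_comp, LinearMap.det_comp]
    change _ = LinearMap.det B.toLinearMap
    linear_combination (LinearMap.det B.toLinearMap) * h3
  rw [h1, ← hdet]
  exact (μ p).2 (A.toLinearMap ∘ₗ B.toLinearMap ∘ₗ A'.toLinearMap) (coordFrame n x₁ p)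

theorem hasFDerivAt_chart_change (x₀ x₁ : M) {p : M} (hp₀ : p ∈ (ψ x₀).source)
    (hp₁ : p ∈ (ψ x₁).source) :
    HasFDerivAt (ψ x₁ ∘ (ψ x₀).symm) (tangentCoordChange (𝓡 n) x₀ x₁ p) (ψ x₀ p) := by
  have : IsManifold (𝓡 n) 1 M := IsManifold.of_le (n := ∞) (by simp)
  have h := hasFDerivWithinAt_tangentCoordChange (I := 𝓡 n) (x := x₀) (y := x₁) ⟨hp₀, hp₁⟩
  simpa using h

theorem hasFDerivAt_comp_chart_symm {f : M → ℝ} (x₀ : M) {p : M} (hp : p ∈ (ψ x₀).source)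
    {L : 𝔼 →L[ℝ] ℝ} (hf : HasMFDerivAt (𝓡 n) 𝓘(ℝ, ℝ) f p L) :
    HasFDerivAt (f ∘ (ψ x₀).symm) (L.comp (tangentCoordChange (𝓡 n) x₀ p p)) (ψ x₀ p) := by
  have hinv : (ψ x₀).symm (ψ x₀ p) = p := (ψ x₀).left_inv hp
  have h1 : ∀ q : M, q = p → HasMFDerivAt (𝓡 n) 𝓘(ℝ, ℝ) f q L := by
    rintro q rfl
    exact hf
  have h2 := (mdifferentiableAt_extChartAt_symm' x₀ hp).hasMFDerivAt
  have h3 := (HasMFDerivAt.comp (ψ x₀ p) (h1 _ hinv) h2).hasFDerivAt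
  have h4 := mfderiv_extChartAt_symm_eq x₀ hp
  rw [← h4]
  exact h3

/-- Coordinate expression of the derivative of a function along a vector. -/
theorem dirDeriv_eq_fderiv {f : M → ℝ} (x₀ : M) {p : M} (hp : p ∈ (ψ x₀).source)
    (hf : MDifferentiableAt (𝓡 n) 𝓘(ℝ, ℝ) f p) (X : ∀ x : M, TangentSpace (𝓡 n) x) :
    dirDeriv f p (X p) = fderiv ℝ (f ∘ (ψ x₀).symm) (ψ x₀ p) (components X x₀ (ψ x₀ p)) := by
  rw [(hasFDerivAt_comp_chart_symm x₀ hp hf.hasMFDerivAt).fderiv, components_eq X x₀ hp]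
  have hpp := mem_extChartAt_source (I := 𝓡 n) p
  have h : tangentCoordChange (𝓡 n) x₀ p p (tangentCoordChange (𝓡 n) p x₀ p (X p : 𝔼)) = (X p : 𝔼) :=
    (tangentCoordChange_comp ⟨⟨hpp, hp⟩, hpp⟩).trans (tangentCoordChange_self hpp)
  exact congrArg (mfderiv (𝓡 n) 𝓘(ℝ, ℝ) f p : 𝔼 →L[ℝ] ℝ) h.symm

theorem contDiffOn_components {X : ∀ x : M, TangentSpace (𝓡 n) x}
    (hX : ContMDiff (𝓡 n) (𝓡 n).tangent ∞ (fun x => (⟨x, X x⟩ : TangentBundle (𝓡 n) M))) (x₀ : M) :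
    ContDiffOn ℝ ∞ (components X x₀) (ψ x₀).target := by
  have h1 : ContMDiffOn (𝓡 n) 𝓘(ℝ, 𝔼) ∞
      (fun p => tangentCoordChange (𝓡 n) p x₀ p (X p : 𝔼)) (ψ x₀).source := by
    intro p hp
    have h := (hX p)
    rw [extChartAt_source] at hp
    refine ContMDiffAt.contMDiffWithinAt ?_
    have := (Bundle.Trivialization.contMDiffAt_section_iff (IB := 𝓡 n) (n := ∞) (trivializationAt 𝔼 (TangentSpace (𝓡 n)) x₀) (s := X) (x₀ := p) (by simpa using hp)).1 h
    exact this
  have h2 : ContMDiffOn (𝓡 n) 𝓘(ℝ, 𝔼) ∞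
      ((fun p => tangentCoordChange (𝓡 n) p x₀ p (X p : 𝔼)) ∘ (ψ x₀).symm) (ψ x₀).target :=
    h1.comp (contMDiffOn_extChartAt_symm x₀) fun y hy => (ψ x₀).map_target hy
  refine (contMDiffOn_iff_contDiffOn.1 h2).congr fun y hy => ?_
  have := components_eq X x₀ ((ψ x₀).map_target hy)
  rw [(ψ x₀).right_inv hy] at this
  exact this

theorem contDiffOn_comp_chart_symm {f : M → ℝ} {s : Set M} (x₀ : M)
    (hf : ContMDiffOn (𝓡 n) 𝓘(ℝ, ℝ) ∞ f s) :
    ContDiffOn ℝ ∞ (f ∘ (ψ x₀).symm) ((ψ x₀).target ∩ (ψ x₀).symm ⁻¹' s) := by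
  refine contMDiffOn_iff_contDiffOn.1 (hf.comp ((contMDiffOn_extChartAt_symm x₀).mono
    Set.inter_subset_left) fun y hy => hy.2)

/-- One basis suffices: every tuple of `n` vectors is the image of that basis under a linear map,
possibly singular. -/
theorem densityFiber_ext {w : ℝ} {p : M} (x₀ : M) (hp : p ∈ (ψ x₀).source)
    {μ ν : densityFiber n w (TangentSpace (𝓡 n) p)}
    (h : μ.1 (coordFrame n x₀ p) = ν.1 (coordFrame n x₀ p)) : μ = ν := by
  ext v
  have hpp := mem_extChartAt_source (I := 𝓡 n) p
  set A : 𝔼 →L[ℝ] 𝔼 := tangentCoordChange (𝓡 n) p x₀ p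
  let b := (EuclideanSpace.basisFun (Fin n) ℝ).toBasis
  let B : 𝔼 →ₗ[ℝ] 𝔼 := (b.constr ℝ fun i => (v i : 𝔼)) ∘ₗ A.toLinearMap
  have hv : v = fun i => (B (coordFrame n x₀ p i : 𝔼) : 𝔼) := by
    funext i
    have h1 : A (coordFrame n x₀ p i : 𝔼) = EuclideanSpace.single i 1 := by
      rw [coordFrame_eq x₀ hp i]
      exact (tangentCoordChange_comp ⟨⟨hp, hpp⟩, hp⟩).trans (tangentCoordChange_self hp)
    have h2 : B (coordFrame n x₀ p i : 𝔼) = v i := by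
      change (b.constr ℝ fun i => (v i : 𝔼)) (A (coordFrame n x₀ p i : 𝔼)) = v i
      rw [h1]
      have : (EuclideanSpace.single i 1 : 𝔼) = b i := by simp [b]
      rw [this, Module.Basis.constr_basis]
    exact h2.symm
  rw [hv]
  exact (μ.2 B (coordFrame n x₀ p)).trans ((congrArg _ h).trans (ν.2 B (coordFrame n x₀ p)).symm)

theorem lieDeriv_apply {w : ℝ} (X : ∀ x : M, TangentSpace (𝓡 n) x) (μ : Density n M w) (p : M) :
    (lieDeriv X μ p).1 (coordFrame n p p) =
      fderiv ℝ (coeff μ p) (ψ p p) (components X p (ψ p p))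
      + w * (∑ i, fderiv ℝ (components X p) (ψ p p) (EuclideanSpace.single i (1 : ℝ)) i)
        * coeff μ p (ψ p p) := by
  have h : (EuclideanSpace.basisFun (Fin n) ℝ).toBasis.det
      (fun i => (coordFrame n p p i : 𝔼)) = 1 := by
    have : (fun i => (coordFrame n p p i : 𝔼)) = (EuclideanSpace.basisFun (Fin n) ℝ).toBasis := by
      funext i
      refine (coordFrame_self p i).trans ?_
      simp
    rw [this, Module.Basis.det_self]
  have h2 : (lieDeriv X μ p).1 (coordFrame n p p) =
    |(EuclideanSpace.basisFun (Fin n) ℝ).toBasis.det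
      (fun i => (coordFrame n p p i : 𝔼))| ^ w * (fderiv ℝ (coeff μ p) (ψ p p) (components X p (ψ p p))
      + w * (∑ i, fderiv ℝ (components X p) (ψ p p) (EuclideanSpace.single i (1 : ℝ)) i)
        * coeff μ p (ψ p p)) := rfl
  rw [h2, h, abs_one, Real.one_rpow, one_mul]

end Densities
end GenRicci

/-! ### Integration of densities: charts and partitions of unity -/

namespace GenRicci
section Densities
variable {n : ℕ} {M : Type*} [TopologicalSpace M] [ChartedSpace (EuclideanSpace ℝ (Fin n)) M]
  [IsManifold (𝓡 n) ∞ M]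

local notation "𝔼" => EuclideanSpace ℝ (Fin n)
local notation "ψ" => extChartAt (𝓡 n)

/-- Smooth functions on `M`. -/
abbrev Smooth (n : ℕ) {M : Type*} [TopologicalSpace M] [ChartedSpace (EuclideanSpace ℝ (Fin n)) M]
    (f : M → ℝ) : Prop := ContMDiff (𝓡 n) 𝓘(ℝ, ℝ) ∞ f

/-- Continuous functions with compact support in `U`. -/
structure IsTest {M : Type*} [TopologicalSpace M] (U : Set M) (f : M → ℝ) : Prop where
  cont : Continuous f
  compact : HasCompactSupport f
  sub : tsupport f ⊆ U

theorem IsTest.mul_right {U : Set M} {f g : M → ℝ} (hf : IsTest U f) (hg : Continuous g) :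
    IsTest U (fun x => f x * g x) :=
  ⟨hf.cont.mul hg, hf.compact.mul_right, (tsupport_mul_subset_left).trans hf.sub⟩

theorem IsTest.mul_left {U : Set M} {f g : M → ℝ} (hf : IsTest U f) (hg : Continuous g) :
    IsTest U (fun x => g x * f x) := by
  simpa only [mul_comm] using hf.mul_right hg

/-- A smooth positive density. -/
structure IsVolume (μ : Density n M 1) : Prop where
  smooth : IsSmoothDensity μ
  pos : ∀ x₀ : M, ∀ y ∈ (ψ x₀).target, 0 < coeff μ x₀ y

theorem isOpen_target (x₀ : M) : IsOpen (ψ x₀).target := isOpen_extChartAt_target x₀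

/-- The integral of `h μ` over the domain of the chart at `i`. -/
def chartInt (μ : Density n M 1) (i : M) (h : M → ℝ) : ℝ :=
  ∫ y in (ψ i).target, h ((ψ i).symm y) * coeff μ i y

theorem continuousOn_chart_symm {f : M → ℝ} (hf : Continuous f) (i : M) :
    ContinuousOn (fun y => f ((ψ i).symm y)) (ψ i).target :=
  hf.comp_continuousOn (continuousOn_extChartAt_symm i)

/-- `g` vanishes off the compact image of the support of `f`, so its continuity on the target is
enough. -/
theorem integrableOn_target {i : M} {f : M → ℝ} (hf : HasCompactSupport f)
    (hs : tsupport f ⊆ (ψ i).source) {g : 𝔼 → ℝ} (hg : ContinuousOn g (ψ i).target)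
    (h0 : ∀ y ∈ (ψ i).target, f ((ψ i).symm y) = 0 → g y = 0) : IntegrableOn g (ψ i).target := by
  have hK : IsCompact (ψ i '' tsupport f) :=
    hf.isCompact.image_of_continuousOn ((continuousOn_extChartAt i).mono hs)
  have hKs : ψ i '' tsupport f ⊆ (ψ i).target := by
    rintro _ ⟨x, hx, rfl⟩
    exact (ψ i).map_source (hs hx)
  refine ((hg.mono hKs).integrableOn_compact hK).of_forall_sdiff_eq_zero
    (isOpen_target i).measurableSet fun y hy => h0 y hy.1 ?_
  by_contra h
  exact hy.2 ⟨_, subset_tsupport _ h, (ψ i).right_inv hy.1⟩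

theorem IsVolume.continuousOn {μ : Density n M 1} (hμ : IsVolume μ) (i : M) :
    ContinuousOn (coeff μ i) (ψ i).target := (hμ.smooth i).continuousOn

theorem IsVolume.integrableOn {μ : Density n M 1} (hμ : IsVolume μ) {i : M} {f : M → ℝ}
    (hf : IsTest (ψ i).source f) :
    IntegrableOn (fun y => f ((ψ i).symm y) * coeff μ i y) (ψ i).target :=
  integrableOn_target hf.compact hf.sub ((continuousOn_chart_symm hf.cont i).mul (hμ.continuousOn i))
    fun y _ h => by rw [h, zero_mul]

/-- Both integrals live on the overlap of the two charts, where the Jacobian in the change of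
variables formula is the factor of `coeff_change` in weight 1. -/
theorem chartInt_change (μ : Density n M 1) {i j : M} {f : M → ℝ}
    (h0 : ∀ x, x ∉ (ψ i).source ∩ (ψ j).source → f x = 0) : chartInt μ j f = chartInt μ i f := by
  have hSmeas : ∀ i j : M, MeasurableSet (ψ i '' ((ψ i).source ∩ (ψ j).source)) := fun i j => by
    have : ψ i '' ((ψ i).source ∩ (ψ j).source) = (ψ i).target ∩ (ψ i).symm ⁻¹' (ψ j).source :=
      (ψ i).image_source_inter_eq' _
    rw [this]
    exact ((continuousOn_extChartAt_symm i).isOpen_inter_preimage (isOpen_target i)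
      (isOpen_extChartAt_source j)).measurableSet
  have hred : ∀ i j : M, (∀ x, x ∉ (ψ i).source ∩ (ψ j).source → f x = 0) →
      chartInt μ i f = ∫ y in ψ i '' ((ψ i).source ∩ (ψ j).source),
        f ((ψ i).symm y) * coeff μ i y := fun i j h0 => by
    refine setIntegral_eq_of_subset_of_forall_sdiff_eq_zero (isOpen_target i).measurableSet ?_ ?_
    · rintro _ ⟨x, hx, rfl⟩
      exact (ψ i).map_source hx.1
    · intro y hy
      rw [h0, zero_mul]
      exact fun h => hy.2 ⟨_, h, (ψ i).right_inv hy.1⟩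
  rw [hred i j h0, hred j i (fun x hx => h0 x (by rwa [Set.inter_comm]))]
  have himg : ψ j '' ((ψ j).source ∩ (ψ i).source)
      = (ψ j ∘ (ψ i).symm) '' (ψ i '' ((ψ i).source ∩ (ψ j).source)) := by
    rw [← Set.image_comp, Set.inter_comm]
    refine Set.image_congr fun x hx => ?_
    simp only [Function.comp]
    rw [(ψ i).left_inv hx.1]
  rw [himg, integral_image_eq_integral_abs_det_fderiv_smul volume (hSmeas i j)
    (f' := fun y => tangentCoordChange (𝓡 n) i j ((ψ i).symm y))]
  · refine setIntegral_congr_fun (hSmeas i j) ?_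
    rintro _ ⟨x, hx, rfl⟩
    simp only [Function.comp, smul_eq_mul]
    rw [(ψ i).left_inv hx.1, (ψ j).left_inv hx.2, coeff_change μ i j hx.1 hx.2, Real.rpow_one]
    ring
  · rintro _ ⟨x, hx, rfl⟩
    have := hasFDerivAt_chart_change i j hx.1 hx.2
    rw [(ψ i).left_inv hx.1]
    exact this.hasFDerivWithinAt
  · rintro _ ⟨x, hx, rfl⟩ _ ⟨x', hx', rfl⟩ h
    simp only [Function.comp] at h
    rw [(ψ i).left_inv hx.1, (ψ i).left_inv hx'.1] at h
    rw [(ψ j).injOn hx.2 hx'.2 h]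

variable [T2Space M] [SigmaCompactSpace M]

local notation "ϱ" => chartPartition n M

theorem tsupport_chartPartition (i : M) : tsupport (ϱ i) ⊆ (ψ i).source := by
  rw [extChartAt_source]
  exact (SmoothPartitionOfUnity.exists_isSubordinate_chartAt_source (𝓡 n) M).choose_spec i

/-- Only finitely many members of the partition meet a compact set; this makes the `finsum` in
`integral` a genuine finite sum. -/
theorem chartPartition_finite {K : Set M} (hK : IsCompact K) :
    ∃ t : Finset M, ∀ i ∉ t, ∀ x ∈ K, ϱ i x = 0 := by
  refine ⟨((ϱ).locallyFinite.finite_nonempty_inter_compact hK).toFinset, fun i hi x hx => ?_⟩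
  by_contra h
  exact hi (by simpa using ⟨x, h, hx⟩)

theorem isTest_chartPartition_mul {f : M → ℝ} (hf : Continuous f) (hc : HasCompactSupport f)
    (i : M) : IsTest (ψ i).source (fun x => ϱ i x * f x) :=
  ⟨(ϱ i).contMDiff.continuous.mul hf, hc.mul_left,
    (tsupport_mul_subset_left).trans (tsupport_chartPartition i)⟩

theorem integral_eq_sum (μ : Density n M 1) {K : Set M} {t : Finset M}
    (ht : ∀ i ∉ t, ∀ x ∈ K, ϱ i x = 0) {f : M → ℝ} (hf : ∀ x ∉ K, f x = 0) :
    integral (fun x => f x • μ x) = ∑ i ∈ t, chartInt μ i (fun x => ϱ i x * f x) := by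
  have h1 : ∀ i, (∫ y in (ψ i).target, ϱ i ((ψ i).symm y) * coeff (fun x => f x • μ x) i y)
      = chartInt μ i (fun x => ϱ i x * f x) := fun i => by
    unfold chartInt
    congr 1
    funext y
    rw [mul_assoc]
    rfl
  unfold integral
  simp only [h1]
  refine finsum_eq_sum_of_support_subset _ fun i hi => ?_
  by_contra h
  refine hi ?_
  unfold chartInt
  have : ∀ x, ϱ i x * f x = 0 := fun x => by
    by_cases hx : x ∈ K
    · rw [ht i h x hx, zero_mul]
    · rw [hf x hx, mul_zero]
  simp [this]

theorem sum_chartPartition {K : Set M} {t : Finset M}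
    (ht : ∀ i ∉ t, ∀ x ∈ K, ϱ i x = 0) {x : M} (hx : x ∈ K) : ∑ i ∈ t, ϱ i x = 1 := by
  rw [← (ϱ).sum_eq_one (Set.mem_univ x)]
  refine (finsum_eq_sum_of_support_subset _ fun i hi => ?_).symm
  by_contra h
  exact hi (ht i h x hx)

/-- If the support of `f` is contained in the domain of a chart, then the integral of `f μ` can be
computed in this chart. -/
theorem IsVolume.integral_eq_chartInt {μ : Density n M 1} (hμ : IsVolume μ) {f : M → ℝ} {j : M}
    (hf : IsTest (ψ j).source f) : integral (fun x => f x • μ x) = chartInt μ j f := by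
  obtain ⟨t, ht⟩ := chartPartition_finite (n := n) (M := M) hf.compact.isCompact
  rw [integral_eq_sum μ ht (f := f) fun x hx => image_eq_zero_of_notMem_tsupport hx]
  -- Every piece is moved to the chart at `j`; there the pieces add up to `f`, because the partition
  -- functions sum to 1 on its support.
  have h1 : ∀ i ∈ t, chartInt μ i (fun x => ϱ i x * f x) = chartInt μ j (fun x => ϱ i x * f x) := by
    intro i _
    refine (chartInt_change μ fun x hx => ?_).symm
    by_contra h
    obtain ⟨h1, h2⟩ := mul_ne_zero_iff.1 h
    exact hx ⟨tsupport_chartPartition i (subset_tsupport _ h1), hf.sub (subset_tsupport _ h2)⟩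
  rw [Finset.sum_congr rfl h1]
  unfold chartInt
  rw [← integral_finsetSum]
  · refine setIntegral_congr_fun (isOpen_target j).measurableSet fun y _ => ?_
    simp only [← Finset.sum_mul]
    by_cases hy : (ψ j).symm y ∈ tsupport f
    · rw [sum_chartPartition ht hy, one_mul]
    · rw [image_eq_zero_of_notMem_tsupport hy]; simp
  · intro i _
    exact hμ.integrableOn (hf.mul_left (ϱ i).contMDiff.continuous)

theorem IsVolume.integral_add {μ : Density n M 1} (hμ : IsVolume μ) {f g : M → ℝ}
    (hf : Continuous f) (hfc : HasCompactSupport f) (hg : Continuous g)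
    (hgc : HasCompactSupport g) :
    integral (fun x => (f x + g x) • μ x)
      = integral (fun x => f x • μ x) + integral (fun x => g x • μ x) := by
  obtain ⟨t, ht⟩ := chartPartition_finite (n := n) (M := M) (hfc.isCompact.union hgc.isCompact)
  have hf0 : ∀ x ∉ tsupport f ∪ tsupport g, f x = 0 := fun x hx =>
    image_eq_zero_of_notMem_tsupport fun h => hx (Or.inl h)
  have hg0 : ∀ x ∉ tsupport f ∪ tsupport g, g x = 0 := fun x hx =>
    image_eq_zero_of_notMem_tsupport fun h => hx (Or.inr h)
  rw [integral_eq_sum μ ht hf0, integral_eq_sum μ ht hg0,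
    integral_eq_sum μ ht (f := fun x => f x + g x) fun x hx => by rw [hf0 x hx, hg0 x hx, add_zero],
    ← Finset.sum_add_distrib]
  refine Finset.sum_congr rfl fun i _ => ?_
  unfold chartInt
  rw [← MeasureTheory.integral_add (hμ.integrableOn (isTest_chartPartition_mul hf hfc i))
    (hμ.integrableOn (isTest_chartPartition_mul hg hgc i))]
  congr 1
  funext y
  ring

theorem IsVolume.integral_smul (μ : Density n M 1) {f : M → ℝ} (hfc : HasCompactSupport f)
    (c : ℝ) : integral (fun x => (c * f x) • μ x) = c * integral (fun x => f x • μ x) := by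
  obtain ⟨t, ht⟩ := chartPartition_finite (n := n) (M := M) hfc.isCompact
  have hf0 : ∀ x ∉ tsupport f, f x = 0 := fun x hx => image_eq_zero_of_notMem_tsupport hx
  rw [integral_eq_sum μ ht hf0, integral_eq_sum μ ht (f := fun x => c * f x) fun x hx => by
    rw [hf0 x hx, mul_zero], Finset.mul_sum]
  refine Finset.sum_congr rfl fun i _ => ?_
  unfold chartInt
  rw [← integral_const_mul]
  congr 1
  funext y
  ring

theorem IsVolume.chartInt_nonneg {μ : Density n M 1} (hμ : IsVolume μ) {f : M → ℝ} (i : M)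
    (h0 : ∀ x, 0 ≤ f x) : 0 ≤ chartInt μ i f :=
  setIntegral_nonneg (isOpen_target i).measurableSet fun y hy =>
    mul_nonneg (h0 _) (hμ.pos i y hy).le

theorem IsVolume.integral_nonneg {μ : Density n M 1} (hμ : IsVolume μ) {f : M → ℝ}
    (hfc : HasCompactSupport f) (h0 : ∀ x, 0 ≤ f x) : 0 ≤ integral (fun x => f x • μ x) := by
  obtain ⟨t, ht⟩ := chartPartition_finite (n := n) (M := M) hfc.isCompact
  rw [integral_eq_sum μ ht fun x hx => image_eq_zero_of_notMem_tsupport hx]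
  exact Finset.sum_nonneg fun i _ => hμ.chartInt_nonneg i fun x => mul_nonneg ((ϱ).nonneg i x) (h0 x)

theorem IsVolume.integral_pos {μ : Density n M 1} (hμ : IsVolume μ) {f : M → ℝ}
    (hf : Continuous f) (hfc : HasCompactSupport f) (h0 : ∀ x, 0 ≤ f x) {x : M} (hx : 0 < f x) :
    0 < integral (fun x => f x • μ x) := by
  obtain ⟨t, ht⟩ := chartPartition_finite (n := n) (M := M) hfc.isCompact
  have hxt : x ∈ tsupport f := subset_tsupport _ hx.ne'
  rw [integral_eq_sum μ ht fun x hx => image_eq_zero_of_notMem_tsupport hx]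
  have hnn : ∀ i x, 0 ≤ ϱ i x * f x := fun i x => mul_nonneg ((ϱ).nonneg i x) (h0 x)
  -- All terms are nonnegative, so one strictly positive term is enough; it comes from a chart whose
  -- partition function does not vanish at `x`.
  obtain ⟨i, hi, hix⟩ : ∃ i ∈ t, ϱ i x ≠ 0 := by
    by_contra h
    push Not at h
    have := sum_chartPartition ht hxt
    rw [Finset.sum_eq_zero h] at this
    exact zero_ne_one this
  refine Finset.sum_pos' (fun i _ => hμ.chartInt_nonneg i (hnn i)) ⟨i, hi, ?_⟩
  have hxs : x ∈ (ψ i).source := tsupport_chartPartition i (subset_tsupport _ hix)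
  have htest := isTest_chartPartition_mul hf hfc (n := n) i
  unfold chartInt
  rw [setIntegral_pos_iff_support_of_nonneg_ae]
  · set g : 𝔼 → ℝ := fun y => ϱ i ((ψ i).symm y) * f ((ψ i).symm y) * coeff μ i y with hg
    have hgc : ContinuousOn g (ψ i).target :=
      (continuousOn_chart_symm htest.cont i).mul (hμ.continuousOn i)
    have hopen : IsOpen ((ψ i).target ∩ g ⁻¹' {0}ᶜ) :=
      hgc.isOpen_inter_preimage (isOpen_target i) isOpen_compl_singleton
    refine lt_of_lt_of_le (hopen.measure_pos volume ⟨ψ i x, (ψ i).map_source hxs, ?_⟩)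
      (measure_mono fun y hy => ⟨hy.2, hy.1⟩)
    simp only [hg, Set.mem_preimage, Set.mem_compl_iff, Set.mem_singleton_iff]
    rw [(ψ i).left_inv hxs]
    exact mul_ne_zero (mul_ne_zero hix hx.ne') (hμ.pos i _ ((ψ i).map_source hxs)).ne'
  · refine (ae_restrict_iff' (isOpen_target i).measurableSet).2 (Filter.Eventually.of_forall
      fun y hy => mul_nonneg (hnn _ _) (hμ.pos i y hy).le)
  · exact hμ.integrableOn htest

end Densities
end GenRicci

/-! ### Differentiation under the integral sign; the divergence in a chart -/

namespace GenRicci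
section Densities
variable {n : ℕ} {M : Type*} [TopologicalSpace M] [ChartedSpace (EuclideanSpace ℝ (Fin n)) M]
  [IsManifold (𝓡 n) ∞ M]

local notation "𝔼" => EuclideanSpace ℝ (Fin n)
local notation "ψ" => extChartAt (𝓡 n)

variable [T2Space M] [SigmaCompactSpace M]

-- Linearity and positivity on compactly supported continuous functions give a measure by the
-- Riesz–Markov theorem. Dominated convergence then applies to `integral`, which is defined through
-- charts.
open CompactlySupported in
theorem IsVolume.exists_measure [MeasurableSpace M] [BorelSpace M] {μ : Density n M 1}
    (hμ : IsVolume μ) : ∃ ν : Measure M, IsFiniteMeasureOnCompacts ν ∧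
      ∀ f : M → ℝ, Continuous f → HasCompactSupport f →
        integral (fun x => f x • μ x) = ∫ x, f x ∂ν := by
  have : LocallyCompactSpace M := ChartedSpace.locallyCompactSpace (EuclideanSpace ℝ (Fin n)) M
  let Λ₀ : C_c(M, ℝ) →ₗ[ℝ] ℝ :=
    { toFun := fun f => integral (fun x => f x • μ x)
      map_add' := fun f g => hμ.integral_add f.continuous f.hasCompactSupport g.continuous
        g.hasCompactSupport
      map_smul' := fun c f => IsVolume.integral_smul μ f.hasCompactSupport c }
  let Λ : C_c(M, ℝ) →ₚ[ℝ] ℝ := PositiveLinearMap.mk₀ Λ₀ fun f hf =>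
    hμ.integral_nonneg f.hasCompactSupport hf
  refine ⟨RealRMK.rieszMeasure Λ, ?_, fun f hf hfc => ?_⟩
  · unfold RealRMK.rieszMeasure
    infer_instance
  · exact (RealRMK.integral_rieszMeasure Λ ⟨⟨f, hf⟩, hfc⟩).symm

/-- Differentiation under the integral sign, for functions with support in a fixed compact set. -/
theorem IsVolume.hasDerivAt_integral {μ : Density n M 1} (hμ : IsVolume μ) {G : ℝ → M → ℝ}
    {G' : M → ℝ} {K : Set M} (hK : IsCompact K) (hcont : ∀ᶠ t in 𝓝 0, Continuous (G t))
    (hsupp : ∀ᶠ t in 𝓝 0, ∀ x ∉ K, G t x = 0) (hG' : Continuous G')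
    (hlip : ∀ x ∈ K, ∃ U ∈ 𝓝 x, ∃ ε > 0, ∃ c : ℝ, ∀ y ∈ U, ∀ s ∈ Metric.ball (0 : ℝ) ε,
      ∀ t ∈ Metric.ball (0 : ℝ) ε, |G s y - G t y| ≤ c * |s - t|)
    (hderiv : ∀ x, HasDerivAt (fun t => G t x) (G' x) 0) :
    HasDerivAt (fun t => integral (fun x => G t x • μ x)) (integral (fun x => G' x • μ x)) 0 := by
  let _ : MeasurableSpace M := borel M
  have : BorelSpace M := ⟨rfl⟩
  have : SecondCountableTopology M :=
    ChartedSpace.secondCountable_of_sigmaCompact (EuclideanSpace ℝ (Fin n)) M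
  obtain ⟨ν, hν, hint⟩ := hμ.exists_measure
  have hcs : ∀ f : M → ℝ, (∀ x ∉ K, f x = 0) → HasCompactSupport f := fun f hf =>
    HasCompactSupport.intro hK hf
  have hG'0 : ∀ x ∉ K, G' x = 0 := fun x hx => by
    have h1 : (fun t => G t x) =ᶠ[𝓝 0] fun _ => 0 := hsupp.mono fun t ht => ht x hx
    exact ((hderiv x).congr_of_eventuallyEq h1.symm).unique (hasDerivAt_const 0 0)
  -- Compactness of `K` makes the local radii and Lipschitz constants uniform.
  obtain ⟨ε, hε, c, hc⟩ : ∃ ε > 0, ∃ c : ℝ, ∀ y ∈ K, ∀ s ∈ Metric.ball (0 : ℝ) ε,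
      ∀ t ∈ Metric.ball (0 : ℝ) ε, |G s y - G t y| ≤ c * |s - t| := by
    refine hK.induction_on (p := fun K => ∃ ε > 0, ∃ c : ℝ, ∀ y ∈ K, ∀ s ∈ Metric.ball (0 : ℝ) ε,
      ∀ t ∈ Metric.ball (0 : ℝ) ε, |G s y - G t y| ≤ c * |s - t|) ⟨1, one_pos, 0, by simp⟩ ?_ ?_ ?_
    · rintro s t hst ⟨ε, hε, c, h⟩
      exact ⟨ε, hε, c, fun y hy => h y (hst hy)⟩
    · rintro A B ⟨ε, hε, c, h⟩ ⟨ε', hε', c', h'⟩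
      refine ⟨min ε ε', lt_min hε hε', max c c', ?_⟩
      rintro y hy s hs t ht
      rw [Metric.mem_ball, lt_min_iff] at hs ht
      rcases hy with hy | hy
      · exact (h y hy s hs.1 t ht.1).trans
          (mul_le_mul_of_nonneg_right (le_max_left _ _) (abs_nonneg _))
      · exact (h' y hy s hs.2 t ht.2).trans
          (mul_le_mul_of_nonneg_right (le_max_right _ _) (abs_nonneg _))
    · intro x hx
      obtain ⟨U, hU, ε, hε, c, h⟩ := hlip x hx
      exact ⟨U, mem_nhdsWithin_of_mem_nhds hU, ε, hε, c, h⟩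
  obtain ⟨ε', hε', hball⟩ := Metric.eventually_nhds_iff_ball.1 (hcont.and hsupp)
  have h0 := hball 0 (Metric.mem_ball_self hε')
  set r := min ε ε'
  have hr : 0 < r := lt_min hε hε'
  -- The dominating function is `|c|` on `K` and zero elsewhere; it is integrable because `K` has
  -- finite measure.
  have key := hasDerivAt_integral_of_dominated_loc_of_lip (μ := ν) (F := G) (x₀ := (0 : ℝ))
    (F' := G') (bound := K.indicator fun _ => |c|) (Metric.ball_mem_nhds 0 hr)
    (hcont.mono fun t ht => ht.aestronglyMeasurable)
    (h0.1.integrable_of_hasCompactSupport (hcs _ h0.2)) hG'.aestronglyMeasurable ?_ ?_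
    (Filter.Eventually.of_forall hderiv)
  · rw [hint G' hG' (hcs _ hG'0)]
    refine key.2.congr_of_eventuallyEq ?_
    filter_upwards [hcont, hsupp] with t h1 h2
    exact hint _ h1 (hcs _ h2)
  · refine Filter.Eventually.of_forall fun x => LipschitzOnWith.of_dist_le_mul fun s hs t ht => ?_
    rw [Metric.mem_ball, lt_min_iff] at hs ht
    by_cases hx : x ∈ K
    · simp only [Set.indicator_of_mem hx, Real.dist_eq, Real.coe_nnabs, abs_abs]
      exact (hc x hx s hs.1 t ht.1).trans
        (mul_le_mul_of_nonneg_right (le_abs_self c) (abs_nonneg _))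
    · rw [(hball s hs.2).2 x hx, (hball t ht.2).2 x hx]
      simp [Set.indicator_of_notMem hx]
  · rw [integrable_indicator_iff hK.measurableSet]
    exact integrableOn_const hK.measure_lt_top.ne

/-! ### The divergence of a vector field -/

/-- The divergence of `X` with respect to the density `μ`, computed in the chart at `x₀`. -/
def divChart (μ : Density n M 1) (X : ∀ x : M, TangentSpace (𝓡 n) x) (x₀ : M) (y : 𝔼) : ℝ :=
  (fderiv ℝ (coeff μ x₀) y (components X x₀ y)
    + (∑ i, fderiv ℝ (components X x₀) y (EuclideanSpace.single i (1 : ℝ)) i) * coeff μ x₀ y)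
    / coeff μ x₀ y

/-- Smooth vector fields. -/
abbrev SmoothField (X : ∀ x : M, TangentSpace (𝓡 n) x) : Prop :=
  ContMDiff (𝓡 n) (𝓡 n).tangent ∞ (fun x => (⟨x, X x⟩ : TangentBundle (𝓡 n) M))

theorem contDiffOn_fderiv {G : Type*} [NormedAddCommGroup G] [NormedSpace ℝ G] {f : 𝔼 → G} (x₀ : M)
    (hf : ContDiffOn ℝ ∞ f (ψ x₀).target) : ContDiffOn ℝ ∞ (fderiv ℝ f) (ψ x₀).target :=
  hf.fderiv_of_isOpen (isOpen_target x₀) (by simp)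

theorem IsVolume.contDiffOn_divChart {μ : Density n M 1} (hμ : IsVolume μ)
    {X : ∀ x : M, TangentSpace (𝓡 n) x} (hX : SmoothField X) (x₀ : M) :
    ContDiffOn ℝ ∞ (divChart μ X x₀) (ψ x₀).target := by
  have hc := contDiffOn_components hX x₀
  refine ContDiffOn.div (((contDiffOn_fderiv x₀ (hμ.smooth x₀)).clm_apply hc).add
    ((ContDiffOn.sum fun i _ => ?_).mul (hμ.smooth x₀))) (hμ.smooth x₀)
    fun y hy => (hμ.pos x₀ y hy).ne'
  have h := (contDiffOn_fderiv x₀ hc).clm_apply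
    (contDiffOn_const (c := (EuclideanSpace.single i (1 : ℝ) : 𝔼)))
  exact (EuclideanSpace.proj (𝕜 := ℝ) i : 𝔼 →L[ℝ] ℝ).contDiff.comp_contDiffOn h

/-- The field vanishes off a compact subset of `U`, so its extension by zero is smooth on the whole
space, and each partial derivative of it integrates to zero. -/
theorem integral_divergence_eq_zero {U : Set 𝔼} (hU : IsOpen U) {K : Set 𝔼} (hK : IsCompact K)
    (hKU : K ⊆ U) {Y : 𝔼 → 𝔼} (hY : ContDiffOn ℝ ∞ Y U) (h0 : ∀ y ∈ U, y ∉ K → Y y = 0) :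
    ∫ y in U, ∑ i, fderiv ℝ Y y (EuclideanSpace.single i (1 : ℝ)) i = 0 := by
  classical
  set Z : 𝔼 → 𝔼 := U.indicator Y with hZ
  have hZU : ∀ y ∈ U, Z =ᶠ[𝓝 y] Y := fun y hy =>
    Filter.eventuallyEq_of_mem (hU.mem_nhds hy) fun z hz => Set.indicator_of_mem hz _
  have hZ0 : ∀ y ∉ K, Z y = 0 := fun y hy => by
    by_cases h : y ∈ U
    · rw [hZ, Set.indicator_of_mem h, h0 y h hy]
    · exact Set.indicator_of_notMem h _
  have hZs : ContDiff ℝ ∞ Z := contDiff_iff_contDiffAt.2 fun y => by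
    by_cases h : y ∈ U
    · exact ((hY y h).contDiffAt (hU.mem_nhds h)).congr_of_eventuallyEq (hZU y h)
    · have h2 : y ∉ K := fun h' => h (hKU h')
      exact (contDiffAt_const (c := (0 : 𝔼))).congr_of_eventuallyEq
        (Filter.eventuallyEq_of_mem (hK.isClosed.isOpen_compl.mem_nhds h2) fun z hz => hZ0 z hz)
  have hZc : HasCompactSupport Z := HasCompactSupport.intro hK hZ0
  have hs : ∀ i, ContDiff ℝ ∞ (fun y => Z y i) := fun i =>
    (EuclideanSpace.proj (𝕜 := ℝ) i : 𝔼 →L[ℝ] ℝ).contDiff.comp hZs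
  have hc : ∀ i, HasCompactSupport (fun y => Z y i) := fun i =>
    hZc.comp_left (g := fun v : 𝔼 => v i) rfl
  have hint : ∀ i, Integrable fun y => fderiv ℝ (fun y => Z y i) y
      (EuclideanSpace.single i (1 : ℝ)) := fun i =>
    (((hs i).continuous_fderiv (by simp)).clm_apply continuous_const).integrable_of_hasCompactSupport
      ((hc i).fderiv_apply ℝ _)
  have h1 : ∀ i, ∫ y, fderiv ℝ (fun y => Z y i) y (EuclideanSpace.single i (1 : ℝ)) = 0 := by
    intro i
    -- Integration by parts against the constant function 1.
    have := integral_mul_fderiv_eq_neg_fderiv_mul_of_integrable (μ := (volume : Measure 𝔼))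
      (f := fun _ => (1 : ℝ)) (g := fun y => Z y i) (v := EuclideanSpace.single i (1 : ℝ))
      (by simp) (by simpa using hint i)
      (by simpa using (hs i).continuous.integrable_of_hasCompactSupport (hc i))
      (fun _ _ => differentiableAt_const _)
      (fun y _ => ((hs i).differentiable (by simp)).differentiableAt)
    simpa using this
  have h2 : ∀ y, y ∉ U → ∑ i, fderiv ℝ Z y (EuclideanSpace.single i (1 : ℝ)) i = 0 := fun y hy => by
    have h3 : Z =ᶠ[𝓝 y] fun _ => 0 := Filter.eventuallyEq_of_mem
      (hK.isClosed.isOpen_compl.mem_nhds fun h' => hy (hKU h')) fun z hz => hZ0 z hz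
    rw [h3.fderiv_eq]
    simp
  have h3 : ∫ y in U, ∑ i, fderiv ℝ Y y (EuclideanSpace.single i (1 : ℝ)) i
      = ∫ y in U, ∑ i, fderiv ℝ Z y (EuclideanSpace.single i (1 : ℝ)) i :=
    setIntegral_congr_fun hU.measurableSet fun y hy => by
      simp only [(hZU y hy).fderiv_eq]
  rw [h3, setIntegral_eq_integral_of_forall_compl_eq_zero h2]
  have h4 : ∀ y i, fderiv ℝ Z y (EuclideanSpace.single i (1 : ℝ)) i
      = fderiv ℝ (fun y => Z y i) y (EuclideanSpace.single i (1 : ℝ)) := fun y i => by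
    have := ((EuclideanSpace.proj (𝕜 := ℝ) i : 𝔼 →L[ℝ] ℝ).hasFDerivAt.comp y
      (hZs.differentiable (by simp) y).hasFDerivAt).fderiv
    have h5 : fderiv ℝ (fun y => Z y i) y
      = (EuclideanSpace.proj (𝕜 := ℝ) i : 𝔼 →L[ℝ] ℝ).comp (fderiv ℝ Z y) := this
    rw [h5]
    rfl
  simp only [h4]
  rw [integral_finsetSum _ fun i _ => hint i]
  simp [h1]

theorem contMDiffAt_of_chart {g : 𝔼 → ℝ} {f : M → ℝ} {x₀ x : M} (hx : x ∈ (ψ x₀).source)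
    (hg : ContDiffOn ℝ ∞ g (ψ x₀).target) (hfg : ∀ p ∈ (ψ x₀).source, f p = g (ψ x₀ p)) :
    ContMDiffAt (𝓡 n) 𝓘(ℝ, ℝ) ∞ f x := by
  have h1 : ContDiffAt ℝ ∞ g (ψ x₀ x) :=
    (hg _ ((ψ x₀).map_source hx)).contDiffAt ((isOpen_target x₀).mem_nhds ((ψ x₀).map_source hx))
  have hx' := hx
  rw [extChartAt_source] at hx'
  have h2 := h1.contMDiffAt.comp x (contMDiffAt_extChartAt' (I := 𝓡 n) (n := ∞) hx')
  exact h2.congr_of_eventuallyEq (Filter.eventuallyEq_of_mem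
    ((isOpen_extChartAt_source x₀).mem_nhds hx) hfg)

theorem contDiffOn_chart {f : M → ℝ} (hf : Smooth n f) (x₀ : M) :
    ContDiffOn ℝ ∞ (f ∘ (ψ x₀).symm) (ψ x₀).target :=
  (contDiffOn_comp_chart_symm (s := Set.univ) x₀ hf.contMDiffOn).mono fun _ hy => ⟨hy, trivial⟩

theorem smooth_dirDeriv {f : M → ℝ} (hf : Smooth n f) {X : ∀ x : M, TangentSpace (𝓡 n) x}
    (hX : SmoothField X) : Smooth n (fun x => dirDeriv f x (X x)) := by
  intro x₀
  refine contMDiffAt_of_chart (mem_extChartAt_source x₀)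
    ((contDiffOn_fderiv x₀ (contDiffOn_chart hf x₀)).clm_apply (contDiffOn_components hX x₀))
    fun p hp => dirDeriv_eq_fderiv x₀ hp (hf.mdifferentiable (by simp) p) X

theorem dirDeriv_congr {f g : M → ℝ} {x : M} (h : f =ᶠ[𝓝 x] g) (v : TangentSpace (𝓡 n) x) :
    dirDeriv f x v = dirDeriv g x v := by
  unfold dirDeriv
  rw [h.mfderiv_eq]
  rfl

theorem dirDeriv_const (c : ℝ) (x : M) (v : TangentSpace (𝓡 n) x) :
    dirDeriv (fun _ : M => c) x v = 0 := by
  unfold dirDeriv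
  rw [mfderiv_const]
  rfl

theorem IsTest.mul_continuousOn {U : Set M} (hU : IsOpen U) {f g : M → ℝ} (hf : IsTest U f)
    (hg : ContinuousOn g U) : IsTest U (fun x => f x * g x) := by
  refine ⟨continuous_iff_continuousAt.2 fun x => ?_, hf.compact.mul_right,
    (tsupport_mul_subset_left).trans hf.sub⟩
  by_cases hx : x ∈ tsupport f
  · exact hf.cont.continuousAt.mul (hg.continuousAt (hU.mem_nhds (hf.sub hx)))
  · refine (continuousAt_const (y := (0 : ℝ))).congr ?_
    filter_upwards [(isClosed_tsupport f).isOpen_compl.mem_nhds hx] with y hy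
    rw [image_eq_zero_of_notMem_tsupport hy, zero_mul]

theorem isTest_dirDeriv {U : Set M} {f : M → ℝ} (hf : Smooth n f) (ht : IsTest U f)
    {X : ∀ x : M, TangentSpace (𝓡 n) x} (hX : SmoothField X) :
    IsTest U (fun x => dirDeriv f x (X x)) := by
  have h : ∀ x, x ∉ tsupport f → dirDeriv f x (X x) = 0 := fun x hx => by
    have h1 : f =ᶠ[𝓝 x] fun _ => 0 :=
      Filter.eventuallyEq_of_mem ((isClosed_tsupport f).isOpen_compl.mem_nhds hx)
        fun y hy => image_eq_zero_of_notMem_tsupport hy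
    rw [dirDeriv_congr h1, dirDeriv_const]
  have h2 : tsupport (fun x => dirDeriv f x (X x)) ⊆ tsupport f :=
    closure_minimal (fun x hx => by_contra fun h' => hx (h x h')) (isClosed_tsupport f)
  exact ⟨(smooth_dirDeriv hf hX).continuous, HasCompactSupport.intro ht.compact.isCompact h,
    h2.trans ht.sub⟩

/-- The product rule for the Euclidean divergence of `f s X`, with `s` the coefficient of `μ`: it is
`div (f X) = f div X + X f` multiplied by `s`. Integration by parts and `fieldDiv_smul` both rest on
it. -/
theorem IsVolume.divChart_mul {μ : Density n M 1} (hμ : IsVolume μ)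
    {X : ∀ x : M, TangentSpace (𝓡 n) x} (hX : SmoothField X) {f : M → ℝ} (hf : Smooth n f) {x₀ : M}
    {y : 𝔼} (hy : y ∈ (ψ x₀).target) :
    ∑ i, fderiv ℝ (fun y => (f ((ψ x₀).symm y) * coeff μ x₀ y) • components X x₀ y) y
      (EuclideanSpace.single i (1 : ℝ)) i
      = (f ((ψ x₀).symm y) * divChart μ X x₀ y
        + dirDeriv f ((ψ x₀).symm y) (X ((ψ x₀).symm y))) * coeff μ x₀ y := by
  have h1 : HasFDerivAt (f ∘ (ψ x₀).symm) (fderiv ℝ (f ∘ (ψ x₀).symm) y) y :=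
    ((((contDiffOn_chart hf x₀) y hy).contDiffAt ((isOpen_target x₀).mem_nhds hy)).differentiableAt
      (by simp)).hasFDerivAt
  have h2 : HasFDerivAt (coeff μ x₀) (fderiv ℝ (coeff μ x₀) y) y :=
    (((hμ.smooth x₀ y hy).contDiffAt ((isOpen_target x₀).mem_nhds hy)).differentiableAt
      (by simp)).hasFDerivAt
  have h3 : HasFDerivAt (components X x₀) (fderiv ℝ (components X x₀) y) y :=
    (((contDiffOn_components hX x₀ y hy).contDiffAt
      ((isOpen_target x₀).mem_nhds hy)).differentiableAt (by simp)).hasFDerivAt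
  have h4 := ((h1.mul h2).smul h3).fderiv
  have h5 : (fun y => (f ((ψ x₀).symm y) * coeff μ x₀ y) • components X x₀ y)
    = (((f ∘ (ψ x₀).symm) * coeff μ x₀) • components X x₀) := rfl
  have hsum : ∀ (L : 𝔼 →L[ℝ] ℝ) (v : 𝔼), L v = ∑ i, L (EuclideanSpace.single i (1 : ℝ)) * v i := by
    intro L v
    conv_lhs => rw [← (EuclideanSpace.basisFun (Fin n) ℝ).sum_repr v]
    simp [mul_comm]
  have hpos := (hμ.pos x₀ y hy).ne'
  have h6 := dirDeriv_eq_fderiv x₀ ((ψ x₀).map_target hy) (hf.mdifferentiable (by simp) _) X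
  rw [(ψ x₀).right_inv hy] at h6
  have h7 : f ((ψ x₀).symm y) * divChart μ X x₀ y * coeff μ x₀ y = f ((ψ x₀).symm y) *
      (fderiv ℝ (coeff μ x₀) y (components X x₀ y)
    + (∑ i, fderiv ℝ (components X x₀) y (EuclideanSpace.single i (1 : ℝ)) i) * coeff μ x₀ y) := by
    rw [divChart]
    field_simp
  rw [h5, h4, h6, add_mul, h7, hsum (fderiv ℝ (coeff μ x₀) y),
    hsum (fderiv ℝ (f ∘ (ψ x₀).symm) y), Finset.sum_mul, Finset.sum_mul,
    ← Finset.sum_add_distrib, Finset.mul_sum, ← Finset.sum_add_distrib]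
  refine Finset.sum_congr rfl fun i _ => ?_
  simp only [add_apply, smul_apply,
    ContinuousLinearMap.smulRight_apply, PiLp.add_apply, PiLp.smul_apply, smul_eq_mul, Pi.mul_apply,
    Function.comp_apply]
  ring

end Densities
end GenRicci

/-! ### The divergence on the manifold and integration by parts -/

namespace GenRicci
section Densities
variable {n : ℕ} {M : Type*} [TopologicalSpace M] [ChartedSpace (EuclideanSpace ℝ (Fin n)) M]
  [IsManifold (𝓡 n) ∞ M]

local notation "𝔼" => EuclideanSpace ℝ (Fin n)
local notation "ψ" => extChartAt (𝓡 n)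

variable [T2Space M] [SigmaCompactSpace M]

theorem IsVolume.continuousOn_divChart {μ : Density n M 1} (hμ : IsVolume μ)
    {X : ∀ x : M, TangentSpace (𝓡 n) x} (hX : SmoothField X) (x₀ : M) :
    ContinuousOn (fun x => divChart μ X x₀ (ψ x₀ x)) (ψ x₀).source :=
  (hμ.contDiffOn_divChart hX x₀).continuousOn.comp (continuousOn_extChartAt x₀)
    fun _ hx => (ψ x₀).map_source hx

/-- Integration by parts in the domain of a chart. -/
theorem IsVolume.integral_divChart {μ : Density n M 1} (hμ : IsVolume μ)
    {X : ∀ x : M, TangentSpace (𝓡 n) x} (hX : SmoothField X) {f : M → ℝ} (hf : Smooth n f) {x₀ : M}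
    (ht : IsTest (ψ x₀).source f) :
    integral (fun x => (f x * divChart μ X x₀ (ψ x₀ x)) • μ x)
      + integral (fun x => dirDeriv f x (X x) • μ x) = 0 := by
  have h1 := ht.mul_continuousOn (isOpen_extChartAt_source x₀) (hμ.continuousOn_divChart hX x₀)
  have h2 := isTest_dirDeriv hf ht hX
  rw [hμ.integral_eq_chartInt h1, hμ.integral_eq_chartInt h2, chartInt, chartInt,
    ← MeasureTheory.integral_add (hμ.integrableOn h1) (hμ.integrableOn h2)]
  have hK : IsCompact (ψ x₀ '' tsupport f) :=
    ht.compact.isCompact.image_of_continuousOn ((continuousOn_extChartAt x₀).mono ht.sub)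
  rw [← integral_divergence_eq_zero (isOpen_target x₀) hK
    (Y := fun y => (f ((ψ x₀).symm y) * coeff μ x₀ y) • components X x₀ y)]
  · refine setIntegral_congr_fun (isOpen_target x₀).measurableSet fun y hy => ?_
    simp only [hμ.divChart_mul hX hf hy, (ψ x₀).right_inv hy]
    ring
  · rintro _ ⟨x, hx, rfl⟩
    exact (ψ x₀).map_source (ht.sub hx)
  · exact ((contDiffOn_chart hf x₀).mul (hμ.smooth x₀)).smul (contDiffOn_components hX x₀)
  · intro y hy hyK
    have : f ((ψ x₀).symm y) = 0 := by
      by_contra h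
      exact hyK ⟨_, subset_tsupport _ h, (ψ x₀).right_inv hy⟩
    simp only [this, zero_mul, zero_smul]

/-- A smooth bump function at `x` with support in a given neighbourhood of `x`. -/
theorem exists_bump {x : M} {U : Set M} (hU : U ∈ 𝓝 x) :
    ∃ f : M → ℝ, Smooth n f ∧ IsTest U f ∧ (∀ y, 0 ≤ f y) ∧ f =ᶠ[𝓝 x] 1 := by
  obtain ⟨f, -, hf⟩ := (SmoothBumpFunction.nhds_basis_tsupport (I := 𝓡 n) x).mem_iff.1 hU
  exact ⟨f, f.contMDiff, ⟨f.continuous, f.hasCompactSupport, hf⟩, fun _ => f.nonneg,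
    f.eventuallyEq_one⟩

/-- The divergence does not depend on the chart. -/
theorem IsVolume.divChart_eq {μ : Density n M 1} (hμ : IsVolume μ)
    {X : ∀ x : M, TangentSpace (𝓡 n) x} (hX : SmoothField X) {x₀ p : M} (hp : p ∈ (ψ x₀).source) :
    divChart μ X p (ψ p p) = divChart μ X x₀ (ψ x₀ p) := by
  set U := (ψ p).source ∩ (ψ x₀).source with hU
  have hUo : IsOpen U := (isOpen_extChartAt_source p).inter (isOpen_extChartAt_source x₀)
  have hpU : p ∈ U := ⟨mem_extChartAt_source p, hp⟩
  -- No formula for derivatives of Jacobians is needed: the two chart expressions satisfy the same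
  -- integration by parts identity, so their difference `k` integrates to zero against every test
  -- function supported in the overlap.
  set k : M → ℝ := fun x => divChart μ X p (ψ p x) - divChart μ X x₀ (ψ x₀ x) with hk
  have hkc : ContinuousOn k U :=
    ((hμ.continuousOn_divChart hX p).mono Set.inter_subset_left).sub
      ((hμ.continuousOn_divChart hX x₀).mono Set.inter_subset_right)
  rw [← sub_eq_zero]
  by_contra hne
  change k p ≠ 0 at hne
  -- With a bump supported where `k` has the sign of `k p`, the integral of `f k · k p` would be
  -- both zero and positive.
  have hW : {x ∈ U | 0 < k x * k p} ∈ 𝓝 p := by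
    have h1 : ContinuousAt (fun x => k x * k p) p :=
      ((hkc.continuousAt (hUo.mem_nhds hpU))).mul continuousAt_const
    exact Filter.inter_mem (hUo.mem_nhds hpU) (h1.eventually_const_lt (mul_self_pos.2 hne))
  obtain ⟨f, hf, ht, hf0, hf1⟩ := exists_bump (n := n) hW
  have ht1 : IsTest (ψ p).source f := ⟨ht.cont, ht.compact, ht.sub.trans fun x hx => hx.1.1⟩
  have ht2 : IsTest (ψ x₀).source f := ⟨ht.cont, ht.compact, ht.sub.trans fun x hx => hx.1.2⟩
  have e1 := hμ.integral_divChart hX hf ht1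
  have e2 := hμ.integral_divChart hX hf ht2
  have c1 := ht1.mul_continuousOn (isOpen_extChartAt_source p) (hμ.continuousOn_divChart hX p)
  have c2 := ht2.mul_continuousOn (isOpen_extChartAt_source x₀) (hμ.continuousOn_divChart hX x₀)
  have c3 : IsTest Set.univ (fun x => f x * k x) :=
    ⟨(c1.cont.sub c2.cont).congr fun x => by simp only [hk, mul_sub, Pi.sub_apply], ht.compact.mul_right,
      Set.subset_univ _⟩
  have e3 : integral (fun x => (f x * k x) • μ x) = 0 := by
    have h := hμ.integral_add c3.cont c3.compact c2.cont c2.compact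
    have h2 : ∀ x, f x * k x + f x * divChart μ X x₀ (ψ x₀ x) = f x * divChart μ X p (ψ p x) :=
      fun x => by simp only [hk]; ring
    simp only [h2] at h
    linarith
  have c4 := c3.mul_right (continuous_const (y := k p))
  have e4 : integral (fun x => (f x * k x * k p) • μ x) = 0 := by
    have := IsVolume.integral_smul μ c3.compact (k p)
    rw [e3, mul_zero] at this
    simpa only [mul_comm (k p)] using this
  have e5 := hμ.integral_pos c4.cont c4.compact (fun x => ?_) (x := p) ?_
  · exact absurd e4 e5.ne'
  · by_cases hx : x ∈ tsupport f
    · rw [mul_assoc]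
      exact mul_nonneg (hf0 x) (ht.sub hx).2.le
    · rw [image_eq_zero_of_notMem_tsupport hx]; simp
  · rw [hf1.self_of_nhds, Pi.one_apply, one_mul]
    exact mul_self_pos.2 hne

/-- The divergence of the vector field `X` with respect to the volume density `μ`. -/
def fieldDiv (μ : Density n M 1) (X : ∀ x : M, TangentSpace (𝓡 n) x) (x : M) : ℝ :=
  divChart μ X x (ψ x x)

theorem IsVolume.smooth_fieldDiv {μ : Density n M 1} (hμ : IsVolume μ)
    {X : ∀ x : M, TangentSpace (𝓡 n) x} (hX : SmoothField X) : Smooth n (fieldDiv μ X) := fun x₀ =>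
  contMDiffAt_of_chart (mem_extChartAt_source x₀) (hμ.contDiffOn_divChart hX x₀)
    fun _ hp => hμ.divChart_eq hX hp

theorem components_congr {X Y : ∀ x : M, TangentSpace (𝓡 n) x} {x : M}
    (h : ∀ᶠ y in 𝓝 x, X y = Y y) : components X x =ᶠ[𝓝 (ψ x x)] components Y x := by
  have h1 : Filter.Tendsto (ψ x).symm (𝓝 (ψ x x)) (𝓝 x) := by
    have := continuousAt_extChartAt_symm (I := 𝓡 n) x
    rwa [ContinuousAt, extChartAt_to_inv] at this
  filter_upwards [h1.eventually h] with y hy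
  unfold components
  rw [hy]

theorem fieldDiv_congr (μ : Density n M 1) {X Y : ∀ x : M, TangentSpace (𝓡 n) x} {x : M}
    (h : ∀ᶠ y in 𝓝 x, X y = Y y) : fieldDiv μ X x = fieldDiv μ Y x := by
  have h1 := components_congr h
  simp only [fieldDiv, divChart, h1.fderiv_eq, h1.eq_of_nhds]

theorem components_add (X Y : ∀ x : M, TangentSpace (𝓡 n) x) (x₀ : M) :
    components (fun x => X x + Y x) x₀ = components X x₀ + components Y x₀ := by
  funext y
  exact map_add _ _ _

theorem differentiableAt_components {X : ∀ x : M, TangentSpace (𝓡 n) x} (hX : SmoothField X)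
    (x : M) : DifferentiableAt ℝ (components X x) (ψ x x) :=
  ((contDiffOn_components hX x _ (mem_extChartAt_target x)).contDiffAt
    ((isOpen_target x).mem_nhds (mem_extChartAt_target x))).differentiableAt (by simp)

theorem fieldDiv_add (μ : Density n M 1) {X Y : ∀ x : M, TangentSpace (𝓡 n) x}
    (hX : SmoothField X) (hY : SmoothField Y) (x : M) :
    fieldDiv μ (fun x => X x + Y x) x = fieldDiv μ X x + fieldDiv μ Y x := by
  simp only [fieldDiv, divChart, components_add]
  rw [fderiv_add (differentiableAt_components hX x) (differentiableAt_components hY x)]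
  simp only [Pi.add_apply, map_add, add_apply, PiLp.add_apply,
    Finset.sum_add_distrib]
  ring

theorem IsVolume.fieldDiv_smul {μ : Density n M 1} (hμ : IsVolume μ)
    {X : ∀ x : M, TangentSpace (𝓡 n) x} (hX : SmoothField X) {f : M → ℝ} (hf : Smooth n f) (x : M) :
    fieldDiv μ (fun x => f x • X x) x = f x * fieldDiv μ X x + dirDeriv f x (X x) := by
  have hy := mem_extChartAt_target (I := 𝓡 n) x
  have hc : components (fun x => f x • X x) x = fun y => f ((ψ x).symm y) • components X x y := by
    funext y
    exact map_smul _ _ _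
  have hfX : DifferentiableAt ℝ (components (fun x => f x • X x) x) (ψ x x) := by
    rw [hc]
    refine DifferentiableAt.smul (𝕜' := ℝ) ?_ (differentiableAt_components hX x)
    exact (((contDiffOn_chart hf x) _ hy).contDiffAt ((isOpen_target x).mem_nhds hy)).differentiableAt
      (by simp)
  have h1 := hμ.divChart_mul hX hf hy
  have h2 : (fun y => (f ((ψ x).symm y) * coeff μ x y) • components X x y)
      = coeff μ x • components (fun x => f x • X x) x := by
    funext y
    simp only [hc, Pi.smul_apply', smul_smul, mul_comm]
  have h3 : DifferentiableAt ℝ (coeff μ x) (ψ x x) :=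
    (((hμ.smooth x) _ hy).contDiffAt ((isOpen_target x).mem_nhds hy)).differentiableAt (by simp)
  have hsum : ∀ (L : 𝔼 →L[ℝ] ℝ) (v : 𝔼), L v = ∑ i, L (EuclideanSpace.single i (1 : ℝ)) * v i := by
    intro L v
    conv_lhs => rw [← (EuclideanSpace.basisFun (Fin n) ℝ).sum_repr v]
    simp [mul_comm]
  have hpos := (hμ.pos x _ hy).ne'
  rw [h2, (h3.hasFDerivAt.smul hfX.hasFDerivAt).fderiv] at h1
  rw [extChartAt_to_inv] at h1
  simp only [add_apply, smul_apply,
    ContinuousLinearMap.smulRight_apply, PiLp.add_apply, PiLp.smul_apply, smul_eq_mul,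
    Finset.sum_add_distrib, ← hsum, ← Finset.mul_sum] at h1
  simp only [fieldDiv]
  rw [divChart, div_eq_iff hpos, ← h1]
  ring

theorem dirDeriv_self {f : M → ℝ} {x : M} (hf : MDifferentiableAt (𝓡 n) 𝓘(ℝ, ℝ) f x)
    (v : TangentSpace (𝓡 n) x) :
    dirDeriv f x v = fderiv ℝ (f ∘ (ψ x).symm) (ψ x x) (v : 𝔼) := by
  have h := dirDeriv_eq_fderiv x (mem_extChartAt_source x) hf (fun _ => (v : 𝔼))
  refine h.trans (congrArg _ ?_)
  exact components_self (fun y => ((v : 𝔼) : TangentSpace (𝓡 n) y)) x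

theorem Smooth.add {f g : M → ℝ} (hf : Smooth n f) (hg : Smooth n g) :
    Smooth n (fun x => f x + g x) := ContMDiff.add hf hg

theorem Smooth.mul {f g : M → ℝ} (hf : Smooth n f) (hg : Smooth n g) :
    Smooth n (fun x => f x * g x) := ContMDiff.mul hf hg

theorem Smooth.sum {ι : Type*} {s : Finset ι} {f : ι → M → ℝ} (hf : ∀ i ∈ s, Smooth n (f i)) :
    Smooth n (fun x => ∑ i ∈ s, f i x) := ContMDiff.sum hf

theorem Smooth.mdiff {f : M → ℝ} (hf : Smooth n f) (x : M) :
    MDifferentiableAt (𝓡 n) 𝓘(ℝ, ℝ) f x := hf.mdifferentiable (by simp) x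

theorem differentiableAt_chart {f : M → ℝ} (hf : Smooth n f) (x : M) :
    DifferentiableAt ℝ (f ∘ (ψ x).symm) (ψ x x) :=
  (((contDiffOn_chart hf x) _ (mem_extChartAt_target x)).contDiffAt
    ((isOpen_target x).mem_nhds (mem_extChartAt_target x))).differentiableAt (by simp)

theorem dirDeriv_add {f g : M → ℝ} (hf : Smooth n f) (hg : Smooth n g) {x : M}
    (v : TangentSpace (𝓡 n) x) :
    dirDeriv (fun x => f x + g x) x v = dirDeriv f x v + dirDeriv g x v := by
  rw [dirDeriv_self ((hf.add hg).mdiff x), dirDeriv_self (hf.mdiff x), dirDeriv_self (hg.mdiff x)]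
  have := fderiv_add (differentiableAt_chart hf x) (differentiableAt_chart hg x)
  exact congrArg (fun L : 𝔼 →L[ℝ] ℝ => L v) this

theorem dirDeriv_mul {f g : M → ℝ} (hf : Smooth n f) (hg : Smooth n g) {x : M}
    (v : TangentSpace (𝓡 n) x) :
    dirDeriv (fun x => f x * g x) x v = f x * dirDeriv g x v + g x * dirDeriv f x v := by
  rw [dirDeriv_self ((hf.mul hg).mdiff x), dirDeriv_self (hf.mdiff x), dirDeriv_self (hg.mdiff x)]
  have := fderiv_mul (differentiableAt_chart hf x) (differentiableAt_chart hg x)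
  refine (congrArg (fun L : 𝔼 →L[ℝ] ℝ => L v) this).trans ?_
  simp only [Function.comp_apply, extChartAt_to_inv]
  rfl

theorem dirDeriv_const_mul {f : M → ℝ} (hf : Smooth n f) (c : ℝ) {x : M}
    (v : TangentSpace (𝓡 n) x) : dirDeriv (fun x => c * f x) x v = c * dirDeriv f x v := by
  rw [dirDeriv_mul contMDiff_const hf, dirDeriv_const, mul_zero, add_zero]

theorem dirDeriv_sum {ι : Type*} (s : Finset ι) {f : ι → M → ℝ} (hf : ∀ i ∈ s, Smooth n (f i))
    {x : M} (v : TangentSpace (𝓡 n) x) :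
    dirDeriv (fun x => ∑ i ∈ s, f i x) x v = ∑ i ∈ s, dirDeriv (f i) x v := by
  classical
  induction s using Finset.induction_on with
  | empty => simpa using dirDeriv_const 0 x v
  | insert a s ha ih =>
    simp only [Finset.sum_insert ha]
    have h1 : ∀ i ∈ s, Smooth n (f i) := fun i hi => hf i (Finset.mem_insert_of_mem hi)
    rw [dirDeriv_add (hf a (Finset.mem_insert_self _ _)) (Smooth.sum h1), ih h1]

theorem HasCompactSupport.sum {ι : Type*} (s : Finset ι) {f : ι → M → ℝ}
    (hc : ∀ i ∈ s, HasCompactSupport (f i)) : HasCompactSupport fun x => ∑ i ∈ s, f i x := by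
  classical
  induction s using Finset.induction_on with
  | empty =>
    simp only [Finset.sum_empty]
    exact HasCompactSupport.zero
  | insert a s ha ih =>
    simp only [Finset.sum_insert ha]
    exact (hc a (Finset.mem_insert_self _ _)).add (ih fun i hi => hc i (Finset.mem_insert_of_mem hi))

theorem IsVolume.integral_sum {μ : Density n M 1} (hμ : IsVolume μ) {ι : Type*} (s : Finset ι)
    {f : ι → M → ℝ} (hf : ∀ i ∈ s, Continuous (f i)) (hc : ∀ i ∈ s, HasCompactSupport (f i)) :
    integral (fun x => (∑ i ∈ s, f i x) • μ x) = ∑ i ∈ s, integral (fun x => f i x • μ x) := by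
  classical
  induction s using Finset.induction_on with
  | empty =>
    have := IsVolume.integral_smul μ (f := fun _ => (0 : ℝ)) HasCompactSupport.zero 0
    simpa using this
  | insert a s ha ih =>
    have hf' : ∀ i ∈ s, Continuous (f i) := fun i hi => hf i (Finset.mem_insert_of_mem hi)
    have hc' : ∀ i ∈ s, HasCompactSupport (f i) := fun i hi => hc i (Finset.mem_insert_of_mem hi)
    simp only [Finset.sum_insert ha]
    rw [hμ.integral_add (hf a (Finset.mem_insert_self _ _)) (hc a (Finset.mem_insert_self _ _))
      (continuous_finsetSum s hf') (HasCompactSupport.sum s hc'), ih hf' hc']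

/-- Integration by parts on `M`. -/
theorem IsVolume.integral_fieldDiv {μ : Density n M 1} (hμ : IsVolume μ)
    {X : ∀ x : M, TangentSpace (𝓡 n) x} (hX : SmoothField X) {f : M → ℝ} (hf : Smooth n f)
    (hc : HasCompactSupport f) :
    integral (fun x => (f x * fieldDiv μ X x + dirDeriv f x (X x)) • μ x) = 0 := by
  have hDc := (hμ.smooth_fieldDiv hX).continuous
  -- For a function supported in one chart this is `integral_divChart`, the chart expression and
  -- `fieldDiv` being equal on the support. The partition of unity reduces the general case to this
  -- one.
  have key : ∀ (g : M → ℝ), Smooth n g → ∀ i, IsTest (ψ i).source g →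
      integral (fun x => (g x * fieldDiv μ X x + dirDeriv g x (X x)) • μ x) = 0 := by
    intro g hg i ht
    have h1 := ht.mul_right hDc
    have h2 := isTest_dirDeriv hg ht hX
    rw [hμ.integral_add h1.cont h1.compact h2.cont h2.compact, ← hμ.integral_divChart hX hg ht]
    congr 2
    funext x
    by_cases hx : x ∈ tsupport g
    · rw [fieldDiv, hμ.divChart_eq hX (ht.sub hx)]
    · rw [image_eq_zero_of_notMem_tsupport hx, zero_mul, zero_mul]
  obtain ⟨t, ht⟩ := chartPartition_finite (n := n) (M := M) hc.isCompact
  have hsm : ∀ i, Smooth n (fun x => chartPartition n M i x * f x) := fun i =>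
    (chartPartition n M i).contMDiff.mul hf
  have hz : ∀ i ∈ t, integral (fun x => ((chartPartition n M i x * f x) * fieldDiv μ X x
      + dirDeriv (fun x => chartPartition n M i x * f x) x (X x)) • μ x) = 0 := fun i _ =>
    key _ (hsm i) i (isTest_chartPartition_mul hf.continuous hc i)
  have hfs : f = fun x => ∑ i ∈ t, chartPartition n M i x * f x := by
    funext x
    rw [← Finset.sum_mul]
    by_cases hx : x ∈ tsupport f
    · rw [sum_chartPartition ht hx, one_mul]
    · rw [image_eq_zero_of_notMem_tsupport hx, mul_zero]
  have hd : ∀ x, dirDeriv f x (X x)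
      = ∑ i ∈ t, dirDeriv (fun x => chartPartition n M i x * f x) x (X x) := by
    intro x
    conv_lhs => rw [hfs]
    exact dirDeriv_sum t (fun i _ => hsm i) (X x)
  have hf1 : ∀ x, f x * fieldDiv μ X x + dirDeriv f x (X x)
      = ∑ i ∈ t, ((chartPartition n M i x * f x) * fieldDiv μ X x
        + dirDeriv (fun x => chartPartition n M i x * f x) x (X x)) := fun x => by
    rw [hd x, Finset.sum_add_distrib, ← Finset.sum_mul]
    congr 2
    exact congrFun hfs x
  simp only [hf1]
  rw [hμ.integral_sum, Finset.sum_eq_zero hz]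
  · intro i _
    have h1 := isTest_chartPartition_mul (n := n) hf.continuous hc i
    exact ((h1.mul_right hDc).cont.add (isTest_dirDeriv (hsm i) h1 hX).cont)
  · intro i _
    have h1 := isTest_chartPartition_mul (n := n) hf.continuous hc i
    exact ((h1.mul_right hDc).compact.add (isTest_dirDeriv (hsm i) h1 hX).compact)

end Densities
end GenRicci

/-! ### Half-densities relative to a nowhere vanishing one -/

namespace GenRicci
section Densities
variable {n : ℕ} {M : Type*} [TopologicalSpace M] [ChartedSpace (EuclideanSpace ℝ (Fin n)) M]
  [IsManifold (𝓡 n) ∞ M]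

local notation "𝔼" => EuclideanSpace ℝ (Fin n)
local notation "ψ" => extChartAt (𝓡 n)

variable [T2Space M] [SigmaCompactSpace M]

theorem coeff_ne_zero {w : ℝ} {σ : Density n M w} (hσ₀ : NowhereVanishing σ) (x₀ : M) {p : M}
    (hp : p ∈ (ψ x₀).source) : (σ p).1 (coordFrame n x₀ p) ≠ 0 := fun h =>
  hσ₀ p (densityFiber_ext x₀ hp h)

theorem isVolume_mulHalf {σ : Density n M (1 / 2)} (hσ : IsSmoothDensity σ)
    (hσ₀ : NowhereVanishing σ) : IsVolume (mulHalf σ σ) := by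
  refine ⟨fun x₀ => (hσ x₀).mul (hσ x₀), fun x₀ y hy => ?_⟩
  have h := coeff_ne_zero hσ₀ x₀ ((ψ x₀).map_target hy)
  exact mul_self_pos.2 h

/-- The quotient of two half-densities. -/
def ratio (τ σ : Density n M (1 / 2)) (x : M) : ℝ :=
  (τ x).1 (coordFrame n x x) / (σ x).1 (coordFrame n x x)

theorem ratio_smul (τ : Density n M (1 / 2)) {σ : Density n M (1 / 2)} (hσ₀ : NowhereVanishing σ)
    (x : M) : τ x = ratio τ σ x • σ x := by
  refine densityFiber_ext x (mem_extChartAt_source x) ?_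
  exact (div_mul_cancel₀ _ (coeff_ne_zero hσ₀ x (mem_extChartAt_source x))).symm

/-- `ratio` uses a different chart at each point, but a quotient of densities of equal weight is the
same in every frame. Near `x₀` it is thus a quotient of smooth coefficients in a single chart. -/
theorem smooth_ratio {τ σ : Density n M (1 / 2)} (hτ : IsSmoothDensity τ) (hσ : IsSmoothDensity σ)
    (hσ₀ : NowhereVanishing σ) : Smooth n (ratio τ σ) := fun x₀ => by
  refine contMDiffAt_of_chart (mem_extChartAt_source x₀)
    ((hτ x₀).div (hσ x₀) fun y hy => coeff_ne_zero hσ₀ x₀ ((ψ x₀).map_target hy)) fun p hp => ?_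
  change ratio τ σ p = coeff τ x₀ (ψ x₀ p) / coeff σ x₀ (ψ x₀ p)
  rw [coeff_eq τ x₀ hp, coeff_eq σ x₀ hp, eq_div_iff (coeff_ne_zero hσ₀ x₀ hp)]
  have h := ratio_smul τ hσ₀ p
  exact (congrArg (fun μ : densityFiber n (1 / 2) (TangentSpace (𝓡 n) p) =>
    μ.1 (coordFrame n x₀ p)) h).symm

theorem smul_right_cancel_density {w : ℝ} {σ : Density n M w} (hσ₀ : NowhereVanishing σ) {x : M}
    {a b : ℝ} (h : a • σ x = b • σ x) : a = b := smul_left_injective ℝ (hσ₀ x) h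

/-- If `s` is the coefficient of `σ`, then the divergence for `σ²` is `∂ᵢXⁱ + 2 X(s)/s`. Half of it
absorbs both the derivative of `s` and the weight term of the Lie derivative. -/
theorem lieDeriv_smul {σ : Density n M (1 / 2)} (hσ : IsSmoothDensity σ)
    (hσ₀ : NowhereVanishing σ) {X : ∀ x : M, TangentSpace (𝓡 n) x} {f : M → ℝ}
    (hf : Smooth n f) :
    lieDeriv X (fun x => f x • σ x) = fun x =>
      (dirDeriv f x (X x) + 1 / 2 * f x * fieldDiv (mulHalf σ σ) X x) • σ x := by
  funext x
  refine densityFiber_ext x (mem_extChartAt_source x) ?_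
  have hy := mem_extChartAt_target (I := 𝓡 n) x
  have hs : DifferentiableAt ℝ (coeff σ x) (ψ x x) :=
    (((hσ x) _ hy).contDiffAt ((isOpen_target x).mem_nhds hy)).differentiableAt (by simp)
  have hs0 : coeff σ x (ψ x x) ≠ 0 := by
    rw [coeff_eq σ x (mem_extChartAt_source x)]
    exact coeff_ne_zero hσ₀ x (mem_extChartAt_source x)
  have h1 : coeff (fun x => f x • σ x) x = (f ∘ (ψ x).symm) * coeff σ x := rfl
  have h2 : coeff (mulHalf σ σ) x = coeff σ x * coeff σ x := rfl
  rw [lieDeriv_apply, h1, fderiv_mul (differentiableAt_chart hf x) hs, fieldDiv, divChart, h2,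
    fderiv_mul hs hs]
  have h3 : ((dirDeriv f x (X x) + 1 / 2 * f x * ((((coeff σ x (ψ x x)) • fderiv ℝ (coeff σ x) (ψ x x)
      + (coeff σ x (ψ x x)) • fderiv ℝ (coeff σ x) (ψ x x)) (components X x (ψ x x))
      + (∑ i, fderiv ℝ (components X x) (ψ x x) (EuclideanSpace.single i (1 : ℝ)) i) *
        (coeff σ x * coeff σ x) (ψ x x)) / (coeff σ x * coeff σ x) (ψ x x))) • σ x).1 (coordFrame n x x)
      = (dirDeriv f x (X x) + 1 / 2 * f x * ((((coeff σ x (ψ x x)) • fderiv ℝ (coeff σ x) (ψ x x)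
      + (coeff σ x (ψ x x)) • fderiv ℝ (coeff σ x) (ψ x x)) (components X x (ψ x x))
      + (∑ i, fderiv ℝ (components X x) (ψ x x) (EuclideanSpace.single i (1 : ℝ)) i) *
        (coeff σ x * coeff σ x) (ψ x x)) / (coeff σ x * coeff σ x) (ψ x x)))
        * coeff σ x (ψ x x) := by
    rw [coeff_eq σ x (mem_extChartAt_source x)]
    rfl
  rw [h3, dirDeriv_eq_fderiv x (mem_extChartAt_source x) (hf.mdiff x)]
  simp only [add_apply, smul_apply, smul_eq_mul, Pi.mul_apply, Function.comp_apply,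
    extChartAt_to_inv]
  field_simp
  ring

theorem mulHalf_smul_smul (σ : Density n M (1 / 2)) (f g : M → ℝ) :
    mulHalf (fun x => f x • σ x) (fun x => g x • σ x) = fun x => (f x * g x) • mulHalf σ σ x := by
  funext x
  ext v
  change (f x * (σ x).1 v) * (g x * (σ x).1 v) = (f x * g x) * ((σ x).1 v * (σ x).1 v)
  ring

end Densities
end GenRicci

/-! ### Sections as a module over the smooth functions; cutoffs -/

namespace GenRicci
section SmoothSections

variable {n : ℕ} {M : Type*} [TopologicalSpace M] [ChartedSpace (EuclideanSpace ℝ (Fin n)) M]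
  {F : Type*} [NormedAddCommGroup F] [NormedSpace ℝ F]
  {E : M → Type*} [TopologicalSpace (Bundle.TotalSpace F E)]
  [∀ x, TopologicalSpace (E x)] [∀ x, AddCommGroup (E x)] [∀ x, Module ℝ (E x)]
  [FiberBundle F E] [VectorBundle ℝ F E] [ContMDiffVectorBundle ∞ F E (𝓡 n)]

local notation "𝒜" => C^∞⟮𝓡 n, M; 𝓘(ℝ, ℝ), ℝ⟯
local notation "Γ" => Cₛ^∞⟮𝓡 n; F, E⟯

/-- The sections of a vector bundle form a module over the smooth functions. -/
instance sectionModule : Module 𝒜 Γ where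
  smul f u := ⟨fun x => f x • u x, f.contMDiff.smul_section u.contMDiff⟩
  one_smul u := by ext x; exact one_smul ℝ (u x)
  mul_smul f g u := by ext x; exact mul_smul (f x) (g x) (u x)
  smul_zero f := by ext x; exact smul_zero (f x)
  smul_add f u v := by ext x; exact smul_add (f x) (u x) (v x)
  add_smul f g u := by ext x; exact add_smul (f x) (g x) (u x)
  zero_smul u := by ext x; exact zero_smul ℝ (u x)

@[simp] theorem section_smul_apply (f : 𝒜) (u : Γ) (x : M) : (f • u) x = f x • u x := rfl

@[simp] theorem section_const_smul_apply (c : ℝ) (u : Γ) (x : M) : (c • u) x = c • u x := rfl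

@[simp] theorem section_add_apply (u v : Γ) (x : M) : (u + v) x = u x + v x := rfl

@[simp] theorem section_sub_apply (u v : Γ) (x : M) : (u - v) x = u x - v x := rfl

@[simp] theorem section_zero_apply (x : M) : (0 : Γ) x = 0 := rfl

@[simp] theorem section_sum_apply {ι : Type*} (s : Finset ι) (u : ι → Γ) (x : M) :
    (∑ i ∈ s, u i) x = ∑ i ∈ s, u i x := by
  have h := map_sum (ContMDiffSection.coeAddHom (𝓡 n) F ∞ E) u s
  simp only [ContMDiffSection.coeAddHom_apply] at h
  rw [h, Finset.sum_apply]

instance : IsScalarTower ℝ 𝒜 Γ where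
  smul_assoc c f u := by ext x; exact smul_assoc c (f x) (u x)

@[simp] theorem fn_mul_apply (f g : 𝒜) (x : M) : (f * g) x = f x * g x := rfl

@[simp] theorem fn_add_apply (f g : 𝒜) (x : M) : (f + g) x = f x + g x := rfl

@[simp] theorem fn_sub_apply (f g : 𝒜) (x : M) : (f - g) x = f x - g x := rfl

@[simp] theorem fn_smul_apply (c : ℝ) (f : 𝒜) (x : M) : (c • f) x = c * f x := rfl

@[simp] theorem fn_one_apply (x : M) : (1 : 𝒜) x = 1 := rfl

@[simp] theorem fn_zero_apply (x : M) : (0 : 𝒜) x = 0 := rfl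

/-- Evaluation of smooth functions at a point. -/
def evalFn (x : M) : 𝒜 →+* ℝ where
  toFun f := f x
  map_one' := rfl
  map_mul' _ _ := rfl
  map_zero' := rfl
  map_add' _ _ := rfl

@[simp] theorem fn_sum_apply {ι : Type*} (s : Finset ι) (f : ι → 𝒜) (x : M) :
    (∑ i ∈ s, f i) x = ∑ i ∈ s, f i x := map_sum (evalFn x) f s

@[simp] theorem fn_pow_apply (f : 𝒜) (k : ℕ) (x : M) : (f ^ k) x = f x ^ k := map_pow (evalFn x) f k

variable [T2Space M] [SigmaCompactSpace M] [IsManifold (𝓡 n) ∞ M]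

/-- A section which is smooth near a point coincides near the point with a global smooth section. -/
theorem exists_section_eventuallyEq {x₀ : M} {s : ∀ x, E x}
    (hs : ∀ᶠ x in 𝓝 x₀, ContMDiffAt (𝓡 n) ((𝓡 n).prod 𝓘(ℝ, F)) ∞
      (fun x => Bundle.TotalSpace.mk' F x (s x)) x) :
    ∃ u : Γ, ∀ᶠ x in 𝓝 x₀, u x = s x := by
  obtain ⟨χ, hχ, hχt, -, hχ1⟩ := exists_bump (n := n) hs
  refine ⟨⟨fun x => χ x • s x, fun x => ?_⟩, ?_⟩
  · by_cases hx : x ∈ tsupport χ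
    · exact (hχ x).smul_section (hχt.sub hx)
    · have h0 : ∀ᶠ y in 𝓝 x, χ y • s y = 0 := by
        filter_upwards [(isClosed_tsupport χ).isOpen_compl.mem_nhds hx] with y hy
        rw [image_eq_zero_of_notMem_tsupport hy, zero_smul]
      have hz : ContMDiffAt (𝓡 n) ((𝓡 n).prod 𝓘(ℝ, F)) ∞
          (fun x => Bundle.TotalSpace.mk' F x (0 : E x)) x :=
        (0 : Γ).contMDiff x
      refine hz.congr_of_eventuallyEq (h0.mono fun y hy => ?_)
      simp only [hy]
  · filter_upwards [hχ1] with y hy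
    change χ y • s y = s y
    rw [hy, Pi.one_apply, one_smul]

/-- A function which is smooth near a point coincides near the point with a global smooth
function. -/
theorem exists_fn_eventuallyEq {x₀ : M} {s : M → ℝ}
    (hs : ∀ᶠ x in 𝓝 x₀, ContMDiffAt (𝓡 n) 𝓘(ℝ, ℝ) ∞ s x) :
    ∃ u : 𝒜, ∀ᶠ x in 𝓝 x₀, u x = s x := by
  obtain ⟨χ, hχ, hχt, -, hχ1⟩ := exists_bump (n := n) hs
  refine ⟨⟨fun x => χ x * s x, fun x => ?_⟩, ?_⟩
  · by_cases hx : x ∈ tsupport χ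
    · exact (hχ x).mul (hχt.sub hx)
    · have h0 : ∀ᶠ y in 𝓝 x, χ y * s y = 0 := by
        filter_upwards [(isClosed_tsupport χ).isOpen_compl.mem_nhds hx] with y hy
        rw [image_eq_zero_of_notMem_tsupport hy, zero_mul]
      exact contMDiffAt_const.congr_of_eventuallyEq h0
  · filter_upwards [hχ1] with y hy
    change χ y * s y = s y
    rw [hy, Pi.one_apply, one_mul]

/-- A bump function as an element of the algebra of smooth functions. -/
theorem exists_bump_fn {x : M} {U : Set M} (hU : U ∈ 𝓝 x) :
    ∃ χ : 𝒜, IsTest U χ ∧ (∀ y, 0 ≤ χ y) ∧ χ =ᶠ[𝓝 x] 1 := by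
  obtain ⟨χ, hχ, hχt, h0, h1⟩ := exists_bump (n := n) hU
  exact ⟨⟨χ, hχ⟩, hχt, h0, h1⟩

variable [FiniteDimensional ℝ F]

/-- Local frames, consisting of global sections. -/
theorem exists_localFrame (x₀ : M) : ∃ (k : ℕ) (s : Fin k → Γ), ∀ᶠ x in 𝓝 x₀,
    LinearIndependent ℝ (fun i => s i x) ∧ Submodule.span ℝ (Set.range fun i => s i x) = ⊤ := by
  let t := trivializationAt F E x₀
  have hx₀ : x₀ ∈ t.baseSet := FiberBundle.mem_baseSet_trivializationAt F E x₀
  let b := Module.finBasis ℝ F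
  have h := fun i => exists_section_eventuallyEq (E := E) (F := F) (n := n) (x₀ := x₀)
    (s := t.localFrame b i) (by
      filter_upwards [t.open_baseSet.mem_nhds hx₀] with x hx
      exact contMDiffAt_localFrame_of_mem ∞ t b i hx)
  choose s hs using h
  refine ⟨_, s, ?_⟩
  filter_upwards [t.open_baseSet.mem_nhds hx₀, Filter.eventually_all.2 hs] with x hx hsx
  have he : (fun i => s i x) = t.basisAt b hx := by
    funext i
    rw [hsx, t.localFrame_apply_of_mem_baseSet b hx]
  rw [he]
  exact ⟨(t.basisAt b hx).linearIndependent, (t.basisAt b hx).span_eq⟩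

/-- There is a smooth section through every vector. -/
theorem exists_section_apply (x : M) (v : E x) : ∃ u : Γ, u x = v := by
  obtain ⟨k, s, hs⟩ := exists_localFrame (n := n) (F := F) (E := E) x
  obtain ⟨c, hc⟩ := (Submodule.mem_span_range_iff_exists_fun ℝ).1
    (show v ∈ Submodule.span ℝ (Set.range fun i => s i x) by
      rw [hs.self_of_nhds.2]; trivial)
  exact ⟨∑ i, c i • s i, by simpa using hc⟩

/-- A section that vanishes near `x` is a multiple of itself by a function that vanishes
near `x`. -/
theorem exists_smul_eq_self {x : M} {u : Γ} (hu : ∀ᶠ y in 𝓝 x, u y = 0) :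
    ∃ g : 𝒜, g • u = u ∧ ∀ᶠ y in 𝓝 x, g y = 0 := by
  obtain ⟨χ, hχ, -, h1⟩ := exists_bump_fn (n := n) hu
  -- `χ` is supported where `u` vanishes and equals 1 near `x`.
  refine ⟨1 - χ, ?_, ?_⟩
  · ext y
    by_cases hy : y ∈ tsupport χ
    · have : u y = 0 := hχ.sub hy
      simp [this]
    · simp [image_eq_zero_of_notMem_tsupport hy]
  · filter_upwards [h1] with y hy
    simp [hy]

end SmoothSections
end GenRicci

/-! ### Calculus in a Courant algebroid -/

namespace GenRicci
section Courant

variable {n : ℕ} {M : Type*} [TopologicalSpace M] [ChartedSpace (EuclideanSpace ℝ (Fin n)) M]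
  [IsManifold (𝓡 n) ∞ M] [T2Space M] [SigmaCompactSpace M]
  {F : Type*} [NormedAddCommGroup F] [NormedSpace ℝ F] [FiniteDimensional ℝ F]
  {E : M → Type*} [TopologicalSpace (Bundle.TotalSpace F E)]
  [∀ x, TopologicalSpace (E x)] [∀ x, AddCommGroup (E x)] [∀ x, Module ℝ (E x)]
  [FiberBundle F E] [VectorBundle ℝ F E] [ContMDiffVectorBundle ∞ F E (𝓡 n)]

local notation "𝒜" => C^∞⟮𝓡 n, M; 𝓘(ℝ, ℝ), ℝ⟯
local notation "Γ" => Cₛ^∞⟮𝓡 n; F, E⟯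

namespace CourantAlgebroid

variable (C : CourantAlgebroid n F E)

/-- The inner product of sections. -/
def ip : Γ →ₗ[𝒜] Γ →ₗ[𝒜] 𝒜 :=
  LinearMap.mk₂ 𝒜 (fun u v => ⟨fun x => C.metric x (u x) (v x), C.metric_smooth u v⟩)
    (fun u u' v => by ext x; change C.metric x (u x + u' x) (v x) = _; rw [map_add]; rfl)
    (fun f u v => by ext x; change C.metric x (f x • u x) (v x) = _; rw [map_smul]; rfl)
    (fun u v v' => by ext x; change C.metric x (u x) (v x + v' x) = _; rw [map_add]; rfl)
    (fun f u v => by ext x; change C.metric x (u x) (f x • v x) = _; rw [map_smul]; rfl)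

theorem ip_apply (u v : Γ) (x : M) : C.ip u v x = C.metric x (u x) (v x) := rfl

theorem ip_comm (u v : Γ) : C.ip u v = C.ip v u := by
  ext x; exact C.metric_symm x _ _

theorem eq_of_ip {x : M} {u v : E x} (h : ∀ w : Γ, C.metric x (w x) u = C.metric x (w x) v) :
    u = v := by
  refine sub_eq_zero.1 (C.metric_nondegenerate x _ fun w => ?_)
  obtain ⟨w, rfl⟩ := exists_section_apply (n := n) (F := F) (E := E) x w
  rw [C.metric_symm, map_sub, h, sub_self]

theorem ext_ip {u v : Γ} (h : ∀ w, C.ip w u = C.ip w v) : u = v := by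
  ext x
  exact C.eq_of_ip fun w => congrArg (fun f : 𝒜 => f x) (h w)

/-- The derivation `f ↦ u · f` of the smooth functions. -/
def der : Γ →ₗ[𝒜] Derivation ℝ 𝒜 𝒜 where
  toFun u := Derivation.mk'
    { toFun := fun f => ⟨C.act u f, smooth_dirDeriv f.contMDiff (C.anchor_smooth u)⟩
      map_add' := fun f g => by
        ext x; exact dirDeriv_add f.contMDiff g.contMDiff _
      map_smul' := fun c f => by
        ext x; exact dirDeriv_const_mul f.contMDiff c _ }
    (fun f g => by
      ext x
      refine (dirDeriv_mul f.contMDiff g.contMDiff (C.anchorField u x)).trans ?_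
      change _ = f x * C.act u g x + g x * C.act u f x
      simp only [act])
  map_add' u v := by
    ext f x
    change dirDeriv f x (C.anchor x (u x + v x)) = dirDeriv f x _ + dirDeriv f x _
    rw [map_add]
    exact map_add _ _ _
  map_smul' g u := by
    ext f x
    change dirDeriv f x (C.anchor x (g x • u x)) = g x * dirDeriv f x _
    rw [map_smul]
    exact map_smul _ _ _

theorem der_mul (u : Γ) (f g : 𝒜) : C.der u (f * g) = f * C.der u g + g * C.der u f := by
  simp

theorem der_smul_left (u : Γ) (f g : 𝒜) : C.der (f • u) g = f * C.der u g := by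
  rw [map_smul]; rfl

theorem der_add_left (u v : Γ) (g : 𝒜) : C.der (u + v) g = C.der u g + C.der v g := by
  rw [map_add]; rfl

theorem der_sub_left (u v : Γ) (g : 𝒜) : C.der (u - v) g = C.der u g - C.der v g := by
  rw [map_sub]; rfl

theorem der_sum_left {ι : Type*} (s : Finset ι) (u : ι → Γ) (g : 𝒜) :
    C.der (∑ i ∈ s, u i) g = ∑ i ∈ s, C.der (u i) g := by
  rw [map_sum]
  exact map_sum (⟨⟨fun D : Derivation ℝ 𝒜 𝒜 => D g, rfl⟩, fun _ _ => rfl⟩ :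
    Derivation ℝ 𝒜 𝒜 →+ 𝒜) _ _

/-- The value of `u · f` at `x` depends only on the germ of `f`. -/
theorem der_congr (u : Γ) {f g : 𝒜} {x : M} (h : ∀ᶠ y in 𝓝 x, f y = g y) :
    C.der u f x = C.der u g x := dirDeriv_congr h _

theorem der_apply_congr {u v : Γ} (f : 𝒜) {x : M} (h : u x = v x) :
    C.der u f x = C.der v f x := by
  change dirDeriv f x (C.anchor x (u x)) = dirDeriv f x (C.anchor x (v x))
  rw [h]

theorem bracket_smul (u v : Γ) (f : 𝒜) :
    C.bracket u (f • v) = f • C.bracket u v + C.der u f • v := by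
  ext x
  exact C.leibniz u v (f • v) f f.contMDiff (fun _ => rfl) x

theorem der_ip (u v w : Γ) :
    C.der u (C.ip v w) = C.ip (C.bracket u v) w + C.ip v (C.bracket u w) := by
  ext x
  exact C.metric_invariant u v w x

theorem ip_symm_part (u v w : Γ) :
    C.ip w (C.bracket u v + C.bracket v u) = C.der w (C.ip u v) := by
  ext x
  exact C.symm_part u v w x

/-- The Riesz lemma for sections: a fibrewise linear smooth functional is given by the inner
product with a smooth section. -/
theorem exists_section_ip (ℓ : ∀ x, E x →ₗ[ℝ] ℝ)
    (hℓ : ∀ u : Γ, ContMDiff (𝓡 n) 𝓘(ℝ, ℝ) ∞ (fun x => ℓ x (u x))) :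
    ∃ v : Γ, ∀ x (w : E x), C.metric x w (v x) = ℓ x w := by
  have hex : ∀ x, ∃ v : E x, ∀ w : E x, C.metric x w v = ℓ x w := fun x => by
    have := finiteDimensional_fiber F E x
    have hinj : Function.Injective (C.metric x) := by
      refine (injective_iff_map_eq_zero _).2 fun u hu => C.metric_nondegenerate x u fun v => ?_
      rw [hu]; rfl
    have hsurj : Function.Surjective (C.metric x) :=
      (LinearMap.injective_iff_surjective_of_finrank_eq_finrank
        (Subspace.dual_finrank_eq (K := ℝ) (V := E x)).symm).1 hinj
    obtain ⟨v, hv⟩ := hsurj (ℓ x)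
    exact ⟨v, fun w => by rw [C.metric_symm, hv]⟩
  choose v hv using hex
  refine ⟨⟨v, fun x₀ => ?_⟩, hv⟩
  obtain ⟨k, s, hs⟩ := exists_localFrame (n := n) (F := F) (E := E) x₀
  set G : M → Matrix (Fin k) (Fin k) ℝ :=
    fun x => Matrix.of fun i j => C.metric x (s i x) (s j x) with hG
  have hdet : ∀ᶠ x in 𝓝 x₀, (G x).det ≠ 0 := hs.mono fun x hx h => by
    obtain ⟨c, hc, hc'⟩ := Matrix.exists_mulVec_eq_zero_iff.2 h
    refine hc (funext (Fintype.linearIndependent_iff.1 hx.1 c ?_))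
    refine C.metric_nondegenerate x _ fun w => ?_
    have hw : w ∈ Submodule.span ℝ (Set.range fun i => s i x) := by rw [hx.2]; trivial
    obtain ⟨d, rfl⟩ := (Submodule.mem_span_range_iff_exists_fun ℝ).1 hw
    simp only [map_sum, LinearMap.sum_apply, map_smul, LinearMap.smul_apply]
    refine Finset.sum_eq_zero fun i _ => ?_
    have h1 := congrFun hc' i
    simp only [hG, Matrix.mulVec, dotProduct, Matrix.of_apply, Pi.zero_apply] at h1
    have h2 : ∑ j, c j • C.metric x (s i x) (s j x) = 0 := by
      rw [← h1]; exact Finset.sum_congr rfl fun j _ => mul_comm _ _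
    simp only [fun j => C.metric_symm x (s j x) (s i x)]
    rw [h2, smul_zero]
  have hinv := contMDiffAt_matrix_inv G x₀ (fun i j => C.metric_smooth (s i) (s j) x₀)
    hdet.self_of_nhds
  -- In a local frame the coefficients of `v` are obtained by applying the inverse Gram matrix to
  -- the values of `ℓ` on the frame, so they are smooth.
  have key : ∀ᶠ x in 𝓝 x₀, v x = ∑ i, (∑ j, (G x)⁻¹ i j * ℓ x (s j x)) • s i x := by
    filter_upwards [hs, hdet] with x hx hd
    refine sub_eq_zero.1 (C.metric_nondegenerate x _ fun w => ?_)
    have hw : w ∈ Submodule.span ℝ (Set.range fun i => s i x) := by rw [hx.2]; trivial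
    obtain ⟨d, rfl⟩ := (Submodule.mem_span_range_iff_exists_fun ℝ).1 hw
    rw [C.metric_symm]
    simp only [map_sum, LinearMap.sum_apply, map_smul, LinearMap.smul_apply]
    refine Finset.sum_eq_zero fun i _ => ?_
    rw [map_sub, hv, map_sum]
    have h1 : (G x * (G x)⁻¹) = 1 := Matrix.mul_nonsing_inv _ (isUnit_iff_ne_zero.2 hd)
    have h2 := congrFun (congrArg (fun A => Matrix.mulVec A (fun j => ℓ x (s j x))) h1) i
    rw [← Matrix.mulVec_mulVec, Matrix.one_mulVec] at h2
    have h3 : ∑ j, C.metric x (s i x) ((∑ l, (G x)⁻¹ j l * ℓ x (s l x)) • s j x) = ℓ x (s i x) := by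
      rw [← h2]
      simp only [map_smul, Matrix.mulVec, dotProduct, smul_eq_mul]
      exact Finset.sum_congr rfl fun j _ => mul_comm _ _
    rw [h3, sub_self, smul_zero]
  have hsm : ContMDiffAt (𝓡 n) ((𝓡 n).prod 𝓘(ℝ, F)) ∞
      (fun x => Bundle.TotalSpace.mk' F x (∑ i, (∑ j, (G x)⁻¹ i j * ℓ x (s j x)) • s i x)) x₀ := by
    refine ContMDiffAt.sum_section fun i _ => ContMDiffAt.smul_section ?_ ((s i).contMDiff x₀)
    exact ContMDiffAt.sum fun j _ => (hinv i j).mul (hℓ (s j) x₀)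
  refine hsm.congr_of_eventuallyEq (key.mono fun x hx => ?_)
  simp only [hx]

theorem exists_grad (f : 𝒜) : ∃ v : Γ, ∀ w, C.ip w v = C.der w f := by
  obtain ⟨v, hv⟩ := C.exists_section_ip
    (fun x => ((mfderiv (𝓡 n) 𝓘(ℝ, ℝ) f x).toLinearMap : TangentSpace (𝓡 n) x →ₗ[ℝ] ℝ) ∘ₗ C.anchor x)
    (fun u => (C.der u f).contMDiff)
  exact ⟨v, fun w => by ext x; exact hv x (w x)⟩

/-- The gradient of a function, with respect to the inner product of the Courant algebroid. -/
def grad (f : 𝒜) : Γ := (C.exists_grad f).choose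

theorem ip_grad (w : Γ) (f : 𝒜) : C.ip w (C.grad f) = C.der w f := (C.exists_grad f).choose_spec w

theorem grad_mul (f g : 𝒜) : C.grad (f * g) = f • C.grad g + g • C.grad f :=
  C.ext_ip fun w => by
    simp only [map_add, map_smul, ip_grad, der_mul, smul_eq_mul]

theorem bracket_add_swap (u v : Γ) : C.bracket u v + C.bracket v u = C.grad (C.ip u v) :=
  C.ext_ip fun w => by rw [ip_symm_part, ip_grad]

theorem bracket_swap (u v : Γ) : C.bracket u v = C.grad (C.ip u v) - C.bracket v u :=
  eq_sub_of_add_eq (C.bracket_add_swap u v)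

/-- The Leibniz rule is an axiom only for the second argument. The symmetric part `grad ⟨u, v⟩`
carries it over to the first, and leaves the gradient of `f` behind. -/
theorem smul_bracket (u v : Γ) (f : 𝒜) :
    C.bracket (f • u) v = f • C.bracket u v - C.der v f • u + C.ip u v • C.grad f := by
  rw [bracket_swap, bracket_smul, bracket_swap C u v, map_smul, LinearMap.smul_apply, smul_eq_mul,
    grad_mul]
  module

/-- The anchor is a homomorphism of brackets. -/
theorem der_bracket (u v : Γ) (f : 𝒜) :
    C.der (C.bracket u v) f = C.der u (C.der v f) - C.der v (C.der u f) := by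
  ext x
  by_cases hx : ∃ w₀ : E x, w₀ ≠ 0
  · obtain ⟨w₀, hw₀⟩ := hx
    obtain ⟨w, rfl⟩ := exists_section_apply (n := n) (F := F) (E := E) x w₀
    -- In the Jacobi identity for `f w` everything cancels except the claimed difference times `w`,
    -- and `w` is nonzero at `x`.
    have h1 := C.jacobi u v (f • w)
    simp only [bracket_smul, map_add, C.jacobi u v w] at h1
    have h2 : (C.der (C.bracket u v) f - (C.der u (C.der v f) - C.der v (C.der u f))) • w = 0 := by
      refine Eq.trans ?_ (sub_eq_zero.2 h1.symm)
      module
    have h3 := congrArg (fun s : Γ => s x) h2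
    simp only [section_smul_apply, section_zero_apply, smul_eq_zero, hw₀, or_false] at h3
    exact sub_eq_zero.1 h3
  -- If the fibre is zero, all derivatives along sections vanish at `x`.
  · push Not at hx
    have h0 : ∀ (w : Γ) (g : 𝒜), C.der w g x = 0 := fun w g => by
      have : w x = (0 : Γ) x := hx _
      rw [C.der_apply_congr g this, map_zero]; rfl
    simp [h0]

/-- Gradients act trivially on functions. -/
theorem der_grad (f g : 𝒜) : C.der (C.grad f) g = 0 := by
  -- `[u, v] + [v, u]` acts as the sum of two opposite commutators.
  have h1 : ∀ u v : Γ, C.der (C.grad (C.ip u v)) g = 0 := fun u v => by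
    rw [← bracket_add_swap, der_add_left, der_bracket, der_bracket]
    abel
  ext x
  by_cases hx : ∃ u v : E x, C.metric x u v ≠ 0
  · obtain ⟨u, v, h⟩ := hx
    obtain ⟨u, rfl⟩ := exists_section_apply (n := n) (F := F) (E := E) x u
    obtain ⟨v, rfl⟩ := exists_section_apply (n := n) (F := F) (E := E) x v
    -- Expansion of `grad (f ⟨u, v⟩)` isolates `⟨u, v⟩ grad f`, and `⟨u, v⟩` is nonzero at `x`.
    have h2 := h1 (f • u) v
    rw [map_smul, LinearMap.smul_apply, smul_eq_mul, grad_mul, der_add_left, der_smul_left,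
      der_smul_left, h1, mul_zero, zero_add] at h2
    have h3 := congrArg (fun s : 𝒜 => s x) h2
    simpa [ip_apply, h] using h3
  · push Not at hx
    have : C.grad f x = (0 : Γ) x := C.metric_nondegenerate x _ fun v => hx _ _
    rw [C.der_apply_congr g this, map_zero]; rfl

theorem ip_grad_grad (f g : 𝒜) : C.ip (C.grad f) (C.grad g) = 0 := by
  rw [ip_grad, der_grad]

theorem grad_congr {f g : 𝒜} {x : M} (h : ∀ᶠ y in 𝓝 x, f y = g y) : C.grad f x = C.grad g x := by
  refine C.eq_of_ip fun w => ?_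
  have h1 := congrArg (fun s : 𝒜 => s x) (C.ip_grad w f)
  have h2 := congrArg (fun s : 𝒜 => s x) (C.ip_grad w g)
  simp only [ip_apply] at h1 h2
  rw [h1, h2, C.der_congr w h]

/-- A difference that vanishes near `x` equals `g` times itself with `g` zero near `x`; the Leibniz
rule then kills both terms at `x`. -/
theorem bracket_congr_right (u : Γ) {v v' : Γ} {x : M} (h : ∀ᶠ y in 𝓝 x, v y = v' y) :
    C.bracket u v x = C.bracket u v' x := by
  have h0 : ∀ᶠ y in 𝓝 x, (v - v') y = 0 := h.mono fun y hy => sub_eq_zero.2 hy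
  obtain ⟨g, hg, hgx⟩ := exists_smul_eq_self h0
  have h1 : C.bracket u (v - v') x = 0 := by
    rw [← hg, bracket_smul, section_add_apply, section_smul_apply, section_smul_apply,
      hgx.self_of_nhds, h0.self_of_nhds, zero_smul, smul_zero, add_zero]
  rw [map_sub, section_sub_apply] at h1
  exact sub_eq_zero.1 h1

/-- `bracket_swap` reduces this to the other argument, the gradient term being local as well. -/
theorem bracket_congr_left {u u' : Γ} (v : Γ) {x : M} (h : ∀ᶠ y in 𝓝 x, u y = u' y) :
    C.bracket u v x = C.bracket u' v x := by
  rw [bracket_swap, bracket_swap C u', section_sub_apply, section_sub_apply,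
    C.bracket_congr_right v h, C.grad_congr (h.mono fun y hy => ?_)]
  rw [ip_apply, ip_apply, hy]

theorem bracket_congr {u u' v v' : Γ} {x : M} (hu : ∀ᶠ y in 𝓝 x, u y = u' y)
    (hv : ∀ᶠ y in 𝓝 x, v y = v' y) : C.bracket u v x = C.bracket u' v' x :=
  (C.bracket_congr_left v hu).trans (C.bracket_congr_right u' hv)

/-- The divergence of a section with respect to a volume density. -/
def dv {μ : Density n M 1} (hμ : IsVolume μ) (u : Γ) : 𝒜 :=
  ⟨fieldDiv μ (C.anchorField u), hμ.smooth_fieldDiv (C.anchor_smooth u)⟩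

variable {μ : Density n M 1} (hμ : IsVolume μ)

theorem divergence_eq (hμ : IsVolume μ) (u : Γ) : C.divergence μ u = C.dv hμ u := by
  funext x
  change _ / _ = divChart μ (C.anchorField u) x (extChartAt (𝓡 n) x x)
  rw [lieDeriv_apply, divChart, coeff_eq μ x (mem_extChartAt_source x), one_mul]

theorem dv_add (u v : Γ) : C.dv hμ (u + v) = C.dv hμ u + C.dv hμ v := by
  ext x
  refine Eq.trans ?_ (fieldDiv_add μ (C.anchor_smooth u) (C.anchor_smooth v) x)
  refine fieldDiv_congr μ (.of_forall fun y => ?_)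
  exact map_add (C.anchor y) (u y) (v y)

theorem dv_smul (f : 𝒜) (u : Γ) : C.dv hμ (f • u) = f * C.dv hμ u + C.der u f := by
  ext x
  refine Eq.trans ?_ (hμ.fieldDiv_smul (C.anchor_smooth u) f.contMDiff x)
  refine fieldDiv_congr μ (.of_forall fun y => ?_)
  exact map_smul (C.anchor y) (f y) (u y)

theorem dv_zero : C.dv hμ (0 : Γ) = 0 := by
  have h := C.dv_add hμ 0 0
  rw [add_zero] at h
  exact left_eq_add.1 h

theorem dv_sum {ι : Type*} (s : Finset ι) (u : ι → Γ) :
    C.dv hμ (∑ i ∈ s, u i) = ∑ i ∈ s, C.dv hμ (u i) :=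
  map_sum (⟨⟨C.dv hμ, C.dv_zero hμ⟩, C.dv_add hμ⟩ : Γ →+ 𝒜) _ _

theorem dv_congr {u v : Γ} {x : M} (h : ∀ᶠ y in 𝓝 x, u y = v y) : C.dv hμ u x = C.dv hμ v x :=
  fieldDiv_congr μ (h.mono fun y hy => by rw [anchorField, anchorField, hy])

theorem dv_congr_eventually {u v : Γ} {x : M} (h : ∀ᶠ y in 𝓝 x, u y = v y) :
    ∀ᶠ y in 𝓝 x, C.dv hμ u y = C.dv hμ v y :=
  h.eventually_nhds.mono fun _ hy => C.dv_congr hμ hy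

theorem bracket_congr_eventually {u u' v v' : Γ} {x : M} (hu : ∀ᶠ y in 𝓝 x, u y = u' y)
    (hv : ∀ᶠ y in 𝓝 x, v y = v' y) : ∀ᶠ y in 𝓝 x, C.bracket u v y = C.bracket u' v' y := by
  filter_upwards [hu.eventually_nhds, hv.eventually_nhds] with y h1 h2
  exact C.bracket_congr h1 h2

theorem der_congr_eventually {u u' : Γ} {f f' : 𝒜} {x : M} (hu : ∀ᶠ y in 𝓝 x, u y = u' y)
    (hf : ∀ᶠ y in 𝓝 x, f y = f' y) : ∀ᶠ y in 𝓝 x, C.der u f y = C.der u' f' y := by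
  filter_upwards [hu, hf.eventually_nhds] with y h1 h2
  rw [C.der_congr u h2, C.der_apply_congr f' h1]

end CourantAlgebroid
end Courant
end GenRicci

/-! ### Smooth normalisation of Gram matrices -/

namespace GenRicci
section MatrixRoot

attribute [local instance] Matrix.linftyOpNormedRing Matrix.linftyOpNormedAlgebra

/-- A smooth square root of matrices near the identity. -/
theorem exists_matrix_sqrt (k : ℕ) : ∃ s : Matrix (Fin k) (Fin k) ℝ → Matrix (Fin k) (Fin k) ℝ,
    s 1 = 1 ∧ (∀ᶠ H in 𝓝 1, ContDiffAt ℝ ω s H) ∧ (∀ᶠ H in 𝓝 1, s H * s H = H) ∧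
      ∀ᶠ S in 𝓝 1, s (S * S) = S := by
  set f : Matrix (Fin k) (Fin k) ℝ → Matrix (Fin k) (Fin k) ℝ := fun S => S * S with hf
  have hcd : ContDiffAt ℝ ω f 1 := contDiffAt_id.mul contDiffAt_id
  -- Squaring has derivative `2 · id` at the identity, so the inverse function theorem applies.
  let L : Matrix (Fin k) (Fin k) ℝ ≃L[ℝ] Matrix (Fin k) (Fin k) ℝ :=
    ContinuousLinearEquiv.smulLeft (Units.mk0 (2 : ℝ) two_ne_zero)
  have hd : HasFDerivAt f (L : Matrix (Fin k) (Fin k) ℝ →L[ℝ] Matrix (Fin k) (Fin k) ℝ) 1 := by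
    have h := (hasFDerivAt_id (𝕜 := ℝ) (1 : Matrix (Fin k) (Fin k) ℝ)).mul'
      (hasFDerivAt_id (𝕜 := ℝ) (1 : Matrix (Fin k) (Fin k) ℝ))
    refine h.congr_fderiv ?_
    ext1 S
    change (1 : Matrix (Fin k) (Fin k) ℝ) * S + S * 1 = (2 : ℝ) • S
    rw [one_mul, mul_one, two_smul]
  have h11 : f 1 = 1 := one_mul 1
  let e := hcd.toOpenPartialHomeomorph f hd (by simp)
  have hs : (1 : Matrix (Fin k) (Fin k) ℝ) ∈ e.source :=
    hcd.mem_toOpenPartialHomeomorph_source hd (by simp)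
  have ht : (1 : Matrix (Fin k) (Fin k) ℝ) ∈ e.target := by
    have := hcd.image_mem_toOpenPartialHomeomorph_target hd (by simp)
    rwa [h11] at this
  have he : ∀ S, e S = S * S := fun S => rfl
  refine ⟨e.symm, ?_, ?_, ?_, ?_⟩
  · have := e.left_inv hs
    rwa [he, one_mul] at this
  · have h := hcd.to_localInverse hd (by simp)
    rw [h11] at h
    exact h.eventually (by simp)
  · filter_upwards [e.open_target.mem_nhds ht] with H hH
    have := e.right_inv hH
    rwa [he] at this
  · filter_upwards [e.open_source.mem_nhds hs] with S hS
    have := e.left_inv hS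
    rwa [he] at this

/-- The normalization of Gram matrices near a diagonal matrix with entries `±1`. -/
theorem exists_gram_normalization {k : ℕ} (ε : Fin k → ℝ) (hε : ∀ i, ε i * ε i = 1) :
    ∃ Φ : (Fin k → Fin k → ℝ) → (Fin k → Fin k → ℝ),
      Φ (Matrix.diagonal ε) = (1 : Matrix (Fin k) (Fin k) ℝ) ∧
      (∀ᶠ G in 𝓝 (Matrix.diagonal ε : Fin k → Fin k → ℝ), ContDiffAt ℝ ∞ Φ G) ∧
      ∀ᶠ G in 𝓝 (Matrix.diagonal ε : Fin k → Fin k → ℝ), (∀ i j, G i j = G j i) →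
        ∀ i j, ∑ a, ∑ b, Φ G i a * G a b * Φ G j b = if i = j then ε i else 0 := by
  obtain ⟨s, hs1, hsc, hsr, hsl⟩ := exists_matrix_sqrt k
  set D : Matrix (Fin k) (Fin k) ℝ := Matrix.diagonal ε with hD
  have hDD : D * D = 1 := by
    rw [hD, Matrix.diagonal_mul_diagonal, ← Matrix.diagonal_one]
    congr 1; funext i; exact hε i
  let ι : (Fin k → Fin k → ℝ) ≃L[ℝ] Matrix (Fin k) (Fin k) ℝ :=
    (Matrix.ofLinearEquiv ℝ).toContinuousLinearEquiv
  have hι : ∀ G, ι G = Matrix.of G := fun _ => rfl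
  let τ : Matrix (Fin k) (Fin k) ℝ →L[ℝ] Matrix (Fin k) (Fin k) ℝ :=
    LinearMap.toContinuousLinearMap (Matrix.transposeLinearEquiv (Fin k) (Fin k) ℝ ℝ).toLinearMap
  have hτ : ∀ G, τ G = G.transpose := fun _ => rfl
  have hιD : ι D * D = 1 := hDD
  have hcont : ContinuousAt (fun G : Fin k → Fin k → ℝ => ι G * D) D :=
    (ι.continuous.mul continuous_const).continuousAt
  have htend : Filter.Tendsto (fun G : Fin k → Fin k → ℝ => ι G * D) (𝓝 D) (𝓝 1) := by
    have := hcont.tendsto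
    rwa [hιD] at this
  have hsc1 : ContinuousAt s 1 := hsc.self_of_nhds.continuousAt
  have hstend : Filter.Tendsto (fun G : Fin k → Fin k → ℝ => s (ι G * D)) (𝓝 D) (𝓝 1) := by
    have := hsc1.tendsto.comp htend
    rwa [hs1] at this
  have hunit : ∀ᶠ G in 𝓝 (D : Fin k → Fin k → ℝ), IsUnit (s (ι G * D)) :=
    hstend.eventually (Units.isOpen.mem_nhds isUnit_one)
  -- With `D = diag ε`, the matrix `Φ(G)` is the inverse of the root `S` of `G D` near 1. If `D Sᵀ D
  -- = S`, then `S D Sᵀ = S² D = G`, which is the required normalisation.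
  refine ⟨fun G => ι.symm (Ring.inverse (s (ι G * D))), ?_, ?_, ?_⟩
  · change ι.symm (Ring.inverse (s (ι D * D))) = _
    rw [hιD, hs1, Ring.inverse_one]
    rfl
  · filter_upwards [htend.eventually hsc, hunit] with G hG hu
    obtain ⟨u, hu⟩ := hu
    have h1 : ContDiffAt ℝ ∞ (fun G : Fin k → Fin k → ℝ => s (ι G * D)) G := by
      have h2 : ContDiffAt ℝ ∞ (fun G : Fin k → Fin k → ℝ => ι G * D) G :=
        ι.contDiff.contDiffAt.mul contDiffAt_const
      exact (hG.of_le (by simp)).comp G h2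
    have h3 : ContDiffAt ℝ ∞ Ring.inverse (s (ι G * D)) := hu ▸ contDiffAt_ringInverse ℝ u
    have h4 : ContDiffAt ℝ ∞ (fun G : Fin k → Fin k → ℝ => Ring.inverse (s (ι G * D))) G :=
      ContDiffAt.comp (g := Ring.inverse) G h3 h1
    exact ι.symm.contDiff.contDiffAt.comp G h4
  · have hS' : Filter.Tendsto (fun G : Fin k → Fin k → ℝ => D * τ (s (ι G * D)) * D) (𝓝 D)
        (𝓝 1) := by
      have h1 : Continuous fun S : Matrix (Fin k) (Fin k) ℝ => D * τ S * D :=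
        (continuous_const.mul τ.continuous).mul continuous_const
      have h2 := (h1.tendsto 1).comp hstend
      have h3 : D * τ 1 * D = 1 := by rw [hτ, Matrix.transpose_one, mul_one, hDD]
      rwa [h3] at h2
    filter_upwards [hunit, htend.eventually hsr, hstend.eventually hsl, hS'.eventually hsl]
      with G hu hr hl hl' hsymm
    set S := s (ι G * D) with hS
    have hG : (ι G).transpose = ι G := by
      ext i j; exact hsymm j i
    have hDt : D.transpose = D := Matrix.diagonal_transpose ε
    -- `D Sᵀ D` squares to `G D` too, by the symmetry of `G`. It is also close to 1, where the root
    -- is unique, so it equals `S`.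
    have h4 : D * S.transpose * D * (D * S.transpose * D) = S * S := by
      have : D * S.transpose * D * (D * S.transpose * D) = D * (S * S).transpose * D := by
        rw [Matrix.transpose_mul]
        calc D * S.transpose * D * (D * S.transpose * D)
            = D * S.transpose * (D * D) * S.transpose * D := by noncomm_ring
          _ = _ := by rw [hDD]; noncomm_ring
      rw [this, hr, Matrix.transpose_mul, hDt, hG]
      calc D * (D * ι G) * D = (D * D) * ι G * D := by noncomm_ring
        _ = _ := by rw [hDD, one_mul]
    rw [hτ, h4, hl] at hl'
    have h5 : S * D * S.transpose = ι G := by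
      calc S * D * S.transpose = S * (D * S.transpose * (D * D)) := by rw [hDD]; noncomm_ring
        _ = S * (D * S.transpose * D) * D := by noncomm_ring
        _ = S * S * D := by rw [← hl']
        _ = ι G * (D * D) := by rw [hr]; noncomm_ring
        _ = ι G := by rw [hDD, mul_one]
    have h6 : Ring.inverse S * S = 1 := Ring.inverse_mul_cancel S hu
    have h7 : Ring.inverse S * ι G * (Ring.inverse S).transpose = D := by
      rw [← h5]
      have h8 : S.transpose * (Ring.inverse S).transpose = 1 := by
        rw [← Matrix.transpose_mul, h6, Matrix.transpose_one]
      calc Ring.inverse S * (S * D * S.transpose) * (Ring.inverse S).transpose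
          = (Ring.inverse S * S) * D * (S.transpose * (Ring.inverse S).transpose) := by noncomm_ring
        _ = D := by rw [h6, h8, one_mul, mul_one]
    intro i j
    have h9 := congrFun (congrFun h7 i) j
    rw [hD, Matrix.diagonal_apply] at h9
    rw [← h9, Matrix.mul_apply]
    simp only [Matrix.mul_apply, Matrix.transpose_apply, Finset.sum_mul]
    rw [Finset.sum_comm]
    rfl

end MatrixRoot
end GenRicci

/-! ### Pseudo-orthonormal frames of subbundles -/

namespace GenRicci
section Courant

variable {n : ℕ} {M : Type*} [TopologicalSpace M] [ChartedSpace (EuclideanSpace ℝ (Fin n)) M]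
  [IsManifold (𝓡 n) ∞ M] [T2Space M] [SigmaCompactSpace M]
  {F : Type*} [NormedAddCommGroup F] [NormedSpace ℝ F] [FiniteDimensional ℝ F]
  {E : M → Type*} [TopologicalSpace (Bundle.TotalSpace F E)]
  [∀ x, TopologicalSpace (E x)] [∀ x, AddCommGroup (E x)] [∀ x, Module ℝ (E x)]
  [FiberBundle F E] [VectorBundle ℝ F E] [ContMDiffVectorBundle ∞ F E (𝓡 n)]

local notation "𝒜" => C^∞⟮𝓡 n, M; 𝓘(ℝ, ℝ), ℝ⟯
local notation "Γ" => Cₛ^∞⟮𝓡 n; F, E⟯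

/-- A local frame of a subbundle `S` near `x` with inner products `⟨eᵢ, eⱼ⟩ = εᵢ δᵢⱼ`,
`εᵢ = ±1`. -/
structure IsOrthoFrame (C : CourantAlgebroid n F E) (S : ∀ x, Submodule ℝ (E x)) (x : M) {k : ℕ}
    (ε : Fin k → ℝ) (e : Fin k → Γ) : Prop where
  sq : ∀ i, ε i * ε i = 1
  mem : ∀ᶠ y in 𝓝 x, ∀ i, e i y ∈ S y
  ortho : ∀ᶠ y in 𝓝 x, ∀ i j, C.metric y (e i y) (e j y) = if i = j then ε i else 0
  expand : ∀ᶠ y in 𝓝 x, ∀ v ∈ S y, v = ∑ i, (ε i * C.metric y (e i y) v) • e i y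

namespace IsOrthoFrame

variable {C : CourantAlgebroid n F E} {S : ∀ x, Submodule ℝ (E x)} {x : M} {k : ℕ}
  {ε : Fin k → ℝ}

theorem eventually {e : Fin k → Γ} (h : IsOrthoFrame C S x ε e) : ∀ᶠ y in 𝓝 x, IsOrthoFrame C S y ε e := by
  filter_upwards [h.mem.eventually_nhds, h.ortho.eventually_nhds,
    h.expand.eventually_nhds] with y h0 h1 h2
  exact ⟨h.sq, h0, h1, h2⟩

theorem linearIndependent {e : Fin k → Γ} (h : IsOrthoFrame C S x ε e) : LinearIndependent ℝ fun i => e i x := by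
  refine Fintype.linearIndependent_iff.2 fun c hc i => ?_
  have h1 := congrArg (fun v => ε i * C.metric x (e i x) v) hc
  simp only [map_sum, map_smul, h.ortho.self_of_nhds, smul_eq_mul, mul_ite, mul_zero,
    Finset.sum_ite_eq, Finset.mem_univ, if_true, map_zero] at h1
  have h2 := h.sq i
  linear_combination h1 - c i * h2

theorem span_eq {e : Fin k → Γ} (h : IsOrthoFrame C S x ε e) :
    Submodule.span ℝ (Set.range fun i => e i x) = S x := by
  refine le_antisymm (Submodule.span_le.2 ?_) fun v hv => ?_
  · rintro _ ⟨i, rfl⟩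
    exact h.mem.self_of_nhds i
  · rw [h.expand.self_of_nhds v hv]
    exact Submodule.sum_mem _ fun i _ => Submodule.smul_mem _ _ (Submodule.subset_span ⟨i, rfl⟩)

/-- Orthogonal vectors of square `±1` are linearly independent, so the rank count forces them to
span, and the coefficients of the expansion are read off by pairing. -/
theorem of_finrank {e : Fin k → Γ} (hε : ∀ i, ε i * ε i = 1)
    (hmem : ∀ᶠ y in 𝓝 x, ∀ i, e i y ∈ S y)
    (hortho : ∀ᶠ y in 𝓝 x, ∀ i j, C.metric y (e i y) (e j y) = if i = j then ε i else 0)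
    (hrank : ∀ᶠ y in 𝓝 x, Module.finrank ℝ (S y) = k) : IsOrthoFrame C S x ε e := by
  refine ⟨hε, hmem, hortho, ?_⟩
  · filter_upwards [hmem, hortho, hrank] with y h0 h1 h2 v hv
    have := finiteDimensional_fiber F E y
    have hli : LinearIndependent ℝ fun i => (⟨e i y, h0 i⟩ : S y) := by
      refine Fintype.linearIndependent_iff.2 fun c hc i => ?_
      have h3 := congrArg (fun v : S y => ε i * C.metric y (e i y) v) hc
      simp only [Submodule.coe_sum, Submodule.coe_smul, map_sum, map_smul, h1, smul_eq_mul, mul_ite,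
        mul_zero, Finset.sum_ite_eq, Finset.mem_univ, if_true, Submodule.coe_zero, map_zero] at h3
      linear_combination h3 - c i * hε i
    have hsp := hli.span_eq_top_of_card_eq_finrank' (by rw [h2, Fintype.card_fin])
    have hv' : (⟨v, hv⟩ : S y) ∈ Submodule.span ℝ (Set.range fun i => (⟨e i y, h0 i⟩ : S y)) := by
      rw [hsp]; trivial
    obtain ⟨c, hc⟩ := (Submodule.mem_span_range_iff_exists_fun ℝ).1 hv'
    have hc' : ∑ i, c i • e i y = v := by
      have := congrArg Subtype.val hc
      simpa [Submodule.coe_sum] using this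
    rw [← hc']
    refine Finset.sum_congr rfl fun i _ => ?_
    congr 1
    simp only [map_sum, map_smul, h1, smul_eq_mul, mul_ite, mul_zero, Finset.sum_ite_eq,
      Finset.mem_univ, if_true]
    linear_combination -c i * hε i

end IsOrthoFrame

/-- An orthogonal basis with `⟨bᵢ, bᵢ⟩ = ±1` of a non-degenerate subspace. -/
theorem exists_ortho_basis {T : Type*} [AddCommGroup T] [Module ℝ T] (B : LinearMap.BilinForm ℝ T)
    (hB : ∀ u v, B u v = B v u) (S : Submodule ℝ T) [FiniteDimensional ℝ S]
    (hnd : ∀ u ∈ S, (∀ v ∈ S, B u v = 0) → u = 0) :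
    ∃ (ε : Fin (Module.finrank ℝ S) → ℝ) (b : Module.Basis (Fin (Module.finrank ℝ S)) ℝ S),
      (∀ i, ε i * ε i = 1) ∧ ∀ i j, B (b i) (b j) = if i = j then ε i else 0 := by
  have hs : LinearMap.IsSymm (B.restrict S) := ⟨fun u v => hB u v⟩
  obtain ⟨v, hv⟩ := LinearMap.BilinForm.exists_orthogonal_basis (B := B.restrict S) hs
  have hsep : (B.restrict S).SeparatingLeft := fun u hu =>
    Subtype.ext (hnd u u.2 fun w hw => hu ⟨w, hw⟩)
  have hne : ∀ i, B (v i) (v i) ≠ 0 := fun i =>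
    hv.not_isOrtho_basis_self_of_separatingLeft hsep i
  have hr : ∀ i, Real.sqrt |B (v i) (v i)| ≠ 0 := fun i =>
    (Real.sqrt_pos.2 (abs_pos.2 (hne i))).ne'
  have hr2 : ∀ i, Real.sqrt |B (v i) (v i)| * Real.sqrt |B (v i) (v i)| = |B (v i) (v i)| :=
    fun i => Real.mul_self_sqrt (abs_nonneg _)
  refine ⟨fun i => B (v i) (v i) / |B (v i) (v i)|,
    v.unitsSMul fun i => (Units.mk0 _ (hr i))⁻¹, fun i => ?_, fun i j => ?_⟩
  · rw [div_mul_div_comm, abs_mul_abs_self, div_self (mul_ne_zero (hne i) (hne i))]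
  · simp only [Module.Basis.unitsSMul_apply, Units.smul_def, Units.val_inv_eq_inv_val, Units.val_mk0,
      Submodule.coe_smul, map_smul, LinearMap.smul_apply, smul_eq_mul]
    split_ifs with h
    · subst h
      have h2 := hr2 i
      have h3 := hr i
      generalize Real.sqrt |B (v i) (v i)| = r at h2 h3
      rw [← h2]
      field_simp
    · have : B (v i) (v j) = 0 := hv h
      rw [this, mul_zero, mul_zero]

/-- The normalization of a family of sections with values in a subbundle, whose Gram matrix at
`x₀` is diagonal with entries `±1`. -/
theorem exists_orthoFrame_of_gram (C : CourantAlgebroid n F E) {S : ∀ x, Submodule ℝ (E x)} {x₀ : M}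
    {k : ℕ} {ε : Fin k → ℝ} (hε : ∀ i, ε i * ε i = 1) (s : Fin k → Γ) (hs : ∀ i y, s i y ∈ S y)
    (hgram : ∀ i j, C.metric x₀ (s i x₀) (s j x₀) = if i = j then ε i else 0)
    (hrank : ∀ᶠ y in 𝓝 x₀, Module.finrank ℝ (S y) = k) :
    ∃ e : Fin k → Γ, IsOrthoFrame C S x₀ ε e ∧ (∀ i y, e i y ∈ S y) ∧ ∀ i, e i x₀ = s i x₀ := by
  obtain ⟨Φ, hΦ1, hΦ, hΦG⟩ := exists_gram_normalization ε hε
  set G : M → Fin k → Fin k → ℝ := fun y i j => C.metric y (s i y) (s j y) with hG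
  have hG0 : G x₀ = Matrix.diagonal ε := by
    funext i j; rw [hG, Matrix.diagonal_apply]; exact hgram i j
  have hGs : ContMDiff (𝓡 n) 𝓘(ℝ, Fin k → Fin k → ℝ) ∞ G :=
    contMDiff_pi_space.2 fun i => contMDiff_pi_space.2 fun j => C.metric_smooth (s i) (s j)
  have ht : Filter.Tendsto G (𝓝 x₀) (𝓝 (Matrix.diagonal ε : Fin k → Fin k → ℝ)) :=
    hG0 ▸ hGs.continuous.continuousAt.tendsto
  -- The entries of `Φ(G)` are controlled only near `x₀`. Global functions with the same germs
  -- replace them, so the new frame consists of global sections with values in `S` everywhere.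
  have hA : ∀ i j, ∃ a : 𝒜, ∀ᶠ y in 𝓝 x₀, a y = Φ (G y) i j := fun i j =>
    exists_fn_eventuallyEq (by
      filter_upwards [ht.eventually hΦ] with y hy
      have h1 : ContMDiffAt (𝓡 n) 𝓘(ℝ, Fin k → Fin k → ℝ) ∞ (fun y => Φ (G y)) y :=
        hy.contMDiffAt.comp y (hGs y)
      exact contMDiffAt_pi_space.1 (contMDiffAt_pi_space.1 h1 i) j)
  choose a ha using hA
  set e : Fin k → Γ := fun i => ∑ j, a i j • s j with he
  have hev : ∀ᶠ y in 𝓝 x₀, ∀ i j, a i j y = Φ (G y) i j :=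
    Filter.eventually_all.2 fun i => Filter.eventually_all.2 fun j => ha i j
  have hey : ∀ i y, e i y = ∑ j, a i j y • s j y := fun i y => by simp [he]
  have hmem : ∀ i y, e i y ∈ S y := fun i y => by
    rw [hey]
    exact Submodule.sum_mem _ fun j _ => Submodule.smul_mem _ _ (hs j y)
  have hortho : ∀ᶠ y in 𝓝 x₀, ∀ i j, C.metric y (e i y) (e j y) = if i = j then ε i else 0 := by
    filter_upwards [hev, ht.eventually hΦG] with y h1 h2 i j
    rw [← h2 (fun i j => C.metric_symm y _ _) i j, hey, hey]
    simp only [map_sum, LinearMap.sum_apply, map_smul, LinearMap.smul_apply, smul_eq_mul, h1]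
    simp only [Finset.mul_sum]
    rw [Finset.sum_comm]
    exact Finset.sum_congr rfl fun p _ => Finset.sum_congr rfl fun q _ => by simp only [hG]; ring
  refine ⟨e, .of_finrank hε (.of_forall fun y i => hmem i y) hortho hrank, hmem, fun i => ?_⟩
  · rw [hey]
    have h1 : ∀ j, a i j x₀ = if i = j then 1 else 0 := fun j => by
      rw [hev.self_of_nhds, hG0, hΦ1, Matrix.one_apply]
    simp [h1]

namespace GenPseudometric

variable {C : CourantAlgebroid n F E} (V : GenPseudometric C)

theorem projAt_mem (x : M) (u : E x) : V.projAt x u ∈ V.plus x :=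
  Submodule.projection_apply_mem _ _

theorem projAt_of_mem {x : M} {u : E x} (hu : u ∈ V.plus x) : V.projAt x u = u :=
  Submodule.projection_apply_of_mem_left (V.isCompl x) hu

theorem sub_projAt_mem (x : M) (u : E x) : u - V.projAt x u ∈ V.minus x := by
  have h : V.projAt x (u - V.projAt x u) = 0 := by
    rw [map_sub, V.projAt_of_mem (V.projAt_mem x u), sub_self]
  exact (Submodule.projection_apply_eq_zero_iff (V.isCompl x)).1 h

theorem projAt_of_mem_minus {x : M} {u : E x} (hu : u ∈ V.minus x) : V.projAt x u = 0 :=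
  (Submodule.projection_apply_eq_zero_iff (V.isCompl x)).2 hu

theorem metric_plus_minus {x : M} {u v : E x} (hu : u ∈ V.plus x) (hv : v ∈ V.minus x) :
    C.metric x u v = 0 := hv u hu

theorem metric_minus_plus {x : M} {u v : E x} (hu : u ∈ V.minus x) (hv : v ∈ V.plus x) :
    C.metric x u v = 0 := by rw [C.metric_symm]; exact hu v hv

theorem metric_projAt_left (x : M) (u v : E x) :
    C.metric x (V.projAt x u) v = C.metric x (V.projAt x u) (V.projAt x v) := by
  have h := V.metric_plus_minus (V.projAt_mem x u) (V.sub_projAt_mem x v)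
  rw [map_sub, sub_eq_zero] at h
  exact h

theorem metric_projAt_comm (x : M) (u v : E x) :
    C.metric x (V.projAt x u) v = C.metric x u (V.projAt x v) := by
  rw [metric_projAt_left, C.metric_symm x u, V.metric_projAt_left x v u, C.metric_symm]

theorem minus_nondegenerate (x : M) (u : E x) (hu : u ∈ V.minus x)
    (h : ∀ v ∈ V.minus x, C.metric x u v = 0) : u = 0 := by
  refine C.metric_nondegenerate x u fun v => ?_
  have h1 : v = V.projAt x v + (v - V.projAt x v) := by abel
  rw [h1, map_add, h _ (V.sub_projAt_mem x v), V.metric_minus_plus hu (V.projAt_mem x v), add_zero]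

theorem projPlus_apply (u : Γ) (x : M) : V.projPlus u x = V.projAt x (u x) := rfl

theorem projMinus_apply (u : Γ) (x : M) : V.projMinus u x = u x - V.projAt x (u x) := rfl

theorem isPlus_projPlus (u : Γ) : V.IsPlus (V.projPlus u) := fun x => V.projAt_mem x _

theorem isMinus_projMinus (u : Γ) : V.IsMinus (V.projMinus u) := fun x => V.sub_projAt_mem x _

theorem finrank_plus_eventually (x₀ : M) :
    ∀ᶠ x in 𝓝 x₀, Module.finrank ℝ (V.plus x) = Module.finrank ℝ (V.plus x₀) := by
  obtain ⟨k, s, hs⟩ := V.exists_frame x₀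
  have h1 : ∀ᶠ x in 𝓝 x₀, Module.finrank ℝ (V.plus x) = k := hs.mono fun x hx => by
    rw [← hx.2, finrank_span_eq_card hx.1, Fintype.card_fin]
  filter_upwards [h1] with x hx
  rw [hx, h1.self_of_nhds]

theorem finrank_minus_eventually (x₀ : M) :
    ∀ᶠ x in 𝓝 x₀, Module.finrank ℝ (V.minus x) = Module.finrank ℝ (V.minus x₀) := by
  have h1 : ∀ x, Module.finrank ℝ (V.plus x) + Module.finrank ℝ (V.minus x)
      = Module.finrank ℝ F := fun x => by
    have := finiteDimensional_fiber F E x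
    rw [Submodule.finrank_add_eq_of_isCompl (V.isCompl x)]
    exact (((trivializationAt F E x).continuousLinearEquivAt ℝ x
      (FiberBundle.mem_baseSet_trivializationAt F E x)).toLinearEquiv).finrank_eq
  filter_upwards [V.finrank_plus_eventually x₀] with x hx
  have h2 := h1 x
  have h3 := h1 x₀
  omega

theorem exists_orthoFrame_plus (x₀ : M) : ∃ (k : ℕ) (ε : Fin k → ℝ) (e : Fin k → Γ),
    IsOrthoFrame C V.plus x₀ ε e ∧ ∀ i, V.IsPlus (e i) := by
  have := finiteDimensional_fiber F E x₀
  obtain ⟨ε, b, hε, hb⟩ := exists_ortho_basis (C.metric x₀) (C.metric_symm x₀) (V.plus x₀)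
    (V.nondegenerate x₀)
  choose s hs using fun i => exists_section_apply (n := n) (F := F) (E := E) x₀ (b i : E x₀)
  obtain ⟨e, he, he', -⟩ := exists_orthoFrame_of_gram C (S := V.plus) hε (fun i => V.projPlus (s i))
    (fun i => V.isPlus_projPlus _) (fun i j => by
      rw [projPlus_apply, projPlus_apply, hs, hs, V.projAt_of_mem (b i).2, V.projAt_of_mem (b j).2,
        hb]) (V.finrank_plus_eventually x₀)
  exact ⟨_, ε, e, he, he'⟩

theorem exists_orthoFrame_minus (x₀ : M) : ∃ (k : ℕ) (ε : Fin k → ℝ) (e : Fin k → Γ),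
    IsOrthoFrame C V.minus x₀ ε e ∧ ∀ i, V.IsMinus (e i) := by
  have := finiteDimensional_fiber F E x₀
  obtain ⟨ε, b, hε, hb⟩ := exists_ortho_basis (C.metric x₀) (C.metric_symm x₀) (V.minus x₀)
    (V.minus_nondegenerate x₀)
  choose s hs using fun i => exists_section_apply (n := n) (F := F) (E := E) x₀ (b i : E x₀)
  obtain ⟨e, he, he', -⟩ := exists_orthoFrame_of_gram C (S := V.minus) hε (fun i => V.projMinus (s i))
    (fun i => V.isMinus_projMinus _) (fun i j => by
      rw [projMinus_apply, projMinus_apply, hs, hs, V.projAt_of_mem_minus (b i).2,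
        V.projAt_of_mem_minus (b j).2, sub_zero, sub_zero, hb]) (V.finrank_minus_eventually x₀)
  exact ⟨_, ε, e, he, he'⟩

theorem nonempty_adaptedFrame (x₀ : M) : Nonempty (V.AdaptedFrame x₀) := by
  obtain ⟨p, ε, e, he, -⟩ := V.exists_orthoFrame_plus x₀
  obtain ⟨q, δ, f, hf, -⟩ := V.exists_orthoFrame_minus x₀
  have h1 : ∀ᶠ x in 𝓝 x₀, LinearIndependent ℝ (fun a => e a x) ∧
      Submodule.span ℝ (Set.range fun a => e a x) = V.plus x := by
    filter_upwards [he.eventually] with x hx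
    exact ⟨hx.linearIndependent, hx.span_eq⟩
  have h2 : ∀ᶠ x in 𝓝 x₀, LinearIndependent ℝ (fun a => f a x) ∧
      Submodule.span ℝ (Set.range fun a => f a x) = V.minus x := by
    filter_upwards [hf.eventually] with x hx
    exact ⟨hx.linearIndependent, hx.span_eq⟩
  exact ⟨⟨p, q, e, f, Matrix.diagonal ε, Matrix.diagonal δ, h1, h2,
    he.ortho.mono fun x hx a b => by rw [hx, Matrix.diagonal_apply],
    hf.ortho.mono fun x hx a b => by rw [hx, Matrix.diagonal_apply]⟩⟩

end GenPseudometric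
end Courant
end GenRicci

/-! ### The algebra behind frame independence -/

namespace GenRicci
section Symmetrization

/-- A triple sum vanishes if the symmetrization of the summand does. -/
theorem sum_eq_zero_of_symmetrization {ι : Type*} [Fintype ι] (f : ι → ι → ι → ℝ)
    (h : ∀ a b c, f a b c + f b c a + f c a b + f b a c + f a c b + f c b a = 0) :
    ∑ a, ∑ b, ∑ c, f a b c = 0 := by
  have h1 : ∑ a, ∑ b, ∑ c, f b c a = ∑ a, ∑ b, ∑ c, f a b c := by
    rw [Finset.sum_comm]
    exact Finset.sum_congr rfl fun b _ => Finset.sum_comm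
  have h2 : ∑ a, ∑ b, ∑ c, f c a b = ∑ a, ∑ b, ∑ c, f a b c := by
    rw [← h1]
    rw [Finset.sum_comm]
    exact Finset.sum_congr rfl fun b _ => Finset.sum_comm
  have h3 : ∑ a, ∑ b, ∑ c, f b a c = ∑ a, ∑ b, ∑ c, f a b c := Finset.sum_comm
  have h4 : ∑ a, ∑ b, ∑ c, f a c b = ∑ a, ∑ b, ∑ c, f a b c :=
    Finset.sum_congr rfl fun a _ => Finset.sum_comm
  have h5 : ∑ a, ∑ b, ∑ c, f c b a = ∑ a, ∑ b, ∑ c, f a b c := by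
    rw [← h2, Finset.sum_comm]
  have h6 : ∑ a, ∑ b, ∑ c, (f a b c + f b c a + f c a b + f b a c + f a c b + f c b a) = 0 := by
    simp only [h, Finset.sum_const_zero]
  simp only [Finset.sum_add_distrib, h1, h2, h3, h4, h5] at h6
  linarith

variable {ι : Type*} [Fintype ι] {ε d : ι → ℝ} {w : ι → ι → ι → ℝ}

/-- Exchange of the names `a` and `b` together with antisymmetry in the last two indices. This
removes the terms that are linear in the derivatives of the rotation and contain divergences or
derivatives of a function. -/
theorem sum_divergence_cancel (hw : ∀ c a b, w c a b = -w c b a) :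
    ∑ a, ∑ b, ε a * ε b * d b * w a a b = -∑ a, ∑ b, ε a * ε b * d a * w b a b := by
  rw [Finset.sum_comm, ← Finset.sum_neg_distrib]
  refine Finset.sum_congr rfl fun a _ => ?_
  rw [← Finset.sum_neg_distrib]
  refine Finset.sum_congr rfl fun b _ => ?_
  rw [hw b b a]; ring

/-- The change of the zeroth order part of the Laplacian under a rotation of the frame. -/
theorem scal_change {E : ι → ℝ} {t : ι → ι → ι → ℝ} {S L X Y : ι → ι → ℝ}
    (hε : ∀ a, ε a * ε a = 1) (hw : ∀ c a b, w c a b = -w c b a)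
    (ht : ∀ c a b, t c a b = -t c b a) (ht' : ∀ c a b, t c a b = -t b a c)
    (hS : ∀ a b, ε b * S a b + ε a * (S b a - L b a)
      + ∑ c, ε c * (w a a c * w b b c + w b a c * w a b c) = 0)
    (hY : ∀ a b, Y a b = X a b + 2 * ∑ c, ε c * ((w a b c - w b a c) * t c a b) + 2 * ε b * L a b
      + ∑ c, ε c * (w a b c - w b a c) ^ 2 + 2 * ∑ c, ε c * ((w a b c - w b a c) * w c a b)) :
    ∑ a, ε a * (2 * (E a + ∑ b, (ε b * d b * w a a b + S a b)) + (d a + ∑ b, ε b * w b a b) ^ 2)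
      - ∑ a, ∑ b, ε a * ε b * (1 / 2 * Y a b
        - 1 / 3 * ∑ c, ε c * (t c a b + (w a b c - w b a c) + w c a b) ^ 2)
    = ∑ a, ε a * (2 * E a + d a ^ 2)
      - ∑ a, ∑ b, ε a * ε b * (1 / 2 * X a b - 1 / 3 * ∑ c, ε c * t c a b ^ 2) := by
  -- In the application `d` and `E` are the divergences of the frame and their derivatives, and `t`
  -- are the structure constants. `w c a b` is the derivative along `e c` of the entry `O a b` of
  -- the rotation, multiplied by `ε b`; `S` collects second derivatives of `O` and `L` its
  -- derivatives along brackets. `X` and `Y` are the squares of the brackets before and after the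
  -- rotation.
  have hA := sum_divergence_cancel (ε := ε) (d := d) hw
  have hB : ∑ a, ε a * (∑ b, ε b * w b a b) ^ 2
      = ∑ a, ∑ b, ∑ c, ε a * ε b * ε c * (w a a c * w b b c) := by
    have h1 : ∀ c, ε c * (∑ b, ε b * w b c b) ^ 2
        = ∑ a, ∑ b, ε a * ε b * ε c * (w a a c * w b b c) := fun c => by
      rw [sq, Finset.sum_mul_sum, Finset.mul_sum]
      refine Finset.sum_congr rfl fun a _ => ?_
      rw [Finset.mul_sum]
      refine Finset.sum_congr rfl fun b _ => ?_
      rw [hw a c a, hw b c b]; ring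
    simp only [h1]
    rw [Finset.sum_comm]
    exact Finset.sum_congr rfl fun b _ => Finset.sum_comm
  -- The relation `hS`, weighted with `ε a * ε b` and summed, trades the second derivatives for `L`
  -- and for products of first derivatives.
  have hC : 2 * ∑ a, ∑ b, ε a * S a b = ∑ a, ∑ b, ε a * L a b
      - ∑ a, ∑ b, ∑ c, ε a * ε b * ε c * (w a a c * w b b c)
      - ∑ a, ∑ b, ∑ c, ε a * ε b * ε c * (w b a c * w a b c) := by
    have h1 : ∀ a b, ε a * S a b + ε b * S b a - ε b * L b a
        + ∑ c, (ε a * ε b * ε c * (w a a c * w b b c) + ε a * ε b * ε c * (w b a c * w a b c)) = 0 := by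
      intro a b
      have h2 : ∑ c, (ε a * ε b * ε c * (w a a c * w b b c)
          + ε a * ε b * ε c * (w b a c * w a b c))
          = ε a * ε b * ∑ c, ε c * (w a a c * w b b c + w b a c * w a b c) := by
        rw [Finset.mul_sum]
        exact Finset.sum_congr rfl fun c _ => by ring
      rw [h2]
      linear_combination ε a * ε b * hS a b - ε a * S a b * hε b - ε b * (S b a - L b a) * hε a
    have h2 : ∑ a, ∑ b, (ε a * S a b + ε b * S b a - ε b * L b a
        + ∑ c, (ε a * ε b * ε c * (w a a c * w b b c)
          + ε a * ε b * ε c * (w b a c * w a b c))) = 0 := by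
      simp only [h1, Finset.sum_const_zero]
    simp only [Finset.sum_add_distrib, Finset.sum_sub_distrib] at h2
    have h3 : ∑ a, ∑ b, ε b * S b a = ∑ a, ∑ b, ε a * S a b := Finset.sum_comm
    have h4 : ∑ a, ∑ b, ε b * L b a = ∑ a, ∑ b, ε a * L a b := Finset.sum_comm
    rw [h3, h4] at h2
    linear_combination h2
  -- The remaining summand adds up to zero over the six permutations of its indices: `w` is
  -- antisymmetric in the last two indices and `t` is totally antisymmetric.
  have hD : ∑ a, ∑ b, ∑ c, ε a * ε b * ε c * (-(1 / 2) * (w a b c - w b a c) ^ 2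
      - (w a b c - w b a c) * t c a b - (w a b c - w b a c) * w c a b
      + 1 / 3 * ((t c a b + (w a b c - w b a c) + w c a b) ^ 2 - t c a b ^ 2)
      - w b a c * w a b c) = 0 := by
    refine sum_eq_zero_of_symmetrization _ fun a b c => ?_
    have e1 := hw a c b
    have e2 := hw b c a
    have e3 := hw c b a
    have t1 : t a b c = t c a b := by rw [ht' a b c, ht c b a, neg_neg]
    have t2 : t b c a = t c a b := by rw [ht' b c a, ht a c b, neg_neg, t1]
    have t3 : t c b a = -t c a b := ht c b a
    have t4 : t a c b = -t c a b := by rw [ht a c b, t1]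
    have t5 : t b a c = -t c a b := by rw [ht b a c, t2]
    rw [e1, e2, e3, t1, t2, t3, t4, t5]
    ring
  have hL : ∀ a b, ε a * ε b * (1 / 2 * Y a b
        - 1 / 3 * ∑ c, ε c * (t c a b + (w a b c - w b a c) + w c a b) ^ 2)
      = ε a * ε b * (1 / 2 * X a b - 1 / 3 * ∑ c, ε c * t c a b ^ 2) + ε a * L a b
        - ∑ c, ε a * ε b * ε c * (-(1 / 2) * (w a b c - w b a c) ^ 2
      - (w a b c - w b a c) * t c a b - (w a b c - w b a c) * w c a b
      + 1 / 3 * ((t c a b + (w a b c - w b a c) + w c a b) ^ 2 - t c a b ^ 2)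
      - w b a c * w a b c) - ∑ c, ε a * ε b * ε c * (w b a c * w a b c) := by
    intro a b
    rw [hY]
    have h1 : ∑ c, ε a * ε b * ε c * (-(1 / 2) * (w a b c - w b a c) ^ 2
      - (w a b c - w b a c) * t c a b - (w a b c - w b a c) * w c a b
      + 1 / 3 * ((t c a b + (w a b c - w b a c) + w c a b) ^ 2 - t c a b ^ 2)
      - w b a c * w a b c) = ε a * ε b * (-(1 / 2) * ∑ c, ε c * (w a b c - w b a c) ^ 2
        - ∑ c, ε c * ((w a b c - w b a c) * t c a b) - ∑ c, ε c * ((w a b c - w b a c) * w c a b)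
        + 1 / 3 * ∑ c, ε c * (t c a b + (w a b c - w b a c) + w c a b) ^ 2
        - 1 / 3 * ∑ c, ε c * t c a b ^ 2) - ∑ c, ε a * ε b * ε c * (w b a c * w a b c) := by
      simp only [Finset.mul_sum, ← Finset.sum_sub_distrib, ← Finset.sum_add_distrib]
      exact Finset.sum_congr rfl fun c _ => by ring
    rw [h1]
    linear_combination ε a * L a b * hε b
  have hM : ∀ a, ε a * (2 * (E a + ∑ b, (ε b * d b * w a a b + S a b))
        + (d a + ∑ b, ε b * w b a b) ^ 2)
      = ε a * (2 * E a + d a ^ 2) + 2 * ∑ b, ε a * ε b * d b * w a a b + 2 * ∑ b, ε a * S a b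
        + 2 * ∑ b, ε a * ε b * d a * w b a b + ε a * (∑ b, ε b * w b a b) ^ 2 := by
    intro a
    have h1 : ∑ b, ε a * ε b * d b * w a a b = ε a * ∑ b, ε b * d b * w a a b := by
      rw [Finset.mul_sum]; exact Finset.sum_congr rfl fun b _ => by ring
    have h2 : ∑ b, ε a * ε b * d a * w b a b = ε a * d a * ∑ b, ε b * w b a b := by
      rw [Finset.mul_sum]; exact Finset.sum_congr rfl fun b _ => by ring
    rw [h1, h2, ← Finset.mul_sum, Finset.sum_add_distrib]
    ring
  rw [Finset.sum_congr rfl fun a _ => hM a]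
  simp only [hL, Finset.sum_add_distrib, Finset.sum_sub_distrib, ← Finset.mul_sum]
  rw [hD, hB]
  simp only [← Finset.mul_sum] at hC hA
  linear_combination 2 * hA + hC

end Symmetrization
end GenRicci

/-! ### Frame independence of the coefficients of the Laplacian -/

namespace GenRicci
section Courant

variable {n : ℕ} {M : Type*} [TopologicalSpace M] [ChartedSpace (EuclideanSpace ℝ (Fin n)) M]
  [IsManifold (𝓡 n) ∞ M] [T2Space M] [SigmaCompactSpace M]
  {F : Type*} [NormedAddCommGroup F] [NormedSpace ℝ F] [FiniteDimensional ℝ F]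
  {E : M → Type*} [TopologicalSpace (Bundle.TotalSpace F E)]
  [∀ x, TopologicalSpace (E x)] [∀ x, AddCommGroup (E x)] [∀ x, Module ℝ (E x)]
  [FiberBundle F E] [VectorBundle ℝ F E] [ContMDiffVectorBundle ∞ F E (𝓡 n)]

local notation "𝒜" => C^∞⟮𝓡 n, M; 𝓘(ℝ, ℝ), ℝ⟯
local notation "Γ" => Cₛ^∞⟮𝓡 n; F, E⟯

namespace CourantAlgebroid

variable (C : CourantAlgebroid n F E)

theorem der_const (u : Γ) (c : ℝ) : C.der u (algebraMap ℝ 𝒜 c) = 0 :=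
  Derivation.map_algebraMap _ c

theorem der_eq_zero_of_eventually_const (u : Γ) {f : 𝒜} {c : ℝ} {x : M}
    (h : ∀ᶠ y in 𝓝 x, f y = c) : C.der u f x = 0 := by
  rw [C.der_congr u (g := algebraMap ℝ 𝒜 c) h, der_const]; rfl

theorem der_sum (u : Γ) {ι : Type*} (s : Finset ι) (f : ι → 𝒜) :
    C.der u (∑ i ∈ s, f i) = ∑ i ∈ s, C.der u (f i) := map_sum _ _ _

theorem der_const_smul (u : Γ) (c : ℝ) (f : 𝒜) : C.der u (c • f) = c • C.der u f :=
  (C.der u).map_smul c f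

theorem bracket_sum_sum_apply {ι κ : Type*} [Fintype ι] [Fintype κ] (f : ι → 𝒜) (u : ι → Γ)
    (g : κ → 𝒜) (v : κ → Γ) :
    C.bracket (∑ i, f i • u i) (∑ j, g j • v j) = ∑ i, ∑ j,
      ((f i * g j) • C.bracket (u i) (v j) + (f i * C.der (u i) (g j)) • v j
        - (g j * C.der (v j) (f i)) • u i + (g j * C.ip (u i) (v j)) • C.grad (f i)) := by
  simp only [map_sum, LinearMap.sum_apply]
  rw [Finset.sum_comm]
  refine Finset.sum_congr rfl fun i _ => Finset.sum_congr rfl fun j _ => ?_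
  rw [smul_bracket, bracket_smul, der_smul_left, map_smul, smul_eq_mul]
  module

/-- Bracket invariance of the inner product, at a point near which `⟨v, w⟩` is constant. -/
theorem ip_bracket_of_const {u v w : Γ} {c : ℝ} {x : M}
    (h : ∀ᶠ y in 𝓝 x, C.metric y (v y) (w y) = c) :
    C.metric x (w x) (C.bracket u v x) = -C.metric x (v x) (C.bracket u w x) := by
  have h1 := congrArg (fun f : 𝒜 => f x) (C.der_ip u v w)
  simp only [C.der_eq_zero_of_eventually_const u (f := C.ip v w) h, fn_add_apply, ip_apply] at h1
  rw [C.metric_symm x (w x)]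
  linarith

theorem bracket_antisymm_of_const {u v : Γ} {c : ℝ} {x : M}
    (h : ∀ᶠ y in 𝓝 x, C.metric y (u y) (v y) = c) : C.bracket u v x = -C.bracket v u x := by
  rw [bracket_swap, section_sub_apply, C.grad_congr (g := algebraMap ℝ 𝒜 c) h]
  have : C.grad (algebraMap ℝ 𝒜 c) = 0 := C.ext_ip fun w => by
    rw [ip_grad, der_const, map_zero]
  rw [this, section_zero_apply, zero_sub]

end CourantAlgebroid

namespace GenPseudometric

variable {C : CourantAlgebroid n F E} (V : GenPseudometric C)

theorem metric_projAt_eq_sum {x : M} {k : ℕ} {ε : Fin k → ℝ} {e : Fin k → Γ}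
    (he : IsOrthoFrame C V.plus x ε e) (u v : E x) :
    C.metric x (V.projAt x u) v = ∑ i, ε i * (C.metric x (e i x) u * C.metric x (e i x) v) := by
  have h := he.expand.self_of_nhds _ (V.projAt_mem x u)
  rw [h]
  simp only [map_sum, map_smul, LinearMap.sum_apply, LinearMap.smul_apply, smul_eq_mul]
  refine Finset.sum_congr rfl fun i _ => ?_
  rw [← V.metric_projAt_comm, V.projAt_of_mem (he.mem.self_of_nhds i), mul_assoc]

variable {μ : Density n M 1} (hμ : IsVolume μ)

/-- The zeroth order term of the Laplacian, in terms of an orthonormal frame. -/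
def scal {k : ℕ} (ε : Fin k → ℝ) (e : Fin k → Γ) : 𝒜 :=
  ∑ a, ε a • ((2 : ℝ) • C.der (e a) (C.dv hμ (e a)) + C.dv hμ (e a) ^ 2)
    - ∑ a, ∑ b, (ε a * ε b) • ((1 / 2 : ℝ) • C.ip (C.bracket (e a) (e b)) (C.bracket (e a) (e b))
      - (1 / 3 : ℝ) • C.ip (V.projPlus (C.bracket (e a) (e b))) (C.bracket (e a) (e b)))

variable (C) in
/-- The leading part of the Laplacian, in terms of an orthonormal frame. -/
def principal {k : ℕ} (ε : Fin k → ℝ) (e : Fin k → Γ) (f : 𝒜) : 𝒜 :=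
  ∑ a, ε a • (C.der (e a) (C.der (e a) f) + C.dv hμ (e a) * C.der (e a) f)

theorem scal_apply {k : ℕ} (ε : Fin k → ℝ) (e : Fin k → Γ) (x : M) :
    V.scal hμ ε e x = ∑ a, ε a * (2 * C.der (e a) (C.dv hμ (e a)) x + C.dv hμ (e a) x ^ 2)
      - ∑ a, ∑ b, ε a * ε b * (1 / 2 * C.metric x (C.bracket (e a) (e b) x) (C.bracket (e a) (e b) x)
      - 1 / 3 * C.metric x (V.projAt x (C.bracket (e a) (e b) x)) (C.bracket (e a) (e b) x)) := by
  simp only [scal, fn_sub_apply, fn_sum_apply, fn_smul_apply, fn_add_apply, fn_pow_apply,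
    CourantAlgebroid.ip_apply, projPlus_apply]

theorem principal_apply {k : ℕ} (ε : Fin k → ℝ) (e : Fin k → Γ) (f : 𝒜) (x : M) :
    principal C hμ ε e f x = ∑ a, ε a * (C.der (e a) (C.der (e a) f) x
      + C.dv hμ (e a) x * C.der (e a) f x) := by
  simp only [principal, fn_sum_apply, fn_smul_apply, fn_add_apply, fn_mul_apply]

/-- `O a b = ε_b ⟨e'_a, e_b⟩` is the transition matrix. It preserves the constant form `diag ε` near
`x`, and this makes its derivatives at `x` antisymmetric. -/
theorem frame_rotation {x : M} {k : ℕ} {ε : Fin k → ℝ} {e e' : Fin k → Γ}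
    (he : IsOrthoFrame C V.plus x ε e) (he' : IsOrthoFrame C V.plus x ε e')
    (hx : ∀ i, e' i x = e i x) :
    ∃ O : Fin k → Fin k → 𝒜, (∀ a b, O a b x = if a = b then 1 else 0) ∧
      (∀ᶠ y in 𝓝 x, ∀ a, e' a y = (∑ b, O a b • e b) y) ∧
      ∀ a b, ∀ᶠ y in 𝓝 x, (∑ c, ε c • (O a c * O b c)) y = if a = b then ε a else 0 := by
  have hO : ∀ a b y, (ε b • C.ip (e' a) (e b)) y = ε b * C.metric y (e' a y) (e b y) :=
    fun a b y => rfl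
  have hexp : ∀ᶠ y in 𝓝 x, ∀ a, e' a y = (∑ b, (ε b • C.ip (e' a) (e b)) • e b) y := by
    filter_upwards [he.expand, he'.mem] with y h1 h2 a
    rw [section_sum_apply]
    refine (h1 _ (h2 a)).trans (Finset.sum_congr rfl fun b _ => ?_)
    rw [section_smul_apply, hO, C.metric_symm]
  refine ⟨fun a b => ε b • C.ip (e' a) (e b), fun a b => ?_, hexp, fun a b => ?_⟩
  · rw [hO, hx, he.ortho.self_of_nhds]
    split_ifs with h
    · rw [h, he.sq]
    · rw [mul_zero]
  · filter_upwards [hexp, he'.ortho, he.ortho] with y h1 h2 h3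
    rw [← h2 a b]
    conv_rhs => rw [h1 b]
    simp only [section_sum_apply, section_smul_apply, fn_sum_apply, fn_smul_apply, fn_mul_apply, hO,
      map_sum, map_smul, smul_eq_mul]
    exact Finset.sum_congr rfl fun c _ => by
      linear_combination ε c * C.metric y (e' a y) (e c y) * C.metric y (e' b y) (e c y) * he.sq c

variable {V} in
/-- The first derivatives of a rotation are antisymmetric. -/
theorem rotation_antisymm {x : M} {k : ℕ} {ε : Fin k → ℝ} {O : Fin k → Fin k → 𝒜}
    (hO : ∀ a b, O a b x = if a = b then 1 else 0)
    (hrel : ∀ a b, ∀ᶠ y in 𝓝 x, (∑ c, ε c • (O a c * O b c)) y = if a = b then ε a else 0)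
    (u : Γ) (a b : Fin k) : ε b * C.der u (O a b) x = -(ε a * C.der u (O b a) x) := by
  have h := C.der_eq_zero_of_eventually_const u (hrel a b)
  simp only [C.der_sum, C.der_const_smul, C.der_mul, fn_sum_apply, fn_smul_apply, fn_add_apply,
    fn_mul_apply, hO, mul_add, Finset.sum_add_distrib, ite_mul, one_mul, zero_mul, mul_ite, mul_zero,
    Finset.sum_ite_eq, Finset.mem_univ, if_true] at h
  linarith

/-- Second derivative of the pseudo-orthogonality relation, whose right-hand side is constant near
`x`; with `O` the identity at `x`, the sums against `O` collapse. -/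
theorem rotation_second {x : M} {k : ℕ} {ε : Fin k → ℝ} {O : Fin k → Fin k → 𝒜}
    (hO : ∀ a b, O a b x = if a = b then 1 else 0)
    (hrel : ∀ a b, ∀ᶠ y in 𝓝 x, (∑ c, ε c • (O a c * O b c)) y = if a = b then ε a else 0)
    (u v : Γ) (a b : Fin k) :
    ε b * C.der u (C.der v (O a b)) x + ε a * C.der u (C.der v (O b a)) x
      + ∑ c, ε c * (C.der u (O a c) x * C.der v (O b c) x
        + C.der v (O a c) x * C.der u (O b c) x) = 0 := by
  have h : C.der u (C.der v (∑ c, ε c • (O a c * O b c))) x = 0 := by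
    refine C.der_eq_zero_of_eventually_const u (c := 0) ?_
    filter_upwards [(hrel a b).eventually_nhds] with y hy
    exact C.der_eq_zero_of_eventually_const v hy
  simp only [C.der_sum, C.der_const_smul, C.der_mul, map_add, fn_sum_apply, fn_smul_apply,
    fn_add_apply, fn_mul_apply, hO, mul_add, Finset.sum_add_distrib, ite_mul, one_mul, zero_mul,
    mul_ite, mul_zero, Finset.sum_ite_eq, Finset.mem_univ, if_true] at h
  simp only [mul_add, Finset.sum_add_distrib]
  have h1 : ∑ c, ε c * (C.der v (O b c) x * C.der u (O a c) x)
      = ∑ c, ε c * (C.der u (O a c) x * C.der v (O b c) x) :=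
    Finset.sum_congr rfl fun c _ => by ring
  linarith

theorem dv_rotation {x : M} {k : ℕ} {e e' : Fin k → Γ} {O : Fin k → Fin k → 𝒜}
    (hexp : ∀ᶠ y in 𝓝 x, ∀ a, e' a y = (∑ b, O a b • e b) y) (a : Fin k) :
    ∀ᶠ y in 𝓝 x, C.dv hμ (e' a) y
      = (∑ b, (O a b * C.dv hμ (e b) + C.der (e b) (O a b))) y := by
  filter_upwards [C.dv_congr_eventually hμ (u := e' a) (hexp.mono fun y hy => hy a)] with y hy
  rw [hy, C.dv_sum]
  simp only [C.dv_smul]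

/-- Independence of the zeroth order term of the frame, for frames with the same value at `x`. -/
theorem scal_eq_of_apply_eq {x : M} {k : ℕ} {ε : Fin k → ℝ} {e e' : Fin k → Γ}
    (he : IsOrthoFrame C V.plus x ε e) (he' : IsOrthoFrame C V.plus x ε e')
    (hx : ∀ i, e' i x = e i x) : V.scal hμ ε e' x = V.scal hμ ε e x := by
  obtain ⟨O, hO, hexp, hrel⟩ := V.frame_rotation he he' hx
  have hε := he.sq
  have hexp' : ∀ a, ∀ᶠ y in 𝓝 x, e' a y = (∑ b, O a b • e b) y := fun a =>
    hexp.mono fun y hy => hy a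
  set s : Fin k → Fin k → Fin k → ℝ := fun c a b => C.der (e c) (O a b) x with hs
  set w : Fin k → Fin k → Fin k → ℝ := fun c a b => ε b * s c a b with hw
  have hsw : ∀ c a b, s c a b = ε b * w c a b := fun c a b => by
    simp only [hw]; linear_combination -s c a b * hε b
  have hanti : ∀ c a b, w c a b = -w c b a := fun c a b => rotation_antisymm hO hrel (e c) a b
  set S : Fin k → Fin k → ℝ := fun a b => C.der (e a) (C.der (e b) (O a b)) x with hS
  set L : Fin k → Fin k → ℝ := fun a b => C.der (C.bracket (e a) (e b)) (O a b) x with hL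
  set d : Fin k → ℝ := fun a => C.dv hμ (e a) x with hd
  set G : Fin k → ℝ := fun a => C.der (e a) (C.dv hμ (e a)) x with hG
  set t : Fin k → Fin k → Fin k → ℝ := fun c a b =>
    C.metric x (e c x) (C.bracket (e a) (e b) x) with ht
  set X : Fin k → Fin k → ℝ := fun a b =>
    C.metric x (C.bracket (e a) (e b) x) (C.bracket (e a) (e b) x) with hX
  have hconst : ∀ a b, ∀ᶠ y in 𝓝 x, C.metric y (e a y) (e b y) = if a = b then ε a else 0 :=
    fun a b => he.ortho.mono fun y hy => hy a b
  have hbr : ∀ a b, C.bracket (e a) (e b) x = -C.bracket (e b) (e a) x := fun a b =>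
    C.bracket_antisymm_of_const (hconst a b)
  have ht1 : ∀ c a b, t c a b = -t c b a := fun c a b => by
    simp only [ht]; rw [hbr a b, map_neg]
  have ht2 : ∀ c a b, t c a b = -t b a c := fun c a b => C.ip_bracket_of_const (hconst b c)
  have hdv : ∀ a, C.dv hμ (e' a) x = d a + ∑ b, ε b * w b a b := fun a => by
    rw [(dv_rotation hμ hexp a).self_of_nhds]
    simp only [fn_sum_apply, fn_add_apply, fn_mul_apply, hO, ite_mul, one_mul, zero_mul,
      Finset.sum_add_distrib, Finset.sum_ite_eq, Finset.mem_univ, if_true, ← hsw]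
    rfl
  have hder : ∀ a, C.der (e' a) (C.dv hμ (e' a)) x
      = G a + ∑ b, (ε b * d b * w a a b + S a b) := fun a => by
    rw [C.der_apply_congr _ (hx a), C.der_congr _ (dv_rotation hμ hexp a)]
    simp only [C.der_sum, map_add, C.der_mul, fn_sum_apply, fn_add_apply, fn_mul_apply, hO, ite_mul,
      one_mul, zero_mul, Finset.sum_add_distrib, Finset.sum_ite_eq, Finset.mem_univ, if_true]
    have h1 : ∑ b, C.dv hμ (e b) x * C.der (e a) (O a b) x = ∑ b, ε b * d b * w a a b :=
      Finset.sum_congr rfl fun b _ => by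
        have := hsw a a b
        simp only [hs] at this
        rw [this]; ring
    rw [h1]
    ring
  have hSrel : ∀ a b, ε b * S a b + ε a * (S b a - L b a)
      + ∑ c, ε c * (w a a c * w b b c + w b a c * w a b c) = 0 := fun a b => by
    have h1 := rotation_second (C := C) hO hrel (e a) (e b) a b
    -- `S b a` has its two derivatives in the opposite order; as the anchor is a homomorphism of
    -- brackets, the correction is the derivative `L b a` along the bracket.
    have h2 := congrArg (fun f : 𝒜 => f x) (C.der_bracket (e b) (e a) (O b a))
    simp only [fn_sub_apply] at h2
    have h3 : S b a - L b a = C.der (e a) (C.der (e b) (O b a)) x := by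
      simp only [hS, hL, h2]; ring
    rw [h3, ← h1]
    congr 1
    refine Finset.sum_congr rfl fun c _ => ?_
    have hh : ∀ i j, C.der (e i) (O j c) x = ε c * w i j c := fun i j => hsw i j c
    rw [hh, hh, hh, hh]
    linear_combination -ε c * (w a a c * w b b c + w b a c * w a b c) * hε c
  set v : Fin k → Fin k → E x := fun a b => ∑ c, (s a b c - s b a c) • e c x with hv
  set θ : Fin k → Fin k → E x := fun a b => ε b • C.grad (O a b) x with hθ
  -- At `x` the bracket changes by the vector `v` in `V₊`, whose coefficients are first derivatives
  -- of `O`, and by the gradient `θ` that the Leibniz rule in the first argument produces.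
  have hY : ∀ a b, C.bracket (e' a) (e' b) x = C.bracket (e a) (e b) x + v a b + θ a b := by
    intro a b
    rw [C.bracket_congr (hexp' a) (hexp' b), C.bracket_sum_sum_apply]
    simp only [section_sum_apply, section_add_apply, section_sub_apply, section_smul_apply,
      fn_mul_apply, hO, ite_mul, one_mul, zero_mul, mul_ite, mul_one, mul_zero, ite_smul, zero_smul,
      Finset.sum_add_distrib, Finset.sum_sub_distrib, Finset.sum_ite_eq, Finset.mem_univ, if_true,
      CourantAlgebroid.ip_apply, he.ortho.self_of_nhds]
    simp only [hv, hθ, hs, sub_smul, Finset.sum_sub_distrib]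
    rw [Finset.sum_comm]
    simp only [Finset.sum_ite_eq, Finset.mem_univ, if_true, one_smul]
    abel
  have hgrad : ∀ (u : Γ) a b, C.metric x (u x) (θ a b) = ε b * C.der u (O a b) x := fun u a b => by
    rw [← C.ip_grad, C.ip_apply]
    simp only [hθ, map_smul, smul_eq_mul]
  have hvZ : ∀ a b Z, C.metric x (v a b) Z
      = ∑ c, ε c * ((w a b c - w b a c) * C.metric x (e c x) Z) := fun a b Z => by
    simp only [hv, map_sum, map_smul, LinearMap.sum_apply, LinearMap.smul_apply, smul_eq_mul, hsw]
    exact Finset.sum_congr rfl fun c _ => by ring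
  have hve : ∀ a b c, C.metric x (e c x) (v a b) = w a b c - w b a c := fun a b c => by
    rw [C.metric_symm, hvZ]
    simp only [he.ortho.self_of_nhds, mul_ite, mul_zero, Finset.sum_ite_eq', Finset.mem_univ,
      if_true]
    linear_combination (w a b c - w b a c) * hε c
  have hYe : ∀ a b c, C.metric x (e c x) (C.bracket (e' a) (e' b) x)
      = t c a b + (w a b c - w b a c) + w c a b := by
    intro a b c
    rw [hY, map_add, map_add, hve, hgrad]
  have hYY : ∀ a b, C.metric x (C.bracket (e' a) (e' b) x) (C.bracket (e' a) (e' b) x)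
      = X a b + 2 * ∑ c, ε c * ((w a b c - w b a c) * t c a b) + 2 * ε b * L a b
      + ∑ c, ε c * (w a b c - w b a c) ^ 2 + 2 * ∑ c, ε c * ((w a b c - w b a c) * w c a b) := by
    intro a b
    -- Gradients are isotropic, so the square of `θ` drops out.
    have hθθ : C.metric x (θ a b) (θ a b) = 0 := by
      have h1 := congrArg (fun f : 𝒜 => f x) (C.ip_grad_grad (O a b) (O a b))
      simp only [C.ip_apply, fn_zero_apply] at h1
      simp only [hθ, map_smul, LinearMap.smul_apply, h1, smul_zero]
    have hvv : C.metric x (v a b) (v a b) = ∑ c, ε c * (w a b c - w b a c) ^ 2 := by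
      rw [hvZ]
      exact Finset.sum_congr rfl fun c _ => by rw [hve]; ring
    have hXv := hvZ a b (C.bracket (e a) (e b) x)
    have hvθ : C.metric x (v a b) (θ a b) = ∑ c, ε c * ((w a b c - w b a c) * w c a b) := by
      rw [hvZ]
      exact Finset.sum_congr rfl fun c _ => by rw [hgrad]
    have hXθ := hgrad (C.bracket (e a) (e b)) a b
    rw [hY]
    simp only [map_add, LinearMap.add_apply]
    rw [C.metric_symm x (C.bracket (e a) (e b) x) (v a b), C.metric_symm x (θ a b) (v a b),
      C.metric_symm x (θ a b) (C.bracket (e a) (e b) x), hθθ, hvv, hXv, hvθ, hXθ]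
    simp only [hX, hL, ht]
    ring
  rw [scal_apply, scal_apply]
  simp only [V.metric_projAt_eq_sum he, ← sq, hYe, hder, hdv]
  exact scal_change hε hanti ht1 ht2 hSrel hYY

/-- Independence of the leading part of the frame, for frames with the same value at `x`. -/
theorem principal_eq_of_apply_eq {x : M} {k : ℕ} {ε : Fin k → ℝ} {e e' : Fin k → Γ}
    (he : IsOrthoFrame C V.plus x ε e) (he' : IsOrthoFrame C V.plus x ε e')
    (hx : ∀ i, e' i x = e i x) (f : 𝒜) :
    principal C hμ ε e' f x = principal C hμ ε e f x := by
  obtain ⟨O, hO, hexp, hrel⟩ := V.frame_rotation he he' hx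
  have hε := he.sq
  have hexp' : ∀ a, ∀ᶠ y in 𝓝 x, e' a y = (∑ b, O a b • e b) y := fun a =>
    hexp.mono fun y hy => hy a
  set w : Fin k → Fin k → Fin k → ℝ := fun c a b => ε b * C.der (e c) (O a b) x with hw
  have hsw : ∀ c a b, C.der (e c) (O a b) x = ε b * w c a b := fun c a b => by
    simp only [hw]; linear_combination -C.der (e c) (O a b) x * hε b
  have hanti : ∀ c a b, w c a b = -w c b a := fun c a b => rotation_antisymm hO hrel (e c) a b
  have hdv : ∀ a, C.dv hμ (e' a) x = C.dv hμ (e a) x + ∑ b, ε b * w b a b := fun a => by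
    rw [(dv_rotation hμ hexp a).self_of_nhds]
    simp only [fn_sum_apply, fn_add_apply, fn_mul_apply, hO, ite_mul, one_mul, zero_mul,
      Finset.sum_add_distrib, Finset.sum_ite_eq, Finset.mem_univ, if_true, ← hsw]
  have hder : ∀ a, C.der (e' a) (C.der (e' a) f) x
      = C.der (e a) (C.der (e a) f) x + ∑ b, ε b * C.der (e b) f x * w a a b := fun a => by
    rw [C.der_apply_congr _ (hx a), C.der_congr _ (C.der_congr_eventually (hexp' a)
      (.of_forall fun _ => rfl)), C.der_sum_left]
    simp only [C.der_sum, C.der_smul_left, C.der_mul, fn_sum_apply, fn_add_apply, fn_mul_apply, hO,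
      ite_mul, one_mul, zero_mul, Finset.sum_add_distrib, Finset.sum_ite_eq, Finset.mem_univ,
      if_true, hsw]
    congr 1
    exact Finset.sum_congr rfl fun b _ => by ring
  have hA := sum_divergence_cancel (ε := ε) (d := fun b => C.der (e b) f x) hanti
  rw [principal_apply, principal_apply]
  have h1 : ∀ a, ε a * (C.der (e' a) (C.der (e' a) f) x + C.dv hμ (e' a) x * C.der (e' a) f x)
      = ε a * (C.der (e a) (C.der (e a) f) x + C.dv hμ (e a) x * C.der (e a) f x)
        + ∑ b, ε a * ε b * C.der (e b) f x * w a a b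
        + ∑ b, ε a * ε b * C.der (e a) f x * w b a b := fun a => by
    rw [hder, hdv, C.der_apply_congr f (hx a)]
    have h2 : ∑ b, ε a * ε b * C.der (e b) f x * w a a b
        = ε a * ∑ b, ε b * C.der (e b) f x * w a a b := by
      rw [Finset.mul_sum]; exact Finset.sum_congr rfl fun b _ => by ring
    have h3 : ∑ b, ε a * ε b * C.der (e a) f x * w b a b
        = ε a * C.der (e a) f x * ∑ b, ε b * w b a b := by
      rw [Finset.mul_sum]; exact Finset.sum_congr rfl fun b _ => by ring
    rw [h2, h3]; ring
  simp only [h1, Finset.sum_add_distrib]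
  rw [hA]; ring

end GenPseudometric
end Courant
end GenRicci

/-! ### The Laplacian in a pseudo-orthonormal frame -/

namespace GenRicci
section Courant

variable {n : ℕ} {M : Type*} [TopologicalSpace M] [ChartedSpace (EuclideanSpace ℝ (Fin n)) M]
  [IsManifold (𝓡 n) ∞ M] [T2Space M] [SigmaCompactSpace M]
  {F : Type*} [NormedAddCommGroup F] [NormedSpace ℝ F] [FiniteDimensional ℝ F]
  {E : M → Type*} [TopologicalSpace (Bundle.TotalSpace F E)]
  [∀ x, TopologicalSpace (E x)] [∀ x, AddCommGroup (E x)] [∀ x, Module ℝ (E x)]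
  [FiberBundle F E] [VectorBundle ℝ F E] [ContMDiffVectorBundle ∞ F E (𝓡 n)]

local notation "𝒜" => C^∞⟮𝓡 n, M; 𝓘(ℝ, ℝ), ℝ⟯
local notation "Γ" => Cₛ^∞⟮𝓡 n; F, E⟯

/-- The value of a section at a point, as a linear map. -/
def evalSec (x : M) : Γ →ₗ[ℝ] E x where
  toFun u := u x
  map_add' _ _ := rfl
  map_smul' _ _ := rfl

/-- Expansion of a vector in a basis of a non-degenerate subspace, by means of the dual basis. -/
theorem eq_sum_dual_basis {T : Type*} [AddCommGroup T] [Module ℝ T] (B : LinearMap.BilinForm ℝ T)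
    (hB : ∀ u v, B u v = B v u) {S : Submodule ℝ T} (hnd : ∀ u ∈ S, (∀ v ∈ S, B u v = 0) → u = 0)
    {k : ℕ} {b : Fin k → T} (hli : LinearIndependent ℝ b) (hsp : Submodule.span ℝ (Set.range b) = S)
    {g : Matrix (Fin k) (Fin k) ℝ} (hg : ∀ i j, B (b i) (b j) = g i j) {v : T} (hv : v ∈ S) :
    v = ∑ i, B v (b i) • ∑ j, g⁻¹ i j • b j := by
  have hsum : ∀ c : Fin k → ℝ, ∑ i, c i • b i ∈ S := fun c => hsp ▸
    Submodule.sum_mem _ fun i _ => Submodule.smul_mem _ _ (Submodule.subset_span ⟨i, rfl⟩)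
  have hz : ∀ u ∈ S, (∀ i, B u (b i) = 0) → u = 0 := fun u hu h => hnd u hu fun w hw => by
    rw [← hsp] at hw
    obtain ⟨c, rfl⟩ := (Submodule.mem_span_range_iff_exists_fun ℝ).1 hw
    simp only [map_sum, map_smul, h, smul_zero, Finset.sum_const_zero]
  have hdet : g.det ≠ 0 := fun h => by
    obtain ⟨c, hc, hc'⟩ := Matrix.exists_mulVec_eq_zero_iff.2 h
    refine hc (funext (Fintype.linearIndependent_iff.1 hli c (hz _ (hsum c) fun i => ?_)))
    have h1 := congrFun hc' i
    simp only [Matrix.mulVec, dotProduct, Pi.zero_apply] at h1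
    simp only [map_sum, map_smul, LinearMap.sum_apply, LinearMap.smul_apply, smul_eq_mul]
    rw [← h1]
    exact Finset.sum_congr rfl fun j _ => by rw [hB, hg, mul_comm]
  have h1 : g⁻¹ * g = 1 := Matrix.nonsing_inv_mul _ (isUnit_iff_ne_zero.2 hdet)
  refine sub_eq_zero.1 (hz _ (S.sub_mem hv ?_) fun l => ?_)
  · exact S.sum_mem fun i _ => S.smul_mem _ (hsum _)
  · have h2 : ∀ i, ∑ j, g⁻¹ i j * g j l = if i = l then 1 else 0 := fun i => by
      rw [← Matrix.mul_apply, h1, Matrix.one_apply]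
    simp only [map_sub, LinearMap.sub_apply, map_sum, map_smul, LinearMap.sum_apply,
      LinearMap.smul_apply, smul_eq_mul, hg, h2, mul_ite, mul_one, mul_zero, Finset.sum_ite_eq',
      Finset.mem_univ, if_true, sub_self]

namespace CourantAlgebroid

variable (C : CourantAlgebroid n F E)

theorem der_const_smul_left (u : Γ) (c : ℝ) (f : 𝒜) : C.der (c • u) f = c • C.der u f := by
  have h : c • u = algebraMap ℝ 𝒜 c • u := by ext x; rfl
  rw [h, der_smul_left, Algebra.smul_def]

theorem dv_const_smul {μ : Density n M 1} (hμ : IsVolume μ) (u : Γ) (c : ℝ) :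
    C.dv hμ (c • u) = c • C.dv hμ u := by
  have h : c • u = algebraMap ℝ 𝒜 c • u := by ext x; rfl
  rw [h, dv_smul, Algebra.smul_def, der_const, add_zero]

end CourantAlgebroid

namespace GenPseudometric

variable {C : CourantAlgebroid n F E} (V : GenPseudometric C)

section FrameChange

variable {V} {x : M} (A : V.AdaptedFrame x)

theorem AdaptedFrame.eUp_apply (a : Fin A.p) (y : M) :
    A.eUp a y = ∑ b, A.g⁻¹ a b • A.e b y := by
  simp [AdaptedFrame.eUp]

theorem AdaptedFrame.fUp_apply (a : Fin A.q) (y : M) :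
    A.fUp a y = ∑ b, A.h⁻¹ a b • A.f b y := by
  simp [AdaptedFrame.fUp]

/-- Contraction over dual bases of `V₊` is the inner product of the projections; it turns sums of
squares of structure constants into norms of projected brackets. -/
theorem AdaptedFrame.sum_e_eUp (u v : E x) :
    ∑ a, C.metric x (A.e a x) u * C.metric x (A.eUp a x) v = C.metric x (V.projAt x u) v := by
  have h := A.frame_e.self_of_nhds
  conv_rhs => rw [eq_sum_dual_basis (C.metric x) (C.metric_symm x) (V.nondegenerate x) h.1 h.2
    A.gram_e.self_of_nhds (V.projAt_mem x u)]
  simp only [map_sum, map_smul, LinearMap.sum_apply, LinearMap.smul_apply, smul_eq_mul]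
  refine Finset.sum_congr rfl fun a _ => ?_
  have ha : A.e a x ∈ V.plus x := h.2 ▸ Submodule.subset_span ⟨a, rfl⟩
  rw [V.metric_projAt_comm, V.projAt_of_mem ha, C.metric_symm, A.eUp_apply]
  simp only [map_sum, map_smul, LinearMap.sum_apply, LinearMap.smul_apply, smul_eq_mul]

theorem AdaptedFrame.sum_f_fUp (u v : E x) :
    ∑ a, C.metric x (A.f a x) u * C.metric x (A.fUp a x) v
      = C.metric x u v - C.metric x (V.projAt x u) v := by
  have h := A.frame_f.self_of_nhds
  rw [← LinearMap.sub_apply, ← map_sub]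
  conv_rhs => rw [eq_sum_dual_basis (C.metric x) (C.metric_symm x) (V.minus_nondegenerate x) h.1 h.2
    A.gram_f.self_of_nhds (V.sub_projAt_mem x u)]
  simp only [map_sum, map_smul, LinearMap.sum_apply, LinearMap.smul_apply, smul_eq_mul]
  refine Finset.sum_congr rfl fun a _ => ?_
  have ha : A.f a x ∈ V.minus x := h.2 ▸ Submodule.subset_span ⟨a, rfl⟩
  rw [map_sub, LinearMap.sub_apply, V.metric_plus_minus (V.projAt_mem x u) ha, sub_zero,
    C.metric_symm, A.fUp_apply]
  simp only [map_sum, map_smul, LinearMap.sum_apply, LinearMap.smul_apply, smul_eq_mul]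

/-- An adapted frame can be made orthonormal by a constant matrix. -/
theorem AdaptedFrame.exists_constant_change {k : ℕ} {ε : Fin k → ℝ} {e : Fin k → Γ}
    (he : IsOrthoFrame C V.plus x ε e) :
    ∃ (K : Fin k → Fin A.p → ℝ), IsOrthoFrame C V.plus x ε (fun i => ∑ j, K i j • A.e j) ∧
      (∀ i, (∑ j, K i j • A.e j) x = e i x) ∧ ∀ a b, A.g⁻¹ a b = ∑ i, ε i * K i a * K i b := by
  have h := A.frame_e.self_of_nhds
  have hK : ∀ i, ∃ c : Fin A.p → ℝ, ∑ j, c j • A.e j x = e i x := fun i =>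
    (Submodule.mem_span_range_iff_exists_fun ℝ).1 (h.2 ▸ he.mem.self_of_nhds i)
  choose K hK using hK
  have hKx : ∀ i, (∑ j, K i j • A.e j) x = e i x := fun i => by simp [hK]
  have hval : ∀ y, (∀ a b, C.metric y (A.e a y) (A.e b y) = A.g a b) → ∀ i j,
      C.metric y ((∑ l, K i l • A.e l) y) ((∑ l, K j l • A.e l) y)
        = ∑ b, ∑ a, K j b * (K i a * A.g a b) := fun y hy i j => by
    simp only [section_sum_apply, section_const_smul_apply, map_sum, map_smul, LinearMap.sum_apply,
      LinearMap.smul_apply, smul_eq_mul, hy, Finset.mul_sum]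
  have hgK : ∀ i j, ∑ b, ∑ a, K j b * (K i a * A.g a b) = if i = j then ε i else 0 := fun i j => by
    rw [← hval x A.gram_e.self_of_nhds, hKx, hKx, he.ortho.self_of_nhds]
  refine ⟨K, .of_finrank he.sq ?_ ?_ ?_, hKx, ?_⟩
  · filter_upwards [A.frame_e] with y hy i
    rw [← hy.2, section_sum_apply]
    exact Submodule.sum_mem _ fun j _ => Submodule.smul_mem _ _ (Submodule.subset_span ⟨j, rfl⟩)
  · filter_upwards [A.gram_e] with y hy i j
    rw [hval y hy, hgK]
  · filter_upwards [he.eventually] with y hy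
    rw [← hy.span_eq, finrank_span_eq_card hy.linearIndependent, Fintype.card_fin]
  · have h1 : (Matrix.of fun a b => ∑ i, ε i * K i a * K i b) * A.g = 1 := by
      ext l j
      have h2 := he.expand.self_of_nhds (A.e j x) (h.2 ▸ Submodule.subset_span ⟨j, rfl⟩)
      have h3 : ∑ l, (∑ i, ε i * K i l * C.metric x (e i x) (A.e j x)) • A.e l x
          = ∑ l, (if j = l then (1 : ℝ) else 0) • A.e l x := by
        simp only [ite_smul, one_smul, zero_smul, Finset.sum_ite_eq, Finset.mem_univ, if_true]
        conv_rhs => rw [h2]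
        simp only [Finset.sum_smul]
        rw [Finset.sum_comm]
        refine Finset.sum_congr rfl fun i _ => ?_
        conv_rhs => rw [← hK i]
        rw [Finset.smul_sum]
        refine Finset.sum_congr rfl fun l _ => ?_
        rw [hK, smul_smul]
        congr 1
        ring
      have h4 := Fintype.linearIndependent_iff.1 h.1 (fun l =>
        (∑ i, ε i * K i l * C.metric x (e i x) (A.e j x)) - if j = l then (1 : ℝ) else 0) (by
          simp only [sub_smul, Finset.sum_sub_distrib]; rw [h3, sub_self]) l
      rw [Matrix.mul_apply, Matrix.one_apply]
      have h5 : ∀ i, C.metric x (e i x) (A.e j x) = ∑ b, K i b * A.g b j := fun i => by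
        rw [← hK i]
        simp only [map_sum, map_smul, LinearMap.sum_apply, LinearMap.smul_apply, smul_eq_mul,
          A.gram_e.self_of_nhds]
      simp only [h5, Finset.mul_sum] at h4
      rw [Finset.sum_comm, sub_eq_zero] at h4
      rw [if_congr eq_comm rfl rfl, ← h4]
      simp only [Matrix.of_apply, Finset.sum_mul, mul_assoc]
    have h5 := Matrix.inv_eq_left_inv h1
    intro a b
    rw [h5]; rfl

/-- The contraction of a bilinear form with the inverse Gram matrix does not change under
constant changes of the frame. -/
theorem AdaptedFrame.sum_eUp_eq {k : ℕ} {ε : Fin k → ℝ} {K : Fin k → Fin A.p → ℝ}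
    (hK : ∀ a b, A.g⁻¹ a b = ∑ i, ε i * K i a * K i b) (B : Γ →ₗ[ℝ] Γ →ₗ[ℝ] ℝ) :
    ∑ a, B (A.e a) (A.eUp a) = ∑ i, ε i * B (∑ j, K i j • A.e j) (∑ j, K i j • A.e j) := by
  simp only [AdaptedFrame.eUp, map_sum, map_smul, LinearMap.sum_apply, LinearMap.smul_apply,
    smul_eq_mul, hK, Finset.sum_mul, Finset.mul_sum]
  rw [Finset.sum_congr rfl fun a _ => Finset.sum_comm, Finset.sum_comm]
  refine Finset.sum_congr rfl fun i _ => ?_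
  rw [Finset.sum_comm]
  exact Finset.sum_congr rfl fun a _ => Finset.sum_congr rfl fun b _ => by ring

end FrameChange

section Laplacian

variable {σ : Density n M (1 / 2)} (hσ : IsSmoothDensity σ) (hσ₀ : NowhereVanishing σ)

theorem lieDeriv_anchorField_smul (u : Γ) (f : 𝒜) :
    lieDeriv (C.anchorField u) (fun x => f x • σ x) = fun x =>
      (C.der u f + (1 / 2 : ℝ) • (f * C.dv (isVolume_mulHalf hσ hσ₀) u)) x • σ x := by
  rw [lieDeriv_smul hσ hσ₀ f.contMDiff]
  funext x
  congr 1
  simp only [fn_add_apply, fn_smul_apply, fn_mul_apply, mul_assoc]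
  rfl

/-- The second Lie derivatives in the Laplacian. -/
def secondLie {μ : Density n M 1} (hμ : IsVolume μ) (f : 𝒜) (x : M) : Γ →ₗ[ℝ] Γ →ₗ[ℝ] ℝ :=
  LinearMap.mk₂ ℝ (fun u v => (C.der v (C.der u f + (1 / 2 : ℝ) • (f * C.dv hμ u))
      + (1 / 2 : ℝ) • ((C.der u f + (1 / 2 : ℝ) • (f * C.dv hμ u)) * C.dv hμ v)) x)
    (fun u u' v => by
      rw [C.der_add_left, C.dv_add, ← fn_add_apply]
      congr 1
      simp only [map_add, mul_add, add_mul, smul_add]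
      abel)
    (fun c u v => by
      rw [C.der_const_smul_left, C.dv_const_smul, smul_eq_mul, ← fn_smul_apply]
      congr 1
      rw [mul_smul_comm, smul_comm _ c, ← smul_add, C.der_const_smul, smul_mul_assoc,
        smul_comm _ c, ← smul_add])
    (fun u v v' => by
      rw [C.der_add_left, C.dv_add, ← fn_add_apply]
      congr 1
      simp only [mul_add, smul_add]
      abel)
    (fun c u v => by
      rw [C.der_const_smul_left, C.dv_const_smul, smul_eq_mul, ← fn_smul_apply]
      congr 1
      rw [mul_smul_comm, smul_comm _ c, ← smul_add])

theorem secondLie_apply {μ : Density n M 1} (hμ : IsVolume μ) (f : 𝒜) (x : M) (u v : Γ) :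
    secondLie (C := C) hμ f x u v = (C.der v (C.der u f + (1 / 2 : ℝ) • (f * C.dv hμ u))
      + (1 / 2 : ℝ) • ((C.der u f + (1 / 2 : ℝ) • (f * C.dv hμ u)) * C.dv hμ v)) x := rfl

theorem secondLie_self {μ : Density n M 1} (hμ : IsVolume μ) (f : 𝒜) (x : M) (u : Γ) :
    4 * secondLie (C := C) hμ f x u u
      = 4 * (C.der u (C.der u f) x + C.dv hμ u x * C.der u f x)
        + f x * (2 * C.der u (C.dv hμ u) x + C.dv hμ u x ^ 2) := by
  simp only [secondLie_apply, map_add, C.der_const_smul, C.der_mul, fn_add_apply, fn_smul_apply,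
    fn_mul_apply]
  ring

/-- The quadratic form `½ ⟨u, v⟩ - ⅓ ⟨u₊, v⟩`. -/
def quadForm (V : GenPseudometric C) (x : M) : E x →ₗ[ℝ] E x →ₗ[ℝ] ℝ :=
  (1 / 2 : ℝ) • C.metric x - (1 / 3 : ℝ) • (C.metric x ∘ₗ V.projAt x)

theorem quadForm_apply (x : M) (u v : E x) : V.quadForm x u v
    = 1 / 2 * C.metric x u v - 1 / 3 * C.metric x (V.projAt x u) v := rfl

variable {V}

/-- The structure constants of `V₊` contract to `|[e_b, e_c]₊|²`. In the mixed ones `⟨e_a, [e_b,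
f_c]⟩ = -⟨f_c, [e_b, e_a]⟩` moves the `V₋` index out of the bracket, so they contract to `|[e_b,
e_a]₋|²`. Then `1/6 |u₊|² + 1/2 |u₋|² = 1/2 |u|² - 1/3 |u₊|²`, and bilinearity over constants passes
to the orthonormal frame. -/
theorem AdaptedFrame.triple_sum {x : M} (A : V.AdaptedFrame x) {k : ℕ} {ε : Fin k → ℝ}
    {K : Fin k → Fin A.p → ℝ} (hK : ∀ a b, A.g⁻¹ a b = ∑ i, ε i * K i a * K i b) :
    (1 / 6 : ℝ) * ∑ a, ∑ b, ∑ c, C.triple (A.e a) (A.e b) (A.e c) x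
        * C.triple (A.eUp a) (A.eUp b) (A.eUp c) x
      + (1 / 2 : ℝ) * ∑ a, ∑ b, ∑ c, C.triple (A.e a) (A.e b) (A.f c) x
        * C.triple (A.eUp a) (A.eUp b) (A.fUp c) x
    = ∑ i, ∑ j, ε i * ε j * V.quadForm x
        (C.bracket (∑ l, K i l • A.e l) (∑ l, K j l • A.e l) x)
        (C.bracket (∑ l, K i l • A.e l) (∑ l, K j l • A.e l) x) := by
  have hef : ∀ a b, ∀ᶠ y in 𝓝 x, C.metric y (A.e a y) (A.f b y) = 0 := fun a b => by
    filter_upwards [A.frame_e, A.frame_f] with y h1 h2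
    exact V.metric_plus_minus (h1.2 ▸ Submodule.subset_span ⟨a, rfl⟩)
      (h2.2 ▸ Submodule.subset_span ⟨b, rfl⟩)
  have hefU : ∀ a b, ∀ᶠ y in 𝓝 x, C.metric y (A.eUp a y) (A.fUp b y) = 0 := fun a b => by
    filter_upwards [A.frame_e, A.frame_f] with y h1 h2
    rw [A.eUp_apply, A.fUp_apply]
    exact V.metric_plus_minus (h1.2 ▸ Submodule.sum_mem _ fun _ _ =>
      Submodule.smul_mem _ _ (Submodule.subset_span ⟨_, rfl⟩)) (h2.2 ▸ Submodule.sum_mem _ fun _ _ =>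
      Submodule.smul_mem _ _ (Submodule.subset_span ⟨_, rfl⟩))
  have h1 : ∑ a, ∑ b, ∑ c, C.triple (A.e a) (A.e b) (A.e c) x
        * C.triple (A.eUp a) (A.eUp b) (A.eUp c) x
      = ∑ b, ∑ c, C.metric x (V.projAt x (C.bracket (A.e b) (A.e c) x))
        (C.bracket (A.eUp b) (A.eUp c) x) := by
    rw [Finset.sum_comm]
    refine Finset.sum_congr rfl fun b _ => ?_
    rw [Finset.sum_comm]
    exact Finset.sum_congr rfl fun c _ => A.sum_e_eUp _ _
  have h2 : ∑ a, ∑ b, ∑ c, C.triple (A.e a) (A.e b) (A.f c) x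
        * C.triple (A.eUp a) (A.eUp b) (A.fUp c) x
      = ∑ b, ∑ a, (C.metric x (C.bracket (A.e b) (A.e a) x) (C.bracket (A.eUp b) (A.eUp a) x)
        - C.metric x (V.projAt x (C.bracket (A.e b) (A.e a) x))
        (C.bracket (A.eUp b) (A.eUp a) x)) := by
    rw [Finset.sum_comm]
    refine Finset.sum_congr rfl fun b _ => Finset.sum_congr rfl fun a _ => ?_
    rw [← A.sum_f_fUp]
    refine Finset.sum_congr rfl fun c _ => ?_
    rw [C.ip_bracket_of_const (hef a c), C.ip_bracket_of_const (hefU a c)]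
    simp only [CourantAlgebroid.triple]
    ring
  have h3 : (1 / 6 : ℝ) * ∑ a, ∑ b, ∑ c, C.triple (A.e a) (A.e b) (A.e c) x
        * C.triple (A.eUp a) (A.eUp b) (A.eUp c) x
      + (1 / 2 : ℝ) * ∑ a, ∑ b, ∑ c, C.triple (A.e a) (A.e b) (A.f c) x
        * C.triple (A.eUp a) (A.eUp b) (A.fUp c) x
      = ∑ b, ∑ c, V.quadForm x (C.bracket (A.e b) (A.e c) x) (C.bracket (A.eUp b) (A.eUp c) x) := by
    rw [h1, h2]
    simp only [Finset.mul_sum, ← Finset.sum_add_distrib, quadForm_apply]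
    exact Finset.sum_congr rfl fun b _ => Finset.sum_congr rfl fun c _ => by ring
  rw [h3]
  have h4 : ∀ u v : Γ, ∑ c, V.quadForm x (C.bracket u (A.e c) x) (C.bracket v (A.eUp c) x)
      = ∑ j, ε j * V.quadForm x (C.bracket u (∑ l, K j l • A.e l) x)
          (C.bracket v (∑ l, K j l • A.e l) x) := fun u v =>
    A.sum_eUp_eq hK ((V.quadForm x).compl₁₂ (evalSec x ∘ₗ C.bracket u) (evalSec x ∘ₗ C.bracket v))
  have h5 : ∀ w : Γ, ∑ b, V.quadForm x (C.bracket (A.e b) w x) (C.bracket (A.eUp b) w x)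
      = ∑ i, ε i * V.quadForm x (C.bracket (∑ l, K i l • A.e l) w x)
          (C.bracket (∑ l, K i l • A.e l) w x) := fun w =>
    A.sum_eUp_eq hK ((V.quadForm x).compl₁₂ (evalSec x ∘ₗ C.bracket.flip w)
      (evalSec x ∘ₗ C.bracket.flip w))
  simp only [h4]
  rw [Finset.sum_comm]
  simp only [← Finset.mul_sum, h5]
  rw [Finset.sum_comm]
  simp only [Finset.mul_sum]
  exact Finset.sum_congr rfl fun i _ => Finset.sum_congr rfl fun j _ => by ring

/-- The Laplacian in terms of an orthonormal frame. -/
theorem AdaptedFrame.laplacian_smul {x : M} (A : V.AdaptedFrame x) {k : ℕ} {ε : Fin k → ℝ}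
    {e : Fin k → Γ} (he : IsOrthoFrame C V.plus x ε e) (f : 𝒜) :
    A.laplacian (fun y => f y • σ y) x
      = (4 * principal C (isVolume_mulHalf hσ hσ₀) ε e f x
        + f x * V.scal (isVolume_mulHalf hσ hσ₀) ε e x) • σ x := by
  -- A constant matrix, under which the defining expression is invariant, makes the chosen frame
  -- orthonormal and equal to `e` at `x`; the rotation lemmas handle what remains.
  obtain ⟨K, he', hx, hK⟩ := A.exists_constant_change he
  set hμ := isVolume_mulHalf hσ hσ₀
  rw [← V.scal_eq_of_apply_eq hμ he he' hx, ← V.principal_eq_of_apply_eq hμ he he' hx,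
    AdaptedFrame.laplacian]
  have h1 : ∀ a, lieDeriv (C.anchorField (A.eUp a)) (lieDeriv (C.anchorField (A.e a))
      (fun y => f y • σ y)) x = secondLie (C := C) hμ f x (A.e a) (A.eUp a) • σ x := fun a => by
    rw [lieDeriv_anchorField_smul hσ hσ₀, lieDeriv_anchorField_smul hσ hσ₀]
    rfl
  simp only [h1]
  rw [← Finset.sum_smul, A.sum_eUp_eq hK, smul_smul, smul_smul, smul_smul, ← sub_smul, ← sub_smul]
  congr 1
  have h2 := A.triple_sum hK
  rw [scal_apply, principal_apply]
  simp only [quadForm_apply] at h2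
  have h3 : 4 * ∑ i, ε i * secondLie (C := C) hμ f x (∑ j, K i j • A.e j) (∑ j, K i j • A.e j)
      = 4 * ∑ i, ε i * (C.der (∑ j, K i j • A.e j) (C.der (∑ j, K i j • A.e j) f) x
          + C.dv hμ (∑ j, K i j • A.e j) x * C.der (∑ j, K i j • A.e j) f x)
        + f x * ∑ i, ε i * (2 * C.der (∑ j, K i j • A.e j) (C.dv hμ (∑ j, K i j • A.e j)) x
          + C.dv hμ (∑ j, K i j • A.e j) x ^ 2) := by
    simp only [Finset.mul_sum, ← Finset.sum_add_distrib]
    refine Finset.sum_congr rfl fun i _ => ?_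
    have := secondLie_self (C := C) hμ f x (∑ j, K i j • A.e j)
    linear_combination ε i * this
  rw [h3]
  linear_combination -f x * h2

theorem laplacian_smul {x : M} {k : ℕ} {ε : Fin k → ℝ}
    {e : Fin k → Γ} (he : IsOrthoFrame C V.plus x ε e) (f : 𝒜) :
    V.laplacian (fun y => f y • σ y) x
      = (4 * principal C (isVolume_mulHalf hσ hσ₀) ε e f x
        + f x * V.scal (isVolume_mulHalf hσ hσ₀) ε e x) • σ x := by
  rw [laplacian, dif_pos (V.nonempty_adaptedFrame x)]
  exact AdaptedFrame.laplacian_smul hσ hσ₀ _ he f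

/-- The zeroth order term of the Laplacian, `Δ σ = R σ`. -/
def potential (V : GenPseudometric C) (σ : Density n M (1 / 2)) (x : M) : ℝ :=
  ratio (V.laplacian σ) σ x

theorem laplacian_eq_potential {V : GenPseudometric C} {σ : Density n M (1 / 2)}
    (hσ₀ : NowhereVanishing σ) (x : M) : V.laplacian σ x = V.potential σ x • σ x :=
  ratio_smul _ hσ₀ x

/-- The case `f = 1` of `laplacian_smul`, in which the derivatives of `f` vanish. -/
theorem potential_eq {x : M} {k : ℕ} {ε : Fin k → ℝ}
    {e : Fin k → Γ} (he : IsOrthoFrame C V.plus x ε e) :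
    V.potential σ x = V.scal (isVolume_mulHalf hσ hσ₀) ε e x := by
  have h := laplacian_smul hσ hσ₀ he 1
  have h1 : (fun y => (1 : 𝒜) y • σ y) = σ := funext fun y => one_smul ℝ (σ y)
  have h2 : principal C (isVolume_mulHalf hσ hσ₀) ε e 1 x = 0 := by
    simp [principal_apply]
  rw [h1, h2, mul_zero, zero_add, fn_one_apply, one_mul, laplacian_eq_potential hσ₀] at h
  exact smul_right_cancel_density hσ₀ h

theorem potential_eventually {x : M} {k : ℕ} {ε : Fin k → ℝ}
    {e : Fin k → Γ} (he : IsOrthoFrame C V.plus x ε e) :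
    ∀ᶠ y in 𝓝 x, V.potential σ y = V.scal (isVolume_mulHalf hσ hσ₀) ε e y :=
  he.eventually.mono fun _ hy => potential_eq hσ hσ₀ hy

theorem smooth_potential {σ : Density n M (1 / 2)} (hσ : IsSmoothDensity σ)
    (hσ₀ : NowhereVanishing σ) (V : GenPseudometric C) : Smooth n (V.potential σ) := fun x => by
  obtain ⟨k, ε, e, he, -⟩ := V.exists_orthoFrame_plus x
  exact ((V.scal (isVolume_mulHalf hσ hσ₀) ε e).contMDiff x).congr_of_eventuallyEq
    (potential_eventually hσ hσ₀ he)

end Laplacian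

end GenPseudometric
end Courant
end GenRicci

/-! ### The generalized Ricci tensor and its tensoriality -/

namespace GenRicci
section Courant

variable {n : ℕ} {M : Type*} [TopologicalSpace M] [ChartedSpace (EuclideanSpace ℝ (Fin n)) M]
  [IsManifold (𝓡 n) ∞ M] [T2Space M] [SigmaCompactSpace M]
  {F : Type*} [NormedAddCommGroup F] [NormedSpace ℝ F] [FiniteDimensional ℝ F]
  {E : M → Type*} [TopologicalSpace (Bundle.TotalSpace F E)]
  [∀ x, TopologicalSpace (E x)] [∀ x, AddCommGroup (E x)] [∀ x, Module ℝ (E x)]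
  [FiberBundle F E] [VectorBundle ℝ F E] [ContMDiffVectorBundle ∞ F E (𝓡 n)]

local notation "𝒜" => C^∞⟮𝓡 n, M; 𝓘(ℝ, ℝ), ℝ⟯
local notation "Γ" => Cₛ^∞⟮𝓡 n; F, E⟯

namespace GenPseudometric

variable {C : CourantAlgebroid n F E} (V : GenPseudometric C)

theorem ip_plus_minus {u v : Γ} (hu : V.IsPlus u) (hv : V.IsMinus v) : C.ip u v = 0 := by
  ext x; exact V.metric_plus_minus (hu x) (hv x)

theorem ip_minus_plus {u v : Γ} (hu : V.IsMinus u) (hv : V.IsPlus v) : C.ip u v = 0 := by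
  ext x; exact V.metric_minus_plus (hu x) (hv x)

theorem bracket_eq_neg_of_ip {u v : Γ} (h : C.ip u v = 0) : C.bracket u v = -C.bracket v u := by
  have h0 : C.grad (0 : 𝒜) = 0 := C.ext_ip fun w => by rw [C.ip_grad, map_zero, map_zero]
  rw [C.bracket_swap, h, h0, zero_sub]

theorem ip_bracket_of_ip {u v w : Γ} (h : C.ip v w = 0) :
    C.ip w (C.bracket u v) = -C.ip v (C.bracket u w) := by
  have h1 := C.der_ip u v w
  rw [h, map_zero, C.ip_comm (C.bracket u v)] at h1
  exact eq_neg_of_add_eq_zero_left h1.symm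

/-- The projection to `V₊`, as a linear map of sections. -/
def projP : Γ →ₗ[𝒜] Γ where
  toFun := V.projPlus
  map_add' u v := by ext x; exact map_add (V.projAt x) (u x) (v x)
  map_smul' f u := by ext x; exact map_smul (V.projAt x) (f x) (u x)

theorem projP_apply (u : Γ) : V.projP u = V.projPlus u := rfl

theorem projPlus_of_isPlus {u : Γ} (hu : V.IsPlus u) : V.projPlus u = u := by
  ext x; exact V.projAt_of_mem (hu x)

theorem projPlus_of_isMinus {u : Γ} (hu : V.IsMinus u) : V.projPlus u = 0 := by
  ext x; exact V.projAt_of_mem_minus (hu x)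

theorem ip_projPlus_left {u v : Γ} (hv : V.IsPlus v) : C.ip v (V.projPlus u) = C.ip v u := by
  ext x
  simp only [CourantAlgebroid.ip_apply, projPlus_apply]
  rw [← V.metric_projAt_comm, V.projAt_of_mem (hv x)]

theorem ip_projMinus_left {u v : Γ} (hv : V.IsMinus v) : C.ip v (V.projMinus u) = C.ip v u := by
  rw [projMinus, map_sub, V.ip_minus_plus hv (V.isPlus_projPlus u), sub_zero]

theorem ip_projMinus_comm (u v : Γ) : C.ip (V.projMinus u) v = C.ip u (V.projMinus v) := by
  rw [← V.ip_projMinus_left (V.isMinus_projMinus u), C.ip_comm, C.ip_comm u,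
    ← V.ip_projMinus_left (u := u) (V.isMinus_projMinus v)]

/-- The transpose of the map whose trace enters the generalized Ricci tensor. -/
theorem ip_trace_map {a b u v : Γ} (ha : V.IsPlus a) (hb : V.IsMinus b) (hu : V.IsPlus u)
    (hv : V.IsPlus v) :
    C.ip v (V.projPlus (C.bracket (V.projMinus (C.bracket u b)) a))
      = C.ip u (C.bracket b (V.projMinus (C.bracket a v))) := by
  have hp := V.isMinus_projMinus (C.bracket u b)
  have hw := V.isMinus_projMinus (C.bracket a v)
  rw [V.ip_projPlus_left hv, bracket_eq_neg_of_ip (V.ip_minus_plus hp ha), map_neg,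
    ip_bracket_of_ip (V.ip_minus_plus hp hv), neg_neg, V.ip_projMinus_comm,
    bracket_eq_neg_of_ip (V.ip_plus_minus hu hb), map_neg, LinearMap.neg_apply, C.ip_comm,
    ip_bracket_of_ip (V.ip_plus_minus hu hw), neg_neg]

/-- The generalized Ricci tensor, in terms of an orthonormal frame of `V₊`. -/
def ricFn {μ : Density n M 1} (hμ : IsVolume μ) {k : ℕ} (ε : Fin k → ℝ) (e : Fin k → Γ)
    (a b : Γ) : 𝒜 :=
  C.dv hμ (V.projPlus (C.bracket b a)) - C.der b (C.dv hμ a)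
    - ∑ c, ε c • C.ip (V.projMinus (C.bracket (e c) b)) (C.bracket a (e c))

variable {V} in
-- By `ip_trace_map` the endomorphism is the sum of the rank-one maps `u ↦ ε_c ⟨z_c, u⟩ e_c`, so
-- that its trace is `Σ ε_c ⟨z_c, e_c⟩`.
theorem tracePlus_eq {x : M} {k : ℕ} {ε : Fin k → ℝ} {e : Fin k → Γ}
    (he : IsOrthoFrame C V.plus x ε e) (hep : ∀ i, V.IsPlus (e i)) {a b : Γ} (ha : V.IsPlus a)
    (hb : V.IsMinus b) :
    V.tracePlus (fun u => V.projPlus (C.bracket (V.projMinus (C.bracket u b)) a)) x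
      = ∑ c, ε c * C.metric x (V.projMinus (C.bracket (e c) b) x) (C.bracket a (e c) x) := by
  have := finiteDimensional_fiber F E x
  set z : Fin k → E x := fun c => C.bracket b (V.projMinus (C.bracket a (e c))) x with hz
  let T : Module.End ℝ (V.plus x) :=
    ∑ c, ε c • ((C.metric x (z c)) ∘ₗ (V.plus x).subtype).smulRight (⟨e c x, hep c x⟩ : V.plus x)
  have hT : ∀ (u : Γ) (hu : V.IsPlus u),
      (T ⟨u x, hu x⟩ : E x) = V.projPlus (C.bracket (V.projMinus (C.bracket u b)) a) x := by
    intro u hu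
    have h1 := he.expand.self_of_nhds _
      (V.isPlus_projPlus (C.bracket (V.projMinus (C.bracket u b)) a) x)
    rw [h1]
    simp only [T, LinearMap.sum_apply, LinearMap.smul_apply, LinearMap.smulRight_apply,
      Submodule.coe_sum, Submodule.coe_smul, LinearMap.comp_apply, Submodule.subtype_apply, smul_smul]
    refine Finset.sum_congr rfl fun c _ => ?_
    have h2 := congrArg (fun f : 𝒜 => f x) (V.ip_trace_map ha hb hu (hep c))
    simp only [C.ip_apply] at h2
    rw [h2, C.metric_symm]
  have hex : ∃ T : Module.End ℝ (V.plus x), ∀ (u : Γ) (hu : V.IsPlus u),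
      (T ⟨u x, hu x⟩ : E x) = V.projPlus (C.bracket (V.projMinus (C.bracket u b)) a) x := ⟨T, hT⟩
  rw [tracePlus, dif_pos hex]
  -- The endomorphism chosen in `tracePlus` is determined, since sections of `V₊` pass through every
  -- vector of the fibre.
  have huniq : hex.choose = T := by
    refine LinearMap.ext fun v => Subtype.ext ?_
    obtain ⟨u, hu⟩ := exists_section_apply (n := n) (F := F) (E := E) x (v : E x)
    have hux : V.projPlus u x = v := by rw [projPlus_apply, hu, V.projAt_of_mem v.2]
    have h1 := hex.choose_spec (V.projPlus u) (V.isPlus_projPlus u)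
    have h2 := hT (V.projPlus u) (V.isPlus_projPlus u)
    have h3 : (⟨V.projPlus u x, V.isPlus_projPlus u x⟩ : V.plus x) = v := Subtype.ext hux
    rw [h3] at h1 h2
    rw [h1, h2]
  rw [huniq]
  simp only [T, map_sum, map_smul, LinearMap.trace_smulRight, LinearMap.comp_apply,
    Submodule.subtype_apply, smul_eq_mul]
  refine Finset.sum_congr rfl fun c _ => ?_
  congr 1
  have h1 : C.ip (e c) (C.bracket b (V.projMinus (C.bracket a (e c))))
      = C.ip (V.projMinus (C.bracket (e c) b)) (C.bracket a (e c)) := by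
    rw [ip_bracket_of_ip (V.ip_minus_plus (V.isMinus_projMinus _) (hep c)),
      bracket_eq_neg_of_ip (V.ip_minus_plus hb (hep c)), map_neg, neg_neg, C.ip_comm,
      V.ip_projMinus_comm]
  have h2 := congrArg (fun f : 𝒜 => f x) h1
  simp only [C.ip_apply] at h2
  rw [C.metric_symm]
  exact h2

variable {σ : Density n M (1 / 2)} (hσ : IsSmoothDensity σ) (hσ₀ : NowhereVanishing σ)

variable {V} in
theorem ricci_eq_ricFn {x : M} {k : ℕ} {ε : Fin k → ℝ} {e : Fin k → Γ}
    (he : IsOrthoFrame C V.plus x ε e) (hep : ∀ i, V.IsPlus (e i)) {a b : Γ} (ha : V.IsPlus a)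
    (hb : V.IsMinus b) :
    V.ricci σ a b x = V.ricFn (isVolume_mulHalf hσ hσ₀) ε e a b x := by
  rw [ricci, genRicci, tracePlus_eq he hep ha hb, C.divergence_eq (isVolume_mulHalf hσ hσ₀),
    C.divergence_eq (isVolume_mulHalf hσ hσ₀)]
  simp only [ricFn, fn_sub_apply, fn_sum_apply, fn_smul_apply, C.ip_apply]
  rfl

theorem smooth_ricci {σ : Density n M (1 / 2)} (hσ : IsSmoothDensity σ)
    (hσ₀ : NowhereVanishing σ) {a b : Γ} (ha : V.IsPlus a) (hb : V.IsMinus b) :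
    Smooth n (V.ricci σ a b) := fun x => by
  obtain ⟨k, ε, e, he, hep⟩ := V.exists_orthoFrame_plus x
  exact ((V.ricFn (isVolume_mulHalf hσ hσ₀) ε e a b).contMDiff x).congr_of_eventuallyEq
    (he.eventually.mono fun y hy => ricci_eq_ricFn hσ hσ₀ hy hep ha hb)

section Tensorial

variable {μ : Density n M 1} (hμ : IsVolume μ) {k : ℕ}

theorem ricFn_add_left (ε : Fin k → ℝ) (e : Fin k → Γ) (a a' b : Γ) :
    V.ricFn hμ ε e (a + a') b = V.ricFn hμ ε e a b + V.ricFn hμ ε e a' b := by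
  simp only [ricFn, ← projP_apply, map_add, LinearMap.add_apply, C.dv_add, smul_add,
    Finset.sum_add_distrib]
  abel

theorem ricFn_add_right (ε : Fin k → ℝ) (e : Fin k → Γ) (a b b' : Γ) :
    V.ricFn hμ ε e a (b + b') = V.ricFn hμ ε e a b + V.ricFn hμ ε e a b' := by
  have h : ∀ u v, V.projMinus (u + v) = V.projMinus u + V.projMinus v := fun u v => by
    rw [projMinus, projMinus, projMinus, ← projP_apply, ← projP_apply, ← projP_apply, map_add]
    abel
  have h' := C.der_add_left b b' (C.dv hμ a)
  rw [ricFn, h']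
  simp only [ricFn, map_add, LinearMap.add_apply, h, smul_add, Finset.sum_add_distrib]
  simp only [← projP_apply, map_add, C.dv_add]
  abel

theorem ricFn_sum_left {ι : Type*} (s : Finset ι) (ε : Fin k → ℝ) (e : Fin k → Γ) (a : ι → Γ)
    (b : Γ) : V.ricFn hμ ε e (∑ i ∈ s, a i) b = ∑ i ∈ s, V.ricFn hμ ε e (a i) b :=
  map_sum (AddMonoidHom.mk' (fun a => V.ricFn hμ ε e a b) fun a a' =>
    V.ricFn_add_left hμ ε e a a' b) a s

theorem ricFn_sum_right {ι : Type*} (s : Finset ι) (ε : Fin k → ℝ) (e : Fin k → Γ) (a : Γ)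
    (b : ι → Γ) : V.ricFn hμ ε e a (∑ i ∈ s, b i) = ∑ i ∈ s, V.ricFn hμ ε e a (b i) :=
  map_sum (AddMonoidHom.mk' (fun b => V.ricFn hμ ε e a b) fun b b' =>
    V.ricFn_add_right hμ ε e a b b') b s

theorem ricFn_congr (ε : Fin k → ℝ) (e : Fin k → Γ) {a a' b b' : Γ} {x : M} (ha : ∀ᶠ y in 𝓝 x, a y = a' y)
    (hb : ∀ᶠ y in 𝓝 x, b y = b' y) : V.ricFn hμ ε e a b x = V.ricFn hμ ε e a' b' x := by
  have h1 : C.dv hμ (V.projPlus (C.bracket b a)) x = C.dv hμ (V.projPlus (C.bracket b' a')) x :=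
    C.dv_congr hμ ((C.bracket_congr_eventually hb ha).mono fun y hy => by
      rw [projPlus_apply, projPlus_apply, hy])
  have h2 : C.der b (C.dv hμ a) x = C.der b' (C.dv hμ a') x :=
    (C.der_congr_eventually hb (C.dv_congr_eventually hμ ha)).self_of_nhds
  simp only [ricFn, fn_sub_apply, fn_sum_apply, fn_smul_apply, C.ip_apply, projMinus_apply, h1, h2,
    C.bracket_congr_left _ ha, C.bracket_congr_right _ hb]

variable {V}

/-- The derivatives of `f` that appear are `[b, a]₊ f + a(b f) - b(a f)` from the two divergence
terms and `-[a, b]₋ f` from the trace. They cancel because `[b, a]₊ - [a, b]₋ = [b, a]` and the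
anchor is a homomorphism of brackets. -/
theorem ricFn_smul_left {ε : Fin k → ℝ} {e : Fin k → Γ} {x : M} (he : IsOrthoFrame C V.plus x ε e) (hep : ∀ i, V.IsPlus (e i))
    (f : 𝒜) {a b : Γ} (ha : V.IsPlus a) (hb : V.IsMinus b) :
    V.ricFn hμ ε e (f • a) b x = f x * V.ricFn hμ ε e a b x := by
  have h1 : V.projPlus (C.bracket b (f • a)) = f • V.projPlus (C.bracket b a) + C.der b f • a := by
    rw [C.bracket_smul, ← projP_apply, map_add, map_smul, map_smul, projP_apply, projP_apply,
      V.projPlus_of_isPlus ha]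
  have h2 : ∀ c, C.ip (V.projMinus (C.bracket (e c) b)) (C.bracket (f • a) (e c))
      = f * C.ip (V.projMinus (C.bracket (e c) b)) (C.bracket a (e c))
        + C.ip a (e c) * C.der (V.projMinus (C.bracket (e c) b)) f := fun c => by
    rw [C.smul_bracket, map_add, map_sub, map_smul, map_smul, map_smul,
      V.ip_minus_plus (V.isMinus_projMinus _) ha, C.ip_grad]
    simp
  have h3 : ∑ c, ε c * (C.metric x (a x) (e c x) * C.der (V.projMinus (C.bracket (e c) b)) f x)
      = C.der (V.projMinus (C.bracket a b)) f x := by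
    have h4 : V.projMinus (C.bracket a b) x
        = (∑ c, (ε c • C.ip a (e c)) • V.projMinus (C.bracket (e c) b)) x := by
      have h5 : ∀ᶠ y in 𝓝 x, a y = (∑ c, (ε c • C.ip a (e c)) • e c) y := by
        filter_upwards [he.expand] with y hy
        rw [section_sum_apply]
        refine (hy _ (ha y)).trans (Finset.sum_congr rfl fun c _ => ?_)
        rw [section_smul_apply, fn_smul_apply, C.ip_apply, C.metric_symm]
      rw [projMinus_apply, C.bracket_congr_left b h5, ← projMinus_apply]
      congr 1
      rw [projMinus, ← projP_apply]
      simp only [map_sum, LinearMap.sum_apply, ← Finset.sum_sub_distrib]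
      refine Finset.sum_congr rfl fun c _ => ?_
      generalize ε c • C.ip a (e c) = g
      rw [C.smul_bracket, V.ip_plus_minus (hep c) hb, zero_smul, add_zero, map_sub V.projP,
        map_smul V.projP, map_smul V.projP, projP_apply, projP_apply, V.projPlus_of_isPlus (hep c),
        projMinus, smul_sub]
      abel
    rw [C.der_apply_congr f h4, C.der_sum_left, fn_sum_apply]
    refine Finset.sum_congr rfl fun c _ => ?_
    rw [C.der_smul_left, fn_mul_apply, fn_smul_apply, C.ip_apply, mul_assoc]
  have h6 : C.der (V.projPlus (C.bracket b a)) f - C.der (V.projMinus (C.bracket a b)) f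
      = C.der b (C.der a f) - C.der a (C.der b f) := by
    rw [← C.der_bracket, bracket_eq_neg_of_ip (V.ip_plus_minus ha hb), ← C.der_sub_left]
    congr 1
    rw [projMinus, ← projP_apply, ← projP_apply, map_neg]
    abel_nf
  have h7 := congrArg (fun f : 𝒜 => f x) h6
  simp only [fn_sub_apply] at h7
  simp only [ricFn, h1, h2, C.dv_add, C.dv_smul, map_add, C.der_mul, fn_sub_apply, fn_add_apply,
    fn_mul_apply, fn_sum_apply, fn_smul_apply, mul_add, Finset.sum_add_distrib, C.ip_apply, h3,
    mul_sub, Finset.mul_sum]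
  have h8 : ∑ c, ε c * (f x * C.metric x (V.projMinus (C.bracket (e c) b) x) (C.bracket a (e c) x))
      = ∑ c, f x * (ε c * C.metric x (V.projMinus (C.bracket (e c) b) x) (C.bracket a (e c) x)) :=
    Finset.sum_congr rfl fun c _ => by ring
  rw [h8]
  linear_combination h7

/-- The divergence contributes `[b, a]₊ f` and the trace contributes `[a, b]₊ f`; they cancel,
because the bracket of `V₊` with `V₋` is antisymmetric. -/
theorem ricFn_smul_right {ε : Fin k → ℝ} {e : Fin k → Γ} {x : M} (he : IsOrthoFrame C V.plus x ε e) (hep : ∀ i, V.IsPlus (e i))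
    (f : 𝒜) {a b : Γ} (ha : V.IsPlus a) (hb : V.IsMinus b) :
    V.ricFn hμ ε e a (f • b) x = f x * V.ricFn hμ ε e a b x := by
  have h1 : V.projPlus (C.bracket (f • b) a) = f • V.projPlus (C.bracket b a) := by
    rw [C.smul_bracket, V.ip_minus_plus hb ha, zero_smul, add_zero, ← projP_apply, map_sub, map_smul,
      map_smul, projP_apply, projP_apply, V.projPlus_of_isMinus hb, smul_zero, sub_zero]
  have h2 : ∀ c, C.ip (V.projMinus (C.bracket (e c) (f • b))) (C.bracket a (e c))
      = f * C.ip (V.projMinus (C.bracket (e c) b)) (C.bracket a (e c))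
        - C.der (e c) f * C.ip (e c) (C.bracket a b) := fun c => by
    have h3 : V.projMinus (C.bracket (e c) (f • b))
        = f • V.projMinus (C.bracket (e c) b) + C.der (e c) f • b := by
      rw [C.bracket_smul, projMinus, ← projP_apply, map_add, map_smul, map_smul, projP_apply,
        projP_apply, V.projPlus_of_isMinus hb, projMinus, smul_sub, smul_zero]
      abel
    rw [h3, map_add, LinearMap.add_apply, map_smul, map_smul, LinearMap.smul_apply,
      LinearMap.smul_apply, ip_bracket_of_ip (V.ip_plus_minus (hep c) hb)]
    simp only [smul_eq_mul]
    ring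
  have h3 : ∑ c, ε c * (C.der (e c) f x * C.metric x (e c x) (C.bracket a b x))
      = C.der (V.projPlus (C.bracket a b)) f x := by
    have h4 : V.projPlus (C.bracket a b) x = (∑ c, (ε c • C.ip (e c) (C.bracket a b)) • e c) x := by
      rw [section_sum_apply]
      refine (he.expand.self_of_nhds _ (V.isPlus_projPlus _ x)).trans
        (Finset.sum_congr rfl fun c _ => ?_)
      rw [section_smul_apply, fn_smul_apply, C.ip_apply, projPlus_apply, ← V.metric_projAt_comm,
        V.projAt_of_mem (hep c x)]
    rw [C.der_apply_congr f h4, C.der_sum_left, fn_sum_apply]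
    refine Finset.sum_congr rfl fun c _ => ?_
    rw [C.der_smul_left, fn_mul_apply, fn_smul_apply, C.ip_apply]
    ring
  have h5 : C.der (V.projPlus (C.bracket a b)) f x = -C.der (V.projPlus (C.bracket b a)) f x := by
    rw [bracket_eq_neg_of_ip (V.ip_plus_minus ha hb), ← projP_apply, map_neg, projP_apply, map_neg]
    rfl
  rw [h5] at h3
  simp only [ricFn, h1, h2, C.dv_smul, C.der_smul_left, fn_sub_apply, fn_add_apply,
    fn_mul_apply, fn_sum_apply, fn_smul_apply, mul_sub, Finset.sum_sub_distrib, C.ip_apply, h3,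
    Finset.mul_sum]
  have h8 : ∑ c, ε c * (f x * C.metric x (V.projMinus (C.bracket (e c) b) x) (C.bracket a (e c) x))
      = ∑ c, f x * (ε c * C.metric x (V.projMinus (C.bracket (e c) b) x) (C.bracket a (e c) x)) :=
    Finset.sum_congr rfl fun c _ => by ring
  rw [h8]
  ring

end Tensorial

end GenPseudometric
end Courant
end GenRicci

/-! ### Sections of `V₊ ⊗ V₋` and the Ricci section -/

namespace GenRicci
section Courant

variable {n : ℕ} {M : Type*} [TopologicalSpace M] [ChartedSpace (EuclideanSpace ℝ (Fin n)) M]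
  [IsManifold (𝓡 n) ∞ M] [T2Space M] [SigmaCompactSpace M]
  {F : Type*} [NormedAddCommGroup F] [NormedSpace ℝ F] [FiniteDimensional ℝ F]
  {E : M → Type*} [TopologicalSpace (Bundle.TotalSpace F E)]
  [∀ x, TopologicalSpace (E x)] [∀ x, AddCommGroup (E x)] [∀ x, Module ℝ (E x)]
  [FiberBundle F E] [VectorBundle ℝ F E] [ContMDiffVectorBundle ∞ F E (𝓡 n)]

local notation "𝒜" => C^∞⟮𝓡 n, M; 𝓘(ℝ, ℝ), ℝ⟯
local notation "Γ" => Cₛ^∞⟮𝓡 n; F, E⟯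

/-- Smoothness of a section can be tested by pairing, thanks to `exists_section_ip`. -/
theorem CourantAlgebroid.contMDiff_of_metric (C : CourantAlgebroid n F E) (s : ∀ x, E x)
    (h : ∀ u : Γ, ContMDiff (𝓡 n) 𝓘(ℝ, ℝ) ∞ (fun x => C.metric x (s x) (u x))) :
    ContMDiff (𝓡 n) ((𝓡 n).prod 𝓘(ℝ, F)) ∞ (fun x => Bundle.TotalSpace.mk' F x (s x)) := by
  obtain ⟨v, hv⟩ := C.exists_section_ip (fun x => C.metric x (s x)) h
  have h1 : ∀ x, v x = s x := fun x => sub_eq_zero.1 <| C.metric_nondegenerate x _ fun w => by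
    rw [C.metric_symm, map_sub, hv, C.metric_symm x w, sub_self]
  exact v.contMDiff.congr fun x => by rw [h1]

namespace GenPseudometric

variable {C : CourantAlgebroid n F E} (V : GenPseudometric C)

theorem sharp_tmul {x : M} (v : V.plus x) (w : V.minus x) (u : E x) :
    V.sharp x (v ⊗ₜ w) u = C.metric x v u • (w : E x) := rfl

theorem pair_tmul {x : M} (v v' : V.plus x) (w w' : V.minus x) :
    V.pair x (v ⊗ₜ w) (v' ⊗ₜ w') = C.metric x v v' * C.metric x w w' := mul_comm _ _

theorem sharp_mem_minus {x : M} (τ : V.plus x ⊗[ℝ] V.minus x) (u : E x) :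
    V.sharp x τ u ∈ V.minus x := by
  induction τ with
  | zero => simp
  | tmul v w => exact Submodule.smul_mem _ _ w.2
  | add τ τ' h h' => rw [map_add]; exact Submodule.add_mem _ h h'

theorem sharp_projAt {x : M} (τ : V.plus x ⊗[ℝ] V.minus x) (u : E x) :
    V.sharp x τ (V.projAt x u) = V.sharp x τ u := by
  induction τ with
  | zero => simp
  | tmul v w => rw [sharp_tmul, sharp_tmul, ← V.metric_projAt_comm, V.projAt_of_mem v.2]
  | add τ τ' h h' => simp only [map_add, LinearMap.add_apply, h, h']

theorem pair_tmul_right {x : M} (τ : V.plus x ⊗[ℝ] V.minus x) (v : V.plus x) (w : V.minus x) :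
    V.pair x τ (v ⊗ₜ w) = C.metric x (V.sharp x τ v) w := by
  induction τ with
  | zero => simp
  | tmul v' w' => rw [pair_tmul, sharp_tmul, map_smul, LinearMap.smul_apply, smul_eq_mul]
  | add τ τ' h h' => simp only [map_add, LinearMap.add_apply, h, h']

/-- The image of a vector under an element of `V₊ ⊗ V₋`, as an element of `V₋`. -/
def sharpMinus (x : M) (u : E x) : V.plus x ⊗[ℝ] V.minus x →ₗ[ℝ] V.minus x :=
  LinearMap.codRestrict (V.minus x) ((V.sharp x).flip u) fun τ => V.sharp_mem_minus τ u

variable {V} in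
-- By additivity only a pure tensor matters, and there the first factor is expanded in the frame.
-- Contractions with a tensor thereby become sums over a frame.
theorem tensor_eq_sum {x : M} {k : ℕ} {ε : Fin k → ℝ} {e : Fin k → Γ}
    (he : IsOrthoFrame C V.plus x ε e) (hep : ∀ i, V.IsPlus (e i)) (τ : V.plus x ⊗[ℝ] V.minus x) :
    τ = ∑ a, ε a • ((⟨e a x, hep a x⟩ : V.plus x) ⊗ₜ[ℝ] V.sharpMinus x (e a x) τ) := by
  induction τ with
  | zero => simp
  | tmul v w =>
    have h1 : v = ∑ a, (ε a * C.metric x v (e a x)) • (⟨e a x, hep a x⟩ : V.plus x) := by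
      refine Subtype.ext ((he.expand.self_of_nhds v v.2).trans ?_)
      rw [Submodule.coe_sum]
      refine Finset.sum_congr rfl fun a _ => ?_
      rw [C.metric_symm]
      rfl
    conv_lhs => rw [h1]
    rw [TensorProduct.sum_tmul]
    refine Finset.sum_congr rfl fun a _ => ?_
    rw [mul_smul, ← TensorProduct.smul_tmul', TensorProduct.smul_tmul]
    rfl
  | add τ τ' h h' =>
    conv_lhs => rw [h, h']
    simp only [map_add, TensorProduct.tmul_add, smul_add, Finset.sum_add_distrib]

variable {V} in
theorem lift_eq_sum {x : M} {k : ℕ} {ε : Fin k → ℝ} {e : Fin k → Γ}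
    (he : IsOrthoFrame C V.plus x ε e) (hep : ∀ i, V.IsPlus (e i))
    (B : V.plus x →ₗ[ℝ] V.minus x →ₗ[ℝ] ℝ) (τ : V.plus x ⊗[ℝ] V.minus x) :
    TensorProduct.lift B τ = ∑ a, ε a * B ⟨e a x, hep a x⟩ (V.sharpMinus x (e a x) τ) := by
  conv_lhs => rw [tensor_eq_sum he hep τ]
  simp only [map_sum, map_smul, TensorProduct.lift.tmul, smul_eq_mul]

theorem eq_zero_of_sharp {x : M} {τ : V.plus x ⊗[ℝ] V.minus x} (h : ∀ v, V.sharp x τ v = 0) :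
    τ = 0 := by
  obtain ⟨k, ε, e, he, hep⟩ := V.exists_orthoFrame_plus x
  rw [tensor_eq_sum he hep τ]
  refine Finset.sum_eq_zero fun a _ => ?_
  have h1 : V.sharpMinus x (e a x) τ = 0 := Subtype.ext (h _)
  rw [h1, TensorProduct.tmul_zero, smul_zero]

theorem eq_zero_of_pair {x : M} {τ : V.plus x ⊗[ℝ] V.minus x}
    (h : ∀ v w, V.pair x τ (v ⊗ₜ w) = 0) : τ = 0 := by
  refine V.eq_zero_of_sharp fun v => V.minus_nondegenerate x _ (V.sharp_mem_minus τ v) fun w hw => ?_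
  rw [← V.sharp_projAt]
  exact (V.pair_tmul_right τ ⟨V.projAt x v, V.projAt_mem x v⟩ ⟨w, hw⟩).symm.trans (h _ _)

section Ricci

variable {σ : Density n M (1 / 2)}

/-- By locality and linearity over functions, `a` and `b` may be expanded in frames, so the value
depends only on `a x` and `b x`. This supplies the bilinear form without which `ricciAt` would take
its default value. -/
theorem ricciAt_apply (hσ : IsSmoothDensity σ) (hσ₀ : NowhereVanishing σ) {a b : Γ}
    (ha : V.IsPlus a) (hb : V.IsMinus b) (x : M) :
    V.ricciAt σ x ⟨a x, ha x⟩ ⟨b x, hb x⟩ = V.ricci σ a b x := by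
  obtain ⟨k, ε, e, he, hep⟩ := V.exists_orthoFrame_plus x
  obtain ⟨l, δ, f, hf, hfm⟩ := V.exists_orthoFrame_minus x
  set μ := isVolume_mulHalf hσ hσ₀
  have hex : ∃ B : V.plus x →ₗ[ℝ] V.minus x →ₗ[ℝ] ℝ,
      ∀ (a b : Γ) (ha : V.IsPlus a) (hb : V.IsMinus b),
        B ⟨a x, ha x⟩ ⟨b x, hb x⟩ = V.ricci σ a b x := by
    refine ⟨LinearMap.mk₂ ℝ (fun v w => ∑ c, ∑ d, (ε c * C.metric x (e c x) v)
        * ((δ d * C.metric x (f d x) w) * V.ricFn μ ε e (e c) (f d) x))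
      (fun v v' w => by
        simp only [Submodule.coe_add, map_add, mul_add, add_mul, Finset.sum_add_distrib])
      (fun r v w => by
        simp only [Submodule.coe_smul, map_smul, smul_eq_mul, Finset.mul_sum]
        exact Finset.sum_congr rfl fun c _ => Finset.sum_congr rfl fun d _ => by ring)
      (fun v w w' => by
        simp only [Submodule.coe_add, map_add, mul_add, add_mul, Finset.sum_add_distrib])
      (fun r v w => by
        simp only [Submodule.coe_smul, map_smul, smul_eq_mul, Finset.mul_sum]
        exact Finset.sum_congr rfl fun c _ => Finset.sum_congr rfl fun d _ => by ring),
      fun a b ha hb => ?_⟩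
    rw [ricci_eq_ricFn hσ hσ₀ he hep ha hb, LinearMap.mk₂_apply]
    have h1 : ∀ b, V.IsMinus b → V.ricFn μ ε e a b x
        = ∑ c, (ε c * C.metric x (e c x) (a x)) * V.ricFn μ ε e (e c) b x := fun b hb => by
      have h2 : ∀ᶠ y in 𝓝 x, a y = (∑ c, (ε c • C.ip (e c) a) • e c) y := by
        filter_upwards [he.expand] with y hy
        rw [section_sum_apply]
        exact (hy _ (ha y)).trans (Finset.sum_congr rfl fun c _ => rfl)
      rw [V.ricFn_congr μ ε e h2 (.of_forall fun _ => rfl),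
        ricFn_sum_left, fn_sum_apply]
      exact Finset.sum_congr rfl fun c _ => V.ricFn_smul_left μ he hep _ (hep c) hb
    rw [h1 b hb]
    refine Finset.sum_congr rfl fun c _ => ?_
    rw [← Finset.mul_sum]
    congr 1
    have h2 : ∀ᶠ y in 𝓝 x, b y = (∑ d, (δ d • C.ip (f d) b) • f d) y := by
      filter_upwards [hf.expand] with y hy
      rw [section_sum_apply]
      exact (hy _ (hb y)).trans (Finset.sum_congr rfl fun c _ => rfl)
    rw [V.ricFn_congr μ ε e (.of_forall fun _ => rfl) h2,
      ricFn_sum_right, fn_sum_apply]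
    exact Finset.sum_congr rfl fun d _ => (V.ricFn_smul_right μ he hep (δ d • C.ip (f d) b)
      (hep c) (hfm d)).symm
  rw [ricciAt, dif_pos hex]
  exact hex.choose_spec a b ha hb

/-- The section of `V₊ ⊗ V₋` that corresponds to the generalized Ricci tensor. -/
theorem exists_ricciSection (hσ : IsSmoothDensity σ) (hσ₀ : NowhereVanishing σ) :
    ∃ R : V.MixedSection, V.IsRicciSection σ R ∧ ∀ x τ,
      TensorProduct.lift (V.ricciAt σ x) τ = V.pair x (R.toFun x) τ := by
  have hex : ∀ x, ∃ τ : V.plus x ⊗[ℝ] V.minus x, ∀ v w,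
      V.pair x τ (v ⊗ₜ w) = V.ricciAt σ x v w := fun x => by
    obtain ⟨k, ε, e, he, hep⟩ := V.exists_orthoFrame_plus x
    obtain ⟨l, δ, f, hf, hfm⟩ := V.exists_orthoFrame_minus x
    refine ⟨∑ c, ∑ d, (ε c * (δ d * V.ricciAt σ x ⟨e c x, hep c x⟩ ⟨f d x, hfm d x⟩)) •
      ((⟨e c x, hep c x⟩ : V.plus x) ⊗ₜ[ℝ] (⟨f d x, hfm d x⟩ : V.minus x)), fun v w => ?_⟩
    have h1 : v = ∑ a, (ε a * C.metric x (e a x) v) • (⟨e a x, hep a x⟩ : V.plus x) := by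
      refine Subtype.ext ((he.expand.self_of_nhds v v.2).trans ?_)
      rw [Submodule.coe_sum]
      rfl
    have h2 : w = ∑ a, (δ a * C.metric x (f a x) w) • (⟨f a x, hfm a x⟩ : V.minus x) := by
      refine Subtype.ext ((hf.expand.self_of_nhds w w.2).trans ?_)
      rw [Submodule.coe_sum]
      rfl
    conv_rhs => rw [h1, h2]
    simp only [map_sum, map_smul, LinearMap.sum_apply, LinearMap.smul_apply, smul_eq_mul, pair_tmul,
      Finset.mul_sum]
    rw [Finset.sum_comm]
    exact Finset.sum_congr rfl fun c _ => Finset.sum_congr rfl fun d _ => by ring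
  choose R hR using hex
  -- Pairing with arbitrary sections reduces the smoothness of `R` to that of `ricci` on projected
  -- sections.
  have hs : ∀ (u w : Γ) (x : M), C.metric x (V.sharp x (R x) (u x)) (w x)
      = V.ricci σ (V.projPlus u) (V.projMinus w) x := fun u w x => by
    have h1 := hR x ⟨_, V.isPlus_projPlus u x⟩ ⟨_, V.isMinus_projMinus w x⟩
    rw [V.ricciAt_apply hσ hσ₀ (V.isPlus_projPlus u) (V.isMinus_projMinus w), pair_tmul_right] at h1
    refine Eq.trans ?_ h1
    change _ = C.metric x (V.sharp x (R x) (V.projAt x (u x))) (w x - V.projAt x (w x))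
    rw [sharp_projAt, map_sub, V.metric_minus_plus (V.sharp_mem_minus _ _) (V.projAt_mem x _),
      sub_zero]
  refine ⟨⟨R, fun u => C.contMDiff_of_metric _ fun w => ?_⟩, fun a b ha hb x => ?_, fun x τ => ?_⟩
  · exact (V.smooth_ricci hσ hσ₀ (V.isPlus_projPlus u) (V.isMinus_projMinus w)).congr (hs u w)
  · rw [hR, V.ricciAt_apply hσ hσ₀ ha hb]
  · induction τ with
    | zero => simp
    | tmul v w => rw [hR, TensorProduct.lift.tmul]
    | add τ τ' h h' => rw [map_add, map_add, h, h']

end Ricci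

namespace MixedSection

variable {V}

theorem ext {φ ψ : V.MixedSection} (h : ∀ x, φ.toFun x = ψ.toFun x) : φ = ψ := by
  cases φ; cases ψ
  congr
  exact funext h

/-- The section `φ(u)`. -/
def map (φ : V.MixedSection) (u : Γ) : Γ := ⟨fun x => V.sharp x (φ.toFun x) (u x), φ.smooth u⟩

theorem map_apply (φ : V.MixedSection) (u : Γ) (x : M) : φ.map u x = V.sharp x (φ.toFun x) (u x) :=
  rfl

theorem isMinus_map (φ : V.MixedSection) (u : Γ) : V.IsMinus (φ.map u) :=
  fun _ => V.sharp_mem_minus _ _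

theorem neg_toFun (φ : V.MixedSection) (x : M) : (-φ).toFun x = -φ.toFun x := rfl

/-- The section `f a ⊗ b`. -/
def tmul (f : 𝒜) {a b : Γ} (ha : V.IsPlus a) (hb : V.IsMinus b) : V.MixedSection :=
  ⟨fun x => f x • ((⟨a x, ha x⟩ : V.plus x) ⊗ₜ[ℝ] (⟨b x, hb x⟩ : V.minus x)), fun u =>
    ((f * C.ip a u) • b).contMDiff.congr fun x => by
      rw [map_smul, LinearMap.smul_apply, sharp_tmul, smul_smul]
      rfl⟩

theorem tmul_toFun (f : 𝒜) {a b : Γ} (ha : V.IsPlus a) (hb : V.IsMinus b) (x : M) :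
    (tmul f ha hb).toFun x
      = f x • ((⟨a x, ha x⟩ : V.plus x) ⊗ₜ[ℝ] (⟨b x, hb x⟩ : V.minus x)) := rfl

end MixedSection

end GenPseudometric
end Courant
end GenRicci

/-! ### Functions depending smoothly on a parameter -/

namespace GenRicci
section JointSmoothness

/-- Symmetry of the second derivative of `H` at `(0, y₀)`, evaluated on the directions `(1, 0)` and
`(0, v)`. -/
theorem hasDerivAt_fderiv_of_contDiffAt {G : Type*} [NormedAddCommGroup G] [NormedSpace ℝ G]
    {H : ℝ × G → ℝ} {y₀ : G} (hH : ContDiffAt ℝ 2 H (0, y₀)) {h' : G → ℝ}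
    (hd : ∀ᶠ y in 𝓝 y₀, HasDerivAt (fun t => H (t, y)) (h' y) 0) (v : G) :
    HasDerivAt (fun t => fderiv ℝ (fun y => H (t, y)) y₀ v) (fderiv ℝ h' y₀ v) 0 := by
  have hdiff : ∀ᶠ z in 𝓝 ((0 : ℝ), y₀), DifferentiableAt ℝ H z :=
    (hH.eventually (by simp)).mono fun z hz => hz.differentiableAt (by simp)
  have hD : HasFDerivAt (fderiv ℝ H) (fderiv ℝ (fderiv ℝ H) (0, y₀)) (0, y₀) :=
    ((hH.fderiv_right (m := 1) (by norm_num)).differentiableAt (by simp)).hasFDerivAt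
  have hi1 : HasDerivAt (fun t : ℝ => (t, y₀)) ((1 : ℝ), (0 : G)) 0 :=
    (hasDerivAt_id 0).prodMk (hasDerivAt_const 0 y₀)
  have hi2 : ∀ t y, HasFDerivAt (fun y : G => ((t : ℝ), y)) (ContinuousLinearMap.inr ℝ ℝ G) y :=
    fun t y => hasFDerivAt_prodMk_right t y
  have h1 : ∀ᶠ t in 𝓝 (0 : ℝ), fderiv ℝ (fun y => H (t, y)) y₀ v = fderiv ℝ H (t, y₀) (0, v) := by
    filter_upwards [hi1.continuousAt.eventually hdiff] with t ht
    have h3 : HasFDerivAt (fun y => H (t, y)) _ y₀ := HasFDerivAt.comp y₀ ht.hasFDerivAt (hi2 t y₀)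
    rw [h3.fderiv]
    rfl
  have h2 : h' =ᶠ[𝓝 y₀] fun y => fderiv ℝ H (0, y) (1, 0) := by
    filter_upwards [hd, (hi2 0 y₀).continuousAt.eventually hdiff] with y hy hy'
    have h3 : HasDerivAt (fun t : ℝ => (t, y)) ((1 : ℝ), (0 : G)) 0 :=
      (hasDerivAt_id 0).prodMk (hasDerivAt_const 0 y)
    exact hy.unique (hy'.hasFDerivAt.comp_hasDerivAt (0 : ℝ) h3)
  have h4 : fderiv ℝ h' y₀ v = fderiv ℝ (fderiv ℝ H) (0, y₀) (0, v) (1, 0) := by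
    rw [h2.fderiv_eq]
    have h5 : HasFDerivAt (fun y => fderiv ℝ H (0, y)) _ y₀ := HasFDerivAt.comp y₀ hD (hi2 0 y₀)
    rw [(h5.clm_apply (hasFDerivAt_const ((1 : ℝ), (0 : G)) y₀)).fderiv]
    simp
  have h6 : HasDerivAt (fun t => fderiv ℝ H (t, y₀)) (fderiv ℝ (fderiv ℝ H) (0, y₀) (1, 0)) 0 :=
    hD.comp_hasDerivAt (0 : ℝ) hi1
  have h7 : HasDerivAt (fun t => fderiv ℝ H (t, y₀) (0, v))
      (fderiv ℝ (fderiv ℝ H) (0, y₀) (1, 0) (0, v)) 0 := by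
    simpa using h6.clm_apply (hasDerivAt_const (0 : ℝ) ((0 : ℝ), v))
  rw [h4, (hH.isSymmSndFDerivAt (by simp)).eq]
  exact h7.congr_of_eventuallyEq h1

variable {n : ℕ} {M : Type*} [TopologicalSpace M] [ChartedSpace (EuclideanSpace ℝ (Fin n)) M]

local notation "𝔼" => EuclideanSpace ℝ (Fin n)
local notation "ψ" => extChartAt (𝓡 n)

/-- `f t x` depends smoothly on `t` and `x`, near `(0, x₀)`. -/
def JointSmooth (n : ℕ) {M : Type*} [TopologicalSpace M]
    [ChartedSpace (EuclideanSpace ℝ (Fin n)) M] (x₀ : M) (f : ℝ → M → ℝ) : Prop :=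
  ∀ᶠ z in 𝓝 ((0 : ℝ), x₀),
    ContMDiffAt (𝓘(ℝ, ℝ).prod (𝓡 n)) 𝓘(ℝ, ℝ) ∞ (fun z : ℝ × M => f z.1 z.2) z

/-- Locality arguments take place on `M` at fixed `t`, so eventual statements on `ℝ × M` have to be
restricted to slices. -/
theorem eventually_slice {X : Type*} [TopologicalSpace X] {x₀ : X} {p : ℝ → X → Prop}
    (h : ∀ᶠ z in 𝓝 ((0 : ℝ), x₀), p z.1 z.2) :
    ∀ᶠ z in 𝓝 ((0 : ℝ), x₀), ∀ᶠ y in 𝓝 z.2, p z.1 y := by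
  filter_upwards [h.eventually_nhds] with z hz
  exact (Continuous.prodMk_right z.1).continuousAt.eventually hz

theorem eventually_slice_right {X : Type*} [TopologicalSpace X] {x₀ : X} {p : ℝ → X → Prop}
    (h : ∀ᶠ z in 𝓝 ((0 : ℝ), x₀), p z.1 z.2) :
    ∀ᶠ x in 𝓝 x₀, ∀ᶠ t in 𝓝 (0 : ℝ), p t x := by
  filter_upwards [(Continuous.prodMk_right (0 : ℝ)).continuousAt.eventually h.eventually_nhds]
    with x hx
  exact (Continuous.prodMk_left x).continuousAt.eventually hx

theorem eventually_prod_right {X : Type*} [TopologicalSpace X] {x₀ : X} {p : X → Prop}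
    (h : ∀ᶠ x in 𝓝 x₀, p x) : ∀ᶠ z in 𝓝 ((0 : ℝ), x₀), p z.2 :=
  continuous_snd.continuousAt.eventually h

namespace JointSmooth

variable {x₀ : M} {f g : ℝ → M → ℝ}

theorem congr (hf : JointSmooth n x₀ f) (h : ∀ᶠ z in 𝓝 ((0 : ℝ), x₀), g z.1 z.2 = f z.1 z.2) :
    JointSmooth n x₀ g := by
  filter_upwards [hf, h.eventually_nhds] with z hz h1
  exact hz.congr_of_eventuallyEq h1

theorem add (hf : JointSmooth n x₀ f) (hg : JointSmooth n x₀ g) :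
    JointSmooth n x₀ (fun t x => f t x + g t x) := by
  filter_upwards [hf, hg] with z h1 h2
  exact h1.add h2

theorem mul (hf : JointSmooth n x₀ f) (hg : JointSmooth n x₀ g) :
    JointSmooth n x₀ (fun t x => f t x * g t x) := by
  filter_upwards [hf, hg] with z h1 h2
  exact h1.mul h2

theorem of_smooth {h : M → ℝ} (hh : Smooth n h) : JointSmooth n x₀ (fun _ => h) :=
  .of_forall fun z => (hh z.2).comp z contMDiffAt_snd

variable [IsManifold (𝓡 n) ∞ M]

/-- In a chart, a jointly smooth function is smooth. -/
theorem contDiffAt (hf : JointSmooth n x₀ f) (a : M) (ha : x₀ ∈ (ψ a).source) :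
    ∀ᶠ z in 𝓝 ((0 : ℝ), x₀), ContDiffAt ℝ ∞ (fun w : ℝ × 𝔼 => f w.1 ((ψ a).symm w.2))
      (z.1, ψ a z.2) := by
  filter_upwards [hf, eventually_prod_right ((isOpen_extChartAt_source a).mem_nhds ha)]
    with z hz hza
  refine contMDiffAt_iff_contDiffAt.1 ?_
  have h2 : (ψ a).symm (ψ a z.2) = z.2 := (ψ a).left_inv hza
  have h1 : ContMDiffAt 𝓘(ℝ, ℝ × 𝔼) (𝓘(ℝ, ℝ).prod (𝓡 n)) ∞
      (fun w : ℝ × 𝔼 => (w.1, (ψ a).symm w.2)) (z.1, ψ a z.2) := by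
    refine ContMDiffAt.prodMk contDiff_fst.contMDiff.contMDiffAt ?_
    refine ContMDiffAt.comp (I' := 𝓘(ℝ, 𝔼)) (z.1, ψ a z.2) (g := (ψ a).symm) (f := Prod.snd) ?_
      contDiff_snd.contMDiff.contMDiffAt
    exact (contMDiffOn_extChartAt_symm a).contMDiffAt
      ((isOpen_extChartAt_target a).mem_nhds ((ψ a).map_source hza))
  refine ContMDiffAt.comp (z.1, ψ a z.2) (g := fun z : ℝ × M => f z.1 z.2) ?_ h1
  rw [h2]
  exact hz

theorem of_contDiffAt (a : M) (ha : x₀ ∈ (ψ a).source) {H : ℝ × 𝔼 → ℝ}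
    (hH : ∀ᶠ z in 𝓝 ((0 : ℝ), x₀), ContDiffAt ℝ ∞ H (z.1, ψ a z.2)) :
    JointSmooth n x₀ (fun t x => H (t, ψ a x)) := by
  filter_upwards [hH, eventually_prod_right ((isOpen_extChartAt_source a).mem_nhds ha)]
    with z hz hza
  have h1 : ContMDiffAt (𝓘(ℝ, ℝ).prod (𝓡 n)) 𝓘(ℝ, ℝ × 𝔼) ∞
      (fun w : ℝ × M => (w.1, ψ a w.2)) z := by
    refine ContMDiffAt.prodMk_space contMDiffAt_fst ?_
    refine ContMDiffAt.comp (I' := 𝓡 n) z (g := ψ a) (f := Prod.snd) ?_ contMDiffAt_snd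
    rw [extChartAt_source] at hza
    exact contMDiffAt_extChartAt' hza
  exact ContMDiffAt.comp z (g := H) (contMDiffAt_iff_contDiffAt.2 hz) h1

/-- A `C¹` function is locally Lipschitz; this is the domination hypothesis of
`IsVolume.hasDerivAt_integral`. -/
theorem exists_lipschitz (hf : JointSmooth n x₀ f) : ∃ U ∈ 𝓝 x₀, ∃ ε > 0, ∃ c : ℝ, ∀ y ∈ U,
    ∀ s ∈ Metric.ball (0 : ℝ) ε, ∀ t ∈ Metric.ball (0 : ℝ) ε, |f s y - f t y| ≤ c * |s - t| := by
  have hx := mem_extChartAt_source (I := 𝓡 n) x₀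
  have h1 := (hf.contDiffAt x₀ hx).self_of_nhds
  obtain ⟨c, S, hS, hc⟩ := (h1.of_le (m := 1) (by exact_mod_cast le_top)).exists_lipschitzOnWith
  have h2 : Filter.Tendsto (fun z : ℝ × M => (z.1, ψ x₀ z.2)) (𝓝 (0, x₀)) (𝓝 (0, ψ x₀ x₀)) :=
    (continuousAt_fst).prodMk_nhds
      (ContinuousAt.comp (x := ((0 : ℝ), x₀)) (continuousAt_extChartAt x₀) continuousAt_snd)
  obtain ⟨T, hT, U, hU, hTU⟩ := mem_nhds_prod_iff.1 (h2 hS)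
  obtain ⟨ε, hε, hεT⟩ := Metric.mem_nhds_iff.1 hT
  refine ⟨U ∩ (ψ x₀).source, Filter.inter_mem hU (extChartAt_source_mem_nhds x₀), ε, hε, c,
    fun y hy s hs t ht => ?_⟩
  have h3 := hc.dist_le_mul _ (hTU (show (s, y) ∈ T ×ˢ U from ⟨hεT hs, hy.1⟩)) _
    (hTU (show (t, y) ∈ T ×ˢ U from ⟨hεT ht, hy.1⟩))
  simp only [(ψ x₀).left_inv hy.2] at h3
  rw [Real.dist_eq, Prod.dist_eq, dist_self, max_eq_left dist_nonneg, Real.dist_eq] at h3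
  exact h3

theorem slice (hf : JointSmooth n x₀ f) :
    ∀ᶠ z in 𝓝 ((0 : ℝ), x₀), ContMDiffAt (𝓡 n) 𝓘(ℝ, ℝ) ∞ (f z.1) z.2 := by
  filter_upwards [hf] with z hz
  exact ContMDiffAt.comp z.2 (f := fun y => (z.1, y)) hz (contMDiffAt_const.prodMk contMDiffAt_id)

theorem dirDeriv_eq (hf : JointSmooth n x₀ f) {X : ∀ x : M, TangentSpace (𝓡 n) x} :
    ∀ᶠ z in 𝓝 ((0 : ℝ), x₀), dirDeriv (f z.1) z.2 (X z.2)
      = fderiv ℝ (fun y => f z.1 ((ψ x₀).symm y)) (ψ x₀ z.2) (components X x₀ (ψ x₀ z.2)) := by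
  filter_upwards [hf.slice, eventually_prod_right (extChartAt_source_mem_nhds (I := 𝓡 n) x₀)]
    with z hz hz0
  exact dirDeriv_eq_fderiv x₀ hz0 (hz.mdifferentiableAt (by simp)) X

theorem dirDeriv (hf : JointSmooth n x₀ f) {X : ∀ x : M, TangentSpace (𝓡 n) x}
    (hX : ContMDiff (𝓡 n) (𝓡 n).tangent ∞ (fun x => (⟨x, X x⟩ : TangentBundle (𝓡 n) M))) :
    JointSmooth n x₀ (fun t x => dirDeriv (f t) x (X x)) := by
  have hx := mem_extChartAt_source (I := 𝓡 n) x₀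
  have h1 := hf.contDiffAt x₀ hx
  refine JointSmooth.congr (of_contDiffAt x₀ hx
    (H := fun w => fderiv ℝ (fun w : ℝ × 𝔼 => f w.1 ((ψ x₀).symm w.2)) w (0, components X x₀ w.2))
    ?_) ?_
  · filter_upwards [h1, eventually_prod_right (extChartAt_source_mem_nhds (I := 𝓡 n) x₀)]
      with z hz hz0
    refine (hz.fderiv_right (m := ∞) (by simp)).clm_apply (contDiffAt_const.prodMk ?_)
    exact ((contDiffOn_components hX x₀).contDiffAt
      ((isOpen_extChartAt_target x₀).mem_nhds ((ψ x₀).map_source hz0))).comp (z.1, ψ x₀ z.2)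
      contDiffAt_snd
  · filter_upwards [h1, hf.dirDeriv_eq (X := X)] with z hz h2
    have h3 : HasFDerivAt (fun y => f z.1 ((ψ x₀).symm y)) _ (ψ x₀ z.2) :=
      HasFDerivAt.comp (g := fun w : ℝ × 𝔼 => f w.1 ((ψ x₀).symm w.2)) (ψ x₀ z.2)
        (hz.differentiableAt (by simp)).hasFDerivAt (hasFDerivAt_prodMk_right z.1 (ψ x₀ z.2))
    rw [h2, h3.fderiv]
    rfl

/-- Commutation of mixed derivatives, read in the chart at `x₀`. -/
theorem hasDerivAt_dirDeriv (hf : JointSmooth n x₀ f) {f' : M → ℝ}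
    (hf' : ContMDiffAt (𝓡 n) 𝓘(ℝ, ℝ) ∞ f' x₀)
    (hd : ∀ᶠ x in 𝓝 x₀, HasDerivAt (fun t => f t x) (f' x) 0) (X : ∀ x : M, TangentSpace (𝓡 n) x) :
    HasDerivAt (fun t => GenRicci.dirDeriv (f t) x₀ (X x₀)) (GenRicci.dirDeriv f' x₀ (X x₀)) 0 := by
  have hx := mem_extChartAt_source (I := 𝓡 n) x₀
  have h1 := (hf.contDiffAt x₀ hx).self_of_nhds
  have h2 := hf.dirDeriv_eq (X := X)
  have h3 : ∀ᶠ y in 𝓝 (ψ x₀ x₀), HasDerivAt (fun t => f t ((ψ x₀).symm y)) (f' ((ψ x₀).symm y)) 0 := by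
    have h4 := continuousAt_extChartAt_symm (I := 𝓡 n) x₀
    rw [ContinuousAt, extChartAt_to_inv] at h4
    exact h4.eventually hd
  rw [dirDeriv_eq_fderiv x₀ hx (hf'.mdifferentiableAt (by simp)) X]
  refine (hasDerivAt_fderiv_of_contDiffAt (H := fun w : ℝ × 𝔼 => f w.1 ((ψ x₀).symm w.2))
    (h1.of_le (by norm_cast)) h3 _).congr_of_eventuallyEq ?_
  filter_upwards [(Continuous.prodMk_left x₀).continuousAt.eventually h2] with t ht
  exact ht

end JointSmooth

end JointSmoothness
end GenRicci

/-! ### Calculus of variations of functions and sections -/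

namespace GenRicci
section Courant

variable {n : ℕ} {M : Type*} [TopologicalSpace M] [ChartedSpace (EuclideanSpace ℝ (Fin n)) M]
  [IsManifold (𝓡 n) ∞ M] [T2Space M] [SigmaCompactSpace M]
  {F : Type*} [NormedAddCommGroup F] [NormedSpace ℝ F] [FiniteDimensional ℝ F]
  {E : M → Type*} [TopologicalSpace (Bundle.TotalSpace F E)]
  [∀ x, TopologicalSpace (E x)] [∀ x, AddCommGroup (E x)] [∀ x, Module ℝ (E x)]
  [FiberBundle F E] [VectorBundle ℝ F E] [ContMDiffVectorBundle ∞ F E (𝓡 n)]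

local notation "𝒜" => C^∞⟮𝓡 n, M; 𝓘(ℝ, ℝ), ℝ⟯
local notation "Γ" => Cₛ^∞⟮𝓡 n; F, E⟯

/-- The family of functions `f t` depends smoothly on `t` near `(0, x₀)`, and its derivative at
`t = 0` is `f'` near `x₀`. -/
structure HasFnVariation (x₀ : M) (f : ℝ → 𝒜) (f' : 𝒜) : Prop where
  smooth : JointSmooth n x₀ (fun t => f t)
  deriv : ∀ᶠ x in 𝓝 x₀, HasDerivAt (fun t => f t x) (f' x) 0

namespace HasFnVariation

variable {x₀ : M}

theorem congr {f g : ℝ → 𝒜} {f' g' : 𝒜} (hf : HasFnVariation x₀ f f')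
    (h : ∀ᶠ z in 𝓝 ((0 : ℝ), x₀), g z.1 z.2 = f z.1 z.2) (h' : ∀ᶠ x in 𝓝 x₀, g' x = f' x) :
    HasFnVariation x₀ g g' := by
  refine ⟨hf.smooth.congr h, ?_⟩
  filter_upwards [hf.deriv, h', eventually_slice_right (p := fun t x => g t x = f t x) h]
    with x h1 h2 h3
  rw [h2]
  exact h1.congr_of_eventuallyEq h3

theorem congr_deriv {f : ℝ → 𝒜} {f' g' : 𝒜} (hf : HasFnVariation x₀ f f') (h' : g' = f') :
    HasFnVariation x₀ f g' := h' ▸ hf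

theorem const (f : 𝒜) : HasFnVariation x₀ (fun _ => f) 0 :=
  ⟨.of_smooth f.contMDiff, .of_forall fun x => hasDerivAt_const 0 (f x)⟩

theorem add {f g : ℝ → 𝒜} {f' g' : 𝒜} (hf : HasFnVariation x₀ f f') (hg : HasFnVariation x₀ g g') :
    HasFnVariation x₀ (fun t => f t + g t) (f' + g') := by
  refine ⟨hf.smooth.add hg.smooth, ?_⟩
  filter_upwards [hf.deriv, hg.deriv] with x h1 h2
  exact h1.add h2

theorem mul {f g : ℝ → 𝒜} {f' g' : 𝒜} (hf : HasFnVariation x₀ f f') (hg : HasFnVariation x₀ g g') :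
    HasFnVariation x₀ (fun t => f t * g t) (f' * g 0 + f 0 * g') := by
  refine ⟨hf.smooth.mul hg.smooth, ?_⟩
  filter_upwards [hf.deriv, hg.deriv] with x h1 h2
  exact h1.mul h2

theorem smul {f : ℝ → 𝒜} {f' : 𝒜} (c : ℝ) (hf : HasFnVariation x₀ f f') :
    HasFnVariation x₀ (fun t => c • f t) (c • f') := by
  have h := (const (x₀ := x₀) (algebraMap ℝ 𝒜 c)).mul hf
  simpa only [zero_mul, zero_add, ← Algebra.smul_def] using h

theorem sub {f g : ℝ → 𝒜} {f' g' : 𝒜} (hf : HasFnVariation x₀ f f') (hg : HasFnVariation x₀ g g') :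
    HasFnVariation x₀ (fun t => f t - g t) (f' - g') := by
  simpa only [neg_one_smul, ← sub_eq_add_neg] using hf.add (hg.smul (-1))

theorem sum {ι : Type*} (s : Finset ι) {f : ι → ℝ → 𝒜} {f' : ι → 𝒜}
    (hf : ∀ i ∈ s, HasFnVariation x₀ (f i) (f' i)) :
    HasFnVariation x₀ (fun t => ∑ i ∈ s, f i t) (∑ i ∈ s, f' i) := by
  classical
  induction s using Finset.induction_on with
  | empty => simpa using const (x₀ := x₀) 0
  | insert i s hi ih =>
    simp only [Finset.sum_insert hi]
    exact (hf i (Finset.mem_insert_self i s)).add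
      (ih fun j hj => hf j (Finset.mem_insert_of_mem hj))

theorem eventually {f : ℝ → 𝒜} {f' : 𝒜} (hf : HasFnVariation x₀ f f') :
    ∀ᶠ x in 𝓝 x₀, HasFnVariation x f f' := by
  have h1 : ∀ᶠ x in 𝓝 x₀, JointSmooth n x (fun t => f t) :=
    (Continuous.prodMk_right (0 : ℝ)).continuousAt.eventually hf.smooth.eventually_nhds
  filter_upwards [h1, hf.deriv.eventually_nhds] with x h1 h2
  exact ⟨h1, h2⟩

theorem der {f : ℝ → 𝒜} {f' : 𝒜} (hf : HasFnVariation x₀ f f') (C : CourantAlgebroid n F E) (u : Γ) :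
    HasFnVariation x₀ (fun t => C.der u (f t)) (C.der u f') := by
  refine ⟨hf.smooth.dirDeriv (C.anchor_smooth u), ?_⟩
  filter_upwards [hf.eventually] with x hx
  exact hx.smooth.hasDerivAt_dirDeriv (f'.contMDiff x) hx.deriv (C.anchorField u)

end HasFnVariation

theorem exists_orthoFrame_top (C : CourantAlgebroid n F E) (x₀ : M) :
    ∃ (k : ℕ) (ε : Fin k → ℝ) (r : Fin k → Γ), IsOrthoFrame C (fun _ => ⊤) x₀ ε r := by
  have := finiteDimensional_fiber F E x₀
  obtain ⟨ε, b, hε, hb⟩ := exists_ortho_basis (C.metric x₀) (C.metric_symm x₀) ⊤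
    fun u _ h => C.metric_nondegenerate x₀ u fun v => h v trivial
  choose s hs using fun i => exists_section_apply (n := n) (F := F) (E := E) x₀ (b i : E x₀)
  obtain ⟨e, he, -⟩ := exists_orthoFrame_of_gram C (S := fun _ => ⊤) hε s (fun _ _ => trivial)
    (fun i j => by rw [hs, hs, hb]) (.of_forall fun x => by
      have h1 : ∀ y, Module.finrank ℝ (⊤ : Submodule ℝ (E y)) = Module.finrank ℝ F := fun y => by
        rw [finrank_top]
        exact (((trivializationAt F E y).continuousLinearEquivAt ℝ y
          (FiberBundle.mem_baseSet_trivializationAt F E y)).toLinearEquiv).finrank_eq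
      exact (h1 x).trans (h1 x₀).symm)
  exact ⟨_, ε, e, he⟩

/-- The family of sections `u t` depends smoothly on `t` near `(0, x₀)`, and its derivative at
`t = 0` is `u'` near `x₀`. -/
def HasSecVariation (C : CourantAlgebroid n F E) (x₀ : M) (u : ℝ → Γ) (u' : Γ) : Prop :=
  ∀ w, HasFnVariation x₀ (fun t => C.ip w (u t)) (C.ip w u')

namespace HasSecVariation

variable {C : CourantAlgebroid n F E} {x₀ : M}

theorem congr {u v : ℝ → Γ} {u' v' : Γ} (hu : HasSecVariation C x₀ u u')
    (h : ∀ᶠ z in 𝓝 ((0 : ℝ), x₀), v z.1 z.2 = u z.1 z.2) (h' : ∀ᶠ x in 𝓝 x₀, v' x = u' x) :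
    HasSecVariation C x₀ v v' := fun w =>
  (hu w).congr (h.mono fun z hz => by rw [C.ip_apply, C.ip_apply, hz])
    (h'.mono fun x hx => by rw [C.ip_apply, C.ip_apply, hx])

theorem const (u : Γ) : HasSecVariation C x₀ (fun _ => u) 0 := fun w => by
  rw [map_zero]
  exact .const _

theorem add {u v : ℝ → Γ} {u' v' : Γ} (hu : HasSecVariation C x₀ u u')
    (hv : HasSecVariation C x₀ v v') : HasSecVariation C x₀ (fun t => u t + v t) (u' + v') :=
  fun w => by simpa only [map_add] using (hu w).add (hv w)

theorem sub {u v : ℝ → Γ} {u' v' : Γ} (hu : HasSecVariation C x₀ u u')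
    (hv : HasSecVariation C x₀ v v') : HasSecVariation C x₀ (fun t => u t - v t) (u' - v') :=
  fun w => by simpa only [map_sub] using (hu w).sub (hv w)

theorem sum {ι : Type*} (s : Finset ι) {u : ι → ℝ → Γ} {u' : ι → Γ}
    (hu : ∀ i ∈ s, HasSecVariation C x₀ (u i) (u' i)) :
    HasSecVariation C x₀ (fun t => ∑ i ∈ s, u i t) (∑ i ∈ s, u' i) := fun w => by
  simpa only [map_sum] using HasFnVariation.sum s fun i hi => hu i hi w

theorem smul {f : ℝ → 𝒜} {f' : 𝒜} {u : ℝ → Γ} {u' : Γ} (hf : HasFnVariation x₀ f f')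
    (hu : HasSecVariation C x₀ u u') :
    HasSecVariation C x₀ (fun t => f t • u t) (f' • u 0 + f 0 • u') := fun w => by
  simpa only [map_add, map_smul, smul_eq_mul] using hf.mul (hu w)

theorem smul_const {f : ℝ → 𝒜} {f' : 𝒜} (hf : HasFnVariation x₀ f f') (u : Γ) :
    HasSecVariation C x₀ (fun t => f t • u) (f' • u) := by
  simpa only [smul_zero, add_zero] using smul hf (const u)

theorem grad {f : ℝ → 𝒜} {f' : 𝒜} (hf : HasFnVariation x₀ f f') :
    HasSecVariation C x₀ (fun t => C.grad (f t)) (C.grad f') := fun w => by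
  simpa only [C.ip_grad] using hf.der C w

theorem eq_sum {k : ℕ} {δ : Fin k → ℝ} {r : Fin k → Γ}
    (hr : IsOrthoFrame C (fun _ => ⊤) x₀ δ r) (u : ℝ → Γ) :
    ∀ᶠ x in 𝓝 x₀, ∀ t, u t x = (∑ i, (δ i • C.ip (r i) (u t)) • r i) x := by
  filter_upwards [hr.expand] with x hx t
  rw [section_sum_apply]
  exact hx _ trivial

/-- A frame of `E` that does not depend on `t` reduces the inner product to products of the
functions controlled by `HasSecVariation`. -/
theorem ip {u v : ℝ → Γ} {u' v' : Γ} (hu : HasSecVariation C x₀ u u')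
    (hv : HasSecVariation C x₀ v v') :
    HasFnVariation x₀ (fun t => C.ip (u t) (v t)) (C.ip u' (v 0) + C.ip (u 0) v') := by
  obtain ⟨k, δ, r, hr⟩ := exists_orthoFrame_top C x₀
  have h := HasFnVariation.sum Finset.univ fun i _ => ((hu (r i)).mul (hv (r i))).smul (δ i)
  have key : ∀ᶠ x in 𝓝 x₀, ∀ a b : Γ,
      C.ip a b x = ∑ i, δ i * (C.ip (r i) a x * C.ip (r i) b x) := by
    filter_upwards [hr.expand] with x hx a b
    simp only [C.ip_apply]
    conv_lhs => rw [hx (a x) trivial]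
    simp only [map_sum, map_smul, LinearMap.sum_apply, LinearMap.smul_apply, smul_eq_mul]
    exact Finset.sum_congr rfl fun i _ => by ring
  refine h.congr ((eventually_prod_right key).mono fun z hz => ?_) (key.mono fun x hx => ?_)
  · rw [hz, fn_sum_apply]; rfl
  · rw [fn_add_apply, hx, hx, fn_sum_apply, ← Finset.sum_add_distrib]
    exact Finset.sum_congr rfl fun i _ => (mul_add _ _ _).symm

variable {μ : Density n M 1} (hμ : IsVolume μ)

theorem dv {u : ℝ → Γ} {u' : Γ} (hu : HasSecVariation C x₀ u u') :
    HasFnVariation x₀ (fun t => C.dv hμ (u t)) (C.dv hμ u') := by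
  obtain ⟨k, δ, r, hr⟩ := exists_orthoFrame_top C x₀
  have hc : ∀ i, HasFnVariation x₀ (fun t => δ i • C.ip (r i) (u t)) (δ i • C.ip (r i) u') :=
    fun i => (hu (r i)).smul (δ i)
  have h := HasFnVariation.sum Finset.univ fun i _ =>
    ((hc i).mul (.const (C.dv hμ (r i)))).add ((hc i).der C (r i))
  have key : ∀ u : ℝ → Γ, ∀ᶠ x in 𝓝 x₀, ∀ t, C.dv hμ (u t) x
      = (∑ i, ((δ i • C.ip (r i) (u t)) * C.dv hμ (r i) + C.der (r i) (δ i • C.ip (r i) (u t)))) x := by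
    intro u
    filter_upwards [(eq_sum hr u).eventually_nhds] with x hx t
    rw [C.dv_congr hμ (hx.mono fun y hy => hy t), C.dv_sum]
    simp only [C.dv_smul]
  refine h.congr ((eventually_prod_right (key u)).mono fun z hz => hz z.1)
    ((key fun _ => u').mono fun x hx => ?_)
  rw [hx 0]
  simp only [mul_zero, add_zero]

theorem der {u : ℝ → Γ} {u' : Γ} {f : ℝ → 𝒜} {f' : 𝒜} (hu : HasSecVariation C x₀ u u')
    (hf : HasFnVariation x₀ f f') :
    HasFnVariation x₀ (fun t => C.der (u t) (f t)) (C.der u' (f 0) + C.der (u 0) f') := by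
  have h := hu.ip (grad hf)
  simpa only [C.ip_grad] using h

/-- In a fixed frame of `E` the bracket is an explicit expression in the coefficients, their first
derivatives and their gradients (`bracket_sum_sum_apply`), all of which have a variation rule. No
continuity of the bracket itself is required. -/
theorem bracket {u v : ℝ → Γ} {u' v' : Γ} (hu : HasSecVariation C x₀ u u')
    (hv : HasSecVariation C x₀ v v') :
    HasSecVariation C x₀ (fun t => C.bracket (u t) (v t)) (C.bracket u' (v 0) + C.bracket (u 0) v') := by
  obtain ⟨k, δ, r, hr⟩ := exists_orthoFrame_top C x₀
  have hc : ∀ (u : ℝ → Γ) (u' : Γ), HasSecVariation C x₀ u u' → ∀ i,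
      HasFnVariation x₀ (fun t => δ i • C.ip (r i) (u t)) (δ i • C.ip (r i) u') :=
    fun u u' hu i => (hu (r i)).smul (δ i)
  have h := HasSecVariation.sum Finset.univ fun i _ => HasSecVariation.sum Finset.univ fun j _ =>
    (((smul_const ((hc u u' hu i).mul (hc v v' hv j)) (C.bracket (r i) (r j))).add
      (smul_const ((hc u u' hu i).mul ((hc v v' hv j).der C (r i))) (r j))).sub
      (smul_const ((hc v v' hv j).mul ((hc u u' hu i).der C (r j))) (r i))).add
      (smul ((hc v v' hv j).mul (.const (C.ip (r i) (r j)))) (grad (C := C) (hc u u' hu i)))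
  have key : ∀ u v : ℝ → Γ, ∀ᶠ x in 𝓝 x₀, ∀ t, C.bracket (u t) (v t) x
      = C.bracket (∑ i, (δ i • C.ip (r i) (u t)) • r i) (∑ i, (δ i • C.ip (r i) (v t)) • r i) x := by
    intro u v
    filter_upwards [(eq_sum hr u).eventually_nhds, (eq_sum hr v).eventually_nhds] with x h1 h2 t
    exact C.bracket_congr (h1.mono fun y hy => hy t) (h2.mono fun y hy => hy t)
  refine h.congr ((eventually_prod_right (key u v)).mono fun z hz => ?_) ?_
  · rw [hz z.1, C.bracket_sum_sum_apply]
  · filter_upwards [key (fun _ => u') v, key u (fun _ => v')] with x h1 h2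
    rw [section_add_apply, h1 0, h2 0, ← section_add_apply]
    congr 1
    rw [C.bracket_sum_sum_apply, C.bracket_sum_sum_apply]
    simp only [← Finset.sum_add_distrib]
    refine Finset.sum_congr rfl fun i _ => Finset.sum_congr rfl fun j _ => ?_
    module

end HasSecVariation

end Courant
end GenRicci

/-! ### Families of generalized pseudometrics and their moving frames -/

namespace GenRicci
section Courant

variable {n : ℕ} {M : Type*} [TopologicalSpace M] [ChartedSpace (EuclideanSpace ℝ (Fin n)) M]
  [IsManifold (𝓡 n) ∞ M] [T2Space M] [SigmaCompactSpace M]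
  {F : Type*} [NormedAddCommGroup F] [NormedSpace ℝ F] [FiniteDimensional ℝ F]
  {E : M → Type*} [TopologicalSpace (Bundle.TotalSpace F E)]
  [∀ x, TopologicalSpace (E x)] [∀ x, AddCommGroup (E x)] [∀ x, Module ℝ (E x)]
  [FiberBundle F E] [VectorBundle ℝ F E] [ContMDiffVectorBundle ∞ F E (𝓡 n)]

local notation "𝒜" => C^∞⟮𝓡 n, M; 𝓘(ℝ, ℝ), ℝ⟯
local notation "Γ" => Cₛ^∞⟮𝓡 n; F, E⟯

/-- In a trivialization the coefficients of `s` are smooth in `(t, x)`, and the frame that they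
multiply does not depend on `t`. -/
theorem contMDiffAt_metric_of_totalSpace (C : CourantAlgebroid n F E) {s : ∀ z : ℝ × M, E z.2}
    {z₀ : ℝ × M}
    (hs : ContMDiffAt (𝓘(ℝ, ℝ).prod (𝓡 n)) ((𝓡 n).prod 𝓘(ℝ, F)) ∞
      (fun z => Bundle.TotalSpace.mk' F z.2 (s z)) z₀) (w : Γ) :
    ContMDiffAt (𝓘(ℝ, ℝ).prod (𝓡 n)) 𝓘(ℝ, ℝ) ∞ (fun z => C.metric z.2 (w z.2) (s z)) z₀ := by
  let t := trivializationAt F E z₀.2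
  have hx₀ : z₀.2 ∈ t.baseSet := FiberBundle.mem_baseSet_trivializationAt F E z₀.2
  let b := Module.finBasis ℝ F
  choose r hr using fun i => exists_section_eventuallyEq (E := E) (F := F) (n := n) (x₀ := z₀.2)
    (s := t.localFrame b i) (by
      filter_upwards [t.open_baseSet.mem_nhds hx₀] with x hx
      exact contMDiffAt_localFrame_of_mem ∞ t b i hx)
  have h1 := (Bundle.contMDiffAt_totalSpace.1 hs).2
  have h2 : ∀ i, ContMDiffAt (𝓘(ℝ, ℝ).prod (𝓡 n)) 𝓘(ℝ, ℝ) ∞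
      (fun z => b.coord i (t ⟨z.2, s z⟩).2) z₀ := fun i =>
    ((LinearMap.toContinuousLinearMap (b.coord i)).contMDiff.contMDiffAt).comp z₀ h1
  have h3 : ContMDiffAt (𝓘(ℝ, ℝ).prod (𝓡 n)) 𝓘(ℝ, ℝ) ∞
      (fun z => ∑ i, b.coord i (t ⟨z.2, s z⟩).2 * C.metric z.2 (w z.2) (r i z.2)) z₀ :=
    ContMDiffAt.sum fun i _ => (h2 i).mul
      (ContMDiffAt.comp (I' := 𝓡 n) z₀ (g := fun x => C.metric x (w x) (r i x)) (f := Prod.snd)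
        (C.metric_smooth w (r i) z₀.2) contMDiffAt_snd)
  refine h3.congr_of_eventuallyEq ?_
  filter_upwards [continuous_snd.continuousAt.eventually
    ((Filter.eventually_all.2 hr).and (t.open_baseSet.mem_nhds hx₀))] with z hz
  obtain ⟨hz, hzb⟩ := hz
  have h4 := (t.basisAt b hzb).sum_repr (s z)
  conv_lhs => rw [← h4]
  simp only [map_sum, map_smul, smul_eq_mul]
  refine Finset.sum_congr rfl fun i _ => ?_
  rw [hz i, t.localFrame_apply_of_mem_baseSet b hzb]
  congr 1

/-- The coefficients in a pseudo-orthonormal frame of `E` are pairings, so the hypothesis controls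
every coordinate of `s`. -/
theorem contMDiffAt_totalSpace_of_metric (C : CourantAlgebroid n F E) {s : ∀ z : ℝ × M, E z.2}
    {z₀ : ℝ × M}
    (hs : ∀ w : Γ, ContMDiffAt (𝓘(ℝ, ℝ).prod (𝓡 n)) 𝓘(ℝ, ℝ) ∞
      (fun z => C.metric z.2 (w z.2) (s z)) z₀) :
    ContMDiffAt (𝓘(ℝ, ℝ).prod (𝓡 n)) ((𝓡 n).prod 𝓘(ℝ, F)) ∞
      (fun z => Bundle.TotalSpace.mk' F z.2 (s z)) z₀ := by
  let t := trivializationAt F E z₀.2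
  have hx₀ : z₀.2 ∈ t.baseSet := FiberBundle.mem_baseSet_trivializationAt F E z₀.2
  obtain ⟨k, δ, r, hr⟩ := exists_orthoFrame_top C z₀.2
  refine Bundle.contMDiffAt_totalSpace.2 ⟨contMDiffAt_snd, ?_⟩
  have h1 : ∀ i, ContMDiffAt (𝓘(ℝ, ℝ).prod (𝓡 n)) 𝓘(ℝ, F) ∞
      (fun z : ℝ × M => (t ⟨z.2, r i z.2⟩).2) z₀ := fun i =>
    ContMDiffAt.comp (I' := 𝓡 n) z₀ (g := fun x => (t ⟨x, r i x⟩).2) (f := Prod.snd)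
      (Bundle.contMDiffAt_totalSpace.1 ((r i).contMDiff z₀.2)).2 contMDiffAt_snd
  have h3 : ContMDiffAt (𝓘(ℝ, ℝ).prod (𝓡 n)) 𝓘(ℝ, F) ∞
      (fun z => ∑ i, (δ i * C.metric z.2 (r i z.2) (s z)) • (t ⟨z.2, r i z.2⟩).2) z₀ :=
    ContMDiffAt.sum fun i _ => (contMDiffAt_const.mul (hs (r i))).smul (h1 i)
  refine h3.congr_of_eventuallyEq ?_
  filter_upwards [continuous_snd.continuousAt.eventually
    (hr.expand.and (t.open_baseSet.mem_nhds hx₀))] with z hz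
  obtain ⟨hz, hzb⟩ := hz
  have h4 : ∀ v : E z.2, (t ⟨z.2, v⟩).2 = t.linearMapAt ℝ z.2 v := fun v => by
    rw [t.coe_linearMapAt_of_mem hzb]
  change (t ⟨z.2, s z⟩).2 = _
  simp only [h4]
  conv_lhs => rw [hz (s z) trivial]
  simp only [map_sum, map_smul]

/-- The calculus of variations is stated for families of global functions; a cutoff extends the
germ, and for `t` outside the chosen neighbourhood the value is set to 0. -/
theorem exists_fnFamily {x₀ : M} {f : ℝ → M → ℝ} (hf : JointSmooth n x₀ f) :
    ∃ g : ℝ → 𝒜, ∀ᶠ z in 𝓝 ((0 : ℝ), x₀), g z.1 z.2 = f z.1 z.2 := by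
  obtain ⟨T, hT, U, hU, hTU⟩ := mem_nhds_prod_iff.1 hf.slice
  obtain ⟨χ, hχ, hχt, -, hχ1⟩ := exists_bump (n := n) hU
  have hsm : ∀ t ∈ T, Smooth n (fun x => χ x * f t x) := fun t ht x => by
    by_cases hx : x ∈ tsupport χ
    · exact (hχ x).mul (hTU (show (t, x) ∈ T ×ˢ U from ⟨ht, hχt.sub hx⟩))
    · have h0 : ∀ᶠ y in 𝓝 x, χ y * f t y = 0 := by
        filter_upwards [(isClosed_tsupport χ).isOpen_compl.mem_nhds hx] with y hy
        rw [image_eq_zero_of_notMem_tsupport hy, zero_mul]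
      exact contMDiffAt_const.congr_of_eventuallyEq h0
  have hex : ∀ t, ∃ g : 𝒜, t ∈ T → ∀ x, g x = χ x * f t x := fun t => by
    by_cases ht : t ∈ T
    · exact ⟨⟨_, hsm t ht⟩, fun _ _ => rfl⟩
    · exact ⟨0, fun h => absurd h ht⟩
  choose g hg using hex
  refine ⟨g, ?_⟩
  filter_upwards [continuous_fst.continuousAt.eventually hT, eventually_prod_right hχ1] with z h1 h2
  rw [hg _ h1, h2, Pi.one_apply, one_mul]

namespace GenPseudometric

variable {C : CourantAlgebroid n F E}

/-- The rank of a projection is its trace, which a frame of `E` expresses through pairings that are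
smooth along a family. -/
theorem finrank_plus_eq_trace (V : GenPseudometric C) {x : M} {k : ℕ} {δ : Fin k → ℝ}
    {r : Fin k → Γ} (hr : IsOrthoFrame C (fun _ => ⊤) x δ r) :
    (Module.finrank ℝ (V.plus x) : ℝ) = ∑ i, δ i * C.metric x (r i x) (V.projAt x (r i x)) := by
  have := finiteDimensional_fiber F E x
  have h1 : LinearMap.IsProj (V.plus x) (V.projAt x) :=
    ⟨V.projAt_mem x, fun _ hu => V.projAt_of_mem hu⟩
  rw [← h1.trace]
  have h2 : V.projAt x = ∑ i, δ i • ((C.metric x (r i x)) ∘ₗ V.projAt x).smulRight (r i x) := by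
    ext v
    conv_lhs => rw [hr.expand.self_of_nhds (V.projAt x v) trivial]
    simp only [LinearMap.sum_apply, LinearMap.smul_apply, LinearMap.smulRight_apply,
      LinearMap.comp_apply, smul_smul]
  conv_lhs => rw [h2]
  simp only [map_sum, map_smul, LinearMap.trace_smulRight, LinearMap.comp_apply, smul_eq_mul]

variable {V : GenPseudometric C} {W : ℝ → GenPseudometric C} {J : Set ℝ} {φ : V.MixedSection}

theorem jointSmooth_projPlus (h0 : (0 : ℝ) ∈ J) (hW : IsSmoothFamily J W) (x₀ : M) (u w : Γ) :
    JointSmooth n x₀ (fun t x => C.metric x (w x) ((W t).projPlus u x)) := by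
  filter_upwards [continuous_fst.continuousAt.eventually (hW.1.mem_nhds h0)] with z hz
  exact contMDiffAt_metric_of_totalSpace C ((hW.2 u z ⟨hz, trivial⟩).contMDiffAt
    ((hW.1.prod isOpen_univ).mem_nhds ⟨hz, trivial⟩)) w

theorem finrank_family_eventually (h0 : (0 : ℝ) ∈ J) (hW : IsSmoothFamily J W) (x₀ : M) :
    ∀ᶠ z in 𝓝 ((0 : ℝ), x₀), Module.finrank ℝ ((W z.1).plus z.2)
      = Module.finrank ℝ ((W 0).plus x₀) := by
  obtain ⟨k, δ, r, hr⟩ := exists_orthoFrame_top C x₀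
  have h1 : ContinuousAt (fun z : ℝ × M =>
      ∑ i, δ i * C.metric z.2 (r i z.2) ((W z.1).projPlus (r i) z.2)) (0, x₀) :=
    tendsto_finsetSum _ fun i _ =>
      ((jointSmooth_projPlus h0 hW x₀ (r i) (r i)).self_of_nhds.continuousAt).const_mul (δ i)
  -- The rank is an integer, so by continuity a deviation less than 1 means none.
  have h2 := h1.eventually (Metric.ball_mem_nhds _ one_pos)
  filter_upwards [h2, eventually_prod_right hr.eventually] with z hz hz'
  have h3 := (W z.1).finrank_plus_eq_trace hz'
  have h4 := (W 0).finrank_plus_eq_trace hr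
  rw [Real.dist_eq] at hz
  change |(∑ i, δ i * C.metric z.2 (r i z.2) ((W z.1).projAt z.2 (r i z.2)))
    - ∑ i, δ i * C.metric x₀ (r i x₀) ((W 0).projAt x₀ (r i x₀))| < 1 at hz
  rw [← h3, ← h4, abs_lt] at hz
  have h5 : Module.finrank ℝ ((W z.1).plus z.2) < Module.finrank ℝ ((W 0).plus x₀) + 1 := by
    rw [← Nat.cast_lt (α := ℝ), Nat.cast_succ]
    linarith [hz.2]
  have h6 : Module.finrank ℝ ((W 0).plus x₀) < Module.finrank ℝ ((W z.1).plus z.2) + 1 := by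
    rw [← Nat.cast_lt (α := ℝ), Nat.cast_succ]
    linarith [hz.1]
  omega

theorem hasSecVariation_projPlus (h0 : (0 : ℝ) ∈ J) (hW : IsSmoothFamily J W)
    (hφ : V.HasVelocity W 0 φ) (x₀ : M) {u : Γ} (hu : V.IsPlus u) :
    HasSecVariation C x₀ (fun t => (W t).projPlus u) (φ.map u) := fun w => by
  refine ⟨jointSmooth_projPlus h0 hW x₀ u w, .of_forall fun x => ?_⟩
  have h := hφ.2 x (u x) (hu x) (w x)
  simp only [C.metric_symm x _ (w x)] at h
  exact h

/-- The frame is projected to `W t` and renormalised by `Φ` of its Gram matrix. Since `φ(e_a)` lies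
in `V₋`, the Gram matrix has derivative zero at `t = 0`; the renormalisation therefore contributes
nothing and the frame moves with velocity exactly `φ(e_a)`. -/
theorem exists_orthoFrame_family (h0 : (0 : ℝ) ∈ J) (hW : IsSmoothFamily J W)
    (hφ : V.HasVelocity W 0 φ) {x₀ : M} {k : ℕ} {ε : Fin k → ℝ} {e : Fin k → Γ}
    (he : IsOrthoFrame C V.plus x₀ ε e) (hep : ∀ i, V.IsPlus (e i)) :
    ∃ e' : Fin k → ℝ → Γ, (∀ a, e' a 0 = e a) ∧
      (∀ a, HasSecVariation C x₀ (e' a) (φ.map (e a))) ∧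
      ∀ᶠ z in 𝓝 ((0 : ℝ), x₀), IsOrthoFrame C (W z.1).plus z.2 ε (fun a => e' a z.1) := by
  obtain ⟨Φ, hΦ1, hΦ, hΦG⟩ := exists_gram_normalization ε he.sq
  have hp : ∀ a, HasSecVariation C x₀ (fun t => (W t).projPlus (e a)) (φ.map (e a)) := fun a =>
    hasSecVariation_projPlus h0 hW hφ x₀ (hep a)
  have hp0 : ∀ a, (W 0).projPlus (e a) = e a := fun a => by
    rw [hφ.1, V.projPlus_of_isPlus (hep a)]
  set G : ℝ → M → Fin k → Fin k → ℝ := fun t x a b =>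
    C.ip ((W t).projPlus (e a)) ((W t).projPlus (e b)) x with hG
  have hGv : ∀ a b, HasFnVariation x₀
      (fun t => C.ip ((W t).projPlus (e a)) ((W t).projPlus (e b))) 0 := fun a b =>
    ((hp a).ip (hp b)).congr_deriv <| by
      rw [hp0, hp0, V.ip_minus_plus (φ.isMinus_map _) (hep b),
        V.ip_plus_minus (hep a) (φ.isMinus_map _), add_zero]
  have hG0 : ∀ᶠ x in 𝓝 x₀, G 0 x = Matrix.diagonal ε := by
    filter_upwards [he.ortho] with x hx
    ext a b
    simp only [hG, hp0, C.ip_apply]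
    rw [hx, Matrix.diagonal_apply]
  have hGs : ∀ᶠ z in 𝓝 ((0 : ℝ), x₀), ContMDiffAt (𝓘(ℝ, ℝ).prod (𝓡 n))
      𝓘(ℝ, Fin k → Fin k → ℝ) ∞ (fun z : ℝ × M => G z.1 z.2) z := by
    filter_upwards [Filter.eventually_all.2 fun a => Filter.eventually_all.2 fun b =>
      (hGv a b).smooth] with z hz
    exact contMDiffAt_pi_space.2 fun a => contMDiffAt_pi_space.2 fun b => hz a b
  have hGt : Filter.Tendsto (fun z : ℝ × M => G z.1 z.2) (𝓝 (0, x₀)) (𝓝 (Matrix.diagonal ε)) := by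
    have h := hGs.self_of_nhds.continuousAt
    rw [ContinuousAt, hG0.self_of_nhds] at h
    exact h
  have hA : ∀ a b, JointSmooth n x₀ (fun t x => Φ (G t x) a b) := fun a b => by
    filter_upwards [hGs, hGt.eventually hΦ] with z h1 h2
    have h3 : ContMDiffAt (𝓘(ℝ, ℝ).prod (𝓡 n)) 𝓘(ℝ, Fin k → Fin k → ℝ) ∞
        (fun z : ℝ × M => Φ (G z.1 z.2)) z :=
      ContMDiffAt.comp z (g := Φ) (contMDiffAt_iff_contDiffAt.2 h2) h1
    exact contMDiffAt_pi_space.1 (contMDiffAt_pi_space.1 h3 a) b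
  choose g hg using fun a b => exists_fnFamily (hA a b)
  have hgv : ∀ a b, HasFnVariation x₀ (g a b) 0 := fun a b => by
    refine ⟨(hA a b).congr (hg a b), ?_⟩
    filter_upwards [hG0, eventually_slice_right (p := fun t x => g a b t x = Φ (G t x) a b) (hg a b),
      Filter.eventually_all.2 fun a => Filter.eventually_all.2 fun b => (hGv a b).deriv]
      with x h1 h2 h3
    have h4 : HasDerivAt (fun t => G t x) 0 0 :=
      hasDerivAt_pi.2 fun a => hasDerivAt_pi.2 fun b => h3 a b
    have h5 : HasFDerivAt Φ (fderiv ℝ Φ (G 0 x)) (G 0 x) := by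
      rw [h1]
      exact (hΦ.self_of_nhds.differentiableAt (by simp)).hasFDerivAt
    have h6 := h5.comp_hasDerivAt (0 : ℝ) h4
    rw [map_zero] at h6
    exact (hasDerivAt_pi.1 (hasDerivAt_pi.1 h6 a) b).congr_of_eventuallyEq h2
  have hg0 : ∀ᶠ x in 𝓝 x₀, ∀ a b, g a b 0 x = if a = b then 1 else 0 := by
    filter_upwards [hG0, Filter.eventually_all.2 fun a => Filter.eventually_all.2 fun b =>
      (Continuous.prodMk_right (0 : ℝ)).continuousAt.eventually (hg a b)] with x h1 h2 a b
    rw [h2 a b, h1, hΦ1, Matrix.one_apply]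
  set e₁ : Fin k → ℝ → Γ := fun a t => ∑ b, g a b t • (W t).projPlus (e b) with he₁
  have he₁0 : ∀ᶠ x in 𝓝 x₀, ∀ a, e₁ a 0 x = e a x := by
    filter_upwards [hg0] with x hx a
    simp [he₁, section_sum_apply, section_smul_apply, hx, hp0]
  -- At `t = 0` the family agrees with `e` only near `x₀`. Overwriting this one value makes the
  -- agreement global and does not change the family near `(0, x₀)`.
  set e' : Fin k → ℝ → Γ := fun a => Function.update (e₁ a) 0 (e a) with he'
  have heq : ∀ᶠ z in 𝓝 ((0 : ℝ), x₀), ∀ a, e' a z.1 z.2 = e₁ a z.1 z.2 := by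
    filter_upwards [eventually_prod_right he₁0] with z hz a
    by_cases hz0 : z.1 = 0
    · rw [he', hz0]
      simp only [Function.update_self]
      exact (hz a).symm
    · rw [he']
      simp only [Function.update_of_ne hz0]
  refine ⟨e', fun a => Function.update_self _ _ _, fun a => ?_, ?_⟩
  · refine (HasSecVariation.sum Finset.univ fun b _ =>
      HasSecVariation.smul (hgv a b) (hp b)).congr (heq.mono fun z hz => hz a) ?_
    filter_upwards [hg0] with x hx
    simp [section_sum_apply, section_smul_apply, hx]
  · have hortho : ∀ᶠ z in 𝓝 ((0 : ℝ), x₀), ∀ i j,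
        C.metric z.2 (e' i z.1 z.2) (e' j z.1 z.2) = if i = j then ε i else 0 := by
      filter_upwards [heq, hGt.eventually hΦG, Filter.eventually_all.2 fun a =>
        Filter.eventually_all.2 fun b => hg a b] with z h1 h2 h3 i j
      rw [← h2 (fun i j => C.metric_symm _ _ _) i j, h1, h1]
      simp only [he₁, section_sum_apply, section_smul_apply, map_sum, map_smul, LinearMap.sum_apply,
        LinearMap.smul_apply, smul_eq_mul, h3]
      rw [Finset.sum_comm]
      refine Finset.sum_congr rfl fun a _ => ?_
      rw [Finset.mul_sum]
      refine Finset.sum_congr rfl fun b _ => ?_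
      simp only [hG, C.ip_apply]
      ring
    have hmem : ∀ᶠ z in 𝓝 ((0 : ℝ), x₀), ∀ i, e' i z.1 z.2 ∈ (W z.1).plus z.2 := by
      filter_upwards [heq] with z h1 i
      rw [h1, he₁, section_sum_apply]
      exact Submodule.sum_mem _ fun b _ => Submodule.smul_mem _ _ ((W z.1).isPlus_projPlus _ _)
    have hrank : ∀ᶠ z in 𝓝 ((0 : ℝ), x₀), Module.finrank ℝ ((W z.1).plus z.2) = k := by
      have h1 : Module.finrank ℝ ((W 0).plus x₀) = k := by
        rw [hφ.1, ← he.span_eq, finrank_span_eq_card he.linearIndependent, Fintype.card_fin]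
      simpa only [h1] using finrank_family_eventually h0 hW x₀
    filter_upwards [eventually_slice (p := fun t x => ∀ i, e' i t x ∈ (W t).plus x) hmem,
      eventually_slice (p := fun t x => ∀ i j, C.metric x (e' i t x) (e' j t x)
        = if i = j then ε i else 0) hortho,
      eventually_slice (p := fun t x => Module.finrank ℝ ((W t).plus x) = k) hrank] with z h1 h2 h3
    exact .of_finrank he.sq h1 h2 h3

end GenPseudometric
end Courant
end GenRicci

/-! ### The first variation of the potential -/

namespace GenRicci
section Courant

variable {n : ℕ} {M : Type*} [TopologicalSpace M] [ChartedSpace (EuclideanSpace ℝ (Fin n)) M]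
  [IsManifold (𝓡 n) ∞ M] [T2Space M] [SigmaCompactSpace M]
  {F : Type*} [NormedAddCommGroup F] [NormedSpace ℝ F] [FiniteDimensional ℝ F]
  {E : M → Type*} [TopologicalSpace (Bundle.TotalSpace F E)]
  [∀ x, TopologicalSpace (E x)] [∀ x, AddCommGroup (E x)] [∀ x, Module ℝ (E x)]
  [FiberBundle F E] [VectorBundle ℝ F E] [ContMDiffVectorBundle ∞ F E (𝓡 n)]

local notation "𝒜" => C^∞⟮𝓡 n, M; 𝓘(ℝ, ℝ), ℝ⟯
local notation "Γ" => Cₛ^∞⟮𝓡 n; F, E⟯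

/-- `T` is totally antisymmetric, so all relabelled sums of `T S` coincide. The bracket with factor
`1/2` contains four of them and the one with factor `1/3` contains six, so they cancel and only `Q`
survives. -/
theorem sum_quadratic_variation {k : ℕ} (ε : Fin k → ℝ) (T S : Fin k → Fin k → Fin k → ℝ)
    (Q : Fin k → Fin k → ℝ) (hT1 : ∀ c a b, T c a b = -T c b a) (hT2 : ∀ c a b, T c a b = -T b a c) :
    ∑ a, ∑ b, ε a * ε b * (1 / 2 * (((∑ c, ε c * (T c a b * S a b c) + Q a b)
        + (∑ c, ε c * (T c b a * S b a c) + Q b a))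
        + ((∑ c, ε c * (T c a b * S a b c) + Q a b)
        + (∑ c, ε c * (T c b a * S b a c) + Q b a)))
      - 1 / 3 * ∑ c, ε c * ((S c a b + (S a b c + S b c a)) * T c a b
        + T c a b * (S c a b + (S a b c + S b c a))))
      = 2 * ∑ a, ∑ b, ε a * ε b * Q a b := by
  set G : Fin k → Fin k → Fin k → ℝ := fun a b c => ε a * ε b * ε c * (T a b c * S a b c) with hG
  have hcyc : ∀ a b c, T c a b = T a b c := fun a b c => by rw [hT2 c a b, hT1 b a c, neg_neg, hT2, hT1, neg_neg]
  have h1 : ∑ a, ∑ b, ∑ c, G b a c = ∑ a, ∑ b, ∑ c, G a b c := Finset.sum_comm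
  have h2 : ∑ a, ∑ b, ∑ c, G c a b = ∑ a, ∑ b, ∑ c, G a b c :=
    (Finset.sum_congr rfl fun a _ => Finset.sum_comm).trans Finset.sum_comm
  have h3 : ∑ a, ∑ b, ∑ c, G b c a = ∑ a, ∑ b, ∑ c, G a b c :=
    Finset.sum_comm.trans (Finset.sum_congr rfl fun a _ => Finset.sum_comm)
  have h4 : ∑ a, ∑ b, ε a * ε b * Q b a = ∑ a, ∑ b, ε a * ε b * Q a b := by
    rw [Finset.sum_comm]
    exact Finset.sum_congr rfl fun a _ => Finset.sum_congr rfl fun b _ => by ring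
  have h5 : ∀ a b, ε a * ε b * (1 / 2 * (((∑ c, ε c * (T c a b * S a b c) + Q a b)
        + (∑ c, ε c * (T c b a * S b a c) + Q b a))
        + ((∑ c, ε c * (T c a b * S a b c) + Q a b)
        + (∑ c, ε c * (T c b a * S b a c) + Q b a)))
      - 1 / 3 * ∑ c, ε c * ((S c a b + (S a b c + S b c a)) * T c a b
        + T c a b * (S c a b + (S a b c + S b c a))))
      = (∑ c, G a b c + ∑ c, G b a c) + (ε a * ε b * Q a b + ε a * ε b * Q b a)
        - 2 / 3 * (∑ c, G c a b + (∑ c, G a b c + ∑ c, G b c a)) := fun a b => by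
    have h6 : ∑ c, G a b c = ε a * ε b * ∑ c, ε c * (T c a b * S a b c) := by
      rw [Finset.mul_sum]
      exact Finset.sum_congr rfl fun c _ => by rw [hcyc a b c]; simp only [hG]; ring
    have h7 : ∑ c, G b a c = ε a * ε b * ∑ c, ε c * (T c b a * S b a c) := by
      rw [Finset.mul_sum]
      exact Finset.sum_congr rfl fun c _ => by rw [hcyc b a c]; simp only [hG]; ring
    have h8 : ε a * ε b * ∑ c, ε c * ((S c a b + (S a b c + S b c a)) * T c a b
        + T c a b * (S c a b + (S a b c + S b c a)))
        = 2 * (∑ c, G c a b + (∑ c, G a b c + ∑ c, G b c a)) := by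
      rw [← Finset.sum_add_distrib, ← Finset.sum_add_distrib, Finset.mul_sum, Finset.mul_sum]
      refine Finset.sum_congr rfl fun c _ => ?_
      simp only [hG]
      rw [hcyc a b c, hcyc b c a]
      ring
    rw [h6] at h8 ⊢
    rw [h7]
    linear_combination -(1 / 3) * h8
  simp only [h5, Finset.sum_sub_distrib, Finset.sum_add_distrib, ← Finset.mul_sum, h1, h2, h3, h4]
  ring

namespace GenPseudometric

variable {C : CourantAlgebroid n F E} {μ : Density n M 1} (hμ : IsVolume μ) {k : ℕ}

variable (C) in
/-- The potential term of the Laplacian as an expression in an orthonormal frame of `V₊`. -/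
def scalFn (ε : Fin k → ℝ) (e : Fin k → Γ) : 𝒜 :=
  ∑ a, ε a • ((2 : ℝ) • C.der (e a) (C.dv hμ (e a)) + C.dv hμ (e a) * C.dv hμ (e a))
    - ∑ a, ∑ b, (ε a * ε b) • ((1 / 2 : ℝ) • C.ip (C.bracket (e a) (e b)) (C.bracket (e a) (e b))
      - (1 / 3 : ℝ) • ∑ c, ε c • (C.ip (e c) (C.bracket (e a) (e b))
        * C.ip (e c) (C.bracket (e a) (e b))))

/-- The projection is replaced by components along the frame, so that only operations with a
variation rule occur. -/
theorem scal_eq_scalFn {V : GenPseudometric C} {x : M} {ε : Fin k → ℝ} {e : Fin k → Γ}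
    (he : IsOrthoFrame C V.plus x ε e) : V.scal hμ ε e x = scalFn C hμ ε e x := by
  simp only [scal_apply, scalFn, fn_sub_apply, fn_sum_apply, fn_smul_apply, fn_add_apply,
    fn_mul_apply, C.ip_apply, V.metric_projAt_eq_sum he, sq]

variable (C) in
/-- The derivative of `scalFn` when the velocity of the frame is `u`. -/
def scalFnDeriv (ε : Fin k → ℝ) (e u : Fin k → Γ) : 𝒜 :=
  ∑ a, ε a • ((2 : ℝ) • (C.der (u a) (C.dv hμ (e a)) + C.der (e a) (C.dv hμ (u a)))
      + (C.dv hμ (u a) * C.dv hμ (e a) + C.dv hμ (e a) * C.dv hμ (u a)))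
    - ∑ a, ∑ b, (ε a * ε b) • ((1 / 2 : ℝ) •
        (C.ip (C.bracket (u a) (e b) + C.bracket (e a) (u b)) (C.bracket (e a) (e b))
          + C.ip (C.bracket (e a) (e b)) (C.bracket (u a) (e b) + C.bracket (e a) (u b)))
      - (1 / 3 : ℝ) • ∑ c, ε c • (
        (C.ip (u c) (C.bracket (e a) (e b))
            + C.ip (e c) (C.bracket (u a) (e b) + C.bracket (e a) (u b)))
          * C.ip (e c) (C.bracket (e a) (e b))
        + C.ip (e c) (C.bracket (e a) (e b)) * (C.ip (u c) (C.bracket (e a) (e b))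
            + C.ip (e c) (C.bracket (u a) (e b) + C.bracket (e a) (u b)))))

theorem hasFnVariation_scalFn {x₀ : M} (ε : Fin k → ℝ) {e : Fin k → ℝ → Γ} {u : Fin k → Γ}
    (he : ∀ a, HasSecVariation C x₀ (e a) (u a)) :
    HasFnVariation x₀ (fun t => scalFn C hμ ε (fun a => e a t))
      (scalFnDeriv C hμ ε (fun a => e a 0) u) := by
  refine HasFnVariation.sub (.sum _ fun a _ => ?_) (.sum _ fun a _ => .sum _ fun b _ => ?_)
  · have h := (he a).dv hμ
    exact ((((he a).der h).smul 2).add (h.mul h)).smul (ε a)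
  · have h := (he a).bracket (he b)
    refine (((h.ip h).smul (1 / 2)).sub (HasFnVariation.smul (1 / 3) (.sum _ fun c _ => ?_))).smul _
    exact (((he c).ip h).mul ((he c).ip h)).smul (ε c)

variable {V : GenPseudometric C} (φ : V.MixedSection)

/-- The section whose divergence is the difference of the two first variations. -/
def divSection (ε : Fin k → ℝ) (e : Fin k → Γ) : Γ :=
  ∑ a, ε a • (V.projPlus (C.bracket (φ.map (e a)) (e a)) + C.dv hμ (φ.map (e a)) • e a)

theorem dv_const_smul' (c : ℝ) (u : Γ) : C.dv hμ (c • u) = c • C.dv hμ u := by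
  have h := C.dv_smul hμ (algebraMap ℝ 𝒜 c) u
  rwa [C.der_const, add_zero, ← Algebra.smul_def, algebraMap_smul] at h

/-- The heart of the first variation. With `u_a = φ(e_a)` the brackets contribute `-2 Σ ε_a ε_b Q a
b`, by `sum_quadratic_variation`, and the traces in the Ricci tensor contribute the opposite. The
divergence terms combine to `2 Σ ε_a (div [u_a, e_a]₊ + div u_a div e_a + e_a · div u_a)`, a total
divergence. -/
theorem scalFnDeriv_add_ricFn {x : M} {ε : Fin k → ℝ} {e : Fin k → Γ}
    (he : IsOrthoFrame C V.plus x ε e) (hep : ∀ i, V.IsPlus (e i)) :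
    scalFnDeriv C hμ ε e (fun a => φ.map (e a)) x
      + 2 * ∑ a, ε a * V.ricFn hμ ε e (e a) (φ.map (e a)) x
      = 2 * C.dv hμ (divSection hμ φ ε e) x := by
  set u : Fin k → Γ := fun a => φ.map (e a) with hu
  have hum : ∀ a, V.IsMinus (u a) := fun a => φ.isMinus_map _
  have hue : ∀ a b, C.ip (u a) (e b) = 0 := fun a b => V.ip_minus_plus (hum a) (hep b)
  have heu : ∀ a b, C.ip (e a) (u b) = 0 := fun a b => V.ip_plus_minus (hep a) (hum b)
  have hanti : ∀ a b, C.bracket (e a) (e b) x = -C.bracket (e b) (e a) x := fun a b =>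
    C.bracket_antisymm_of_const (he.ortho.mono fun y hy => hy a b)
  set T : Fin k → Fin k → Fin k → ℝ := fun c a b => C.ip (e c) (C.bracket (e a) (e b)) x with hT
  set S : Fin k → Fin k → Fin k → ℝ := fun c a b => C.ip (u c) (C.bracket (e a) (e b)) x with hS
  set Q : Fin k → Fin k → ℝ := fun a b =>
    C.ip (V.projMinus (C.bracket (e a) (e b))) (C.bracket (u a) (e b)) x with hQ
  have hT1 : ∀ c a b, T c a b = -T c b a := fun c a b => by
    simp only [hT, C.ip_apply, hanti a b, map_neg]
  have hT2 : ∀ c a b, T c a b = -T b a c := fun c a b =>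
    C.ip_bracket_of_const (he.ortho.mono fun y hy => hy b c)
  have hS1 : ∀ c a b, S c a b = -S c b a := fun c a b => by
    simp only [hS, C.ip_apply, hanti a b, map_neg]
  have hub : ∀ a b, C.bracket (u a) (e b) = -C.bracket (e b) (u a) := fun a b =>
    bracket_eq_neg_of_ip (hue a b)
  have h1 : ∀ c a b, C.ip (e c) (C.bracket (u a) (e b)) x = S a b c := fun c a b => by
    rw [hub, map_neg, ip_bracket_of_ip (hue a c), neg_neg]
  have h2 : ∀ c a b, C.ip (e c) (C.bracket (e a) (u b)) x = S b c a := fun c a b => by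
    rw [ip_bracket_of_ip (hue b c), hS1]
    rfl
  have h3 : ∀ a b, C.ip (C.bracket (e a) (e b)) (C.bracket (u a) (e b)) x
      = ∑ c, ε c * (T c a b * S a b c) + Q a b := fun a b => by
    have h4 : C.bracket (e a) (e b) = V.projPlus (C.bracket (e a) (e b))
        + V.projMinus (C.bracket (e a) (e b)) := by rw [projMinus]; abel
    have h5 : C.ip (V.projPlus (C.bracket (e a) (e b))) (C.bracket (u a) (e b)) x
        = ∑ c, ε c * (T c a b * S a b c) := by
      refine (V.metric_projAt_eq_sum he _ _).trans (Finset.sum_congr rfl fun c _ => ?_)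
      rw [← h1]
      rfl
    conv_lhs => rw [h4]
    rw [map_add, LinearMap.add_apply, fn_add_apply, h5]
  have h4 : ∀ a b, C.ip (C.bracket (e a) (e b)) (C.bracket (e a) (u b)) x
      = C.ip (C.bracket (e b) (e a)) (C.bracket (u b) (e a)) x := fun a b => by
    rw [hub, map_neg]
    simp only [C.ip_apply, hanti a b, map_neg, LinearMap.neg_apply]
    rfl
  have h5 : ∀ a c, C.ip (V.projMinus (C.bracket (e c) (u a))) (C.bracket (e a) (e c)) x
      = -Q a c := fun a c => by
    have h6 : C.bracket (e c) (u a) = -C.bracket (u a) (e c) := bracket_eq_neg_of_ip (heu c a)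
    rw [V.ip_projMinus_comm, h6, map_neg, LinearMap.neg_apply, C.ip_comm]
    rfl
  have hquad := sum_quadratic_variation ε T S Q hT1 hT2
  have hsw : ∀ a b, C.ip (C.bracket (u a) (e b)) (C.bracket (e a) (e b)) x
      = ∑ c, ε c * (T c a b * S a b c) + Q a b := fun a b => by rw [C.ip_comm, h3]
  have hsw' : ∀ a b, C.ip (C.bracket (e a) (u b)) (C.bracket (e a) (e b)) x
      = ∑ c, ε c * (T c b a * S b a c) + Q b a := fun a b => by rw [C.ip_comm, h4, h3]
  have hdv : C.dv hμ (divSection hμ φ ε e) x = ∑ a, ε a * (C.dv hμ (V.projPlus (C.bracket (u a) (e a))) x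
      + (C.dv hμ (u a) x * C.dv hμ (e a) x + C.der (e a) (C.dv hμ (u a)) x)) := by
    simp only [divSection, C.dv_sum, dv_const_smul', C.dv_add, C.dv_smul, fn_sum_apply,
      fn_smul_apply, fn_add_apply, fn_mul_apply, hu]
  have hric : ∀ a, V.ricFn hμ ε e (e a) (u a) x = C.dv hμ (V.projPlus (C.bracket (u a) (e a))) x
      - C.der (u a) (C.dv hμ (e a)) x + ∑ c, ε c * Q a c := fun a => by
    simp only [ricFn, fn_sub_apply, fn_sum_apply, fn_smul_apply, h5, mul_neg,
      Finset.sum_neg_distrib, sub_neg_eq_add]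
  have hsF : scalFnDeriv C hμ ε e u x
      = ∑ a, ε a * (2 * (C.der (u a) (C.dv hμ (e a)) x + C.der (e a) (C.dv hμ (u a)) x)
          + (C.dv hμ (u a) x * C.dv hμ (e a) x + C.dv hμ (e a) x * C.dv hμ (u a) x))
        - 2 * ∑ a, ∑ b, ε a * ε b * Q a b := by
    rw [← hquad]
    simp only [scalFnDeriv, fn_sub_apply, fn_sum_apply, fn_smul_apply, fn_add_apply, fn_mul_apply,
      map_add, LinearMap.add_apply, h3, h4, hsw, hsw', h1, h2]
    rfl
  change scalFnDeriv C hμ ε e u x + 2 * ∑ a, ε a * V.ricFn hμ ε e (e a) (u a) x = _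
  rw [hsF, hdv, Finset.mul_sum, Finset.mul_sum, Finset.mul_sum]
  rw [sub_add_eq_add_sub, ← Finset.sum_add_distrib, ← Finset.sum_sub_distrib]
  refine Finset.sum_congr rfl fun a _ => ?_
  have h7 : ∑ b, ε a * ε b * Q a b = ε a * ∑ c, ε c * Q a c := by
    rw [Finset.mul_sum]
    exact Finset.sum_congr rfl fun c _ => by ring
  rw [hric, h7]
  ring

theorem MixedSection.map_eq_sum {x : M} {ε : Fin k → ℝ} {e : Fin k → Γ}
    (he : IsOrthoFrame C V.plus x ε e) {p : Γ} (hp : V.IsPlus p) :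
    ∀ᶠ y in 𝓝 x, φ.map p y = (∑ a, (ε a • C.ip (e a) p) • φ.map (e a)) y := by
  filter_upwards [he.expand] with y hy
  rw [section_sum_apply, φ.map_apply]
  conv_lhs => rw [hy _ (hp y)]
  rw [map_sum]
  exact Finset.sum_congr rfl fun a _ => map_smul _ _ _

/-- The trace over `V₊` of `a ↦ [φ a, p]`. -/
def traceBracket (ε : Fin k → ℝ) (e : Fin k → Γ) (p : Γ) : 𝒜 :=
  ∑ a, ε a • C.ip (e a) (C.bracket (φ.map (e a)) p)

/-- Derivatives of the transition coefficients appear only next to `⟨f_i, φ e_a⟩` or `⟨φ e_a, p⟩`,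
which vanish because `φ` takes values in `V₋`. -/
theorem traceBracket_eq {l : ℕ} {x : M} {ε : Fin k → ℝ} {e : Fin k → Γ} {δ : Fin l → ℝ}
    {f : Fin l → Γ} (he : IsOrthoFrame C V.plus x ε e) (hep : ∀ i, V.IsPlus (e i))
    (hf : IsOrthoFrame C V.plus x δ f) (hfp : ∀ i, V.IsPlus (f i)) {p : Γ} (hp : V.IsPlus p) :
    traceBracket φ δ f p x = traceBracket φ ε e p x := by
  have h1 : ∀ i, C.ip (f i) (C.bracket (φ.map (f i)) p) x
      = ∑ a, ε a * C.metric x (e a x) (f i x) * C.metric x (f i x) (C.bracket (φ.map (e a)) p x) := by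
    intro i
    rw [C.ip_apply, C.bracket_congr_left p (φ.map_eq_sum he (hfp i)), map_sum, LinearMap.sum_apply,
      section_sum_apply, map_sum]
    refine Finset.sum_congr rfl fun a _ => ?_
    have h2 := congrArg (fun g : 𝒜 => g x) (congrArg (C.ip (f i))
      (C.smul_bracket (φ.map (e a)) p (ε a • C.ip (e a) (f i))))
    simp only [map_sub, map_smul, V.ip_plus_minus (hfp i) (φ.isMinus_map _),
      V.ip_minus_plus (φ.isMinus_map _) hp, zero_smul, smul_zero, sub_zero, add_zero] at h2
    exact h2
  have h3 : ∀ a, C.metric x (e a x) (C.bracket (φ.map (e a)) p x)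
      = ∑ i, δ i * (C.metric x (e a x) (f i x) * C.metric x (f i x) (C.bracket (φ.map (e a)) p x)) := by
    intro a
    conv_lhs => rw [hf.expand.self_of_nhds _ (hep a x)]
    simp only [map_sum, map_smul, LinearMap.sum_apply, LinearMap.smul_apply, smul_eq_mul]
    exact Finset.sum_congr rfl fun i _ => by rw [C.metric_symm x (f i x) (e a x)]; ring
  simp only [traceBracket, fn_sum_apply, fn_smul_apply, h1, C.ip_apply, h3, Finset.mul_sum]
  rw [Finset.sum_comm]
  exact Finset.sum_congr rfl fun a _ => Finset.sum_congr rfl fun i _ => by ring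

/-- On the right-hand side the frame enters only through `traceBracket`, which does not depend on
it. This makes visible that `divSection` is independent of the frame. -/
theorem ip_divSection {x : M} {ε : Fin k → ℝ} {e : Fin k → Γ}
    (he : IsOrthoFrame C V.plus x ε e) (hep : ∀ i, V.IsPlus (e i)) (w : Γ) :
    C.ip w (divSection hμ φ ε e) x = C.dv hμ (φ.map (V.projPlus w)) x
      - traceBracket φ ε e (V.projPlus w) x := by
  set p := V.projPlus w with hp
  have hpp : V.IsPlus p := V.isPlus_projPlus w
  have h1 : ∀ a, C.ip w (e a) = C.ip (e a) p := fun a => by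
    rw [hp, V.ip_projPlus_left (hep a), C.ip_comm]
  have h2 : ∀ a, C.ip w (V.projPlus (C.bracket (φ.map (e a)) (e a)))
      = C.ip (C.bracket (φ.map (e a)) (e a)) p := fun a => by
    rw [C.ip_comm, ← V.ip_projPlus_left (V.isPlus_projPlus _), C.ip_comm,
      V.ip_projPlus_left hpp, C.ip_comm]
  rw [C.dv_congr hμ (φ.map_eq_sum he hpp), C.dv_sum]
  simp only [divSection, traceBracket, map_sum, map_add, map_smul, LinearMap.map_smul_of_tower, h1,
    h2, C.dv_smul, C.der_const_smul, C.der_ip, fn_sum_apply, fn_add_apply, fn_mul_apply,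
    fn_smul_apply, smul_eq_mul]
  rw [← Finset.sum_sub_distrib]
  exact Finset.sum_congr rfl fun a _ => by ring

/-- The local sections `divSection` fit together. -/
theorem exists_divSection : ∃ Z : Γ, (∀ {x : M} {k : ℕ} {ε : Fin k → ℝ} {e : Fin k → Γ},
    IsOrthoFrame C V.plus x ε e → (∀ i, V.IsPlus (e i)) → ∀ᶠ y in 𝓝 x, Z y = divSection hμ φ ε e y) := by
  choose k ε e he hep using V.exists_orthoFrame_plus
  have h1 : ∀ {x : M} {l : ℕ} {δ : Fin l → ℝ} {f : Fin l → Γ}, IsOrthoFrame C V.plus x δ f →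
      (∀ i, V.IsPlus (f i)) → divSection hμ φ (ε x) (e x) x = divSection hμ φ δ f x := by
    intro x l δ f hf hfp
    refine C.eq_of_ip fun w => ?_
    have h2 := ip_divSection hμ φ (he x) (hep x) w
    rw [← traceBracket_eq φ (he x) (hep x) hf hfp (V.isPlus_projPlus w),
      ← ip_divSection hμ φ hf hfp w] at h2
    exact h2
  have h2 : ∀ {x : M} {l : ℕ} {δ : Fin l → ℝ} {f : Fin l → Γ}, IsOrthoFrame C V.plus x δ f →
      (∀ i, V.IsPlus (f i)) →
      ∀ᶠ y in 𝓝 x, divSection hμ φ (ε y) (e y) y = divSection hμ φ δ f y := fun hf hfp =>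
    hf.eventually.mono fun y hy => h1 hy hfp
  refine ⟨⟨fun x => divSection hμ φ (ε x) (e x) x, fun x => ?_⟩, h2⟩
  refine ((divSection hμ φ (ε x) (e x)).contMDiff x).congr_of_eventuallyEq ?_
  filter_upwards [h2 (he x) (hep x)] with y hy
  rw [hy]

end GenPseudometric
end Courant
end GenRicci

/-! ### The first variation of the action in `V₊` -/

namespace GenRicci
section Courant

variable {n : ℕ} {M : Type*} [TopologicalSpace M] [ChartedSpace (EuclideanSpace ℝ (Fin n)) M]
  [IsManifold (𝓡 n) ∞ M] [T2Space M] [SigmaCompactSpace M]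
  {F : Type*} [NormedAddCommGroup F] [NormedSpace ℝ F] [FiniteDimensional ℝ F]
  {E : M → Type*} [TopologicalSpace (Bundle.TotalSpace F E)]
  [∀ x, TopologicalSpace (E x)] [∀ x, AddCommGroup (E x)] [∀ x, Module ℝ (E x)]
  [FiberBundle F E] [VectorBundle ℝ F E] [ContMDiffVectorBundle ∞ F E (𝓡 n)]

local notation "𝒜" => C^∞⟮𝓡 n, M; 𝓘(ℝ, ℝ), ℝ⟯
local notation "Γ" => Cₛ^∞⟮𝓡 n; F, E⟯

theorem exists_cutoff {K : Set M} (hK : IsCompact K) :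
    ∃ χ : 𝒜, HasCompactSupport χ ∧ ∀ x ∈ K, ∀ᶠ y in 𝓝 x, χ y = 1 := by
  have := ChartedSpace.locallyCompactSpace (EuclideanSpace ℝ (Fin n)) M
  obtain ⟨K', hK', hKK'⟩ := exists_compact_superset hK
  obtain ⟨χ, h1, h0, -⟩ := exists_contMDiffMap_one_nhds_of_subset_interior (𝓡 n)
    (n := (⊤ : ℕ∞))
    hK.isClosed hKK'
  exact ⟨χ, HasCompactSupport.intro hK' h0, fun x hx => Filter.eventually_of_mem
    (nhds_le_nhdsSet hx h1) fun y hy => hy⟩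

theorem hasCompactSupport_of_eq_zero {K : Set M} (hK : IsCompact K) {f : M → ℝ}
    (h : ∀ x ∉ K, f x = 0) : HasCompactSupport f := HasCompactSupport.intro hK h

/-- For a cutoff `χ` equal to 1 near `K` one has `div Z = χ div Z + Z · χ`, which integration by
parts makes zero. -/
theorem CourantAlgebroid.integral_dv (C : CourantAlgebroid n F E) {μ : Density n M 1}
    (hμ : IsVolume μ) {K : Set M} (hK : IsCompact K) {Z : Γ} (hZ : ∀ x ∉ K, Z x = 0) :
    integral (fun x => C.dv hμ Z x • μ x) = 0 := by
  obtain ⟨χ, hχ, h1⟩ := exists_cutoff (n := n) hK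
  have h2 := hμ.integral_fieldDiv (C.anchor_smooth Z) χ.contMDiff hχ
  refine Eq.trans ?_ h2
  congr 1
  funext x
  congr 1
  by_cases hx : x ∈ K
  · have h3 : C.der Z χ x = 0 := C.der_eq_zero_of_eventually_const Z (h1 x hx)
    have h4 : χ x = 1 := (h1 x hx).self_of_nhds
    change C.dv hμ Z x = χ x * C.dv hμ Z x + C.der Z χ x
    rw [h3, h4, one_mul, add_zero]
  · have h3 : C.der Z χ x = 0 := by
      rw [C.der_apply_congr (v := 0) χ (hZ x hx), map_zero]
      rfl
    have h4 : C.dv hμ Z x = 0 := by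
      rw [C.dv_congr hμ (v := 0) (Filter.eventually_of_mem (hK.isClosed.isOpen_compl.mem_nhds hx)
        fun y hy => hZ y hy), C.dv_zero]
      rfl
    change C.dv hμ Z x = χ x * C.dv hμ Z x + C.der Z χ x
    rw [h3, h4, mul_zero, add_zero]

namespace GenPseudometric

variable {C : CourantAlgebroid n F E} {V : GenPseudometric C} {σ : Density n M (1 / 2)}

/-- Locally `φ = Σ ε_a e_a ⊗ φ(e_a)`, so the coefficient of `σ²` is the smooth function `Σ ε_a
GRic(e_a, φ e_a)`. -/
theorem ricciDensity_eq_pair (hσ : IsSmoothDensity σ) (hσ₀ : NowhereVanishing σ)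
    (φ : V.MixedSection) : ∃ h : 𝒜, (∀ x, V.ricciDensity σ φ x = h x • mulHalf σ σ x) ∧
      (∀ x, φ.toFun x = 0 → h x = 0) ∧
      ∀ {x : M} {k : ℕ} {ε : Fin k → ℝ} {e : Fin k → Γ}, IsOrthoFrame C V.plus x ε e →
        (∀ i, V.IsPlus (e i)) →
        h x = ∑ a, ε a * V.ricFn (isVolume_mulHalf hσ hσ₀) ε e (e a) (φ.map (e a)) x := by
  have h1 : ∀ {x : M} {k : ℕ} {ε : Fin k → ℝ} {e : Fin k → Γ}, IsOrthoFrame C V.plus x ε e →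
      (∀ i, V.IsPlus (e i)) → TensorProduct.lift (V.ricciAt σ x) (φ.toFun x)
        = ∑ a, ε a * V.ricFn (isVolume_mulHalf hσ hσ₀) ε e (e a) (φ.map (e a)) x := by
    intro x k ε e he hep
    rw [lift_eq_sum he hep]
    refine Finset.sum_congr rfl fun a _ => ?_
    rw [← ricci_eq_ricFn hσ hσ₀ he hep (hep a) (φ.isMinus_map _),
      ← V.ricciAt_apply hσ hσ₀ (hep a) (φ.isMinus_map _)]
    rfl
  refine ⟨⟨fun x => TensorProduct.lift (V.ricciAt σ x) (φ.toFun x), fun x => ?_⟩, fun x => rfl,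
    fun x hx => ?_, h1⟩
  · obtain ⟨k, ε, e, he, hep⟩ := V.exists_orthoFrame_plus x
    refine ((∑ a, ε a • V.ricFn (isVolume_mulHalf hσ hσ₀) ε e (e a) (φ.map (e a)) :
      𝒜).contMDiff x).congr_of_eventuallyEq ?_
    filter_upwards [he.eventually] with y hy
    rw [h1 hy hep, fn_sum_apply]
    rfl
  · change TensorProduct.lift (V.ricciAt σ x) (φ.toFun x) = 0
    rw [hx, map_zero]

/-- A single frame serves both subbundles near `x`, and `scalFn` mentions only the frame. -/
theorem potential_congr (hσ : IsSmoothDensity σ) (hσ₀ : NowhereVanishing σ)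
    {V' : GenPseudometric C} {x : M} (h : ∀ᶠ y in 𝓝 x, V'.plus y = V.plus y) :
    V'.potential σ x = V.potential σ x := by
  obtain ⟨k, ε, e, he, -⟩ := V.exists_orthoFrame_plus x
  have he' : IsOrthoFrame C V'.plus x ε e := by
    refine ⟨he.sq, ?_, he.ortho, ?_⟩
    · filter_upwards [he.mem, h] with y h1 h2
      rwa [h2]
    · filter_upwards [he.expand, h] with y h1 h2
      rwa [h2]
  rw [potential_eq hσ hσ₀ he, potential_eq hσ hσ₀ he', scal_eq_scalFn _ he, scal_eq_scalFn _ he']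

theorem mulHalf_laplacian_self (hσ₀ : NowhereVanishing σ) (V : GenPseudometric C) (x : M) :
    mulHalf σ (V.laplacian σ) x = V.potential σ x • mulHalf σ σ x := by
  have h : V.laplacian σ = fun x => V.potential σ x • σ x :=
    funext fun x => laplacian_eq_potential hσ₀ x
  have h1 := congrFun (mulHalf_smul_smul σ (fun _ => 1) (V.potential σ)) x
  simp only [one_smul, one_mul] at h1
  rw [h]
  exact h1

theorem actionChange_eq (hσ₀ : NowhereVanishing σ) (V' : GenPseudometric C) :
    V.actionChange σ V' σ = -(1 / 2)
      * integral (fun x => (V'.potential σ x - V.potential σ x) • mulHalf σ σ x) := by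
  rw [actionChange]
  congr 2
  funext x
  rw [Pi.sub_apply, mulHalf_laplacian_self hσ₀, mulHalf_laplacian_self hσ₀]
  exact (sub_smul _ _ _).symm

theorem action_eq (hσ₀ : NowhereVanishing σ) (V : GenPseudometric C) :
    V.action σ = -(1 / 2) * integral (fun x => V.potential σ x • mulHalf σ σ x) := by
  rw [action]
  congr 2
  funext x
  exact mulHalf_laplacian_self hσ₀ V x

theorem action_eq_add_actionChange [CompactSpace M] (hσ : IsSmoothDensity σ)
    (hσ₀ : NowhereVanishing σ) (V' : GenPseudometric C) :
    V'.action σ = V.actionChange σ V' σ + V.action σ := by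
  have hc : Continuous (fun x => V'.potential σ x - V.potential σ x) :=
    (smooth_potential hσ hσ₀ V').continuous.sub (smooth_potential hσ hσ₀ V).continuous
  rw [action_eq hσ₀, action_eq hσ₀, actionChange_eq hσ₀, ← mul_add,
    ← (isVolume_mulHalf hσ hσ₀).integral_add hc (HasCompactSupport.of_compactSpace _)
      (smooth_potential hσ hσ₀ V).continuous (HasCompactSupport.of_compactSpace _)]
  simp only [sub_add_cancel]

variable {φ : V.MixedSection} {W : ℝ → GenPseudometric C} {J : Set ℝ}

theorem velocity_eq_zero (h0 : (0 : ℝ) ∈ J) (hJ : IsOpen J) (hφ : V.HasVelocity W 0 φ) {x : M}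
    (h : ∀ t ∈ J, (W t).plus x = V.plus x) : φ.toFun x = 0 := by
  refine V.eq_zero_of_sharp fun v => C.metric_nondegenerate x _ fun w => ?_
  rw [← V.sharp_projAt]
  refine (hφ.2 x _ (V.projAt_mem x v) w).unique ?_
  refine (hasDerivAt_const 0 (C.metric x (V.projAt x v) w)).congr_of_eventuallyEq ?_
  filter_upwards [hJ.mem_nhds h0] with t ht
  rw [(W t).projAt_of_mem]
  rw [h t ht]
  exact V.projAt_mem x v

theorem potential_family (hσ : IsSmoothDensity σ) (hσ₀ : NowhereVanishing σ) (h0 : (0 : ℝ) ∈ J)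
    (hW : IsSmoothFamily J W) (hφ : V.HasVelocity W 0 φ) {x : M} {k : ℕ} {ε : Fin k → ℝ}
    {e : Fin k → Γ} (he : IsOrthoFrame C V.plus x ε e) (hep : ∀ i, V.IsPlus (e i)) :
    JointSmooth n x (fun t => (W t).potential σ) ∧ HasDerivAt (fun t => (W t).potential σ x)
      (scalFnDeriv C (isVolume_mulHalf hσ hσ₀) ε e (fun a => φ.map (e a)) x) 0 := by
  obtain ⟨e', h1, h2, h3⟩ := exists_orthoFrame_family h0 hW hφ he hep
  have h4 := hasFnVariation_scalFn (isVolume_mulHalf hσ hσ₀) ε h2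
  simp only [h1] at h4
  have h5 : ∀ᶠ z in 𝓝 ((0 : ℝ), x), (W z.1).potential σ z.2
      = scalFn C (isVolume_mulHalf hσ hσ₀) ε (fun a => e' a z.1) z.2 := by
    filter_upwards [h3] with z hz
    rw [potential_eq hσ hσ₀ hz, scal_eq_scalFn _ hz]
  refine ⟨h4.smooth.congr h5, h4.deriv.self_of_nhds.congr_of_eventuallyEq ?_⟩
  exact (eventually_slice_right (p := fun t x => (W t).potential σ x
    = scalFn C (isVolume_mulHalf hσ hσ₀) ε (fun a => e' a t) x) h5).self_of_nhds

/-- The first variation of the action with respect to the generalized pseudometric. -/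
theorem hasDerivAt_actionChange (hσ : IsSmoothDensity σ) (hσ₀ : NowhereVanishing σ)
    (h : V.IsVariation φ W) :
    HasDerivAt (fun t => V.actionChange σ (W t) σ) (integral (V.ricciDensity σ φ)) 0 := by
  obtain ⟨J, h0, hW, hφ, K, hK, hWK⟩ := h
  set hμ := isVolume_mulHalf hσ hσ₀
  obtain ⟨Z, hZ⟩ := exists_divSection hμ φ
  obtain ⟨r, hr, hr0, hre⟩ := ricciDensity_eq_pair hσ hσ₀ φ
  have hφK : ∀ x ∉ K, φ.toFun x = 0 := fun x hx =>
    velocity_eq_zero h0 hW.1 hφ fun t ht => hWK t ht x hx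
  have hKc : ∀ x ∉ K, ∀ᶠ y in 𝓝 x, y ∉ K := fun x hx => hK.isClosed.isOpen_compl.mem_nhds hx
  -- As `K` is closed, `φ` vanishes on a neighbourhood of `x`, hence so do the brackets and
  -- divergences in `divSection`.
  have hZK : ∀ x ∉ K, Z x = 0 := fun x hx => by
    obtain ⟨k, ε, e, he, hep⟩ := V.exists_orthoFrame_plus x
    rw [(hZ he hep).self_of_nhds]
    have h1 : ∀ a, ∀ᶠ y in 𝓝 x, φ.map (e a) y = (0 : Γ) y := fun a => by
      filter_upwards [hKc x hx] with y hy
      rw [φ.map_apply, hφK y hy, map_zero]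
      rfl
    rw [divSection, section_sum_apply]
    refine Finset.sum_eq_zero fun a _ => ?_
    rw [section_const_smul_apply, section_add_apply, section_smul_apply, projPlus_apply,
      C.bracket_congr_left _ (h1 a), C.dv_congr hμ (h1 a), C.dv_zero, map_zero]
    simp
  -- `scalFnDeriv_add_ricFn` rewrites the derivative of the potential in terms of global objects.
  have hderiv : ∀ x, HasDerivAt (fun t => (W t).potential σ x - V.potential σ x)
      (2 * C.dv hμ Z x - 2 * r x) 0 := fun x => by
    obtain ⟨k, ε, e, he, hep⟩ := V.exists_orthoFrame_plus x
    have h1 := (potential_family hσ hσ₀ h0 hW hφ he hep).2.sub_const (V.potential σ x)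
    have h2 := scalFnDeriv_add_ricFn hμ φ he hep
    rw [← hre he hep, ← C.dv_congr hμ (hZ he hep)] at h2
    rwa [← h2, add_sub_cancel_right]
  have hlip : ∀ x ∈ K, ∃ U ∈ 𝓝 x, ∃ ε > 0, ∃ c : ℝ, ∀ y ∈ U, ∀ s ∈ Metric.ball (0 : ℝ) ε,
      ∀ t ∈ Metric.ball (0 : ℝ) ε, |((W s).potential σ y - V.potential σ y)
        - ((W t).potential σ y - V.potential σ y)| ≤ c * |s - t| := fun x _ => by
    obtain ⟨k, ε, e, he, hep⟩ := V.exists_orthoFrame_plus x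
    obtain ⟨U, hU, ε, hε, c, hc⟩ :=
      (potential_family hσ hσ₀ h0 hW hφ he hep).1.exists_lipschitz
    refine ⟨U, hU, ε, hε, c, fun y hy s hs t ht => ?_⟩
    rw [sub_sub_sub_cancel_right]
    exact hc y hy s hs t ht
  have hmain := hμ.hasDerivAt_integral hK
    (.of_forall fun t => (smooth_potential hσ hσ₀ (W t)).continuous.sub
      (smooth_potential hσ hσ₀ V).continuous)
    (by
      filter_upwards [hW.1.mem_nhds h0] with t ht x hx
      exact sub_eq_zero.2 (potential_congr hσ hσ₀ ((hKc x hx).mono fun y hy => hWK t ht y hy)))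
    (((C.dv hμ Z).contMDiff.continuous.const_mul 2).sub (r.contMDiff.continuous.const_mul 2))
    hlip hderiv
  have hfun : (fun t => V.actionChange σ (W t) σ) = fun t => -(1 / 2)
      * integral (fun x => ((W t).potential σ x - V.potential σ x) • mulHalf σ σ x) :=
    funext fun t => actionChange_eq hσ₀ (W t)
  rw [hfun]
  refine (hmain.const_mul (-(1 / 2) : ℝ)).congr_deriv ?_
  have hdvK : HasCompactSupport (fun x => C.dv hμ Z x) := hasCompactSupport_of_eq_zero hK
    fun x hx => by
      rw [C.dv_congr hμ (v := 0) ((hKc x hx).mono fun y hy => hZK y hy), C.dv_zero]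
      rfl
  have hrK : HasCompactSupport (fun x => r x) := hasCompactSupport_of_eq_zero hK
    fun x hx => hr0 x (hφK x hx)
  have h1 : integral (fun x => (2 * C.dv hμ Z x - 2 * r x) • mulHalf σ σ x)
      = 2 * integral (fun x => C.dv hμ Z x • mulHalf σ σ x)
        + (-2) * integral (fun x => r x • mulHalf σ σ x) := by
    rw [← IsVolume.integral_smul _ hdvK, ← IsVolume.integral_smul _ hrK, ← hμ.integral_add
      ((C.dv hμ Z).contMDiff.continuous.const_mul 2) (hdvK.mul_left)
      (r.contMDiff.continuous.const_mul (-2)) (hrK.mul_left)]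
    congr 1
    funext x
    congr 1
    ring
  have h2 : V.ricciDensity σ φ = fun x => r x • mulHalf σ σ x := funext hr
  rw [h2]
  refine (congrArg _ h1).trans ?_
  -- The divergence integrates to zero, and `-1/2 · (-2) = 1`.
  rw [C.integral_dv hμ hK hZK]
  ring

end GenPseudometric
end Courant
end GenRicci

/-! ### Existence of variations with prescribed velocity -/

namespace GenRicci
section Courant

variable {n : ℕ} {M : Type*} [TopologicalSpace M] [ChartedSpace (EuclideanSpace ℝ (Fin n)) M]
  [IsManifold (𝓡 n) ∞ M] [T2Space M] [SigmaCompactSpace M]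
  {F : Type*} [NormedAddCommGroup F] [NormedSpace ℝ F] [FiniteDimensional ℝ F]
  {E : M → Type*} [TopologicalSpace (Bundle.TotalSpace F E)]
  [∀ x, TopologicalSpace (E x)] [∀ x, AddCommGroup (E x)] [∀ x, Module ℝ (E x)]
  [FiberBundle F E] [VectorBundle ℝ F E] [ContMDiffVectorBundle ∞ F E (𝓡 n)]

local notation "𝒜" => C^∞⟮𝓡 n, M; 𝓘(ℝ, ℝ), ℝ⟯
local notation "Γ" => Cₛ^∞⟮𝓡 n; F, E⟯

theorem contMDiffAt_matrix_det {G H N : Type*} [NormedAddCommGroup G] [NormedSpace ℝ G]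
    [TopologicalSpace H] {I : ModelWithCorners ℝ G H} [TopologicalSpace N] [ChartedSpace H N]
    {k : ℕ} {A : N → Matrix (Fin k) (Fin k) ℝ} {z : N}
    (h : ∀ i j, ContMDiffAt I 𝓘(ℝ, ℝ) ∞ (fun x => A x i j) z) :
    ContMDiffAt I 𝓘(ℝ, ℝ) ∞ (fun x => (A x).det) z := by
  simp only [Matrix.det_apply']
  exact ContMDiffAt.sum fun σ _ => contMDiffAt_const.mul (ContMDiffAt.prod fun i _ => h _ _)

theorem contMDiffAt_inv_apply {G H N : Type*} [NormedAddCommGroup G] [NormedSpace ℝ G]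
    [TopologicalSpace H] {I : ModelWithCorners ℝ G H} [TopologicalSpace N] [ChartedSpace H N]
    {k : ℕ} {A : N → Matrix (Fin k) (Fin k) ℝ} {z : N}
    (h : ∀ i j, ContMDiffAt I 𝓘(ℝ, ℝ) ∞ (fun x => A x i j) z) (h₀ : (A z).det ≠ 0)
    (i j : Fin k) : ContMDiffAt I 𝓘(ℝ, ℝ) ∞ (fun x => (A x)⁻¹ i j) z := by
  simp only [Matrix.inv_def, Matrix.smul_apply, Ring.inverse_eq_inv', smul_eq_mul,
    Matrix.adjugate_apply]
  refine ((contMDiffAt_matrix_det h).inv₀ h₀).mul (contMDiffAt_matrix_det fun a b => ?_)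
  by_cases hj : a = j
  · subst hj
    simpa using contMDiffAt_const
  · simpa [Matrix.updateRow_ne hj] using h a b

namespace GenPseudometric

variable {C : CourantAlgebroid n F E}

/-- The orthogonal projection in terms of a basis of `V₊` and its Gram matrix. -/
theorem projAt_eq_gram (V : GenPseudometric C) {x : M} {k : ℕ} {s : Fin k → E x}
    (hli : LinearIndependent ℝ s) (hsp : Submodule.span ℝ (Set.range s) = V.plus x) (u : E x) :
    V.projAt x u = ∑ i, (∑ j, (Matrix.of fun i j => C.metric x (s i) (s j))⁻¹ i j
      * C.metric x (s j) u) • s i := by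
  set G : Matrix (Fin k) (Fin k) ℝ := Matrix.of fun i j => C.metric x (s i) (s j) with hG
  have hd : G.det ≠ 0 := V.det_gram_ne_zero s hli hsp
  refine V.projAt_eq ?_ fun w hw => ?_
  · rw [← hsp]
    exact Submodule.sum_mem _ fun j _ => Submodule.smul_mem _ _ (Submodule.subset_span ⟨j, rfl⟩)
  · rw [← hsp] at hw
    change C.metric x w _ = 0
    induction hw using Submodule.span_induction with
    | mem w hw =>
      obtain ⟨i, rfl⟩ := hw
      have h2 := congrFun (congrArg (fun A => Matrix.mulVec A (fun j => C.metric x (s j) u))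
        (Matrix.mul_nonsing_inv G (isUnit_iff_ne_zero.2 hd))) i
      rw [← Matrix.mulVec_mulVec, Matrix.one_mulVec] at h2
      rw [map_sub, sub_eq_zero, ← h2]
      simp only [map_sum, map_smul, Matrix.mulVec, dotProduct, smul_eq_mul]
      refine Finset.sum_congr rfl fun j _ => ?_
      rw [mul_comm]
      rfl
    | zero => simp
    | add a b _ _ ha hb => rw [map_add, LinearMap.add_apply, ha, hb, add_zero]
    | smul c a _ ha => rw [map_smul, LinearMap.smul_apply, ha, smul_zero]

variable {V : GenPseudometric C} (φ : V.MixedSection)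

/-- The map `1 + t φ` on the fibre at `x`. -/
def graphMap (t : ℝ) (x : M) : E x →ₗ[ℝ] E x := LinearMap.id + t • V.sharp x (φ.toFun x)

theorem graphMap_apply (t : ℝ) (x : M) (u : E x) :
    graphMap φ t x u = u + t • V.sharp x (φ.toFun x) u := rfl

/-- `φ` maps into `V₋` and kills `V₋`; hence `φ² = 0`, and `1 + t φ` is injective for every `t`. -/
theorem ker_graphMap (t : ℝ) (x : M) : LinearMap.ker (graphMap φ t x) = ⊥ := by
  refine LinearMap.ker_eq_bot'.2 fun u hu => ?_
  rw [graphMap_apply] at hu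
  have h1 := congrArg (V.sharp x (φ.toFun x)) hu
  have h2 : V.sharp x (φ.toFun x) (V.sharp x (φ.toFun x) u) = 0 := by
    rw [← V.sharp_projAt _ (V.sharp x (φ.toFun x) u),
      V.projAt_of_mem_minus (V.sharp_mem_minus _ _), map_zero]
  rw [map_add, map_smul, h2, smul_zero, add_zero, map_zero] at h1
  rwa [h1, smul_zero, add_zero] at hu

/-- The inner product is non-degenerate on the image of `V₊` under `1 + t φ`, at `x`. -/
def GraphNondegenerate (t : ℝ) (x : M) : Prop :=
  ∀ v ∈ V.plus x, (∀ w ∈ V.plus x, C.metric x (graphMap φ t x v) (graphMap φ t x w) = 0) → v = 0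

theorem graph_frame (t : ℝ) {x : M} {k : ℕ} {s : Fin k → Γ}
    (hs : LinearIndependent ℝ (fun i => s i x) ∧
      Submodule.span ℝ (Set.range fun i => s i x) = V.plus x) :
    LinearIndependent ℝ (fun i => (s i + t • φ.map (s i)) x) ∧
      Submodule.span ℝ (Set.range fun i => (s i + t • φ.map (s i)) x)
        = (V.plus x).map (graphMap φ t x) := by
  refine ⟨hs.1.map' (graphMap φ t x) (ker_graphMap φ t x), ?_⟩
  rw [← hs.2, Submodule.map_span, ← Set.range_comp]
  rfl

/-- The generalized pseudometric `(1 + t φ) V₊`. -/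
def deform (t : ℝ) (h : ∀ x, GraphNondegenerate φ t x) : GenPseudometric C where
  plus x := (V.plus x).map (graphMap φ t x)
  exists_frame x₀ := by
    obtain ⟨k, s, hs⟩ := V.exists_frame x₀
    exact ⟨k, fun i => s i + t • φ.map (s i), hs.mono fun x hx => graph_frame φ t hx⟩
  nondegenerate x u hu huv := by
    obtain ⟨v, hv, rfl⟩ := hu
    rw [h x v hv fun w hw => huv _ ⟨w, hw, rfl⟩, map_zero]

/-- The Gram matrix of the image of a family of sections under `1 + t φ`. -/
def graphGram {k : ℕ} (s : Fin k → Γ) (z : ℝ × M) : Matrix (Fin k) (Fin k) ℝ :=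
  Matrix.of fun i j => C.metric z.2 ((s i + z.1 • φ.map (s i)) z.2) ((s j + z.1 • φ.map (s j)) z.2)

theorem contMDiffAt_family_ip (a b c : Γ) (z : ℝ × M) :
    ContMDiffAt (𝓘(ℝ, ℝ).prod (𝓡 n)) 𝓘(ℝ, ℝ) ∞
      (fun z : ℝ × M => C.metric z.2 (a z.2) ((b + z.1 • c) z.2)) z := by
  have h : ∀ f : 𝒜, ContMDiffAt (𝓘(ℝ, ℝ).prod (𝓡 n)) 𝓘(ℝ, ℝ) ∞ (fun z : ℝ × M => f z.2) z :=
    fun f => ContMDiffAt.comp (I' := 𝓡 n) z (g := f) (f := Prod.snd) (f.contMDiff z.2)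
      contMDiffAt_snd
  refine ((h (C.ip a b)).add (contMDiffAt_fst.mul (h (C.ip a c)))).congr_of_eventuallyEq
    (.of_forall fun z => ?_)
  simp [section_add_apply, section_const_smul_apply, C.ip_apply]

theorem contMDiffAt_graphGram {k : ℕ} (s : Fin k → Γ) (z : ℝ × M) (i j : Fin k) :
    ContMDiffAt (𝓘(ℝ, ℝ).prod (𝓡 n)) 𝓘(ℝ, ℝ) ∞ (fun z => graphGram φ s z i j) z := by
  refine ((contMDiffAt_family_ip (C := C) (s i) (s j) (φ.map (s j)) z).add
    (contMDiffAt_fst.mul (contMDiffAt_family_ip (C := C) (φ.map (s i)) (s j) (φ.map (s j)) z)))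
    |>.congr_of_eventuallyEq (.of_forall fun z => ?_)
  simp [graphGram, section_add_apply, section_const_smul_apply]

theorem graphNondegenerate_of_det {k : ℕ} {s : Fin k → Γ} {z : ℝ × M}
    (hs : Submodule.span ℝ (Set.range fun i => s i z.2) = V.plus z.2)
    (hd : (graphGram φ s z).det ≠ 0) : GraphNondegenerate φ z.1 z.2 := by
  intro v hv h
  rw [← hs] at hv
  obtain ⟨c, rfl⟩ := (Submodule.mem_span_range_iff_exists_fun ℝ).1 hv
  have h1 : Matrix.vecMul c (graphGram φ s z) = 0 := by
    funext j
    have h2 := h (s j z.2) (hs ▸ Submodule.subset_span ⟨j, rfl⟩)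
    simp only [map_sum, map_smul, LinearMap.sum_apply, LinearMap.smul_apply, smul_eq_mul] at h2
    exact h2
  rw [Matrix.eq_zero_of_vecMul_eq_zero hd h1]
  simp

/-- The Gram determinant of the deformed frame is continuous in `(t, x)` and nonzero at `t = 0`. -/
theorem graphNondegenerate_eventually (x₀ : M) :
    ∀ᶠ z in 𝓝 ((0 : ℝ), x₀), GraphNondegenerate φ z.1 z.2 := by
  obtain ⟨k, s, hs⟩ := V.exists_frame x₀
  have h1 : (graphGram φ s (0, x₀)).det ≠ 0 := by
    have h2 := V.det_gram_ne_zero (fun i => s i x₀) hs.self_of_nhds.1 hs.self_of_nhds.2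
    convert h2 using 2
    ext i j
    simp [graphGram]
  filter_upwards [(contMDiffAt_matrix_det (contMDiffAt_graphGram φ s (0, x₀))).continuousAt.eventually_ne
    h1, eventually_prod_right hs] with z hz hz'
  exact graphNondegenerate_of_det φ hz'.2 hz

/-- Every compactly supported section of `V₊ ⊗ V₋` is the velocity of a variation. -/
theorem exists_isVariation (hφ : φ.HasCompactSupport) : ∃ W, V.IsVariation φ W := by
  classical
  obtain ⟨K, hK, hφK⟩ := hφ
  have hA : ∀ t, ∀ x ∉ K, graphMap φ t x = LinearMap.id := fun t x hx => by
    rw [graphMap, hφK x hx, map_zero, smul_zero, add_zero]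
  -- Compactness gives one range of `t` that works at all points of `K`; off `K` the map `1 + t φ`
  -- is the identity.
  have h1 : ∀ᶠ t in 𝓝 (0 : ℝ), ∀ x ∈ K, GraphNondegenerate φ t x :=
    hK.eventually_forall_of_forall_eventually fun x _ => graphNondegenerate_eventually φ x
  have h2 : ∀ᶠ t in 𝓝 (0 : ℝ), ∀ x, GraphNondegenerate φ t x := by
    filter_upwards [h1] with t ht x
    by_cases hx : x ∈ K
    · exact ht x hx
    · intro v hv h
      simp only [hA t x hx] at h
      exact V.nondegenerate x v hv h
  obtain ⟨J, hJ, hJo, h0⟩ := eventually_nhds_iff.1 h2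
  let W : ℝ → GenPseudometric C := fun t => if h : ∀ x, GraphNondegenerate φ t x
    then deform φ t h else V
  have hW : ∀ t ∈ J, ∀ x, (W t).plus x = (V.plus x).map (graphMap φ t x) := fun t ht x => by
    simp only [W, dif_pos (hJ t ht)]
    rfl
  have hid : ∀ x, graphMap φ 0 x = LinearMap.id := fun x => by rw [graphMap, zero_smul, add_zero]
  have hW0 : W 0 = V := by
    have h3 : (W 0).plus = V.plus := funext fun x => by rw [hW 0 h0, hid, Submodule.map_id]
    cases hW0 : W 0
    cases V
    congr
    rw [hW0] at h3
    exact h3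
  have hfam : IsSmoothFamily J W := by
    refine ⟨hJo, fun u z hz => ContMDiffAt.contMDiffWithinAt
      (contMDiffAt_totalSpace_of_metric C fun w => ?_)⟩
    obtain ⟨k, s, hs⟩ := V.exists_frame z.2
    have hframe : ∀ᶠ y in 𝓝 z, LinearIndependent ℝ (fun i => (s i + y.1 • φ.map (s i)) y.2) ∧
        Submodule.span ℝ (Set.range fun i => (s i + y.1 • φ.map (s i)) y.2) = (W y.1).plus y.2 := by
      filter_upwards [continuous_fst.continuousAt.eventually (hJo.mem_nhds hz.1),
        continuous_snd.continuousAt.eventually hs] with y hy hys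
      rw [hW _ hy]
      exact graph_frame φ y.1 hys
    have hd : (graphGram φ s z).det ≠ 0 :=
      (W z.1).det_gram_ne_zero _ hframe.self_of_nhds.1 hframe.self_of_nhds.2
    have h3 : ContMDiffAt (𝓘(ℝ, ℝ).prod (𝓡 n)) 𝓘(ℝ, ℝ) ∞ (fun y : ℝ × M =>
        ∑ i, (∑ j, (graphGram φ s y)⁻¹ i j * C.metric y.2 (u y.2) ((s j + y.1 • φ.map (s j)) y.2))
          * C.metric y.2 (w y.2) ((s i + y.1 • φ.map (s i)) y.2)) z :=
      ContMDiffAt.sum fun i _ => (ContMDiffAt.sum fun j _ =>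
        (contMDiffAt_inv_apply (contMDiffAt_graphGram φ s z) hd i j).mul
          (contMDiffAt_family_ip u (s j) (φ.map (s j)) z)).mul
        (contMDiffAt_family_ip w (s i) (φ.map (s i)) z)
    refine h3.congr_of_eventuallyEq (hframe.mono fun y hy => ?_)
    simp only [(W y.1).projAt_eq_gram hy.1 hy.2, map_sum, map_smul, smul_eq_mul,
      C.metric_symm y.2 (u y.2)]
    rfl
  refine ⟨W, J, h0, hfam, ⟨hW0, fun x v hv w => ?_⟩, K, hK, fun t ht x hx => by
    rw [hW t ht, hA t x hx, Submodule.map_id]⟩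
  -- With `a = φ(v)`, membership of `v + t a` in `W t` gives `P_t v = v + t (a - P_t a)`. Since `P_t
  -- a` tends to `P_0 a = 0`, continuity of the projection is all that the derivative requires.
  set a := V.sharp x (φ.toFun x) v with ha
  obtain ⟨α, hα⟩ := exists_section_apply (n := n) (F := F) (E := E) x a
  obtain ⟨β, hβ⟩ := exists_section_apply (n := n) (F := F) (E := E) x w
  set g : ℝ → ℝ := fun t => C.metric x ((W t).projAt x a) w with hg
  have hgc : ContinuousAt g 0 := by
    have h3 := (jointSmooth_projPlus h0 hfam x α β).self_of_nhds.continuousAt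
    have h4 : ContinuousAt (fun t : ℝ => (t, x)) 0 := (Continuous.prodMk_left x).continuousAt
    have h5 := ContinuousAt.comp (x := (0 : ℝ)) (g := fun z : ℝ × M =>
      C.metric z.2 (β z.2) ((W z.1).projPlus α z.2)) h3 h4
    refine h5.congr (.of_forall fun t => ?_)
    simp only [Function.comp_apply, hg, projPlus_apply, hα, hβ]
    rw [C.metric_symm]
  have hg0 : g 0 = 0 := by
    simp only [hg, hW0]
    rw [V.projAt_of_mem_minus (V.sharp_mem_minus _ _), map_zero, LinearMap.zero_apply]
  have h3 : HasDerivAt (fun t => t * (C.metric x a w - g t)) (C.metric x a w) 0 := by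
    have h4 : ContinuousAt (fun t => C.metric x a w - g t) 0 := continuousAt_const.sub hgc
    rw [hasDerivAt_iff_tendsto_slope_zero]
    have h5 : Filter.Tendsto (fun t => C.metric x a w - g t) (𝓝[≠] 0) (𝓝 (C.metric x a w)) := by
      have h6 := h4.tendsto
      rw [hg0, sub_zero] at h6
      exact h6.mono_left nhdsWithin_le_nhds
    refine h5.congr' ?_
    filter_upwards [self_mem_nhdsWithin] with t ht
    have ht0 : t ≠ 0 := ht
    simp [ht0]
  refine (h3.const_add (C.metric x v w)).congr_of_eventuallyEq ?_
  filter_upwards [hJo.mem_nhds h0] with t ht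
  have h4 : (W t).projAt x (v + t • a) = v + t • a := (W t).projAt_of_mem (by
    rw [hW t ht]
    exact ⟨v, hv, rfl⟩)
  rw [map_add, map_smul] at h4
  rw [eq_sub_of_add_eq h4]
  simp only [map_sub, map_add, map_smul, LinearMap.sub_apply, LinearMap.add_apply,
    LinearMap.smul_apply, smul_eq_mul, hg]
  ring

end GenPseudometric
end Courant
end GenRicci

/-! ### Variation of the half-density, the gradient and stationary points -/

namespace GenRicci
section Courant

variable {n : ℕ} {M : Type*} [TopologicalSpace M] [ChartedSpace (EuclideanSpace ℝ (Fin n)) M]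
  [IsManifold (𝓡 n) ∞ M] [T2Space M] [SigmaCompactSpace M]
  {F : Type*} [NormedAddCommGroup F] [NormedSpace ℝ F] [FiniteDimensional ℝ F]
  {E : M → Type*} [TopologicalSpace (Bundle.TotalSpace F E)]
  [∀ x, TopologicalSpace (E x)] [∀ x, AddCommGroup (E x)] [∀ x, Module ℝ (E x)]
  [FiberBundle F E] [VectorBundle ℝ F E] [ContMDiffVectorBundle ∞ F E (𝓡 n)]

local notation "𝒜" => C^∞⟮𝓡 n, M; 𝓘(ℝ, ℝ), ℝ⟯
local notation "Γ" => Cₛ^∞⟮𝓡 n; F, E⟯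

theorem isSmoothDensity_smul {w : ℝ} {σ : Density n M w} (hσ : IsSmoothDensity σ) (f : 𝒜) :
    IsSmoothDensity (fun x => f x • σ x) := fun x₀ => by
  have h := contDiffOn_comp_chart_symm x₀ (f.contMDiff.contMDiffOn (s := Set.univ))
  rw [Set.preimage_univ, Set.inter_univ] at h
  exact h.mul (hσ x₀)

theorem integral_zero : integral (0 : Density n M 1) = 0 := by
  have h : ∀ (i : M) y, coeff (0 : Density n M 1) i y = 0 := fun _ _ => rfl
  simp [integral, h]

theorem exists_smul_of_hasCompactSupport {σ ς : Density n M (1 / 2)} (hσ : IsSmoothDensity σ)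
    (hσ₀ : NowhereVanishing σ) (hς : IsSmoothDensity ς)
    (hc : ∃ K : Set M, IsCompact K ∧ ∀ x, x ∉ K → ς x = 0) :
    ∃ f : 𝒜, HasCompactSupport f ∧ ς = fun x => f x • σ x := by
  obtain ⟨K, hK, h⟩ := hc
  refine ⟨⟨ratio ς σ, smooth_ratio hς hσ hσ₀⟩, hasCompactSupport_of_eq_zero hK fun x hx => ?_,
    funext (ratio_smul ς hσ₀)⟩
  refine smul_right_cancel_density hσ₀ (x := x) (b := 0) ?_
  rw [zero_smul, ← h x hx]
  exact (ratio_smul ς hσ₀ x).symm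

theorem IsVolume.integral_linear_combination {μ : Density n M 1} (hμ : IsVolume μ)
    {f g h : M → ℝ} (hf : Continuous f) (hfc : HasCompactSupport f) (hg : Continuous g)
    (hgc : HasCompactSupport g) (hh : Continuous h) (hhc : HasCompactSupport h) (a b c : ℝ) :
    integral (fun x => (a * f x + (b * g x + c * h x)) • μ x)
      = a * integral (fun x => f x • μ x)
        + (b * integral (fun x => g x • μ x) + c * integral (fun x => h x • μ x)) := by
  have hs : ∀ {u : M → ℝ} (r : ℝ), HasCompactSupport u → HasCompactSupport fun x => r * u x :=
    fun r hu => hu.mul_left (f := fun _ => r)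
  have h1 := hμ.integral_add (hf.const_mul a) (hs a hfc) ((hg.const_mul b).add (hh.const_mul c))
    ((hs b hgc).add (hs c hhc))
  have h2 := hμ.integral_add (hg.const_mul b) (hs b hgc) (hh.const_mul c) (hs c hhc)
  rw [IsVolume.integral_smul μ hfc] at h1
  rw [IsVolume.integral_smul μ hgc, IsVolume.integral_smul μ hhc] at h2
  rw [← h2]
  exact h1

namespace GenPseudometric

variable {C : CourantAlgebroid n F E} {V : GenPseudometric C} {σ : Density n M (1 / 2)}

section HalfDensities

variable (hσ : IsSmoothDensity σ) (hσ₀ : NowhereVanishing σ)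

/-- Near `x` one has `(grad f)₊ = Σ ε_a (e_a · f) e_a`. The leading part of the Laplacian is thus
the divergence of a global section, which integrates to zero if `f` has compact support. -/
theorem principal_eq_dv {μ : Density n M 1} (hμ : IsVolume μ) {x : M} {k : ℕ} {ε : Fin k → ℝ}
    {e : Fin k → Γ} (he : IsOrthoFrame C V.plus x ε e) (f : 𝒜) :
    principal C hμ ε e f x = C.dv hμ (V.projPlus (C.grad f)) x := by
  have h1 : ∀ᶠ y in 𝓝 x, V.projPlus (C.grad f) y = (∑ a, (ε a • C.der (e a) f) • e a) y := by
    filter_upwards [he.expand, he.mem] with y hy hm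
    rw [section_sum_apply]
    refine (hy _ (V.isPlus_projPlus (C.grad f) y)).trans (Finset.sum_congr rfl fun a _ => ?_)
    rw [projPlus_apply, ← V.metric_projAt_comm, V.projAt_of_mem (hm a), ← C.ip_apply, C.ip_grad]
    rfl
  rw [C.dv_congr hμ h1, C.dv_sum, principal_apply]
  simp only [C.dv_smul, C.der_const_smul, fn_sum_apply, fn_add_apply, fn_mul_apply, fn_smul_apply]
  exact Finset.sum_congr rfl fun a _ => by ring

theorem laplacian_smul_eq (f : 𝒜) (x : M) :
    V.laplacian (fun y => f y • σ y) x
      = (4 * C.dv (isVolume_mulHalf hσ hσ₀) (V.projPlus (C.grad f)) x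
        + f x * V.potential σ x) • σ x := by
  obtain ⟨k, ε, e, he, -⟩ := V.exists_orthoFrame_plus x
  rw [laplacian_smul hσ hσ₀ he, principal_eq_dv _ he, potential_eq hσ hσ₀ he]

theorem mulHalf_laplacian_smul (f : 𝒜) (x : M) :
    mulHalf (fun y => f y • σ y) (V.laplacian (fun y => f y • σ y)) x
      = (f x * (4 * C.dv (isVolume_mulHalf hσ hσ₀) (V.projPlus (C.grad f)) x
        + f x * V.potential σ x)) • mulHalf σ σ x := by
  have h : V.laplacian (fun y => f y • σ y) = fun x =>
      (4 * C.dv (isVolume_mulHalf hσ hσ₀) (V.projPlus (C.grad f)) x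
        + f x * V.potential σ x) • σ x := funext (laplacian_smul_eq hσ hσ₀ f)
  rw [h]
  exact congrFun (mulHalf_smul_smul σ f _) x

theorem mulHalf_smul_laplacian (f : M → ℝ) (x : M) (hσ₀ : NowhereVanishing σ) :
    mulHalf (fun y => f y • σ y) (V.laplacian σ) x
      = (f x * V.potential σ x) • mulHalf σ σ x := by
  have h : V.laplacian σ = fun x => V.potential σ x • σ x :=
    funext fun x => laplacian_eq_potential hσ₀ x
  rw [h]
  exact congrFun (mulHalf_smul_smul σ f _) x

theorem dv_grad_affine {μ : Density n M 1} (hμ : IsVolume μ) (t : ℝ) (f : 𝒜) (x : M) :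
    C.dv hμ (V.projPlus (C.grad (1 + t • f))) x = t * C.dv hμ (V.projPlus (C.grad f)) x := by
  have h : C.grad (1 + t • f) = t • C.grad f := C.ext_ip fun w => by
    rw [C.ip_grad, map_add, Derivation.map_one_eq_zero, zero_add, C.der_const_smul,
      LinearMap.map_smul_of_tower, C.ip_grad]
  have h1 : V.projPlus (t • C.grad f) = t • V.projPlus (C.grad f) := by
    ext x
    exact map_smul (V.projAt x) t _
  rw [h, h1, dv_const_smul']
  rfl

/-- The first variation of the action with respect to the half-density. -/
theorem hasDerivAt_actionChange_density (hσ : IsSmoothDensity σ) (hσ₀ : NowhereVanishing σ)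
    {f : 𝒜} (hf : HasCompactSupport f) :
    HasDerivAt (fun t : ℝ => V.actionChange σ V (σ + t • fun x => f x • σ x))
      (-integral (mulHalf (fun x => f x • σ x) (V.laplacian σ))) 0 := by
  set hμ := isVolume_mulHalf hσ hσ₀
  set D : 𝒜 := C.dv hμ (V.projPlus (C.grad f)) with hD
  set K := tsupport f with hK
  have hKc : IsCompact K := hf
  have hR := (smooth_potential hσ hσ₀ V).continuous
  have hgrad : ∀ x ∉ K, V.projPlus (C.grad f) x = 0 := fun x hx => by
    have h1 : ∀ᶠ y in 𝓝 x, f y = (0 : 𝒜) y :=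
      Filter.eventually_of_mem ((isClosed_tsupport f).isOpen_compl.mem_nhds hx)
        fun y hy => image_eq_zero_of_notMem_tsupport hy
    rw [projPlus_apply, C.grad_congr h1]
    have h0 : C.grad (0 : 𝒜) = 0 := C.ext_ip fun w => by rw [C.ip_grad, map_zero, map_zero]
    rw [h0]
    exact map_zero _
  have hDK : ∀ x ∉ K, D x = 0 := fun x hx => by
    rw [hD, C.dv_congr hμ (v := 0) (Filter.eventually_of_mem
      ((isClosed_tsupport f).isOpen_compl.mem_nhds hx) fun y hy => hgrad y hy), C.dv_zero]
    rfl
  have hfK : ∀ x ∉ K, f x = 0 := fun x hx => image_eq_zero_of_notMem_tsupport hx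
  have hDc : HasCompactSupport D := hasCompactSupport_of_eq_zero hKc hDK
  have hfRc : HasCompactSupport (fun x => f x * V.potential σ x) :=
    hasCompactSupport_of_eq_zero hKc fun x hx => by rw [hfK x hx, zero_mul]
  set B : M → ℝ := fun x => f x * (4 * D x + f x * V.potential σ x) with hB
  have hBc : HasCompactSupport B :=
    hasCompactSupport_of_eq_zero hKc fun x hx => by simp only [hB, hfK x hx, zero_mul]
  have hfcont := f.contMDiff.continuous
  have hDcont := D.contMDiff.continuous
  have hBcont : Continuous B :=
    hfcont.mul ((hDcont.const_mul 4).add (hfcont.mul hR))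
  -- The path is `(1 + t f) σ`, so the change of the action is exactly quadratic in `t`; the
  -- contribution `4 t D` is a divergence and integrates to zero.
  have hchange : ∀ t : ℝ, V.actionChange σ V (σ + t • fun x => f x • σ x)
      = -(1 / 2) * (t * (2 * integral (fun x => (f x * V.potential σ x) • mulHalf σ σ x))
        + t ^ 2 * integral (fun x => B x • mulHalf σ σ x)) := fun t => by
    have h1 : (σ + t • fun x => f x • σ x) = fun x => (1 + t • f) x • σ x := by
      funext x
      change σ x + t • (f x • σ x) = (1 + t * f x) • σ x
      module
    have h2 : mulHalf (σ + t • fun x => f x • σ x)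
        (V.laplacian (σ + t • fun x => f x • σ x)) - mulHalf σ (V.laplacian σ)
        = fun x => (4 * t * D x + (2 * t * (f x * V.potential σ x) + t ^ 2 * B x))
          • mulHalf σ σ x := by
      funext x
      rw [h1, Pi.sub_apply, mulHalf_laplacian_smul hσ hσ₀, mulHalf_laplacian_self hσ₀,
        dv_grad_affine]
      refine (sub_smul _ _ _).symm.trans ?_
      congr 1
      change (1 + t * f x) * (4 * (t * D x) + (1 + t * f x) * V.potential σ x) - V.potential σ x = _
      simp only [hB]
      ring
    rw [actionChange, h2, hμ.integral_linear_combination hDcont hDc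
      (g := fun x => f x * V.potential σ x) (hfcont.mul hR) hfRc hBcont hBc,
      C.integral_dv hμ hKc hgrad]
    ring
  have hlap : mulHalf (fun x => f x • σ x) (V.laplacian σ)
      = fun x => (f x * V.potential σ x) • mulHalf σ σ x :=
    funext fun x => mulHalf_smul_laplacian f x hσ₀
  rw [hlap, funext hchange]
  set a := integral (fun x => (f x * V.potential σ x) • mulHalf σ σ x)
  set b := integral (fun x => B x • mulHalf σ σ x)
  have h1 := (((hasDerivAt_id (0 : ℝ)).mul_const (2 * a)).add
    ((hasDerivAt_pow 2 (0 : ℝ)).mul_const b)).const_mul (-(1 / 2))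
  refine h1.congr_deriv ?_
  norm_num
  ring

theorem action_eq_actionChange_add [CompactSpace M] (hσ : IsSmoothDensity σ)
    (hσ₀ : NowhereVanishing σ) (f : 𝒜) :
    V.action (fun x => f x • σ x) = V.actionChange σ V (fun x => f x • σ x) + V.action σ := by
  set hμ := isVolume_mulHalf hσ hσ₀
  have hR := (smooth_potential hσ hσ₀ V).continuous
  set g : M → ℝ := fun x => f x * (4 * C.dv hμ (V.projPlus (C.grad f)) x
        + f x * V.potential σ x) with hg
  have hgc : Continuous g := f.contMDiff.continuous.mul
    (((C.dv hμ _).contMDiff.continuous.const_mul 4).add (f.contMDiff.continuous.mul hR))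
  have h1 : mulHalf (fun y => f y • σ y) (V.laplacian (fun y => f y • σ y))
      = fun x => (g x - V.potential σ x + V.potential σ x) • mulHalf σ σ x := funext fun x => by
    rw [mulHalf_laplacian_smul hσ hσ₀, sub_add_cancel]
  have h2 : mulHalf (fun y => f y • σ y) (V.laplacian (fun y => f y • σ y))
      - mulHalf σ (V.laplacian σ) = fun x => (g x - V.potential σ x) • mulHalf σ σ x :=
    funext fun x => by
      rw [Pi.sub_apply, mulHalf_laplacian_smul hσ hσ₀, mulHalf_laplacian_self hσ₀]
      exact (sub_smul _ _ _).symm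
  have hc : Continuous (fun x => g x - V.potential σ x) := hgc.sub hR
  rw [action_eq hσ₀, actionChange, h2, action, h1, hμ.integral_add hc
    (HasCompactSupport.of_compactSpace _) hR (HasCompactSupport.of_compactSpace _), mul_add]

end HalfDensities

section Pairing

variable (V) in
theorem exists_isPlus_apply {x : M} (v : V.plus x) :
    ∃ (a : Γ) (ha : V.IsPlus a), (⟨a x, ha x⟩ : V.plus x) = v := by
  obtain ⟨a, ha⟩ := exists_section_apply (n := n) (F := F) (E := E) x (v : E x)
  exact ⟨V.projPlus a, V.isPlus_projPlus a, Subtype.ext (show V.projPlus a x = v by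
    rw [projPlus_apply, ha, V.projAt_of_mem v.2])⟩

variable (V) in
theorem exists_isMinus_apply {x : M} (w : V.minus x) :
    ∃ (b : Γ) (hb : V.IsMinus b), (⟨b x, hb x⟩ : V.minus x) = w := by
  obtain ⟨b, hb⟩ := exists_section_apply (n := n) (F := F) (E := E) x (w : E x)
  exact ⟨V.projMinus b, V.isMinus_projMinus b, Subtype.ext (show V.projMinus b x = w by
    rw [projMinus_apply, hb, V.projAt_of_mem_minus w.2, sub_zero])⟩

theorem pair_eq_sum {x : M} {k : ℕ} {ε : Fin k → ℝ} {e : Fin k → Γ}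
    (he : IsOrthoFrame C V.plus x ε e) (hep : ∀ i, V.IsPlus (e i))
    (τ τ' : V.plus x ⊗[ℝ] V.minus x) :
    V.pair x τ τ' = ∑ a, ε a * C.metric x (V.sharp x τ (e a x)) (V.sharp x τ' (e a x)) := by
  conv_lhs => rw [tensor_eq_sum he hep τ', map_sum]
  simp only [map_smul, pair_tmul_right, smul_eq_mul]
  rfl

theorem smooth_pair (φ ψ : V.MixedSection) :
    Smooth n (fun x => V.pair x (φ.toFun x) (ψ.toFun x)) := fun x => by
  obtain ⟨k, ε, e, he, hep⟩ := V.exists_orthoFrame_plus x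
  refine ((∑ a, ε a • C.ip (φ.map (e a)) (ψ.map (e a)) : 𝒜).contMDiff x).congr_of_eventuallyEq ?_
  filter_upwards [he.eventually] with y hy
  rw [pair_eq_sum hy hep, fn_sum_apply]
  rfl

/-- A section of `V₊ ⊗ V₋` is determined by its integrals against test sections. -/
theorem eq_of_integral_pair {μ : Density n M 1} (hμ : IsVolume μ) {Q Q' : V.MixedSection}
    (h : ∀ φ : V.MixedSection, φ.HasCompactSupport →
      integral (fun x => V.pair x (Q.toFun x) (φ.toFun x) • μ x)
        = integral (fun x => V.pair x (Q'.toFun x) (φ.toFun x) • μ x)) : Q = Q' := by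
  refine MixedSection.ext fun x => sub_eq_zero.1 (V.eq_zero_of_pair fun v w => ?_)
  obtain ⟨a, ha, rfl⟩ := V.exists_isPlus_apply v
  obtain ⟨b, hb, rfl⟩ := V.exists_isMinus_apply w
  set g : 𝒜 := C.ip (Q.map a) b - C.ip (Q'.map a) b with hg
  have hgx : V.pair x (Q.toFun x - Q'.toFun x) ((⟨a x, ha x⟩ : V.plus x) ⊗ₜ
      (⟨b x, hb x⟩ : V.minus x)) = g x := by
    rw [map_sub, LinearMap.sub_apply, pair_tmul_right, pair_tmul_right, hg, fn_sub_apply,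
      C.ip_apply, C.ip_apply, MixedSection.map_apply, MixedSection.map_apply]
  rw [hgx]
  by_contra hne
  obtain ⟨χ, hχ, hχ0, hχ1⟩ := exists_bump_fn (n := n) (x := x) Filter.univ_mem
  -- With this test section the two integrands differ by `χ g²`. Testing with a multiple of `Q - Q'`
  -- would not suffice, as the pairing may be indefinite.
  set φ := MixedSection.tmul (χ * g) ha hb with hφ
  have hφc : φ.HasCompactSupport := ⟨tsupport χ, hχ.compact, fun y hy => by
    rw [hφ, MixedSection.tmul_toFun, fn_mul_apply, image_eq_zero_of_notMem_tsupport hy, zero_mul,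
      zero_smul]⟩
  have hpair : ∀ (R : V.MixedSection) y, V.pair y (R.toFun y) (φ.toFun y)
      = χ y * g y * C.ip (R.map a) b y := fun R y => by
    rw [hφ, MixedSection.tmul_toFun, map_smul, pair_tmul_right, smul_eq_mul]
    rfl
  have hsupp : ∀ R : V.MixedSection, HasCompactSupport (fun y => V.pair y (R.toFun y) (φ.toFun y)) :=
    fun R => hasCompactSupport_of_eq_zero hχ.compact fun y hy => by
      rw [hpair, image_eq_zero_of_notMem_tsupport hy, zero_mul, zero_mul]
  have hpos : 0 < integral (fun y => (V.pair y (Q.toFun y) (φ.toFun y)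
      + -1 * V.pair y (Q'.toFun y) (φ.toFun y)) • μ y) := by
    have hsq : ∀ y, V.pair y (Q.toFun y) (φ.toFun y) + -1 * V.pair y (Q'.toFun y) (φ.toFun y)
        = χ y * (g y) ^ 2 := fun y => by
      rw [hpair, hpair, hg, fn_sub_apply]
      ring
    simp only [hsq]
    refine hμ.integral_pos (χ.contMDiff.continuous.mul (g.contMDiff.continuous.pow 2))
      hχ.compact.mul_right (fun y => mul_nonneg (hχ0 y) (sq_nonneg _)) (x := x) ?_
    rw [hχ1.self_of_nhds, Pi.one_apply, one_mul]
    exact sq_pos_of_ne_zero hne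
  rw [hμ.integral_add (smooth_pair Q φ).continuous (hsupp Q)
    ((smooth_pair Q' φ).continuous.const_mul (-1)) (hsupp Q').mul_left,
    IsVolume.integral_smul _ (hsupp Q'), h φ hφc] at hpos
  linarith

theorem gSigma_pos [CompactSpace M] (hσ : IsSmoothDensity σ) (hσ₀ : NowhereVanishing σ)
    (hV : V.IsMetric) {φ : V.MixedSection} {x : M} (hx : φ.toFun x ≠ 0) : 0 < V.gSigma σ φ φ := by
  have hμ := isVolume_mulHalf hσ hσ₀
  -- Positivity on `V₊` forces `ε a = 1`, so `-⟨φ, φ⟩ = -Σ ⟨φ e_a, φ e_a⟩`, and every term is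
  -- nonnegative because `V₋` is negative definite.
  have hone : ∀ {y : M} {k : ℕ} {ε : Fin k → ℝ} {e : Fin k → Γ},
      IsOrthoFrame C V.plus y ε e → ∀ a, ε a = 1 := fun {y k ε e} he a => by
    have h1 : C.metric y (e a y) (e a y) = ε a := by
      rw [he.ortho.self_of_nhds a a, if_pos rfl]
    have h2 := hV.1 y (e a y) (he.mem.self_of_nhds a) fun h0 => by
      rw [h0, map_zero] at h1
      have := he.sq a
      rw [← h1] at this
      simp at this
    rw [h1] at h2
    nlinarith [he.sq a]
  have hle : ∀ y (u : E y), C.metric y (V.sharp y (φ.toFun y) u) (V.sharp y (φ.toFun y) u) ≤ 0 :=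
    fun y u => by
      by_cases h0 : V.sharp y (φ.toFun y) u = 0
      · simp [h0]
      · exact (hV.2 y _ (V.sharp_mem_minus _ _) h0).le
  have hnn : ∀ y, 0 ≤ -1 * V.pair y (φ.toFun y) (φ.toFun y) := fun y => by
    obtain ⟨k, ε, e, he, hep⟩ := V.exists_orthoFrame_plus y
    rw [pair_eq_sum he hep, neg_one_mul, ← Finset.sum_neg_distrib]
    refine Finset.sum_nonneg fun a _ => ?_
    rw [hone he, one_mul]
    exact neg_nonneg.2 (hle y _)
  have hpos : 0 < -1 * V.pair x (φ.toFun x) (φ.toFun x) := by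
    obtain ⟨k, ε, e, he, hep⟩ := V.exists_orthoFrame_plus x
    obtain ⟨a, ha⟩ : ∃ a, V.sharp x (φ.toFun x) (e a x) ≠ 0 := by
      by_contra! h
      refine hx ((tensor_eq_sum he hep _).trans (Finset.sum_eq_zero fun a _ => ?_))
      have h1 : V.sharpMinus x (e a x) (φ.toFun x) = 0 := Subtype.ext (h a)
      rw [h1, TensorProduct.tmul_zero, smul_zero]
    rw [pair_eq_sum he hep, neg_one_mul, ← Finset.sum_neg_distrib]
    refine Finset.sum_pos' (fun a _ => ?_) ⟨a, Finset.mem_univ a, ?_⟩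
    · rw [hone he, one_mul]
      exact neg_nonneg.2 (hle x _)
    · rw [hone he, one_mul]
      exact neg_pos.2 (hV.2 x _ (V.sharp_mem_minus _ _) ha)
  have h1 := hμ.integral_pos ((smooth_pair φ φ).continuous.const_mul (-1))
    (HasCompactSupport.of_compactSpace _) hnn hpos
  rw [IsVolume.integral_smul _ (HasCompactSupport.of_compactSpace _), neg_one_mul] at h1
  exact h1

theorem isRicciSection_unique {R R' : V.MixedSection} (hR : V.IsRicciSection σ R)
    (hR' : V.IsRicciSection σ R') : R = R' := by
  refine MixedSection.ext fun x => sub_eq_zero.1 (V.eq_zero_of_pair fun v w => ?_)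
  obtain ⟨a, ha, rfl⟩ := V.exists_isPlus_apply v
  obtain ⟨b, hb, rfl⟩ := V.exists_isMinus_apply w
  rw [map_sub, LinearMap.sub_apply, hR a b ha hb, hR' a b ha hb, sub_self]

end Pairing

section Gradient

variable (hσ : IsSmoothDensity σ) (hσ₀ : NowhereVanishing σ)

theorem hasDerivAt_action [CompactSpace M] {φ : V.MixedSection} {W : ℝ → GenPseudometric C}
    (hσ : IsSmoothDensity σ) (hσ₀ : NowhereVanishing σ) (h : V.IsVariation φ W) :
    HasDerivAt (fun t => (W t).action σ) (integral (V.ricciDensity σ φ)) 0 := by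
  have h1 : (fun t => (W t).action σ) = fun t => V.actionChange σ (W t) σ + V.action σ :=
    funext fun t => action_eq_add_actionChange hσ hσ₀ (W t)
  rw [h1]
  exact (hasDerivAt_actionChange hσ hσ₀ h).add_const _

/-- The first variation is `∫ ⟨R, φ⟩ σ² = g_σ(-R, φ)`. Uniqueness holds because every compactly
supported `φ` is the velocity of a variation, so all test sections are available. -/
theorem isGradient_iff [CompactSpace M] (hσ : IsSmoothDensity σ) (hσ₀ : NowhereVanishing σ)
    {R : V.MixedSection}
    (hR : ∀ (φ : V.MixedSection) (x : M),
      V.ricciDensity σ φ x = V.pair x (R.toFun x) (φ.toFun x) • mulHalf σ σ x)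
    (Ψ : V.MixedSection) : V.IsGradient σ Ψ ↔ Ψ = -R := by
  have hμ := isVolume_mulHalf hσ hσ₀
  have hneg : ∀ (Q φ : V.MixedSection),
      integral (fun x => V.pair x ((-Q).toFun x) (φ.toFun x) • mulHalf σ σ x)
        = -integral (fun x => V.pair x (Q.toFun x) (φ.toFun x) • mulHalf σ σ x) := fun Q φ => by
    have h1 : ∀ x, V.pair x ((-Q).toFun x) (φ.toFun x)
        = -1 * V.pair x (Q.toFun x) (φ.toFun x) := fun x => by
      rw [MixedSection.neg_toFun, map_neg, LinearMap.neg_apply, neg_one_mul]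
    simp only [h1]
    rw [IsVolume.integral_smul _ (HasCompactSupport.of_compactSpace _), neg_one_mul]
  have hD : ∀ φ : V.MixedSection, integral (V.ricciDensity σ φ)
      = integral (fun x => V.pair x (R.toFun x) (φ.toFun x) • mulHalf σ σ x) := fun φ => by
    congr 1
    exact funext (hR φ)
  constructor
  · intro h
    refine eq_of_integral_pair hμ fun φ hφ => ?_
    obtain ⟨W, hW⟩ := exists_isVariation φ hφ
    have h1 := (h φ W hW).unique (hasDerivAt_action hσ hσ₀ hW)
    rw [hneg, ← hD, ← h1, gSigma, neg_neg]
  · rintro rfl φ W hW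
    have h1 := hasDerivAt_action hσ hσ₀ hW
    rwa [gSigma, hneg, neg_neg, ← hD]

theorem ricci_eq_zero_of_stationary (hσ : IsSmoothDensity σ) (hσ₀ : NowhereVanishing σ)
    (h : ∀ (φ : V.MixedSection) (W : ℝ → GenPseudometric C), V.IsVariation φ W →
      HasDerivAt (fun t => V.actionChange σ (W t) σ) 0 0)
    {a b : Γ} (ha : V.IsPlus a) (hb : V.IsMinus b) (x : M) : V.ricci σ a b x = 0 := by
  obtain ⟨R, hR, hRd⟩ := V.exists_ricciSection hσ hσ₀
  -- `tmul 0` plays the role of the zero section.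
  have h3 : R = MixedSection.tmul 0 ha hb := by
    refine eq_of_integral_pair (isVolume_mulHalf hσ hσ₀) fun φ hφ => ?_
    obtain ⟨W, hW⟩ := exists_isVariation φ hφ
    have h4 := (h φ W hW).unique (hasDerivAt_actionChange hσ hσ₀ hW)
    have h5 : V.ricciDensity σ φ
        = fun x => V.pair x (R.toFun x) (φ.toFun x) • mulHalf σ σ x :=
      funext fun x => by rw [ricciDensity, hRd]
    have h6 : (fun x => V.pair x ((MixedSection.tmul 0 ha hb).toFun x) (φ.toFun x)
        • mulHalf σ σ x) = 0 := funext fun x => by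
      rw [MixedSection.tmul_toFun, fn_zero_apply, zero_smul, map_zero, LinearMap.zero_apply,
        zero_smul, Pi.zero_apply]
    rw [h6, ← h5, ← h4, integral_zero]
  rw [← hR a b ha hb x, h3, MixedSection.tmul_toFun, fn_zero_apply, zero_smul, map_zero,
    LinearMap.zero_apply]

theorem potential_eq_zero_of_stationary (hσ : IsSmoothDensity σ) (hσ₀ : NowhereVanishing σ)
    (h : ∀ ς : Density n M (1 / 2), IsSmoothDensity ς →
      (∃ K : Set M, IsCompact K ∧ ∀ x, x ∉ K → ς x = 0) →
      HasDerivAt (fun t : ℝ => V.actionChange σ V (σ + t • ς)) 0 0) (x : M) :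
    V.potential σ x = 0 := by
  by_contra hne
  obtain ⟨χ, hχ, hχ0, hχ1⟩ := exists_bump_fn (n := n) (x := x) Filter.univ_mem
  let p : 𝒜 := ⟨V.potential σ, smooth_potential hσ hσ₀ V⟩
  have hχK : ∀ y ∉ tsupport χ, (χ * p) y = 0 := fun y hy => by
    rw [fn_mul_apply, image_eq_zero_of_notMem_tsupport hy, zero_mul]
  have hc : HasCompactSupport (χ * p : 𝒜) := hasCompactSupport_of_eq_zero hχ.compact hχK
  -- With the potential `R` as coefficient, the test half-density `χ R σ` gives the derivative `-∫ χ
  -- R² σ²`.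
  have h3 := (h (fun x => (χ * p) x • σ x) (isSmoothDensity_smul hσ _)
    ⟨tsupport χ, hχ.compact, fun y hy => by rw [hχK y hy, zero_smul]⟩).unique
    (hasDerivAt_actionChange_density hσ hσ₀ hc)
  have h4 : mulHalf (fun x => (χ * p) x • σ x) (V.laplacian σ)
      = fun x => (χ x * V.potential σ x ^ 2) • mulHalf σ σ x := funext fun y => by
    rw [mulHalf_smul_laplacian _ _ hσ₀]
    congr 1
    change χ y * V.potential σ y * V.potential σ y = _
    ring
  rw [h4] at h3
  have h5 := (isVolume_mulHalf hσ hσ₀).integral_pos (f := fun x => χ x * V.potential σ x ^ 2)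
    (χ.contMDiff.continuous.mul ((smooth_potential hσ hσ₀ V).continuous.pow 2))
    (hasCompactSupport_of_eq_zero hχ.compact fun y hy => by
      rw [image_eq_zero_of_notMem_tsupport hy, zero_mul])
    (fun y => mul_nonneg (hχ0 y) (sq_nonneg _)) (x := x) (by
      rw [hχ1.self_of_nhds, Pi.one_apply, one_mul]
      exact sq_pos_of_ne_zero hne)
  linarith

theorem isStationary_iff (hσ : IsSmoothDensity σ) (hσ₀ : NowhereVanishing σ) :
    V.IsStationary σ ↔ (∀ a b, V.IsPlus a → V.IsMinus b → ∀ x, V.ricci σ a b x = 0) ∧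
      ∀ x, V.laplacian σ x = 0 := by
  obtain ⟨R, hR, hRd⟩ := V.exists_ricciSection hσ hσ₀
  constructor
  · rintro ⟨h1, h2⟩
    exact ⟨fun a b ha hb => ricci_eq_zero_of_stationary hσ hσ₀ h1 ha hb, fun x => by
      rw [laplacian_eq_potential hσ₀, potential_eq_zero_of_stationary hσ hσ₀ h2, zero_smul]⟩
  · rintro ⟨h1, h2⟩
    constructor
    · intro φ W hW
      have h3 : ∀ x, R.toFun x = 0 := fun x => V.eq_zero_of_pair fun v w => by
        obtain ⟨a, ha, rfl⟩ := V.exists_isPlus_apply v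
        obtain ⟨b, hb, rfl⟩ := V.exists_isMinus_apply w
        rw [hR a b ha hb, h1 a b ha hb]
      have h4 : V.ricciDensity σ φ = 0 := funext fun x => by
        rw [ricciDensity, hRd, h3, map_zero, LinearMap.zero_apply, zero_smul, Pi.zero_apply]
      have h5 := hasDerivAt_actionChange hσ hσ₀ hW
      rwa [h4, integral_zero] at h5
    · intro ς hς hc
      obtain ⟨f, hf, rfl⟩ := exists_smul_of_hasCompactSupport hσ hσ₀ hς hc
      have h3 := hasDerivAt_actionChange_density (V := V) hσ hσ₀ hf
      have h4 : mulHalf (fun x => f x • σ x) (V.laplacian σ) = 0 := funext fun x => by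
        have h5 : V.potential σ x = 0 := smul_right_cancel_density hσ₀ (x := x) (by
          rw [← laplacian_eq_potential hσ₀, h2, zero_smul])
        rw [mulHalf_smul_laplacian _ _ hσ₀, h5, mul_zero, zero_smul, Pi.zero_apply]
      rwa [h4, integral_zero, neg_zero] at h3

end Gradient

end GenPseudometric
end Courant
end GenRicci

end

/-! ### The theorem -/

theorem mainTheorem1 {n : ℕ} {M : Type*} [TopologicalSpace M]
    [ChartedSpace (EuclideanSpace ℝ (Fin n)) M] [IsManifold (𝓡 n) ∞ M] [T2Space M]
    [SigmaCompactSpace M]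
    {F : Type*} [NormedAddCommGroup F] [NormedSpace ℝ F] [FiniteDimensional ℝ F]
    {E : M → Type*} [TopologicalSpace (Bundle.TotalSpace F E)]
    [∀ x, TopologicalSpace (E x)] [∀ x, AddCommGroup (E x)] [∀ x, Module ℝ (E x)]
    [FiberBundle F E] [VectorBundle ℝ F E] [ContMDiffVectorBundle ∞ F E (𝓡 n)]
    (C : CourantAlgebroid n F E) (σ : Density n M (1 / 2)) (hσ : IsSmoothDensity σ)
    (hσ₀ : NowhereVanishing σ) :
    -- the first variation with respect to `V₊`
    (∀ (V : GenPseudometric C) (φ : V.MixedSection),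
      (φ.HasCompactSupport → ∃ W, V.IsVariation φ W) ∧
      ∀ W, V.IsVariation φ W →
        HasDerivAt (fun t => V.actionChange σ (W t) σ) (integral (V.ricciDensity σ φ)) 0 ∧
        (CompactSpace M →
          HasDerivAt (fun t => (W t).action σ) (integral (V.ricciDensity σ φ)) 0)) ∧
    -- the first variation with respect to `σ`
    (∀ (V : GenPseudometric C) (ς : Density n M (1 / 2)), IsSmoothDensity ς →
      (∃ K : Set M, IsCompact K ∧ ∀ x, x ∉ K → ς x = 0) →
        HasDerivAt (fun t : ℝ => V.actionChange σ V (σ + t • ς))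
          (-integral (mulHalf ς (V.laplacian σ))) 0 ∧
        (CompactSpace M → HasDerivAt (fun t : ℝ => V.action (σ + t • ς))
          (-integral (mulHalf ς (V.laplacian σ))) 0)) ∧
    -- `GRic` is a section of `V₊ ⊗ V₋`, and it is minus the gradient of the action
    (∀ V : GenPseudometric C, ∃ R : V.MixedSection, V.IsRicciSection σ R ∧
      (∀ (φ : V.MixedSection) (x : M),
        V.ricciDensity σ φ x = V.pair x (R.toFun x) (φ.toFun x) • mulHalf σ σ x) ∧
      (CompactSpace M → ∀ Ψ : V.MixedSection, V.IsGradient σ Ψ ↔ Ψ = -R)) ∧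
    -- `g_σ` is a Riemannian metric on the space of generalized metrics
    (CompactSpace M → ∀ V : GenPseudometric C, V.IsMetric → ∀ φ : V.MixedSection,
      (∃ x, φ.toFun x ≠ 0) → 0 < V.gSigma σ φ φ) ∧
    -- the generalized Ricci flow is the gradient flow of the action
    (CompactSpace M → ∀ (J : Set ℝ) (W : ℝ → GenPseudometric C),
      GenPseudometric.IsRicciFlow σ J W ↔ GenPseudometric.IsGradientFlow σ J W) ∧
    -- the Euler-Lagrange equations
    (∀ V : GenPseudometric C, V.IsStationary σ ↔
      (∀ a b, V.IsPlus a → V.IsMinus b → ∀ x, V.ricci σ a b x = 0) ∧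
        ∀ x, V.laplacian σ x = 0) := by
  refine ⟨fun V φ => ⟨GenPseudometric.exists_isVariation φ, fun W hW =>
      ⟨GenPseudometric.hasDerivAt_actionChange hσ hσ₀ hW, fun _ =>
        GenPseudometric.hasDerivAt_action hσ hσ₀ hW⟩⟩, fun V ς hς hc => ?_, fun V => ?_,
    fun _ V hV φ ⟨x, hx⟩ => GenPseudometric.gSigma_pos hσ hσ₀ hV hx, fun _ J W => ?_,
    fun V => GenPseudometric.isStationary_iff hσ hσ₀⟩
  · obtain ⟨f, hf, rfl⟩ := exists_smul_of_hasCompactSupport hσ hσ₀ hς hc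
    have h := GenPseudometric.hasDerivAt_actionChange_density (V := V) hσ hσ₀ hf
    refine ⟨h, fun _ => ?_⟩
    have h1 : (fun t : ℝ => V.action (σ + t • fun x => f x • σ x))
        = fun t : ℝ => V.actionChange σ V (σ + t • fun x => f x • σ x) + V.action σ :=
      funext fun t => by
        have h2 : (σ + t • fun x => f x • σ x)
            = fun x => (1 + t • f : C^∞⟮𝓡 n, M; 𝓘(ℝ, ℝ), ℝ⟯) x • σ x := by
          funext x
          change σ x + t • (f x • σ x) = (1 + t * f x) • σ x
          module
        rw [h2, GenPseudometric.action_eq_actionChange_add hσ hσ₀]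
    rw [h1]
    exact h.add_const _
  · obtain ⟨R, hR, hRd⟩ := V.exists_ricciSection hσ hσ₀
    have hRσ : ∀ (φ : V.MixedSection) (x : M),
        V.ricciDensity σ φ x = V.pair x (R.toFun x) (φ.toFun x) • mulHalf σ σ x := fun φ x => by
      rw [GenPseudometric.ricciDensity, hRd]
    exact ⟨R, hR, hRσ, fun _ Ψ => GenPseudometric.isGradient_iff hσ hσ₀ hRσ Ψ⟩
  -- Both flows impose the same smoothness, so they are compared at each `t` separately: the Ricci
  -- section is unique and the gradient is its negative.
  · refine and_congr_right fun _ => forall₂_congr fun t _ => ?_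
    obtain ⟨R, hR, hRd⟩ := (W t).exists_ricciSection hσ hσ₀
    have hgrad := GenPseudometric.isGradient_iff hσ hσ₀ (R := R) fun φ x => by
      rw [GenPseudometric.ricciDensity, hRd]
    have hneg : -(-R) = R := GenPseudometric.MixedSection.ext fun x => by
      rw [GenPseudometric.MixedSection.neg_toFun, GenPseudometric.MixedSection.neg_toFun, neg_neg]
    constructor
    · rintro ⟨R', hR', h⟩
      obtain rfl := GenPseudometric.isRicciSection_unique hR' hR
      exact ⟨-R', (hgrad _).2 rfl, hneg.symm ▸ h⟩
    · rintro ⟨Ψ, hΨ, h⟩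
      obtain rfl := (hgrad Ψ).1 hΨ
      exact ⟨R, hR, by rwa [hneg] at h⟩
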